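/- Let $E=\mathbb C/(\mathbb Z\omega_1+\mathbb Z\omega_2)$ with $\operatorname{Im}(\omega_2/\omega_1)>0$, and let $p,q\ge 1$. Let $\mathbf x_1=\{x_1,\dots,x_p\}$ and $\mathbf x_2=\{y_1,\dots,y_q\}$ be sets of $p$ and $q$ points of $E$ that are generic, i.e. $\mathbf x_1*\mathbf x_2=\{x_i+y_j\}$ has exactly $pq$ elements. Let $y_0\in E\setminus \mathbf x_1*\mathbf x_2$ and $x_0\in E\setminus(\mathbf x_1\cup (y_0-\mathbf x_2))$. Put $n=p+q$. *Notation.* $[g,h]=ghg^{-1}h^{-1}$ and $g^h=h^{-1}gh$; in fundamental groups $gh$ means first $h$, then $g$. $F_m(E)$ is the space of $m$ distinct ordered points of $E$. The pure braid group $P(m,E)=\pi_1(F_m(E))$ is regarded as a subgroup of the full braid group $\widetilde P(m,E)=\pi_1(F_m(E)/S_m)$. The map $\phi(y)=(x_1,\dots,x_p,y-y_1,\dots,y-y_q)$ induces $\phi_*:\pi_1(E\setminus \mathbf x_1*\mathbf x_2,y_0)\to P(n,E)$, with base point $\phi(y_0)$. The inclusion $x\mapsto(\phi(y_0),x)$ of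 the fibre $E\setminus(\mathbf x_1\cup (y_0-\mathbf x_2))$ of the forgetful map $\theta:F_{n+1}(E)\to F_n(E)$ induces $\iota_*:\pi_1(E\setminus(\mathbf x_1\cup (y_0-\mathbf x_2)),x_0)\to P(n+1,E)$. Given half twists $\beta_1,\dots,\beta_{m-1}\in\widetilde P(m,E)$ put $\beta_{i,j}=\beta_{j-1}\cdots\beta_{i+1}\beta_i^2\beta_{i+1}^{-1}\cdots\beta_{j-1}^{-1}$ for $i<j$. *Choice of generators.* In a standard arrangement the points $x_1,\dots,x_p,y_0-y_1,\dots,y_0-y_q,x_0$ lie in this order, from left to right, on a segment, which is taken as a part of the real axis of a plane covering $E$ (orientation preserving and real-linearly identified with $\mathbb C$) in which $\omega_1$ is $(1-i)/2$ and $\omega_2$ is $(1+i)/2$. With $N=(p+1)(q+2)$ their positions are $i/N$ for $x_i$, $(p+1)j/N$ for $y_0-y_j$ and $(p+1)(q+1)/N$ for $x_0$, and $y_0=0$. There $\beta_k$ is the counterclockwise half twist exchanging the $k$-th and $(k+1)$-st point. The loop $\alpha_k$ runs from $x_0$ below the line to the $k$-th point, once counterclockwise around it, and back, and $\delta_{i,j}$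 runs in the same way from $y_0$ around $x_i+y_j$. The loops $\alpha,\beta$ (based at $x_0$) and $\hat\alpha,\hat\beta$ (based at $y_0$) are the straight loops along the periods $\omega_1,\omega_2$. For an arbitrary generic arrangement, a system of generators $\delta_{i,j},\hat\alpha,\hat\beta\in\pi_1(E\setminus\mathbf x_1*\mathbf x_2,y_0)$, $\alpha_1,\dots,\alpha_n,\alpha,\beta\in\pi_1(E\setminus(\mathbf x_1\cup (y_0-\mathbf x_2)),x_0)$ and $\beta_k\in \widetilde P(n,E)$, $\beta_k\in\widetilde P(n+1,E)$ is called *geometric* if it is obtained from the standard one by a continuous deformation through generic arrangements, with the base points and all loops and twists moving along without collision. *Statement.* Every generic arrangement (with base points $x_0,y_0$) has a geometric system of generators, and each geometric system has the following properties. 1. (Local braids) In $\widetilde P(n,E)$ one has $\phi_*(\delta_{i,1})=\beta_{i,p+1}$ for $1\le i\le p$, and $$\phi_*(\delta_{i,j})=\beta_{i,p+1}^{\ \beta_{p+1}\cdots\beta_{p+j-1}}\qquad(1\le i\le p,\ 2\le j\le q).$$ 2. The global braids $\hat\alpha,\hat\beta$ satisfy $(\delta_{1,q}\cdots\delta_{p,q})(\delta_{1,q-1}\cdots\delta_{p,q-1})\cdots(\delta_{1,1}\cdots\delta_{p,1})\,[\hat\alpha,\hat\beta]=1$.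 3. The loops in the fibre satisfy $\iota_*(\alpha_k)=\beta_{k,n+1}$ in $\widetilde P(n+1,E)$ for $1\le k\le n$, and $\alpha_1\cdots\alpha_n[\alpha,\beta]=1$. 4. (Global braids) There is a homomorphism $s:P(n,E)\to P(n+1,E)$ with $\theta_*\circ s=\mathrm{id}$ such that, when the group of the fibre is acted on by $g^{\phi_*(\gamma)}:=s(\phi_*(\gamma))^{-1}\,g\,s(\phi_*(\gamma))$ inside $P(n+1,E)$ (via $\iota_*$), $$(\alpha_1,\dots,\alpha_{p+q},\alpha,\beta)^{\phi_*(\hat\alpha)}=\bigl(\alpha_1^{\alpha_{p+1}\cdots\alpha_{p+q}},\dots,\alpha_p^{\alpha_{p+1}\cdots\alpha_{p+q}},\ \alpha_{p+1}^{\alpha^{-1}},\dots,\alpha_{p+q}^{\alpha^{-1}},\ \alpha,\ \alpha_{p+q}^{-1}\cdots\alpha_{p+1}^{-1}\beta\bigr),$$ $$(\alpha_1,\dots,\alpha_{p+q},\alpha,\beta)^{\phi_*(\hat\beta)}=\bigl(\alpha_1^{\beta\alpha_{p+q}^{-1}\cdots\alpha_{p+1}^{-1}\beta^{-1}},\dots,\alpha_p^{\beta\alpha_{p+q}^{-1}\cdots\alpha_{p+1}^{-1}\beta^{-1}},\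 \alpha_{p+1}^{\beta^{-1}},\dots,\alpha_{p+q}^{\beta^{-1}},\ \alpha_{p+1}\cdots\alpha_{p+q}\,\alpha,\ \beta\bigr).$$ -/

import Mathlib

noncomputable section

namespace EllipticBraid

/-! ## Fundamental groups

All fundamental groups are Mathlib's `FundamentalGroup`; the product `g * h` is the class of the
loop that runs through `h` first and through `g` afterwards. -/

/-- The class of a loop. -/
def cls {X : Type*} [TopologicalSpace X] {x : X} (γ : Path x x) : FundamentalGroup X x :=
  FundamentalGroup.fromPath (Path.Homotopic.Quotient.mk γ)

/-- The conjugate `g ^ h = h⁻¹ g h`. -/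
def conjBy {G : Type*} [Group G] (g h : G) : G := h⁻¹ * g * h

/-- The commutator `[g, h] = g h g⁻¹ h⁻¹`. -/
def comm {G : Type*} [Group G] (g h : G) : G := g * h * g⁻¹ * h⁻¹

/-! ## Configuration spaces and surface braid groups -/

section Configurations

variable {X : Type*} [TopologicalSpace X] {n : ℕ}

/-- The configuration space `F_n(X)` of `n` distinct ordered points of `X`; its fundamental group
is the pure braid group of `X` on `n` strands. -/
abbrev OrdConf (n : ℕ) (X : Type*) := {c : Fin n → X // Function.Injective c}

/-- Two ordered configurations are identified if they differ by a permutation of the points. -/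
def permSetoid (n : ℕ) (X : Type*) : Setoid (OrdConf n X) where
  r c c' := ∃ σ : Equiv.Perm (Fin n), c'.1 = c.1 ∘ σ
  iseqv :=
    { refl := fun _ => ⟨1, rfl⟩
      symm := by
        rintro c c' ⟨σ, h⟩
        exact ⟨σ⁻¹, by rw [h]; funext i; simp⟩
      trans := by
        rintro c c' c'' ⟨σ, h⟩ ⟨τ, h'⟩
        exact ⟨σ * τ, by rw [h', h]; rfl⟩ }

/-- The space `F_n(X) / S_n` of unordered configurations, with the quotient topology; its
fundamental group is the full braid group of `X` on `n` strands. -/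
abbrev UnordConf (n : ℕ) (X : Type*) := Quotient (permSetoid n X)

/-- The covering `F_n(X) → F_n(X) / S_n`. It embeds the pure into the full braid group. -/
def toUnord (n : ℕ) (X : Type*) [TopologicalSpace X] : C(OrdConf n X, UnordConf n X) where
  toFun := Quotient.mk _
  continuous_toFun := continuous_quotient_mk'

/-- The embedding of the pure braid group in the full braid group. -/
def pureToFull (c : OrdConf n X) :
    FundamentalGroup (OrdConf n X) c →* FundamentalGroup (UnordConf n X) (toUnord n X c) :=
  FundamentalGroup.map (toUnord n X) c

/-- The configuration `c` with the labels `k` and `k + 1` exchanged. -/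
def swapLabels (c : OrdConf n X) (k : ℕ) (hk : k + 1 < n) : OrdConf n X :=
  ⟨c.1 ∘ Equiv.swap ⟨k, Nat.lt_of_succ_lt hk⟩ ⟨k + 1, hk⟩,
    c.2.comp (Equiv.injective _)⟩

theorem toUnord_swapLabels (c : OrdConf n X) (k : ℕ) (hk : k + 1 < n) :
    toUnord n X c = toUnord n X (swapLabels c k hk) :=
  Quotient.sound (s := permSetoid n X) (show ∃ σ : Equiv.Perm (Fin n), _ = _ ∘ σ from ⟨_, rfl⟩)

/-- A family of motions, the `k`-th of which exchanges the points number `k` and `k + 1`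
(points are numbered from `0`). -/
abbrev Twists (c : OrdConf n X) := ∀ (k : ℕ) (hk : k + 1 < n), Path c (swapLabels c k hk)

/-- The elements of the full braid group given by a family of motions exchanging neighbours. They
are numbered from `0`, so that `τ.gen k` exchanges the points number `k` and `k + 1`;
the value for `n ≤ k + 1` is irrelevant. -/
def Twists.gen {c : OrdConf n X} (τ : Twists c) (k : ℕ) :
    FundamentalGroup (UnordConf n X) (toUnord n X c) :=
  if hk : k + 1 < n then
    cls (((τ k hk).map (toUnord n X).continuous).cast rfl (toUnord_swapLabels c k hk))
  else 1

/-- For `i < j` the word `b_{j-1} ⋯ b_{i+1} b_i ^ 2 b_{i+1}⁻¹ ⋯ b_{j-1}⁻¹`. -/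
def pureWord {G : Type*} [Group G] (b : ℕ → G) (i j : ℕ) : G :=
  let w : G := (((List.range' (i + 1) (j - 1 - i)).reverse).map b).prod
  w * b i ^ 2 * w⁻¹

/-- Forgetting the last point, `F_{n+1}(X) → F_n(X)`. -/
def forget (n : ℕ) (X : Type*) [TopologicalSpace X] : C(OrdConf (n + 1) X, OrdConf n X) where
  toFun c := ⟨fun i => c.1 i.castSucc, c.2.comp (Fin.castSucc_injective n)⟩
  continuous_toFun := Continuous.subtype_mk
    (continuous_pi fun i => (continuous_apply i.castSucc).comp continuous_subtype_val) _

end Configurations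

/-! ## The arrangement of singular points -/

section Arrangement

variable {E : Type*} [AddCommGroup E] [TopologicalSpace E] [IsTopologicalAddGroup E] {p q : ℕ}

/-- Two finite sets `{x_1, …, x_p}` and `{y_1, …, y_q}` of points of `E` with `p q` distinct sums
`x_i + y_j`, a base point `y₀` of `E ∖ {x_i + y_j}`, and a base point `x₀` of
`E ∖ {x_1, …, x_p, y₀ - y_1, …, y₀ - y_q}`. -/
structure Arrangement (p q : ℕ) (E : Type*) [AddCommGroup E] where
  x : Fin p → E
  y : Fin q → E
  y₀ : E
  x₀ : E
  x_injective : Function.Injective x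
  y_injective : Function.Injective y
  generic : (Set.range fun ij : Fin p × Fin q => x ij.1 + y ij.2).ncard = p * q
  y₀_ne : ∀ i j, y₀ ≠ x i + y j
  x₀_ne_x : ∀ i, x₀ ≠ x i
  x₀_ne_y : ∀ j, x₀ ≠ y₀ - y j

namespace Arrangement

/-- The base `E ∖ {x_i + y_j}`. -/
abbrev Base (A : Arrangement p q E) := {y : E // ∀ i j, y ≠ A.x i + A.y j}

/-- The fibre `E ∖ {x_1, …, x_p, y₀ - y_1, …, y₀ - y_q}`. -/
abbrev Fibre (A : Arrangement p q E) := {x : E // (∀ i, x ≠ A.x i) ∧ ∀ j, x ≠ A.y₀ - A.y j}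

def basePt (A : Arrangement p q E) : A.Base := ⟨A.y₀, A.y₀_ne⟩

def fibrePt (A : Arrangement p q E) : A.Fibre := ⟨A.x₀, A.x₀_ne_x, A.x₀_ne_y⟩

set_option linter.unusedSectionVars false in
theorem append_injective (A : Arrangement p q E) (y : A.Base) :
    Function.Injective (Fin.append A.x fun j => y.1 - A.y j) := by
  rw [Fin.append_injective_iff]
  refine ⟨A.x_injective, fun j j' h => A.y_injective (sub_right_injective h), ?_⟩
  intro i j h
  exact y.2 i j (by rw [h]; simp)

/-- The map `φ(y) = (x_1, …, x_p, y - y_1, …, y - y_q)`. -/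
def phi (A : Arrangement p q E) : C(A.Base, OrdConf (p + q) E) where
  toFun y := ⟨Fin.append A.x fun j => y.1 - A.y j, A.append_injective y⟩
  continuous_toFun := by
    refine Continuous.subtype_mk (continuous_pi fun k => ?_) _
    refine Fin.addCases (fun i => ?_) (fun j => ?_) k
    · simp only [Fin.append_left]; fun_prop
    · simp only [Fin.append_right]; fun_prop

/-- The inclusion `x ↦ (x_1, …, x_p, y₀ - y_1, …, y₀ - y_q, x)` of the fibre. -/
def iota (A : Arrangement p q E) : C(A.Fibre, OrdConf (p + q + 1) E) where
  toFun x := ⟨Fin.snoc (A.phi A.basePt).1 x.1, by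
    rw [Fin.snoc_injective_iff]
    refine ⟨(A.phi A.basePt).2, ?_⟩
    rintro ⟨k, hk⟩
    revert hk
    refine Fin.addCases (fun i => ?_) (fun j => ?_) k
    · intro hk
      exact x.2.1 i (by rw [← hk]; simp [phi])
    · intro hk
      exact x.2.2 j (by rw [← hk]; simp [phi, basePt])⟩
  continuous_toFun := by
    refine Continuous.subtype_mk (continuous_pi fun k => ?_) _
    refine Fin.lastCases ?_ (fun i => ?_) k
    · simp only [Fin.snoc_last]; fun_prop
    · simp only [Fin.snoc_castSucc]; fun_prop

theorem forget_iota (A : Arrangement p q E) :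
    forget (p + q) E (A.iota A.fibrePt) = A.phi A.basePt :=
  Subtype.ext (funext fun i => by simp [forget, iota])

/-- `π₁(E ∖ {x_i + y_j}, y₀)`. -/
abbrev BaseGroup (A : Arrangement p q E) := FundamentalGroup A.Base A.basePt

/-- `π₁(E ∖ {x_1, …, x_p, y₀ - y_1, …, y₀ - y_q}, x₀)`. -/
abbrev FibreGroup (A : Arrangement p q E) := FundamentalGroup A.Fibre A.fibrePt

/-- The pure elliptic braid group `P(p + q, E)`. -/
abbrev PureGroup (A : Arrangement p q E) :=
  FundamentalGroup (OrdConf (p + q) E) (A.phi A.basePt)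

/-- The pure elliptic braid group `P(p + q + 1, E)`. -/
abbrev PureGroupSucc (A : Arrangement p q E) :=
  FundamentalGroup (OrdConf (p + q + 1) E) (A.iota A.fibrePt)

/-- `φ_* : π₁(E ∖ {x_i + y_j}, y₀) → P(p + q, E)`. -/
def phiStar (A : Arrangement p q E) : A.BaseGroup →* A.PureGroup :=
  FundamentalGroup.map A.phi A.basePt

/-- The homomorphism from the group of the fibre to `P(p + q + 1, E)`. -/
def iotaStar (A : Arrangement p q E) : A.FibreGroup →* A.PureGroupSucc :=
  FundamentalGroup.map A.iota A.fibrePt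

/-- The forgetful homomorphism `P(p + q + 1, E) → P(p + q, E)`. -/
def thetaStar (A : Arrangement p q E) : A.PureGroupSucc →* A.PureGroup :=
  FundamentalGroup.mapOfEq (forget (p + q) E) A.forget_iota

end Arrangement

/-- An arrangement with loops `δ_{i,j}`, `α̂`, `β̂` in the base, loops `α_1, …, α_{p+q}`, `α`, `β`
in the fibre, and motions exchanging neighbours in the configurations
`(x_1, …, x_p, y₀ - y_1, …, y₀ - y_q)` and `(x_1, …, x_p, y₀ - y_1, …, y₀ - y_q, x₀)`. -/
structure Marking (p q : ℕ) (E : Type*) [AddCommGroup E] [TopologicalSpace E]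
    [IsTopologicalAddGroup E] extends Arrangement p q E where
  delta : Fin p → Fin q → Path toArrangement.basePt toArrangement.basePt
  alphaHat : Path toArrangement.basePt toArrangement.basePt
  betaHat : Path toArrangement.basePt toArrangement.basePt
  a : Fin (p + q) → Path toArrangement.fibrePt toArrangement.fibrePt
  alpha : Path toArrangement.fibrePt toArrangement.fibrePt
  beta : Path toArrangement.fibrePt toArrangement.fibrePt
  twist : Twists (toArrangement.phi toArrangement.basePt)
  twistSucc : Twists (toArrangement.iota toArrangement.fibrePt)

/-- A continuous one-parameter family of marked arrangements: the points and all the loops and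
motions depend continuously on the parameter, and are collision-free for each parameter. -/
structure IsDeformation (F : unitInterval → Marking p q E) : Prop where
  x : ∀ i, Continuous fun t => (F t).x i
  y : ∀ j, Continuous fun t => (F t).y j
  y₀ : Continuous fun t => (F t).y₀
  x₀ : Continuous fun t => (F t).x₀
  delta : ∀ i j, Continuous fun ts : unitInterval × unitInterval => ((F ts.1).delta i j ts.2).1
  alphaHat : Continuous fun ts : unitInterval × unitInterval => ((F ts.1).alphaHat ts.2).1
  betaHat : Continuous fun ts : unitInterval × unitInterval => ((F ts.1).betaHat ts.2).1
  a : ∀ k, Continuous fun ts : unitInterval × unitInterval => ((F ts.1).a k ts.2).1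
  alpha : Continuous fun ts : unitInterval × unitInterval => ((F ts.1).alpha ts.2).1
  beta : Continuous fun ts : unitInterval × unitInterval => ((F ts.1).beta ts.2).1
  twist : ∀ k hk, Continuous fun ts : unitInterval × unitInterval => ((F ts.1).twist k hk ts.2).1
  twistSucc : ∀ k hk, Continuous fun ts : unitInterval × unitInterval => ((F ts.1).twistSucc k hk ts.2).1

end Arrangement

/-! ## The standard arrangement on `ℂ / (ℤ ω₁ + ℤ ω₂)` -/

/-- The elliptic curve `ℂ / (ℤ ω₁ + ℤ ω₂)`. -/
abbrev Curve (ω₁ ω₂ : ℂ) : Type := ℂ ⧸ AddSubgroup.closure ({ω₁, ω₂} : Set ℂ)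

/-- The projection `ℂ → ℂ / (ℤ ω₁ + ℤ ω₂)`. -/
def proj (ω₁ ω₂ z : ℂ) : Curve ω₁ ω₂ := (z : ℂ ⧸ AddSubgroup.closure ({ω₁, ω₂} : Set ℂ))

/-- The universal covering of the curve by a plane that is drawn such that the period `ω₁` is
`(1 - i) / 2` and the period `ω₂` is `(1 + i) / 2`; the drawing is true to the orientation if
`ω₂ / ω₁` has positive imaginary part. -/
def chart (ω₁ ω₂ s : ℂ) : Curve ω₁ ω₂ :=
  proj ω₁ ω₂ (((s.re - s.im : ℝ) : ℂ) * ω₁ + ((s.re + s.im : ℝ) : ℂ) * ω₂)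

/-- The counterclockwise half turn from `u` to `v` on the circle with diameter `u v`. -/
def halfTurn (u v : ℂ) : Path u v where
  toFun t := (u + v) / 2 + Complex.exp (Real.pi * (t : ℝ) * Complex.I) * ((u - v) / 2)
  continuous_toFun := by fun_prop
  source' := by simp; ring
  target' := by simp [Complex.exp_pi_mul_I]; ring

/-- For real `w < b` and small `r > 0`: the loop at `b` that runs below the real axis to `w + r`,
once counterclockwise along the circle of radius `r` about `w`, and back. -/
def lasso (b w r : ℂ) : Path b b :=
  ((halfTurn (w + r) b).symm.trans ((halfTurn (w + r) (w - r)).trans (halfTurn (w - r) (w + r)))).trans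
    (halfTurn (w + r) b)

/-- The unit of length `1 / N` of the standard arrangement. -/
def mesh (p q : ℕ) : ℂ := 1 / ((p + 1) * (q + 2))

/-- The positions on the real axis, from left to right, of the `p + q + 1` points
`x_1, …, x_p, y₀ - y_1, …, y₀ - y_q, x₀` of the standard arrangement (numbered from `0`). The `x_i`
have distance `1 / N`, and the others have distance `(p + 1) / N`; all lie between `0` and `1`. -/
def pos (p q k : ℕ) : ℂ :=
  if k < p then ((k : ℂ) + 1) * mesh p q
  else ((p : ℂ) + 1) * ((k : ℂ) - p + 1) * mesh p q

/-- The counterclockwise half twist of the points number `k` and `k + 1` of the standard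
arrangement, at time `s`. -/
def stdTwist (ω₁ ω₂ : ℂ) (p q k : ℕ) (s : unitInterval) (m : ℕ) : Curve ω₁ ω₂ :=
  if m = k then chart ω₁ ω₂ (halfTurn (pos p q k) (pos p q (k + 1)) s)
  else if m = k + 1 then chart ω₁ ω₂ (halfTurn (pos p q (k + 1)) (pos p q k) s)
  else chart ω₁ ω₂ (pos p q m)

/-- The standard marked arrangement: the points lie in the order
`x_1, …, x_p, y₀ - y_1, …, y₀ - y_q, x₀` on a line, all loops `δ_{i,j}` and `α_k` run below the
other points of the line, and `α̂`, `β̂`, `α`, `β` are straight loops along the two periods. -/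
structure IsStandard (ω₁ ω₂ : ℂ) {p q : ℕ} (M : Marking p q (Curve ω₁ ω₂)) : Prop where
  x : ∀ i, M.x i = chart ω₁ ω₂ (pos p q i)
  y : ∀ j : Fin q, M.y j = -chart ω₁ ω₂ (pos p q (p + j))
  y₀ : M.y₀ = 0
  x₀ : M.x₀ = chart ω₁ ω₂ (pos p q (p + q))
  delta : ∀ i j s, (M.delta i j s).1 =
    chart ω₁ ω₂ (lasso 0 (pos p q i - pos p q (p + j)) (mesh p q / 2) s)
  alphaHat : ∀ s : unitInterval, (M.alphaHat s).1 = M.y₀ + proj ω₁ ω₂ ((s : ℝ) * ω₁)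
  betaHat : ∀ s : unitInterval, (M.betaHat s).1 = M.y₀ + proj ω₁ ω₂ ((s : ℝ) * ω₂)
  a : ∀ k s, (M.a k s).1 = chart ω₁ ω₂ (lasso (pos p q (p + q)) (pos p q k) (mesh p q / 2) s)
  alpha : ∀ s : unitInterval, (M.alpha s).1 = M.x₀ + proj ω₁ ω₂ ((s : ℝ) * ω₁)
  beta : ∀ s : unitInterval, (M.beta s).1 = M.x₀ + proj ω₁ ω₂ ((s : ℝ) * ω₂)
  twist : ∀ k hk s m, (M.twist k hk s).1 m = stdTwist ω₁ ω₂ p q k s m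
  twistSucc : ∀ k hk s m, (M.twistSucc k hk s).1 m = stdTwist ω₁ ω₂ p q k s m

/-- A marked arrangement is geometric if it arises from the standard one by deformation. -/
def IsGeometric (ω₁ ω₂ : ℂ) {p q : ℕ} (M : Marking p q (Curve ω₁ ω₂)) : Prop :=
  ∃ F : unitInterval → Marking p q (Curve ω₁ ω₂), IsDeformation F ∧ IsStandard ω₁ ω₂ (F 0) ∧ F 1 = M

/-! ## The elements of the groups in question -/

namespace Marking

variable {E : Type*} [AddCommGroup E] [TopologicalSpace E] [IsTopologicalAddGroup E] {p q : ℕ}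

/-- The local braid `δ_{i,j}` around `x_i + y_j`. -/
def d (M : Marking p q E) (i : Fin p) (j : Fin q) : M.BaseGroup := cls (M.delta i j)

/-- The global braid `α̂`. -/
def gAlphaHat (M : Marking p q E) : M.BaseGroup := cls M.alphaHat

/-- The global braid `β̂`. -/
def gBetaHat (M : Marking p q E) : M.BaseGroup := cls M.betaHat

/-- The generators `α_1, …, α_{p+q}` (numbered from `0`) of the group of the fibre. -/
def gA (M : Marking p q E) (k : Fin (p + q)) : M.FibreGroup := cls (M.a k)

/-- The generator `α` of the group of the fibre. -/
def gAlpha (M : Marking p q E) : M.FibreGroup := cls M.alpha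

/-- The generator `β` of the group of the fibre. -/
def gBeta (M : Marking p q E) : M.FibreGroup := cls M.beta

/-- The product `α_{p+1} ⋯ α_{p+q}`. -/
def prodY (M : Marking p q E) : M.FibreGroup :=
  (List.ofFn fun j : Fin q => M.gA (Fin.natAdd p j)).prod

/-- The half twists `β_1, …, β_{p+q-1}` of the full braid group on `p + q` strands; `M.b k` is
`β_{k+1}`. -/
def b (M : Marking p q E) (k : ℕ) :
    FundamentalGroup (UnordConf (p + q) E) (toUnord (p + q) E (M.phi M.basePt)) :=
  M.twist.gen k

/-- The half twists `β_1, …, β_{p+q}` of the full braid group on `p + q + 1` strands;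
`M.bSucc k` is `β_{k+1}`. -/
def bSucc (M : Marking p q E) (k : ℕ) :
    FundamentalGroup (UnordConf (p + q + 1) E) (toUnord (p + q + 1) E (M.iota M.fibrePt)) :=
  M.twistSucc.gen k

end Marking

end EllipticBraid

end

/-!
# Braids of two generic sets of points on an elliptic curve

*Reduction to the standard arrangement.* Along a deformation all loops and twists move continuously,
and so do the base points `φ(y_0)` and `(φ(y_0), x_0)` in the configuration spaces. An identity
between braids is therefore transported by the base change isomorphism along the path of base points
(`baseChange_cls`); this covers the local braids, the generators of the fibre, and the action of the
global braids, where the splitting is transported as well (`IsDeformation.local_braid`,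
`IsDeformation.fibre_braid`, `IsDeformation.hasAction`). The two relations live in complements of
moving punctures. There the deformation is followed by pushing points: if the points move by a
little, some injective map of the curve carries the old ones to the new ones (`exists_pointPush`),
and a composition of such maps carries the classes of the loops along (`exists_transport`). Pushing
a standard marking along a path of arrangements also proves that geometric systems exist
(`exists_geometric_of_path`); a path from the standard arrangement to a given one is found in the
complex line through lifts of the two, from which only countably many parameters have to be removed
(`exists_path_arrangement`).

*Local braids.* Most homotopies are not written down. Instead, the space in question is covered by
images of star-shaped sets, and in such a patch the class of a path depends only on its ends
(`StarPatch.arc_eq`). For configurations, the patches are given by an imaginary observer for whom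
the strands are stacked at different heights: planar configurations whose imaginary parts are weakly
ordered in a prescribed way form a star-shaped set (`heightPatch`), and a half twist belongs to such
a patch as soon as the strand that passes below has the smaller height (`twist_gen`). Words in half
twists then telescope (`word_eq`), and a loop of several parallel strands around another one is
compared with the word through the same observers (`pushed_lasso_eq_word`). This gives the local
braids, and as a special case the generators of the fibre.

*Relations.* The punctures lie on the real axis of the plane, and the closed strips of height `1/2`
above and below this axis, without the punctures, are star-shaped (`Punctured.strip`). The loops in
question become words in the crossings of the real axis from one strip to the other. The lasso
around a puncture contributes a crossing to its right and the inverse of a crossing to its left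
(`Punctured.lasso_eq`), so that the product of all lassos telescopes, and what remains is the inverse
of the commutator of the two periods (`Punctured.comm_eq`).

*Global braids.* A section of the forgetful map places an additional point slightly to the left of
the first one (`sectionMap`), and transport to `x_0` turns it into a splitting under which the braid
of `\hat α` or `\hat β` becomes the motion of the second group of points along a period, while the
first group and the last point rest (`hold`, `Arrangement.exists_splitting`). While the second group
moves, the last point has plenty of room; each map of a square into that room yields a commutation
relation between a loop of the last point and a motion (`move_square`). In particular a loop around
a point of the first group, after conjugation by both periods, commutes with the motion
(`exists_left_conj`), a loop around a point of the second group commutes with the motion in which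
the last point travels along (`commute_diag`), and the loop along the period of the motion commutes
with it (`slope_commute_hold`). The loop along the other period has to cross the moving points, which
produces the product of their lassos (`conjBy_slope_other`). All formulas for the action follow from
these by computation in a group (`conjBy_hold`).
-/

noncomputable section

namespace EllipticBraid

open unitInterval Topology

/-! ### Paths up to homotopy -/

section PathTools

variable {X Y : Type*} [TopologicalSpace X] [TopologicalSpace Y]

/-- Homotopy classes of paths, the morphisms of the fundamental groupoid; `γ.trans δ` runs through
`γ` first. -/
abbrev Arc (a b : X) := Path.Homotopic.Quotient a b

namespace Arc

variable {a b c d : X}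

theorem trans_left_cancel (f : Arc a b) {g h : Arc b c} (e : f.trans g = f.trans h) : g = h := by
  have := congrArg (fun k => f.symm.trans k) e
  simpa [← Path.Homotopic.Quotient.trans_assoc] using this

@[simp] theorem symm_trans_cancel (f : Arc a b) (g : Arc b c) :
    f.symm.trans (f.trans g) = g := by
  simp [← Path.Homotopic.Quotient.trans_assoc]

@[simp] theorem trans_symm_cancel (f : Arc a b) (g : Arc a c) :
    f.trans (f.symm.trans g) = g := by
  simp [← Path.Homotopic.Quotient.trans_assoc]

@[simp] theorem symm_symm (f : Arc a b) : f.symm.symm = f := by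
  induction f using Path.Homotopic.Quotient.ind with
  | mk f => rw [← Path.Homotopic.Quotient.mk_symm, ← Path.Homotopic.Quotient.mk_symm,
      Path.symm_symm]

@[simp] theorem symm_trans_rev (f : Arc a b) (g : Arc b c) :
    (f.trans g).symm = g.symm.trans f.symm := by
  apply trans_left_cancel (f.trans g)
  simp

theorem map_trans (f : Arc a b) (g : Arc b c) (F : C(X, Y)) :
    (f.trans g).map F = Path.Homotopic.Quotient.trans (f.map F) (g.map F) := by
  induction f using Path.Homotopic.Quotient.ind with
  | mk f =>
    induction g using Path.Homotopic.Quotient.ind with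
    | mk g =>
      rw [← Path.Homotopic.Quotient.mk_trans, ← Path.Homotopic.Quotient.mk_map, Path.map_trans]
      rfl

theorem map_symm (f : Arc a b) (F : C(X, Y)) :
    f.symm.map F = Path.Homotopic.Quotient.symm (f.map F) := by
  induction f using Path.Homotopic.Quotient.ind with
  | mk f => rfl

end Arc

instance contractibleSpace_unitInterval : ContractibleSpace I :=
  (convex_Icc (0 : ℝ) 1).contractibleSpace ⟨0, by simp⟩

/-- A map of the square identifies the two ways around its boundary. -/
theorem square {a b c d : X} (K : I × I → X) (hK : Continuous K)
    {bottom : Path a b} {right : Path b d} {left : Path a c} {top : Path c d}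
    (hb : ∀ s, bottom s = K (s, 0)) (hr : ∀ t, right t = K (1, t))
    (hl : ∀ t, left t = K (0, t)) (ht : ∀ s, top s = K (s, 1)) :
    (Path.Homotopic.Quotient.mk bottom).trans (.mk right) =
      (Path.Homotopic.Quotient.mk left).trans (.mk top) := by
  obtain rfl : a = K (0, 0) := by rw [← hb 0]; simp
  obtain rfl : b = K (1, 0) := by rw [← hb 1]; simp
  obtain rfl : c = K (0, 1) := by rw [← hl 1]; simp
  obtain rfl : d = K (1, 1) := by rw [← hr 1]; simp
  let B : Path ((0 : I), (0 : I)) (1, 0) := ⟨⟨fun s => (s, 0), by fun_prop⟩, rfl, rfl⟩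
  let R : Path ((1 : I), (0 : I)) (1, 1) := ⟨⟨fun s => (1, s), by fun_prop⟩, rfl, rfl⟩
  let L : Path ((0 : I), (0 : I)) (0, 1) := ⟨⟨fun s => (0, s), by fun_prop⟩, rfl, rfl⟩
  let T : Path ((0 : I), (1 : I)) (1, 1) := ⟨⟨fun s => (s, 1), by fun_prop⟩, rfl, rfl⟩
  obtain rfl : bottom = B.map hK := Path.ext (funext hb)
  obtain rfl : right = R.map hK := Path.ext (funext hr)
  obtain rfl : left = L.map hK := Path.ext (funext hl)
  obtain rfl : top = T.map hK := Path.ext (funext ht)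
  have h := (SimplyConnectedSpace.paths_homotopic (B.trans R) (L.trans T)).map ⟨K, hK⟩
  rw [← Path.Homotopic.Quotient.mk_trans, ← Path.Homotopic.Quotient.mk_trans, ← Path.map_trans,
    ← Path.map_trans]
  exact Path.Homotopic.Quotient.eq.2 h

/-- A family of paths with common endpoints is a homotopy. -/
theorem mk_eq_of_family {a b : X} (K : I × I → X) (hK : Continuous K) {γ δ : Path a b}
    (h0 : ∀ t, K (0, t) = a) (h1 : ∀ t, K (1, t) = b)
    (hγ : ∀ s, γ s = K (s, 0)) (hδ : ∀ s, δ s = K (s, 1)) :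
    (.mk γ : Arc a b) = .mk δ := by
  have := square K hK (bottom := γ) (right := Path.refl b) (left := Path.refl a) (top := δ)
    hγ (fun t => (h1 t).symm) (fun t => (h0 t).symm) hδ
  simpa using this

/-! ### Loops -/

theorem cls_eq {a : X} (γ : Path a a) : cls γ = (Path.Homotopic.Quotient.mk γ : Arc a a) := rfl

theorem map_cls {a : X} (F : C(X, Y)) (γ : Path a a) :
    FundamentalGroup.map F a (cls γ) = cls (γ.map F.continuous) := rfl

/-- The change of base point along a path, `g ↦ γ⁻¹ g γ` in the order of travel. -/
theorem baseChange_apply {a b : X} (γ : Path a b) (g : FundamentalGroup X a) :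
    FundamentalGroup.fundamentalGroupMulEquivOfPath γ g =
      ((Path.Homotopic.Quotient.mk γ).symm.trans (Path.Homotopic.Quotient.trans g (.mk γ)) :
        Arc b b) := rfl

/-- Loops that move in a continuous family correspond under the change of base points. -/
theorem baseChange_cls {a b : X} (H : I × I → X) (hH : Continuous H) {c : Path a b}
    (h0 : ∀ t, H (t, 0) = c t) (h1 : ∀ t, H (t, 1) = c t) {γ : Path a a} {δ : Path b b}
    (hγ : ∀ s, γ s = H (0, s)) (hδ : ∀ s, δ s = H (1, s)) :
    FundamentalGroup.fundamentalGroupMulEquivOfPath c (cls γ) = cls δ := by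
  rw [baseChange_apply]
  have := square H hH (bottom := c) (right := δ) (left := γ) (top := c)
    (fun s => (h0 s).symm) hδ hγ (fun s => (h1 s).symm)
  rw [cls_eq, cls_eq, ← this]
  simp

/-! ### Star-shaped patches -/

/-- A continuous map to `X` from a star-shaped subset of a vector space. Paths in `X` that lift to
the patch are determined up to homotopy by their ends, see `StarPatch.arc_eq`. -/
structure StarPatch (V X : Type*) [AddCommGroup V] [Module ℝ V] [TopologicalSpace V]
    [TopologicalSpace X] where
  S : Set V
  Z : V
  mem : Z ∈ S
  star : StarConvex ℝ Z S
  F : S → X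
  cont : Continuous F

namespace StarPatch

variable {V : Type*} [AddCommGroup V] [Module ℝ V] [TopologicalSpace V]
  [IsTopologicalAddGroup V] [ContinuousSMul ℝ V] (T : StarPatch V X)

/-- The image of the centre. -/
def o : X := T.F ⟨T.Z, T.mem⟩

omit [TopologicalSpace V] [IsTopologicalAddGroup V] [ContinuousSMul ℝ V] in
theorem seg_mem {V : Type*} [AddCommGroup V] [Module ℝ V] {S : Set V} {Z z : V}
    (h : StarConvex ℝ Z S) (hz : z ∈ S) (t : I) :
    AffineMap.lineMap Z z (t : ℝ) ∈ S :=
  h.segment_subset hz (by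
    rw [segment_eq_image_lineMap]; exact ⟨t, t.2, rfl⟩)

/-- The straight path from the centre to a point `z`. -/
def rayPath {z : V} (hz : z ∈ T.S) {a : X} (ha : T.F ⟨z, hz⟩ = a) : Path T.o a where
  toFun t := T.F ⟨AffineMap.lineMap T.Z z (t : ℝ), seg_mem T.star hz t⟩
  continuous_toFun := T.cont.comp (Continuous.subtype_mk (by
    simp only [AffineMap.lineMap_apply_module']; fun_prop) _)
  source' := by simp [o]
  target' := by simp [ha]

/-- The class of the straight path from the centre to a point `z`; the end point is allowed to be
given in a different way. -/
def ray {z : V} (hz : z ∈ T.S) {a : X} (ha : T.F ⟨z, hz⟩ = a) : Arc T.o a :=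
  .mk (T.rayPath hz ha)

/-- A path that lifts to a star-shaped patch is homotopic to the path through the centre. -/
theorem arc_eq {a b : X} (γ : Path a b) (g : I → V) (hg : Continuous g) (hS : ∀ t, g t ∈ T.S)
    (hγ : ∀ t, γ t = T.F ⟨g t, hS t⟩) {z w : V} (hz : g 0 = z) (hw : g 1 = w)
    (hzS : z ∈ T.S) (hwS : w ∈ T.S) (ha : T.F ⟨z, hzS⟩ = a) (hb : T.F ⟨w, hwS⟩ = b) :
    (.mk γ : Arc a b) = (T.ray hzS ha).symm.trans (T.ray hwS hb) := by
  subst hz hw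
  have := square (fun st : I × I =>
      T.F ⟨AffineMap.lineMap T.Z (g st.2) (st.1 : ℝ), seg_mem T.star (hS _) _⟩)
    (T.cont.comp (Continuous.subtype_mk (by
          simp only [AffineMap.lineMap_apply_module']; fun_prop) _))
    (bottom := T.rayPath hzS ha) (right := γ) (left := Path.refl T.o) (top := T.rayPath hwS hb)
    (fun s => rfl) (fun t => by simp [hγ]) (fun t => by simp [o]; rfl) (fun s => rfl)
  rw [Path.Homotopic.Quotient.mk_refl, Path.Homotopic.Quotient.refl_trans] at this
  rw [ray, ray, ← this]
  simp

/-- The patch in `Y` obtained by composition with a map `X → Y`. -/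
def map (G : C(X, Y)) : StarPatch V Y where
  S := T.S
  Z := T.Z
  mem := T.mem
  star := T.star
  F := G ∘ T.F
  cont := G.continuous.comp T.cont

end StarPatch

end PathTools

/-! ### The curve and its plane chart -/

section CurveBasics

variable {ω₁ ω₂ : ℂ}

theorem period_independent (hω : 0 < (ω₂ / ω₁).im) {s t : ℝ}
    (h : (s : ℂ) * ω₁ + (t : ℂ) * ω₂ = 0) : s = 0 ∧ t = 0 := by
  have h1 : ω₁ ≠ 0 := by rintro rfl; simp at hω
  have h2 : (s : ℂ) + t * (ω₂ / ω₁) = 0 := by field_simp; linear_combination h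
  have h3 := congrArg Complex.im h2
  simp only [Complex.add_im, Complex.ofReal_im, Complex.im_ofReal_mul, Complex.zero_im, zero_add] at h3
  have ht : t = 0 := by
    rcases mul_eq_zero.1 h3 with h | h
    · exact h
    · exact absurd h hω.ne'
  subst ht
  have h4 := congrArg Complex.re h2
  simp at h4
  exact ⟨h4, rfl⟩

theorem isDiscrete_lattice (hω : 0 < (ω₂ / ω₁).im) :
    DiscreteTopology (AddSubgroup.closure ({ω₁, ω₂} : Set ℂ)) := by
  have li : LinearIndependent ℝ ![ω₁, ω₂] := by
    rw [LinearIndependent.pair_iff]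
    intro s t h
    exact period_independent hω (by simpa using h)
  let b := basisOfLinearIndependentOfCardEqFinrank li (by simp)
  have e : (Submodule.span ℤ (Set.range b)).toAddSubgroup =
      AddSubgroup.closure ({ω₁, ω₂} : Set ℂ) := by
    rw [Submodule.span_int_eq_addSubgroupClosure]
    congr 1
    simp [b, Set.pair_comm]
  rw [← e]
  exact inferInstanceAs (DiscreteTopology (Submodule.span ℤ (Set.range b)))

theorem isClosed_lattice (hω : 0 < (ω₂ / ω₁).im) :
    IsClosed (AddSubgroup.closure ({ω₁, ω₂} : Set ℂ) : Set ℂ) := by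
  have := isDiscrete_lattice hω
  exact AddSubgroup.isClosed_of_discrete

theorem isCoveringMap_proj (hω : 0 < (ω₂ / ω₁).im) : IsCoveringMap (proj ω₁ ω₂) :=
  (AddSubgroup.isAddQuotientCoveringMap _ ⟨isDiscrete_lattice hω⟩).isCoveringMap

theorem continuous_proj : Continuous (proj ω₁ ω₂) := continuous_quotient_mk'

theorem proj_add (z w : ℂ) : proj ω₁ ω₂ (z + w) = proj ω₁ ω₂ z + proj ω₁ ω₂ w := rfl

theorem proj_sub (z w : ℂ) : proj ω₁ ω₂ (z - w) = proj ω₁ ω₂ z - proj ω₁ ω₂ w := rfl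

theorem proj_zero : proj ω₁ ω₂ 0 = 0 := rfl

theorem proj_surjective : Function.Surjective (proj ω₁ ω₂) := Quotient.mk_surjective

theorem proj_eq_zero_iff {z : ℂ} :
    proj ω₁ ω₂ z = 0 ↔ z ∈ AddSubgroup.closure ({ω₁, ω₂} : Set ℂ) :=
  QuotientAddGroup.eq_zero_iff z

theorem continuous_chart : Continuous (chart ω₁ ω₂) :=
  continuous_proj.comp (by fun_prop)

@[fun_prop] theorem _root_.Continuous.chart {X : Type*} [TopologicalSpace X] {f : X → ℂ}
    (hf : Continuous f) : Continuous fun x => chart ω₁ ω₂ (f x) :=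
  continuous_chart.comp hf

theorem chart_add (z w : ℂ) : chart ω₁ ω₂ (z + w) = chart ω₁ ω₂ z + chart ω₁ ω₂ w := by
  simp only [chart, ← proj_add]
  congr 1
  simp only [Complex.add_re, Complex.add_im]
  push_cast
  ring

theorem chart_zero : chart ω₁ ω₂ 0 = 0 := by simp [chart, proj_zero]

theorem chart_neg (z : ℂ) : chart ω₁ ω₂ (-z) = -chart ω₁ ω₂ z := by
  rw [eq_neg_iff_add_eq_zero, ← chart_add, neg_add_cancel, chart_zero]

theorem chart_sub (z w : ℂ) : chart ω₁ ω₂ (z - w) = chart ω₁ ω₂ z - chart ω₁ ω₂ w := by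
  rw [sub_eq_add_neg, chart_add, chart_neg, ← sub_eq_add_neg]

/-- The kernel of the chart. -/
theorem chart_eq_zero_iff (hω : 0 < (ω₂ / ω₁).im) {z : ℂ} :
    chart ω₁ ω₂ z = 0 ↔ ∃ a b : ℤ, z.re - z.im = a ∧ z.re + z.im = b := by
  rw [chart, proj_eq_zero_iff, AddSubgroup.mem_closure_pair]
  refine exists_congr fun a => exists_congr fun b => ⟨fun h => ?_, fun h => ?_⟩
  · have := period_independent hω (s := z.re - z.im - a) (t := z.re + z.im - b) (by
      simp only [zsmul_eq_mul, Complex.ofReal_add, Complex.ofReal_sub] at h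
      push_cast
      linear_combination -h)
    exact ⟨by linarith [this.1], by linarith [this.2]⟩
  · rw [h.1, h.2]
    simp

theorem chart_eq_iff (hω : 0 < (ω₂ / ω₁).im) {z w : ℂ} :
    chart ω₁ ω₂ z = chart ω₁ ω₂ w ↔
      ∃ a b : ℤ, z.re - w.re - (z.im - w.im) = a ∧ z.re - w.re + (z.im - w.im) = b := by
  rw [← sub_eq_zero, ← chart_sub, chart_eq_zero_iff hω]
  simp

/-- Points with the same image lie in rows at distance a multiple of `1 / 2`; neighbouring rows are
shifted by `1 / 2`. -/
theorem rows_of_chart_eq (hω : 0 < (ω₂ / ω₁).im) {z w : ℂ} (h : chart ω₁ ω₂ z = chart ω₁ ω₂ w) :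
    ∃ k l : ℤ, z.im - w.im = k / 2 ∧ z.re - w.re = k / 2 + l := by
  obtain ⟨a, b, h1, h2⟩ := (chart_eq_iff hω).1 h
  refine ⟨b - a, a, ?_, ?_⟩ <;> push_cast <;> linarith

theorem chart_eq_of_rows (hω : 0 < (ω₂ / ω₁).im) {z w : ℂ} (k l : ℤ)
    (h1 : z.im - w.im = k / 2) (h2 : z.re - w.re = k / 2 + l) :
    chart ω₁ ω₂ z = chart ω₁ ω₂ w :=
  (chart_eq_iff hω).2 ⟨l, k + l, by linarith, by push_cast; linarith⟩

theorem eq_zero_of_abs_lt_one {k : ℤ} (h1 : (-1 : ℝ) < k) (h2 : (k : ℝ) < 1) : k = 0 := by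
  have h1' : (-1 : ℤ) < k := by exact_mod_cast h1
  have h2' : k < (1 : ℤ) := by exact_mod_cast h2
  omega

theorem eq_of_chart_eq (hω : 0 < (ω₂ / ω₁).im) {z w : ℂ} (h : chart ω₁ ω₂ z = chart ω₁ ω₂ w)
    (him : |z.im - w.im| < 1 / 2) (hre : |z.re - w.re| < 1) : z = w := by
  obtain ⟨k, l, h1, h2⟩ := rows_of_chart_eq hω h
  rw [abs_lt] at him hre
  obtain rfl := eq_zero_of_abs_lt_one (k := k) (by linarith) (by linarith)
  obtain rfl := eq_zero_of_abs_lt_one (k := l) (by push_cast at h2; linarith)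
    (by push_cast at h2; linarith)
  apply Complex.ext <;> push_cast at h1 h2 <;> linarith

theorem proj_mul_period_one (s : ℝ) :
    proj ω₁ ω₂ (s * ω₁) = chart ω₁ ω₂ (s * ((1 - Complex.I) / 2)) := by
  rw [chart]
  congr 1
  simp
  ring

theorem proj_mul_period_two (s : ℝ) :
    proj ω₁ ω₂ (s * ω₂) = chart ω₁ ω₂ (s * ((1 + Complex.I) / 2)) := by
  rw [chart]
  congr 1
  simp
  left
  ring

theorem norm_chart_real_le (t : ℝ) : ‖chart ω₁ ω₂ t‖ ≤ |t| * ‖ω₁ + ω₂‖ := by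
  have : chart ω₁ ω₂ t = proj ω₁ ω₂ (t * (ω₁ + ω₂)) := by
    rw [chart]; congr 1; simp; ring
  rw [this]
  refine QuotientAddGroup.norm_mk_le_norm.trans ?_
  rw [norm_mul, Complex.norm_real, Real.norm_eq_abs]

theorem norm_proj_le (z : ℂ) : ‖proj ω₁ ω₂ z‖ ≤ ‖z‖ := QuotientAddGroup.norm_mk_le_norm

theorem norm_curve_eq_zero (hω : 0 < (ω₂ / ω₁).im) {x : Curve ω₁ ω₂} (h : ‖x‖ = 0) : x = 0 := by
  have : IsClosed (AddSubgroup.closure ({ω₁, ω₂} : Set ℂ) : Set ℂ) := isClosed_lattice hω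
  obtain ⟨z, rfl⟩ := proj_surjective x
  exact proj_eq_zero_iff.2 ((QuotientAddGroup.norm_mk_eq_zero
    (S := AddSubgroup.closure ({ω₁, ω₂} : Set ℂ))).1 h)

/-- A path in the curve lifts to the plane. -/
theorem exists_lift_path (hω : 0 < (ω₂ / ω₁).im) {f : I → Curve ω₁ ω₂} (hf : Continuous f) :
    ∃ g : I → ℂ, Continuous g ∧ ∀ t, proj ω₁ ω₂ (g t) = f t := by
  obtain ⟨e, he⟩ := proj_surjective (f 0)
  obtain ⟨g, h1, -⟩ := (isCoveringMap_proj hω).exists_path_lifts ⟨f, hf⟩ e he.symm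
  exact ⟨g, g.continuous, fun t => congrFun h1 t⟩

end CurveBasics

/-! ### Planar configurations seen from a vertical stack of points -/

section Heights

variable {ω₁ ω₂ : ℂ} {n : ℕ}

/-- A configuration in the plane projects to one in the curve if it fits into a small box. -/
theorem injective_chart_comp (hω : 0 < (ω₂ / ω₁).im) {z : Fin n → ℂ}
    (hz : ∀ a b, a ≠ b → z a ≠ z b)
    (hbox : ∀ a b, |(z a).re - (z b).re| < 1 ∧ |(z a).im - (z b).im| < 1 / 2) :
    Function.Injective fun a => chart ω₁ ω₂ (z a) := by
  intro a b h
  by_contra hab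
  exact hz a b hab (eq_of_chart_eq hω h (hbox a b).2 (hbox a b).1)

/-- Planar configurations in a box whose points are arranged in height according to `h`,
in the weak sense. -/
def heightSet (h : Fin n → ℝ) : Set (Fin n → ℂ) :=
  {z | (∀ a b, h a < h b → (z a).im ≤ (z b).im) ∧ (∀ a b, a ≠ b → z a ≠ z b) ∧
    ∀ a b, |(z a).re - (z b).re| < 1 ∧ |(z a).im - (z b).im| < 1 / 2}

theorem abs_convex_lt {s t x y r : ℝ} (hs : 0 ≤ s) (ht : 0 ≤ t) (hst : s + t = 1)
    (hx : |x| < r) (hy : |y| < r) : |s * x + t * y| < r := by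
  rw [abs_lt] at *
  rcases hs.eq_or_lt with rfl | hs
  · obtain rfl : t = 1 := by linarith
    constructor <;> linarith
  · constructor <;> nlinarith

/-- The configurations in `heightSet h` are seen, without collision, from a stack of points on the
imaginary axis in the heights `h`. -/
theorem starConvex_heightSet {h : Fin n → ℝ} (hinj : Function.Injective h)
    (hb : ∀ a b, |h a - h b| < 1 / 2) :
    StarConvex ℝ (fun a => (h a : ℂ) * Complex.I) (heightSet h) := by
  intro z hz s t hs ht hst
  refine ⟨fun a b hab => ?_, fun a b hab => ?_, fun a b => ⟨?_, ?_⟩⟩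
  · have := hz.1 a b hab
    simp
    nlinarith
  · intro e
    rcases hs.eq_or_lt with rfl | hs
    · obtain rfl : t = 1 := by linarith
      exact hz.2.1 a b hab (by simpa using e)
    · have him := congrArg Complex.im e
      simp at him
      rcases (hinj.ne hab).lt_or_gt with hlt | hlt
      · have := hz.1 a b hlt
        nlinarith
      · have := hz.1 b a hlt
        nlinarith
  · have := abs_convex_lt (x := 0) hs ht hst (by simp) (hz.2.2 a b).1
    simp
    rw [← mul_sub]
    simpa using this
  · have := abs_convex_lt hs ht hst (hb a b) (hz.2.2 a b).2
    simp
    convert this using 2 <;> ring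

variable (ω₁ ω₂) in
/-- The configuration in the curve given by one in the plane. -/
def confOf (z : Fin n → ℂ) (hz : Function.Injective fun a => chart ω₁ ω₂ (z a)) :
    OrdConf n (Curve ω₁ ω₂) := ⟨fun a => chart ω₁ ω₂ (z a), hz⟩

/-- The patch of the configuration space of the curve whose centre is a stack of points. -/
def heightPatch (hω : 0 < (ω₂ / ω₁).im) (h : Fin n → ℝ) (hinj : Function.Injective h)
    (hb : ∀ a b, |h a - h b| < 1 / 2) : StarPatch (Fin n → ℂ) (OrdConf n (Curve ω₁ ω₂)) where
  S := heightSet h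
  Z a := (h a : ℂ) * Complex.I
  mem := by
    refine ⟨fun a b hab => by simpa using hab.le, fun a b hab e => hab ?_, fun a b => ?_⟩
    · exact hinj (by simpa using e)
    · simpa using hb a b
  star := starConvex_heightSet hinj hb
  F z := confOf ω₁ ω₂ z.1 (injective_chart_comp hω z.2.2.1 z.2.2.2)
  cont := Continuous.subtype_mk (continuous_pi fun a =>
    continuous_chart.comp ((continuous_apply a).comp continuous_subtype_val)) _

/-- The motion between two configurations on the real axis along segments that are bent
upwards in proportion to `η`. -/
def bentMotion (P Q η : Fin n → ℝ) (t : I) (a : Fin n) : ℂ :=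
  ⟨(1 - t) * P a + t * Q a, t * (1 - t) * η a⟩

theorem continuous_bentMotion (P Q η : Fin n → ℝ) : Continuous (bentMotion P Q η) := by
  refine continuous_pi fun a => ?_
  have : (fun t : I => bentMotion P Q η t a) = fun t : I =>
      ((((1 - t) * P a + t * Q a : ℝ) : ℂ) + ((t * (1 - t) * η a : ℝ) : ℂ) * Complex.I) := by
    funext t
    exact Complex.mk_eq_add_mul_I _ _
  rw [this]
  fun_prop

theorem I_pos_of_ne {t : I} (h0 : t ≠ 0) (h1 : t ≠ 1) : 0 < (t : ℝ) ∧ (t : ℝ) < 1 :=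
  ⟨lt_of_le_of_ne t.2.1 fun h => h0 (Subtype.ext h.symm),
    lt_of_le_of_ne t.2.2 fun h => h1 (Subtype.ext h)⟩

/-- A bent motion stays visible from the stack with heights `h` if the bends increase with `h` and
points that are bent in the same way do not change their order. -/
theorem bentMotion_mem {P Q η h : Fin n → ℝ}
    (hmono : ∀ a b, h a < h b → η a ≤ η b)
    (hη : ∀ a b, η a - η b ≤ 1)
    (hcross : ∀ a b, a ≠ b → η a = η b → 0 < (P a - P b) * (Q a - Q b))
    (hP : Function.Injective P) (hQ : Function.Injective Q)
    (hPb : ∀ a b, |P a - P b| < 1) (hQb : ∀ a b, |Q a - Q b| < 1) (t : I) :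
    bentMotion P Q η t ∈ heightSet h := by
  have ht0 := t.2.1
  have ht1 := t.2.2
  have htt : 0 ≤ (t : ℝ) * (1 - t) := mul_nonneg ht0 (by linarith)
  have htt' : (t : ℝ) * (1 - t) ≤ 1 / 4 := by nlinarith [sq_nonneg ((t : ℝ) - 1 / 2)]
  refine ⟨fun a b hab => ?_, fun a b hab e => ?_, fun a b => ⟨?_, ?_⟩⟩
  · exact mul_le_mul_of_nonneg_left (hmono a b hab) htt
  · have hre := congrArg Complex.re e
    have him := congrArg Complex.im e
    simp only [bentMotion] at hre him
    by_cases h0 : t = 0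
    · subst h0; simp at hre; exact hab (hP hre)
    by_cases h1 : t = 1
    · subst h1; simp at hre; exact hab (hQ hre)
    obtain ⟨h0, h1⟩ := I_pos_of_ne h0 h1
    have hc := hcross a b hab (by
      have : (0 : ℝ) < t * (1 - t) := mul_pos h0 (by linarith)
      exact mul_left_cancel₀ this.ne' him)
    have e' : (1 - (t : ℝ)) * (P a - P b) + t * (Q a - Q b) = 0 := by linarith
    rcases mul_pos_iff.1 hc with ⟨h2, h3⟩ | ⟨h2, h3⟩
    · nlinarith [mul_pos h0 h3, mul_pos (sub_pos.2 h1) h2]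
    · nlinarith [mul_pos h0 (neg_pos.2 h3), mul_pos (sub_pos.2 h1) (neg_pos.2 h2)]
  · have := abs_convex_lt (sub_nonneg.2 ht1) ht0 (by ring) (hPb a b) (hQb a b)
    simp only [bentMotion]
    convert this using 2
    ring
  · simp only [bentMotion]
    have h1 := hη a b
    have h2 := hη b a
    rw [← mul_sub, abs_lt]
    constructor <;> nlinarith

theorem bentMotion_zero (P Q η : Fin n → ℝ) : bentMotion P Q η 0 = fun a => (P a : ℂ) := by
  funext a; apply Complex.ext <;> simp [bentMotion]

theorem bentMotion_one (P Q η : Fin n → ℝ) : bentMotion P Q η 1 = fun a => (Q a : ℂ) := by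
  funext a; apply Complex.ext <;> simp [bentMotion]

/-- Configurations on the real axis are visible from every stack. -/
theorem real_mem_heightSet {P : Fin n → ℝ} (hP : Function.Injective P)
    (hPb : ∀ a b, |P a - P b| < 1) (h : Fin n → ℝ) :
    (fun a => (P a : ℂ)) ∈ heightSet h := by
  refine ⟨fun a b _ => by simp, fun a b hab e => hab (hP (by simpa using e)), fun a b => ?_⟩
  simpa using hPb a b

end Heights

/-! ### Half turns -/

section HalfTurns

theorem halfTurn_re (u v : ℝ) (t : I) : (halfTurn u v t).re =
    (1 + Real.cos (Real.pi * t)) / 2 * u + (1 - Real.cos (Real.pi * t)) / 2 * v := by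
  have : (Real.pi * (t : ℝ) * Complex.I : ℂ) = ((Real.pi * t : ℝ) : ℂ) * Complex.I := by push_cast; rfl
  have e : halfTurn u v t = (((u + v) / 2 : ℝ) : ℂ) +
      (Real.cos (Real.pi * t) + Real.sin (Real.pi * t) * Complex.I) * (((u - v) / 2 : ℝ) : ℂ) := by
    change (u + v : ℂ) / 2 + Complex.exp (Real.pi * (t : ℝ) * Complex.I) * ((u - v) / 2) = _
    rw [this, Complex.exp_mul_I, ← Complex.ofReal_cos, ← Complex.ofReal_sin]
    push_cast
    rfl
  rw [e]
  simp only [Complex.add_re, Complex.ofReal_re, Complex.re_mul_ofReal, Complex.mul_I_re,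
    Complex.ofReal_im]
  ring

theorem halfTurn_im (u v : ℝ) (t : I) :
    (halfTurn u v t).im = Real.sin (Real.pi * t) * ((u - v) / 2) := by
  have : (Real.pi * (t : ℝ) * Complex.I : ℂ) = ((Real.pi * t : ℝ) : ℂ) * Complex.I := by push_cast; rfl
  have e : halfTurn u v t = (((u + v) / 2 : ℝ) : ℂ) +
      (Real.cos (Real.pi * t) + Real.sin (Real.pi * t) * Complex.I) * (((u - v) / 2 : ℝ) : ℂ) := by
    change (u + v : ℂ) / 2 + Complex.exp (Real.pi * (t : ℝ) * Complex.I) * ((u - v) / 2) = _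
    rw [this, Complex.exp_mul_I, ← Complex.ofReal_cos, ← Complex.ofReal_sin]
    push_cast
    rfl
  rw [e]
  simp only [Complex.add_im, Complex.ofReal_im, Complex.im_mul_ofReal, Complex.mul_I_im,
    Complex.ofReal_re]
  ring

theorem sin_pi_nonneg (t : I) : 0 ≤ Real.sin (Real.pi * t) :=
  Real.sin_nonneg_of_nonneg_of_le_pi (mul_nonneg Real.pi_pos.le t.2.1)
    (by nlinarith [Real.pi_pos, t.2.2])

theorem sin_pi_pos {t : I} (h0 : t ≠ 0) (h1 : t ≠ 1) : 0 < Real.sin (Real.pi * t) := by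
  obtain ⟨h0, h1⟩ := I_pos_of_ne h0 h1
  exact Real.sin_pos_of_pos_of_lt_pi (by positivity) (by nlinarith [Real.pi_pos])

theorem halfTurn_re_mem {u v : ℝ} (h : u ≤ v) (t : I) :
    u ≤ (halfTurn u v t).re ∧ (halfTurn u v t).re ≤ v := by
  rw [halfTurn_re]
  have h1 := Real.cos_le_one (Real.pi * t)
  have h2 := Real.neg_one_le_cos (Real.pi * t)
  constructor <;> nlinarith

theorem halfTurn_re_mem' {u v : ℝ} (h : v ≤ u) (t : I) :
    v ≤ (halfTurn u v t).re ∧ (halfTurn u v t).re ≤ u := by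
  rw [halfTurn_re]
  have h1 := Real.cos_le_one (Real.pi * t)
  have h2 := Real.neg_one_le_cos (Real.pi * t)
  constructor <;> nlinarith

end HalfTurns

/-! ### Half twists as bent motions -/

section TwistArcs

variable {ω₁ ω₂ : ℂ} {n : ℕ}

theorem toUnord_eq_of_comp {X : Type*} [TopologicalSpace X] {x y : OrdConf n X}
    {ρ : Fin n → Fin n} (hρ : Function.Injective ρ) (h : ∀ a, y.1 a = x.1 (ρ a)) :
    toUnord n X y = toUnord n X x := by
  symm
  refine Quotient.sound (s := permSetoid n X) ?_
  exact ⟨Equiv.ofBijective ρ (Finite.injective_iff_bijective.1 hρ), funext h⟩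

/-- The motion in the plane of the counterclockwise half twist of the points number `k` and `k + 1`
among the points `P 0 < P 1 < ⋯` of the real axis. -/
def twistLift (P : ℕ → ℝ) (k : ℕ) (t : I) (m : ℕ) : ℂ :=
  if m = k then halfTurn (P k) (P (k + 1)) t
  else if m = k + 1 then halfTurn (P (k + 1)) (P k) t
  else P m

theorem continuous_twistLift (P : ℕ → ℝ) (k m : ℕ) : Continuous fun t => twistLift P k t m := by
  unfold twistLift
  split_ifs
  · exact (halfTurn _ _).continuous
  · exact (halfTurn _ _).continuous
  · fun_prop

/-- The strands `lo` and `up`, at the places `k` and `k + 1`, exchange their places. -/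
structure Exchange (k : ℕ) (lo up : Fin n) (ρ ρ' : Fin n → Fin n) : Prop where
  inj : Function.Injective ρ
  lo_eq : (ρ lo : ℕ) = k
  up_eq : (ρ up : ℕ) = k + 1
  lo_eq' : (ρ' lo : ℕ) = k + 1
  up_eq' : (ρ' up : ℕ) = k
  other : ∀ a, a ≠ lo → a ≠ up → ρ' a = ρ a

variable {k : ℕ} {lo up : Fin n} {ρ ρ' : Fin n → Fin n} {P : ℕ → ℝ}

namespace Exchange

theorem other_ne (E : Exchange k lo up ρ ρ') {a : Fin n} (h1 : a ≠ lo) (h2 : a ≠ up) :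
    (ρ a : ℕ) ≠ k ∧ (ρ a : ℕ) ≠ k + 1 :=
  ⟨fun h => h1 (E.inj (Fin.ext (h.trans E.lo_eq.symm))),
    fun h => h2 (E.inj (Fin.ext (h.trans E.up_eq.symm)))⟩

theorem inj' (E : Exchange k lo up ρ ρ') : Function.Injective ρ' := by
  intro a b h
  have hv := congrArg Fin.val h
  by_cases a1 : a = lo <;> by_cases a2 : a = up <;> by_cases b1 : b = lo <;> by_cases b2 : b = up
  all_goals first | (subst a1; subst b1; rfl) | (subst a2; subst b2; rfl) | skip
  all_goals have := E.lo_eq'; have := E.up_eq'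
  all_goals try subst a1
  all_goals try subst a2
  all_goals try subst b1
  all_goals try subst b2
  all_goals try omega
  all_goals first
    | (have e := E.other_ne a1 a2; rw [E.other a a1 a2] at hv; omega)
    | (have e := E.other_ne b1 b2; rw [E.other b b1 b2] at hv; omega)
    | (rw [E.other a a1 a2, E.other b b1 b2] at h; exact E.inj h)

/-- During an exchange only the two strands in question cross. -/
theorem no_cross (E : Exchange k lo up ρ ρ') (hP : StrictMono P) {a b : Fin n} (hab : a ≠ b)
    (h1 : ¬(a = lo ∧ b = up)) (h2 : ¬(a = up ∧ b = lo)) :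
    0 < (P (ρ a) - P (ρ b)) * (P (ρ' a) - P (ρ' b)) := by
  have key : ((ρ a : ℕ) < ρ b ∧ (ρ' a : ℕ) < ρ' b) ∨ ((ρ b : ℕ) < ρ a ∧ (ρ' b : ℕ) < ρ' a) := by
    have hne : (ρ a : ℕ) ≠ ρ b := fun h => hab (E.inj (Fin.ext h))
    have := E.lo_eq'; have := E.up_eq'; have := E.lo_eq; have := E.up_eq
    by_cases a1 : a = lo
    · have b1 : b ≠ lo := fun h => hab (a1.trans h.symm)
      have b2 : b ≠ up := fun h => h1 ⟨a1, h⟩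
      have e := E.other_ne b1 b2
      rw [E.other b b1 b2]
      subst a1
      omega
    by_cases a2 : a = up
    · have b1 : b ≠ lo := fun h => h2 ⟨a2, h⟩
      have b2 : b ≠ up := fun h => hab (a2.trans h.symm)
      have e := E.other_ne b1 b2
      rw [E.other b b1 b2]
      subst a2
      omega
    have ea := E.other_ne a1 a2
    rw [E.other a a1 a2]
    by_cases b1 : b = lo
    · subst b1; omega
    by_cases b2 : b = up
    · subst b2; omega
    rw [E.other b b1 b2]
    omega
  rcases key with ⟨h, h'⟩ | ⟨h, h'⟩
  · exact mul_pos_of_neg_of_neg (sub_neg.2 (hP h)) (sub_neg.2 (hP h'))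
  · exact mul_pos (sub_pos.2 (hP h)) (sub_pos.2 (hP h'))

end Exchange

/-- The real part of a strand other than `lo`, `up` stays put, and the others stay between the two
places, along a motion `z`. -/
def StaysInPlace (P : ℕ → ℝ) (k : ℕ) (lo up : Fin n) (ρ : Fin n → Fin n) (z : Fin n → ℂ) : Prop :=
  ∀ a, ((a = lo ∨ a = up) → P k ≤ (z a).re ∧ (z a).re ≤ P (k + 1)) ∧
    (a ≠ lo → a ≠ up → (z a).re = P (ρ a))

theorem staysInPlace_twistLift (E : Exchange k lo up ρ ρ') (hP : StrictMono P) (t : I) :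
    StaysInPlace P k lo up ρ fun a => twistLift P k t (ρ a) := by
  have hk := (hP (Nat.lt_succ_self k)).le
  intro a
  refine ⟨?_, fun h1 h2 => ?_⟩
  · rintro (rfl | rfl)
    · simp only [twistLift, E.lo_eq, if_true]
      exact halfTurn_re_mem hk t
    · simp only [twistLift, E.up_eq, if_true, Nat.succ_ne_self, if_false]
      exact halfTurn_re_mem' hk t
  · obtain ⟨h3, h4⟩ := E.other_ne h1 h2
    simp [twistLift, h3, h4]

theorem staysInPlace_bentMotion (E : Exchange k lo up ρ ρ') (hP : StrictMono P) (η : Fin n → ℝ)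
    (t : I) : StaysInPlace P k lo up ρ
      (bentMotion (fun a => P (ρ a)) (fun a => P (ρ' a)) η t) := by
  have hk := (hP (Nat.lt_succ_self k)).le
  have ht0 := t.2.1
  have ht1 := t.2.2
  intro a
  refine ⟨?_, fun h1 h2 => ?_⟩
  · rintro (rfl | rfl)
    · simp only [bentMotion, E.lo_eq, E.lo_eq']
      constructor <;> nlinarith
    · simp only [bentMotion, E.up_eq, E.up_eq']
      constructor <;> nlinarith
  · simp only [bentMotion, E.other a h1 h2]
    ring

theorem StaysInPlace.lineMap {z w : Fin n → ℂ} (hz : StaysInPlace P k lo up ρ z)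
    (hw : StaysInPlace P k lo up ρ w) (s : I) :
    StaysInPlace P k lo up ρ (AffineMap.lineMap z w (s : ℝ)) := by
  have hs0 := s.2.1
  have hs1 := s.2.2
  intro a
  have e : (AffineMap.lineMap z w (s : ℝ) a).re = (1 - s) * (z a).re + s * (w a).re := by
    simp [AffineMap.lineMap_apply_module]
  rw [e]
  refine ⟨fun h => ?_, fun h1 h2 => ?_⟩
  · have h1 := (hz a).1 h
    have h2 := (hw a).1 h
    constructor <;> nlinarith
  · rw [(hz a).2 h1 h2, (hw a).2 h1 h2]
    ring

theorem StaysInPlace.bounds {z : Fin n → ℂ} (h : StaysInPlace P k lo up ρ z)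
    (E : Exchange k lo up ρ ρ') (a : Fin n) :
    ∃ i j : ℕ, i < n ∧ j < n ∧ P i ≤ (z a).re ∧ (z a).re ≤ P j := by
  have h1 := (ρ lo).2; have h2 := (ρ up).2
  rw [E.lo_eq] at h1; rw [E.up_eq] at h2
  by_cases a1 : a = lo ∨ a = up
  · exact ⟨k, k + 1, h1, h2, (h a).1 a1⟩
  · push Not at a1
    have := (h a).2 a1.1 a1.2
    exact ⟨ρ a, ρ a, (ρ a).2, (ρ a).2, this.ge, this.le⟩

theorem StaysInPlace.abs_re_lt {z : Fin n → ℂ} (h : StaysInPlace P k lo up ρ z)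
    (E : Exchange k lo up ρ ρ') (hspan : ∀ i j, i < n → j < n → P i - P j < 1) (a b : Fin n) :
    |(z a).re - (z b).re| < 1 := by
  obtain ⟨i, j, hi, hj, h1, h2⟩ := h.bounds E a
  obtain ⟨i', j', hi', hj', h1', h2'⟩ := h.bounds E b
  rw [abs_lt]
  constructor <;> linarith [hspan j i' hj hi', hspan j' i hj' hi]

/-- All strands but the two exchanged ones keep their order on the real axis. -/
theorem StaysInPlace.re_ne {z : Fin n → ℂ} (h : StaysInPlace P k lo up ρ z)
    (E : Exchange k lo up ρ ρ') (hP : StrictMono P) {a b : Fin n} (hab : a ≠ b)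
    (h1 : ¬(a = lo ∧ b = up)) (h2 : ¬(a = up ∧ b = lo)) : (z a).re ≠ (z b).re := by
  have key : ∀ a b : Fin n, (a = lo ∨ a = up) → b ≠ lo → b ≠ up → (z a).re ≠ (z b).re := by
    intro a b ha b1 b2
    rw [(h b).2 b1 b2]
    have hr := (h a).1 ha
    obtain ⟨e1, e2⟩ := E.other_ne b1 b2
    rcases lt_or_ge (ρ b : ℕ) k with hlt | hge
    · exact ((hP hlt).trans_le hr.1).ne'
    · exact (hr.2.trans_lt (hP (by omega))).ne
  by_cases a1 : a = lo ∨ a = up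
  · refine key a b a1 ?_ ?_
    · rintro rfl; rcases a1 with rfl | rfl
      · exact hab rfl
      · exact h2 ⟨rfl, rfl⟩
    · rintro rfl; rcases a1 with rfl | rfl
      · exact h1 ⟨rfl, rfl⟩
      · exact hab rfl
  · push Not at a1
    by_cases b1 : b = lo ∨ b = up
    · exact (key b a b1 a1.1 a1.2).symm
    · push Not at b1
      rw [(h a).2 a1.1 a1.2, (h b).2 b1.1 b1.2]
      exact fun e => hab (E.inj (Fin.ext (hP.injective e)))

/-- During a half twist the strand that moves to the right passes below the real axis and the one
that moves to the left above it. -/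
theorem twistLift_im (E : Exchange k lo up ρ ρ') (t : I) :
    (twistLift P k t (ρ lo)).im = -(Real.sin (Real.pi * t) * ((P (k + 1) - P k) / 2)) ∧
    (twistLift P k t (ρ up)).im = Real.sin (Real.pi * t) * ((P (k + 1) - P k) / 2) ∧
    ∀ a, a ≠ lo → a ≠ up → (twistLift P k t (ρ a)).im = 0 := by
  refine ⟨?_, ?_, fun a h1 h2 => ?_⟩
  · simp only [twistLift, E.lo_eq, if_true, halfTurn_im]
    ring
  · simp only [twistLift, E.up_eq, if_true, Nat.succ_ne_self, if_false, halfTurn_im]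
  · obtain ⟨h3, h4⟩ := E.other_ne h1 h2
    simp [twistLift, h3, h4]

/-- The half twist can be deformed linearly into a bent motion. -/
theorem twist_line_injective (hω : 0 < (ω₂ / ω₁).im) (E : Exchange k lo up ρ ρ')
    (hP : StrictMono P) (hspan : ∀ i j, i < n → j < n → P i - P j < 1)
    (hgap : P (k + 1) - P k < 1 / 2) {η : Fin n → ℝ} (hη : ∀ a b, η a - η b ≤ 1)
    (hlu : η lo < η up) (t s : I) :
    Function.Injective fun a => chart ω₁ ω₂ (AffineMap.lineMap (fun a => twistLift P k t (ρ a))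
      (bentMotion (fun a => P (ρ a)) (fun a => P (ρ' a)) η t) (s : ℝ) a) := by
  have h1 := staysInPlace_twistLift E hP t
  have h2 := staysInPlace_bentMotion E hP η t
  have h3 := h1.lineMap h2 s
  have hs0 := s.2.1
  have hs1 := s.2.2
  have ht0 := t.2.1
  have ht1 := t.2.2
  obtain ⟨i1, i2, i3⟩ := twistLift_im (P := P) E t
  have hg := sub_pos.2 (hP (Nat.lt_succ_self k))
  have hsin := sin_pi_nonneg t
  have hsin' := Real.sin_le_one (Real.pi * t)
  have htt : 0 ≤ (t : ℝ) * (1 - t) := mul_nonneg ht0 (by linarith)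
  have htt' : (t : ℝ) * (1 - t) ≤ 1 / 4 := by nlinarith [sq_nonneg ((t : ℝ) - 1 / 2)]
  have him : ∀ a, (AffineMap.lineMap (fun a => twistLift P k t (ρ a))
      (bentMotion (fun a => P (ρ a)) (fun a => P (ρ' a)) η t) (s : ℝ) a).im =
      (1 - s) * (twistLift P k t (ρ a)).im + s * (t * (1 - t) * η a) := by
    intro a
    simp [AffineMap.lineMap_apply_module, bentMotion]
  have hlu_ne : (AffineMap.lineMap (fun a => twistLift P k t (ρ a))
      (bentMotion (fun a => P (ρ a)) (fun a => P (ρ' a)) η t) (s : ℝ) lo) ≠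
      (AffineMap.lineMap (fun a => twistLift P k t (ρ a))
      (bentMotion (fun a => P (ρ a)) (fun a => P (ρ' a)) η t) (s : ℝ) up) := by
    intro e
    by_cases h0 : t = 0
    · subst h0
      have := congrArg Complex.re e
      simp [AffineMap.lineMap_apply_module, bentMotion, twistLift, E.lo_eq, E.up_eq,
        Complex.smul_re, -Complex.real_smul] at this
      nlinarith
    by_cases h1 : t = 1
    · subst h1
      have := congrArg Complex.re e
      simp [AffineMap.lineMap_apply_module, bentMotion, twistLift, E.lo_eq, E.up_eq, E.lo_eq',
        E.up_eq', Complex.smul_re, -Complex.real_smul] at this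
      nlinarith
    have hsp := sin_pi_pos h0 h1
    obtain ⟨h0, h1⟩ := I_pos_of_ne h0 h1
    have := congrArg Complex.im e
    rw [him, him, i1, i2] at this
    have p1 : 0 < Real.sin (Real.pi * t) * (P (k + 1) - P k) := mul_pos hsp hg
    have p2 : 0 < (t : ℝ) * (1 - t) * (η up - η lo) :=
      mul_pos (mul_pos h0 (by linarith)) (by linarith)
    rcases hs0.eq_or_lt with hs | hs
    · rw [← hs] at this; nlinarith
    · nlinarith [mul_pos hs p2, mul_nonneg (sub_nonneg.2 hs1) p1.le]
  refine injective_chart_comp hω (fun a b hab => ?_) (fun a b => ⟨h3.abs_re_lt E hspan a b, ?_⟩)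
  · by_cases c1 : a = lo ∧ b = up
    · rw [c1.1, c1.2]; exact hlu_ne
    by_cases c2 : a = up ∧ b = lo
    · rw [c2.1, c2.2]; exact hlu_ne.symm
    exact fun e => h3.re_ne E hP hab c1 c2 (congrArg Complex.re e)
  · rw [him, him]
    have b1 : ∀ a, |(twistLift P k t (ρ a)).im| ≤ (P (k + 1) - P k) / 2 := by
      intro a
      by_cases a1 : a = lo
      · rw [a1, i1, abs_neg, abs_of_nonneg (by positivity)]; nlinarith
      by_cases a2 : a = up
      · rw [a2, i2, abs_of_nonneg (by positivity)]; nlinarith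
      rw [i3 a a1 a2]; simp; linarith
    have b2 : |(twistLift P k t (ρ a)).im - (twistLift P k t (ρ b)).im| < 1 / 2 := by
      have := abs_sub (twistLift P k t (ρ a)).im (twistLift P k t (ρ b)).im
      linarith [b1 a, b1 b]
    have b3 : |(t : ℝ) * (1 - t) * η a - t * (1 - t) * η b| < 1 / 2 := by
      rw [← mul_sub, abs_lt]
      have := hη a b; have := hη b a
      constructor <;> nlinarith
    have := abs_convex_lt (sub_nonneg.2 hs1) hs0 (by ring) b2 b3
    convert this using 2
    ring

end TwistArcs

/-! ### Words in half twists -/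

section Words

variable {ω₁ ω₂ : ℂ} {n : ℕ}

/-- Heights for a stack of `n` points, distinct and close together. -/
structure Stack (n : ℕ) where
  h : Fin n → ℝ
  inj : Function.Injective h
  small : ∀ a b, |h a - h b| < 1 / 2

/-- The stack in which the points are arranged by a given injective ranking. -/
def Stack.ofRank (r : Fin n → ℕ) (hr : Function.Injective r) (N : ℕ) (hN : ∀ a, r a < N) :
    Stack n where
  h a := r a / (2 * N)
  inj a b hab := by
    have : (0 : ℝ) < N := by exact_mod_cast (Nat.zero_le _).trans_lt (hN a)
    field_simp at hab
    exact hr (by exact_mod_cast hab)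
  small a b := by
    have h0 : (0 : ℝ) < N := by exact_mod_cast (Nat.zero_le _).trans_lt (hN a)
    have h1 : (r a : ℝ) < N := by exact_mod_cast hN a
    have h2 : (r b : ℝ) < N := by exact_mod_cast hN b
    rw [← sub_div, abs_lt, div_lt_div_iff₀ (by positivity) (by norm_num), lt_div_iff₀ (by positivity)]
    have h3 : (0 : ℝ) ≤ r a := by positivity
    have h4 : (0 : ℝ) ≤ r b := by positivity
    constructor <;> linarith

theorem Stack.ofRank_lt {r : Fin n → ℕ} {hr : Function.Injective r} {N : ℕ} {hN : ∀ a, r a < N}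
    {a b : Fin n} : (Stack.ofRank r hr N hN).h a < (Stack.ofRank r hr N hN).h b ↔ r a < r b := by
  have : (0 : ℝ) < N := by exact_mod_cast (Nat.zero_le _).trans_lt (hN a)
  simp only [Stack.ofRank]
  rw [div_lt_div_iff_of_pos_right (by positivity)]
  exact Nat.cast_lt

/-- A configuration of points on a segment of the real axis of length less than `1`. -/
structure RealConf (n : ℕ) where
  x : Fin n → ℝ
  inj : Function.Injective x
  small : ∀ a b, |x a - x b| < 1

/-- The points of the plane of a configuration on the real axis. -/
def RealConf.pts (Q : RealConf n) (a : Fin n) : ℂ := Q.x a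

variable (hω : 0 < (ω₂ / ω₁).im)

/-- The configuration in the curve given by one on the real axis. -/
def RealConf.conf (Q : RealConf n) : OrdConf n (Curve ω₁ ω₂) :=
  confOf ω₁ ω₂ Q.pts (injective_chart_comp hω
    (real_mem_heightSet Q.inj Q.small fun _ => 0).2.1
    (real_mem_heightSet Q.inj Q.small fun _ => 0).2.2)

namespace Stack

/-- The patch around the stack in the space of ordered configurations of the curve. -/
def patch (S : Stack n) : StarPatch (Fin n → ℂ) (OrdConf n (Curve ω₁ ω₂)) :=
  heightPatch hω S.h S.inj S.small

/-- The patch around the stack in the space of unordered configurations of the curve. -/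
def patchU (S : Stack n) : StarPatch (Fin n → ℂ) (UnordConf n (Curve ω₁ ω₂)) :=
  (S.patch hω).map (toUnord n (Curve ω₁ ω₂))

/-- The straight path from the stack to a configuration on the real axis, up to homotopy. -/
def look (S : Stack n) (Q : RealConf n) {a : UnordConf n (Curve ω₁ ω₂)}
    (ha : toUnord n (Curve ω₁ ω₂) (Q.conf hω) = a) : Arc (S.patchU hω).o a :=
  (S.patchU hω).ray (real_mem_heightSet Q.inj Q.small S.h) ha

/-- The path from one stack to another one through a configuration on the real axis. -/
def via (S S' : Stack n) (Q : RealConf n) : Arc (S.patchU hω).o (S'.patchU hω).o :=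
  (S.look hω Q rfl).trans (S'.look hω Q rfl).symm

theorem via_eq (S S' : Stack n) (Q : RealConf n) {a : UnordConf n (Curve ω₁ ω₂)}
    (ha : toUnord n (Curve ω₁ ω₂) (Q.conf hω) = a) :
    S.via hω S' Q = (S.look hω Q ha).trans (S'.look hω Q ha).symm := by
  subst ha; rfl

end Stack

/-- The bends `η` are compatible with a stack of heights and a pair of configurations. -/
structure BentOK (Q Q' : RealConf n) (η : Fin n → ℝ) : Prop where
  small : ∀ a b, η a - η b ≤ 1
  cross : ∀ a b, a ≠ b → η a = η b → 0 < (Q.x a - Q.x b) * (Q'.x a - Q'.x b)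

/-- The bent motion as a path of ordered configurations, with end points given freely. -/
def bentPath {Q Q' : RealConf n} {η : Fin n → ℝ} (B : BentOK Q Q' η) (S : Stack n)
    (hmono : ∀ a b, S.h a < S.h b → η a ≤ η b) :
    Path (Q.conf hω) (Q'.conf hω) where
  toFun t := (S.patch hω).F ⟨bentMotion Q.x Q'.x η t,
    bentMotion_mem hmono B.small B.cross Q.inj Q'.inj Q.small Q'.small t⟩
  continuous_toFun := (S.patch hω).cont.comp
    (Continuous.subtype_mk (continuous_bentMotion _ _ _) _)
  source' := Subtype.ext (by
    simp only [Stack.patch, heightPatch, bentMotion_zero]; rfl)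
  target' := Subtype.ext (by
    simp only [Stack.patch, heightPatch, bentMotion_one]; rfl)

theorem mk_bentPath {Q Q' : RealConf n} {η : Fin n → ℝ} (B : BentOK Q Q' η) (S S' : Stack n)
    (hmono : ∀ a b, S.h a < S.h b → η a ≤ η b) (hmono' : ∀ a b, S'.h a < S'.h b → η a ≤ η b)
    {a b : UnordConf n (Curve ω₁ ω₂)} (ha : toUnord n (Curve ω₁ ω₂) (Q.conf hω) = a)
    (hb : toUnord n (Curve ω₁ ω₂) (Q'.conf hω) = b) :
    (.mk (((bentPath hω B S' hmono').map (toUnord n _).continuous).cast ha.symm hb.symm) :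
      Arc a b) = (S.look hω Q ha).symm.trans (S.look hω Q' hb) := by
  refine (S.patchU hω).arc_eq _ (bentMotion Q.x Q'.x η) (continuous_bentMotion _ _ _)
    (bentMotion_mem hmono B.small B.cross Q.inj Q'.inj Q.small Q'.small) (fun t => rfl) ?_ ?_
    _ _ ha hb
  · exact bentMotion_zero _ _ _
  · exact bentMotion_one _ _ _

/-- If a bent motion is visible from two stacks, then it makes no difference for the passage from
one to the other. -/
theorem Stack.via_congr {Q Q' : RealConf n} {η : Fin n → ℝ} (B : BentOK Q Q' η) (S S' : Stack n)
    (hmono : ∀ a b, S.h a < S.h b → η a ≤ η b) (hmono' : ∀ a b, S'.h a < S'.h b → η a ≤ η b) :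
    S.via hω S' Q = S.via hω S' Q' := by
  have h1 := mk_bentPath hω B S S hmono hmono rfl rfl
  rw [mk_bentPath hω B S' S hmono' hmono rfl rfl] at h1
  have h2 := congrArg (fun f => (S.look hω Q rfl).trans (f.trans (S'.look hω Q' rfl).symm)) h1
  simp only [Path.Homotopic.Quotient.trans_assoc, Path.Homotopic.Quotient.trans_symm,
    Path.Homotopic.Quotient.trans_refl, Arc.trans_symm_cancel] at h2
  exact h2

variable {P : ℕ → ℝ}

/-- The places of a permuted configuration on the points `P 0 < P 1 < ⋯`. -/
def placed (hP : StrictMono P) (hspan : ∀ i j, i < n → j < n → P i - P j < 1)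
    {ρ : Fin n → Fin n} (hρ : Function.Injective ρ) : RealConf n where
  x a := P (ρ a)
  inj _ _ h := hρ (Fin.ext (hP.injective h))
  small a b := abs_lt.2 ⟨by linarith [hspan _ _ (ρ b).2 (ρ a).2], hspan _ _ (ρ a).2 (ρ b).2⟩

theorem toUnord_placed (hP : StrictMono P) (hspan : ∀ i j, i < n → j < n → P i - P j < 1)
    {ρ : Fin n → Fin n} (hρ : Function.Injective ρ) {c : OrdConf n (Curve ω₁ ω₂)}
    (hc : ∀ a : Fin n, c.1 a = chart ω₁ ω₂ (P a)) :
    toUnord n (Curve ω₁ ω₂) ((placed hP hspan hρ).conf hω) = toUnord n _ c :=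
  toUnord_eq_of_comp hρ fun a => (hc (ρ a)).symm

/-- Strands of different heights may exchange their places. -/
theorem Exchange.bentOK {k : ℕ} {lo up : Fin n} {ρ ρ' : Fin n → Fin n}
    (E : Exchange k lo up ρ ρ') (hP : StrictMono P)
    (hspan : ∀ i j, i < n → j < n → P i - P j < 1) {η : Fin n → ℝ} (hη : ∀ a b, η a - η b ≤ 1)
    (hlu : η lo < η up) : BentOK (placed hP hspan E.inj) (placed hP hspan E.inj') η where
  small := hη
  cross a b hab h := E.no_cross hP hab (by rintro ⟨rfl, rfl⟩; exact hlu.ne h)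
    (by rintro ⟨rfl, rfl⟩; exact hlu.ne' h)

/-- A half twist as seen from a stack in which the strands are arranged such that the one that
moves to the right can pass below. -/
theorem twist_gen {k : ℕ} {lo up : Fin n} {ρ ρ' : Fin n → Fin n}
    (E : Exchange k lo up ρ ρ') (hP : StrictMono P)
    (hspan : ∀ i j, i < n → j < n → P i - P j < 1) (hgap : P (k + 1) - P k < 1 / 2)
    {c : OrdConf n (Curve ω₁ ω₂)} (hc : ∀ a : Fin n, c.1 a = chart ω₁ ω₂ (P a))
    {τ : Twists c} (hτ : ∀ k hk t (a : Fin n), (τ k hk t).1 a = chart ω₁ ω₂ (twistLift P k t a))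
    (S : Stack n) {η : Fin n → ℝ} (hη : ∀ a b, η a - η b ≤ 1) (hlu : η lo < η up)
    (hmono : ∀ a b, S.h a < S.h b → η a ≤ η b) :
    τ.gen k = ((S.look hω _ (toUnord_placed hω hP hspan E.inj hc)).symm.trans
      (S.look hω _ (toUnord_placed hω hP hspan E.inj' hc)) : Arc (toUnord n _ c) (toUnord n _ c)) := by
  rw [← mk_bentPath hω (E.bentOK hP hspan hη hlu) S S hmono hmono]
  have hk : k + 1 < n := by have := (ρ up).2; rw [E.up_eq] at this; exact this
  rw [Twists.gen, dif_pos hk, cls_eq]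
  have h0 : ∀ s : I, (AffineMap.lineMap (fun a => twistLift P k 0 (ρ a))
      (bentMotion (fun a => P (ρ a)) (fun a => P (ρ' a)) η 0) (s : ℝ)) =
      fun a => (P (ρ a) : ℂ) := by
    intro s
    have : (fun a : Fin n => twistLift P k 0 (ρ a)) = fun a => (P (ρ a) : ℂ) := by
      funext a
      simp only [twistLift]
      split_ifs with h1 h2
      · simp [h1]
      · simp [h2]
      · rfl
    rw [this, bentMotion_zero, AffineMap.lineMap_same]
    rfl
  have h1 : ∀ s : I, (AffineMap.lineMap (fun a => twistLift P k 1 (ρ a))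
      (bentMotion (fun a => P (ρ a)) (fun a => P (ρ' a)) η 1) (s : ℝ)) =
      fun a => (P (ρ' a) : ℂ) := by
    intro s
    have : (fun a : Fin n => twistLift P k 1 (ρ a)) = fun a => (P (ρ' a) : ℂ) := by
      funext a
      by_cases a1 : a = lo
      · simp [twistLift, a1, E.lo_eq, E.lo_eq']
      by_cases a2 : a = up
      · simp [twistLift, a2, E.up_eq, E.up_eq']
      obtain ⟨h3, h4⟩ := E.other_ne a1 a2
      simp [twistLift, h3, h4, E.other a a1 a2]
    rw [this, bentMotion_one, AffineMap.lineMap_same]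
    rfl
  -- the linear homotopy from the half twist to the bent motion has no collisions
  refine mk_eq_of_family (fun ts : I × I => toUnord n _ (confOf ω₁ ω₂ _
    (twist_line_injective hω E hP hspan hgap hη hlu ts.1 ts.2))) ?_ ?_ ?_ ?_ ?_
  · refine (toUnord n _).continuous.comp (Continuous.subtype_mk (continuous_pi fun a => ?_) _)
    refine continuous_chart.comp ?_
    have e : (fun ts : I × I => AffineMap.lineMap (fun a => twistLift P k ts.1 (ρ a))
      (bentMotion (fun a => P (ρ a)) (fun a => P (ρ' a)) η ts.1) (ts.2 : ℝ) a) = fun ts =>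
        (((1 - ts.2 : ℝ)) : ℂ) * twistLift P k ts.1 (ρ a) +
        ((ts.2 : ℝ) : ℂ) * bentMotion (fun a => P (ρ a)) (fun a => P (ρ' a)) η ts.1 a := by
      funext ts; simp [AffineMap.lineMap_apply_module]
    have c1 := (continuous_twistLift P k (ρ a)).comp (continuous_fst (X := I) (Y := I))
    have c2 := ((continuous_apply a).comp (continuous_bentMotion (fun a => P (ρ a))
      (fun a => P (ρ' a)) η)).comp (continuous_fst (X := I) (Y := I))
    have c3 : Continuous fun ts : I × I => ((ts.2 : ℝ) : ℂ) := by fun_prop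
    have c4 : Continuous fun ts : I × I => ((1 - ts.2 : ℝ) : ℂ) := by fun_prop
    rw [e]
    exact (c4.mul c1).add (c3.mul c2)
  · intro s
    refine toUnord_eq_of_comp E.inj fun a => ?_
    change chart ω₁ ω₂ ((AffineMap.lineMap _ _ _ : Fin n → ℂ) a) = _
    rw [h0 s, hc]
  · intro s
    refine toUnord_eq_of_comp E.inj' fun a => ?_
    change chart ω₁ ω₂ ((AffineMap.lineMap _ _ _ : Fin n → ℂ) a) = _
    rw [h1 s, hc]
  · intro t
    refine (toUnord_eq_of_comp E.inj fun a => ?_).symm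
    change chart ω₁ ω₂ ((AffineMap.lineMap _ _ ((0 : I) : ℝ) : Fin n → ℂ) a) = _
    rw [hτ]
    simp
  · intro t
    refine congrArg (toUnord n _) (Subtype.ext (funext fun a => ?_))
    change chart ω₁ ω₂ (bentMotion _ _ _ _ _) =
      chart ω₁ ω₂ ((AffineMap.lineMap _ _ ((1 : I) : ℝ) : Fin n → ℂ) a)
    simp
    rfl

end Words

/-! ### Telescoping products -/

section Telescope

variable {X : Type*} [TopologicalSpace X] {o x : X}

/-- A product of generators, each of which is the difference of two consecutive arcs to a common
observer, is the difference of the extreme arcs. -/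
theorem prod_range_telescope (b : ℕ → FundamentalGroup X x) (g : ℕ → Arc o x) (s j : ℕ)
    (h : ∀ k, k < j → b (s + k) = ((g (s + k + 1)).symm.trans (g (s + k)) : Arc x x)) :
    ((List.range j).map fun k => b (s + k)).prod =
      ((g (s + j)).symm.trans (g s) : Arc x x) := by
  induction j with
  | zero => simp; rfl
  | succ j ih =>
    rw [List.range_succ, List.map_append, List.prod_append, ih fun k hk => h k (by omega)]
    simp only [List.map_cons, List.map_nil, List.prod_singleton]
    rw [h j (by omega), FundamentalGroup.mul_def]
    simp [Nat.add_assoc]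

theorem prod_reverse_range_telescope (b : ℕ → FundamentalGroup X x) (g : ℕ → Arc o x) (s l : ℕ)
    (h : ∀ k, k < l → b (s + k) = ((g (s + k)).symm.trans (g (s + k + 1)) : Arc x x)) :
    (((List.range' s l).reverse).map b).prod =
      ((g s).symm.trans (g (s + l)) : Arc x x) := by
  induction l with
  | zero => simp; rfl
  | succ l ih =>
    rw [List.range'_concat, List.reverse_append, List.map_append, List.prod_append,
      ih fun k hk => h k (by omega)]
    simp only [List.reverse_singleton, List.map_cons, List.map_nil, List.prod_singleton, one_mul]
    rw [h l (by omega), FundamentalGroup.mul_def]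
    simp [Nat.add_assoc]

end Telescope

/-! ### The braid of a strand that runs around another one -/

section StrandLoops

variable {ω₁ ω₂ : ℂ} {n : ℕ}

/-- The strand number `m` sits at the place `k ≤ m`, and the strands in between move up by one. -/
def place (m k : ℕ) (_hk : k ≤ m) (hm : m < n) (s : Fin n) : Fin n :=
  if h1 : (s : ℕ) < k then s
  else if h2 : (s : ℕ) < m then ⟨s + 1, by omega⟩
  else if (s : ℕ) = m then ⟨k, by omega⟩
  else s

theorem place_val (m k : ℕ) (hk : k ≤ m) (hm : m < n) (s : Fin n) :
    (place m k hk hm s : ℕ) =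
      if (s : ℕ) < k then (s : ℕ) else if (s : ℕ) < m then s + 1 else if (s : ℕ) = m then k else s := by
  unfold place
  split_ifs <;> rfl

theorem place_injective (m k : ℕ) (hk : k ≤ m) (hm : m < n) :
    Function.Injective (place m k hk hm) := by
  intro a b h
  have := congrArg Fin.val h
  rw [place_val, place_val] at this
  apply Fin.ext
  split_ifs at this <;> omega

theorem exchange_left (m k : ℕ) (hk : k < m) (hm : m < n) :
    Exchange k ⟨k, hk.trans hm⟩ ⟨m, hm⟩ (place m (k + 1) hk hm) (place m k hk.le hm) where
  inj := place_injective _ _ _ _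
  lo_eq := by simp [place_val]
  up_eq := by simp [place_val, hk.not_ge]
  lo_eq' := by simp [place_val, hk]
  up_eq' := by simp [place_val, hk.not_gt]
  other a h1 h2 := by
    have h1 : (a : ℕ) ≠ k := fun e => h1 (Fin.ext e)
    have h2 : (a : ℕ) ≠ m := fun e => h2 (Fin.ext e)
    apply Fin.ext
    rw [place_val, place_val]
    split_ifs <;> omega

theorem exchange_right (m k : ℕ) (hk : k < m) (hm : m < n) :
    Exchange k ⟨m, hm⟩ ⟨k, hk.trans hm⟩ (place m k hk.le hm) (place m (k + 1) hk hm) where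
  inj := place_injective _ _ _ _
  lo_eq := (exchange_left m k hk hm).up_eq'
  up_eq := (exchange_left m k hk hm).lo_eq'
  lo_eq' := (exchange_left m k hk hm).up_eq
  up_eq' := (exchange_left m k hk hm).lo_eq
  other a h1 h2 := ((exchange_left m k hk hm).other a h2 h1).symm

/-- Height ranks: the strands `p', …, m - 1` at the bottom, the strands `0, …, p' - 1` at the top.
-/
def rankLow (n p' m : ℕ) (s : Fin n) : ℕ :=
  if (s : ℕ) < p' then 2 * n + s else if (s : ℕ) < m then s else n + s

/-- Height ranks: the strands `p', …, m - 1` at the bottom, the strand `m` at the top. -/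
def rankHigh (n p' m : ℕ) (s : Fin n) : ℕ :=
  if (s : ℕ) < p' then n + s else if (s : ℕ) < m then s else if (s : ℕ) = m then 2 * n + s
  else n + s

/-- Height ranks: the strands `0, …, p' - 1` at the bottom, the strand `m` at the top. -/
def rankOver (n p' m : ℕ) (s : Fin n) : ℕ :=
  if (s : ℕ) < p' then s else if (s : ℕ) = m then 2 * n + s else n + s

/-- The stack in which the strand `m` is above `p', …, m - 1` and below `0, …, p' - 1`. -/
def stackLow (n p' m : ℕ) : Stack n :=
  Stack.ofRank (rankLow n p' m)
    (fun a b h => Fin.ext (by have := a.2; have := b.2; unfold rankLow at h; split_ifs at h <;> omega))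
    (3 * n) (fun a => by have := a.2; unfold rankLow; split_ifs <;> omega)

/-- The stack in which the strand `m` is on top and `p', …, m - 1` are at the bottom. -/
def stackHigh (n p' m : ℕ) : Stack n :=
  Stack.ofRank (rankHigh n p' m)
    (fun a b h => Fin.ext (by have := a.2; have := b.2; unfold rankHigh at h; split_ifs at h <;> omega))
    (3 * n) (fun a => by have := a.2; unfold rankHigh; split_ifs <;> omega)

/-- The stack in which the strand `m` is on top and `0, …, p' - 1` are at the bottom. -/
def stackOver (n p' m : ℕ) : Stack n :=
  Stack.ofRank (rankOver n p' m)
    (fun a b h => Fin.ext (by have := a.2; have := b.2; unfold rankOver at h; split_ifs at h <;> omega))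
    (3 * n) (fun a => by have := a.2; unfold rankOver; split_ifs <;> omega)

theorem stackLow_lt {p' m : ℕ} {a b : Fin n} :
    (stackLow n p' m).h a < (stackLow n p' m).h b ↔ rankLow n p' m a < rankLow n p' m b :=
  Stack.ofRank_lt

theorem stackHigh_lt {p' m : ℕ} {a b : Fin n} :
    (stackHigh n p' m).h a < (stackHigh n p' m).h b ↔ rankHigh n p' m a < rankHigh n p' m b :=
  Stack.ofRank_lt

theorem stackOver_lt {p' m : ℕ} {a b : Fin n} :
    (stackOver n p' m).h a < (stackOver n p' m).h b ↔ rankOver n p' m a < rankOver n p' m b :=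
  Stack.ofRank_lt

/-- The bend that lets the strands `p', …, m - 1` pass below. -/
def bendLow (p' m : ℕ) (s : Fin n) : ℝ := if p' ≤ (s : ℕ) ∧ (s : ℕ) < m then -1 else 0

/-- The bend that lets the strands `0, …, p' - 1` pass above. -/
def bendTop (p' : ℕ) (s : Fin n) : ℝ := if (s : ℕ) < p' then 1 else 0

/-- The bend that lets the strand `m` pass above. -/
def bendOne (m : ℕ) (s : Fin n) : ℝ := if (s : ℕ) = m then 1 else 0

theorem bendLow_sub_le (p' m : ℕ) (a b : Fin n) : bendLow p' m a - bendLow p' m b ≤ 1 := by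
  unfold bendLow; split_ifs <;> norm_num

theorem bendTop_sub_le (p' : ℕ) (a b : Fin n) : bendTop p' a - bendTop p' b ≤ 1 := by
  unfold bendTop; split_ifs <;> norm_num

theorem bendOne_sub_le (m : ℕ) (a b : Fin n) : bendOne m a - bendOne m b ≤ 1 := by
  unfold bendOne; split_ifs <;> norm_num

theorem bendLow_mono_low {p' m : ℕ} (a b : Fin n)
    (h : (stackLow n p' m).h a < (stackLow n p' m).h b) : bendLow p' m a ≤ bendLow p' m b := by
  rw [stackLow_lt] at h
  have := a.2; have := b.2
  unfold rankLow at h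
  unfold bendLow
  split_ifs <;> first | (norm_num; done) | (exfalso; split_ifs at h <;> omega)

theorem bendLow_mono_high {p' m : ℕ} (a b : Fin n)
    (h : (stackHigh n p' m).h a < (stackHigh n p' m).h b) : bendLow p' m a ≤ bendLow p' m b := by
  rw [stackHigh_lt] at h
  have := a.2; have := b.2
  unfold rankHigh at h
  unfold bendLow
  split_ifs <;> first | (norm_num; done) | (exfalso; split_ifs at h <;> omega)

theorem bendTop_mono_low {p' m : ℕ} (a b : Fin n)
    (h : (stackLow n p' m).h a < (stackLow n p' m).h b) : bendTop p' a ≤ bendTop p' b := by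
  rw [stackLow_lt] at h
  have := a.2; have := b.2
  unfold rankLow at h
  unfold bendTop
  split_ifs <;> first | (norm_num; done) | (exfalso; split_ifs at h <;> omega)

theorem bendOne_mono_high {p' m : ℕ} (hpm : p' ≤ m) (a b : Fin n)
    (h : (stackHigh n p' m).h a < (stackHigh n p' m).h b) : bendOne m a ≤ bendOne m b := by
  rw [stackHigh_lt] at h
  have := a.2; have := b.2
  unfold rankHigh at h
  unfold bendOne
  split_ifs <;> first | (norm_num; done) | (exfalso; split_ifs at h <;> omega)

theorem bendOne_mono_over {p' m : ℕ} (hpm : p' ≤ m) (a b : Fin n)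
    (h : (stackOver n p' m).h a < (stackOver n p' m).h b) : bendOne m a ≤ bendOne m b := by
  rw [stackOver_lt] at h
  have := a.2; have := b.2
  unfold rankOver at h
  unfold bendOne
  split_ifs <;> first | (norm_num; done) | (exfalso; split_ifs at h <;> omega)

variable (hω : 0 < (ω₂ / ω₁).im) {P : ℕ → ℝ} (hP : StrictMono P)
  (hspan : ∀ i j, i < n → j < n → P i - P j < 1)

/-- The configuration with the strand `m` at the place `k`. -/
abbrev placedAt (m k : ℕ) (hk : k ≤ m) (hm : m < n) : RealConf n :=
  placed hP hspan (place_injective m k hk hm)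

/-- The word for the braid in which the strand `m` passes above `p', …, m - 1` and below
`i + 1, …, p' - 1`, runs around the strand `i`, and returns. -/
theorem word_eq (hgap : ∀ k, k + 1 < n → P (k + 1) - P k < 1 / 2)
    {c : OrdConf n (Curve ω₁ ω₂)} (hc : ∀ a : Fin n, c.1 a = chart ω₁ ω₂ (P a))
    {τ : Twists c} (hτ : ∀ k hk t (a : Fin n), (τ k hk t).1 a = chart ω₁ ω₂ (twistLift P k t a))
    {i p' m : ℕ} (hi : i < p') (hpm : p' ≤ m) (hm : m < n) :
    conjBy (pureWord τ.gen i p') ((List.range (m - p')).map fun k => τ.gen (p' + k)).prod =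
      (((stackLow n p' m).look hω (placedAt hP hspan m m le_rfl hm)
          (toUnord_placed hω hP hspan _ hc)).symm.trans
        (((stackLow n p' m).via hω (stackHigh n p' m)
            (placedAt hP hspan m (i + 1) (by omega) hm)).trans
          (((stackLow n p' m).via hω (stackHigh n p' m)
            (placedAt hP hspan m i (by omega) hm)).symm.trans
          ((stackLow n p' m).look hω (placedAt hP hspan m m le_rfl hm)
          (toUnord_placed hω hP hspan _ hc)))) : Arc (toUnord n _ c) (toUnord n _ c)) := by
  have hmn := hm
  let g : ℕ → Arc ((stackLow n p' m).patchU hω).o (toUnord n _ c) := fun k =>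
    if hk : k ≤ m then (stackLow n p' m).look hω (placedAt hP hspan m k hk hm)
      (toUnord_placed hω hP hspan _ hc)
    else (stackLow n p' m).look hω (placedAt hP hspan m m le_rfl hm)
      (toUnord_placed hω hP hspan _ hc)
  have hg : ∀ k (hk : k ≤ m), g k = (stackLow n p' m).look hω (placedAt hP hspan m k hk hm)
      (toUnord_placed hω hP hspan _ hc) := fun k hk => by simp only [g, dif_pos hk]
  -- the first stage: the strand `m` passes above the strands `p', …, m - 1`
  have h1 : ∀ k, p' ≤ k → k < m → τ.gen k = ((g (k + 1)).symm.trans (g k) : Arc _ _) := by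
    intro k hk hkm
    rw [hg _ hkm, hg _ hkm.le]
    refine twist_gen hω (exchange_left m k hkm hm) hP hspan (hgap k (by omega)) hc hτ _
      (bendLow_sub_le p' m) ?_ bendLow_mono_low
    simp [bendLow, hk, hkm]
  -- the second stage, backwards: the strands `i, …, p' - 1` pass above the strand `m`
  have h2 : ∀ k, k < p' → τ.gen k = ((g k).symm.trans (g (k + 1)) : Arc _ _) := by
    intro k hk
    rw [hg _ (by omega), hg _ (by omega)]
    refine twist_gen hω (exchange_right m k (by omega) hm) hP hspan (hgap k (by omega)) hc hτ _
      (bendTop_sub_le p') ?_ bendTop_mono_low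
    simp [bendTop, hk, hpm.not_gt]
  -- the strand `m` passes above the strand `i`
  have h3 : τ.gen i = (((stackHigh n p' m).look hω (placedAt hP hspan m (i + 1) (by omega) hm)
      (toUnord_placed hω hP hspan _ hc)).symm.trans
      ((stackHigh n p' m).look hω (placedAt hP hspan m i (by omega) hm)
      (toUnord_placed hω hP hspan _ hc)) : Arc _ _) := by
    refine twist_gen hω (exchange_left m i (by omega) hm) hP hspan (hgap i (by omega)) hc hτ _
      (bendOne_sub_le m) ?_ (bendOne_mono_high hpm)
    have : i ≠ m := by omega
    simp [bendOne, this]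
  have hA : ((List.range (m - p')).map fun k => τ.gen (p' + k)).prod =
      ((g m).symm.trans (g p') : Arc _ _) := by
    rw [prod_range_telescope τ.gen g p' (m - p') fun k hk => h1 _ (by omega) (by omega)]
    congr 3
    omega
  have hB : (((List.range' (i + 1) (p' - 1 - i)).reverse).map τ.gen).prod =
      ((g (i + 1)).symm.trans (g p') : Arc _ _) := by
    rw [prod_reverse_range_telescope τ.gen g (i + 1) (p' - 1 - i) fun k hk => h2 _ (by omega)]
    congr 2
    omega
  have hii : τ.gen i ^ 2 = (τ.gen i * τ.gen i) := pow_two _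
  have hsq : τ.gen i ^ 2 = ((((stackHigh n p' m).look hω (placedAt hP hspan m (i + 1) (by omega) hm)
      (toUnord_placed hω hP hspan _ hc)).symm.trans
      ((stackHigh n p' m).look hω (placedAt hP hspan m i (by omega) hm)
      (toUnord_placed hω hP hspan _ hc))).trans ((g i).symm.trans (g (i + 1))) : Arc _ _) := by
    rw [hii]
    nth_rw 1 [h2 i hi]
    rw [h3]
    rfl
  rw [conjBy, pureWord, hA, hB, hsq]
  simp only [FundamentalGroup.mul_def, FundamentalGroup.inv_def]
  rw [(stackLow n p' m).via_eq hω _ _ (toUnord_placed hω hP hspan _ hc),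
    (stackLow n p' m).via_eq hω _ _ (toUnord_placed hω hP hspan _ hc),
    ← hg m le_rfl, ← hg (i + 1) (by omega), ← hg i (by omega)]
  simp

end StrandLoops

/-! ### Lassos -/

section Lassos

/-- A lasso is a tail, a full turn consisting of two half turns, and the tail backwards; this is
stated for its image in any space, where the tail need not be closed up in the plane. -/
theorem exists_lasso_split {X : Type*} [TopologicalSpace X] {U : Set ℂ} {G : U → X}
    (hG : Continuous G) {b w r : ℂ} (hH : ∀ t, halfTurn (w + r) b t ∈ U)
    (h1 : ∀ t, halfTurn (w + r) (w - r) t ∈ U) (h2 : ∀ t, halfTurn (w - r) (w + r) t ∈ U)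
    {a e e' : X} (he : ∀ h, G ⟨w + r, h⟩ = e) (he' : ∀ h, G ⟨w - r, h⟩ = e') (γ : Path a a)
    (hγ : ∀ t h, γ t = G ⟨lasso b w r t, h⟩) :
    ∃ (f : Path e a) (c₁ : Path e e') (c₂ : Path e' e),
      (∀ t, f t = G ⟨halfTurn (w + r) b t, hH t⟩) ∧
      (∀ t, c₁ t = G ⟨halfTurn (w + r) (w - r) t, h1 t⟩) ∧
      (∀ t, c₂ t = G ⟨halfTurn (w - r) (w + r) t, h2 t⟩) ∧
      (.mk γ : Arc a a) = ((Path.Homotopic.Quotient.mk f).symm.trans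
        ((Path.Homotopic.Quotient.mk c₁).trans (.mk c₂))).trans (.mk f) := by
  have hb : b ∈ U := by simpa using hH 1
  have hwp : w + r ∈ U := by simpa using hH 0
  have hwm : w - r ∈ U := by simpa using h1 1
  let F : Path (⟨w + r, hwp⟩ : U) ⟨b, hb⟩ :=
    ⟨⟨fun t => ⟨_, hH t⟩, by fun_prop⟩, by simp, by simp⟩
  let C1 : Path (⟨w + r, hwp⟩ : U) ⟨w - r, hwm⟩ :=
    ⟨⟨fun t => ⟨_, h1 t⟩, by fun_prop⟩, by simp, by simp⟩
  let C2 : Path (⟨w - r, hwm⟩ : U) ⟨w + r, hwp⟩ :=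
    ⟨⟨fun t => ⟨_, h2 t⟩, by fun_prop⟩, by simp, by simp⟩
  let Lo : Path (⟨b, hb⟩ : U) ⟨b, hb⟩ := (F.symm.trans (C1.trans C2)).trans F
  have hLo : ∀ t, (Lo t : ℂ) = lasso b w r t := by
    intro t
    have : Lo.map continuous_subtype_val = lasso b w r := by
      simp only [Lo, Path.map_trans, lasso]
      rfl
    rw [← this]; rfl
  have hγ' : ∀ t, γ t = G (Lo t) := fun t => by
    rw [hγ t (by rw [← hLo]; exact (Lo t).2)]
    congr 1
    exact Subtype.ext (hLo t).symm
  obtain rfl : a = G ⟨b, hb⟩ := by have := hγ' 0; simpa using this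
  obtain rfl := he hwp
  obtain rfl := he' hwm
  refine ⟨F.map hG, C1.map hG, C2.map hG, fun t => rfl, fun t => rfl, fun t => rfl, ?_⟩
  obtain rfl : γ = Lo.map hG := Path.ext (funext hγ')
  simp only [Lo, Path.map_trans]
  rfl

end Lassos

section StrandLoops

variable {ω₁ ω₂ : ℂ} {n : ℕ}

theorem BentOK.of_lt {Q Q' : RealConf n} {η : Fin n → ℝ} (hs : ∀ a b, η a - η b ≤ 1)
    (h : ∀ a b, a < b → η a = η b →
      (Q.x a < Q.x b ∧ Q'.x a < Q'.x b) ∨ (Q.x b < Q.x a ∧ Q'.x b < Q'.x a)) : BentOK Q Q' η where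
  small := hs
  cross a b hab e := by
    have key : ∀ a b, a < b → η a = η b → 0 < (Q.x a - Q.x b) * (Q'.x a - Q'.x b) := by
      intro a b hab e
      rcases h a b hab e with ⟨h1, h2⟩ | ⟨h1, h2⟩
      · exact mul_pos_of_neg_of_neg (sub_neg.2 h1) (sub_neg.2 h2)
      · exact mul_pos (sub_pos.2 h1) (sub_pos.2 h2)
    rcases hab.lt_or_gt with h1 | h1
    · exact key a b h1 e
    · have := key b a h1 e.symm
      nlinarith

/-- The positions of the strands when those from number `p'` on are translated by `ζ`. -/
def pushed (P : ℕ → ℝ) (p' : ℕ) (ζ : ℂ) (s : ℕ) : ℂ := if s < p' then P s else P s + ζ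

/-- The conditions under which the strands from number `p'` on can be pushed to the left, below the
strands `0, …, p' - 1`, until the strand `m` runs around the strand `i` on a circle of radius
`r`. -/
structure PushOK (n : ℕ) (P : ℕ → ℝ) (i p' m : ℕ) (r : ℝ) : Prop where
  hi : i < p'
  hpm : p' ≤ m
  hm : m < n
  r_pos : 0 < r
  r_lt : r < 1 / 2
  left : ∀ a, a < i → P a < P i - r
  right : ∀ a, i < a → a < p' → P i + r < P a
  right_m : P i + r < P m
  low : ∀ b, p' ≤ b → b < m → P b - P m + P i + r < P 0
  high : ∀ s, m < s → s < n → P (p' - 1) < P s - P m + P i - r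
  box : ∀ s a, p' ≤ s → s < n → a < p' → -1 < P s - P a + P i - P m - r

namespace PushOK

theorem lt_mi {P : ℕ → ℝ} {i p' m : ℕ} {r : ℝ} (O : PushOK n P i p' m r) : i < m :=
  O.hi.trans_le O.hpm

variable {P : ℕ → ℝ} {i p' m : ℕ} {r : ℝ} (O : PushOK n P i p' m r) (hP : StrictMono P)
  (hspan : ∀ i j, i < n → j < n → P i - P j < 1)

include O hP

/-- Where the pushed strands are in relation to the others at the two ends of the small circle. -/
theorem compare {ε : ℝ} (hε : ε = r ∨ ε = -r) {a s : ℕ} (ha : a < p') (hs : p' ≤ s) (hsn : s < n) :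
    (s < m → P s + (P i - P m + ε) < P a) ∧
    (s = m → (a < i → P a < P s + (P i - P m + ε)) ∧ (i < a → P s + (P i - P m + ε) < P a)) ∧
    (m < s → P a < P s + (P i - P m + ε)) := by
  have hr := O.r_pos
  have h1 : ε ≤ r := by rcases hε with rfl | rfl <;> linarith
  have h2 : -r ≤ ε := by rcases hε with rfl | rfl <;> linarith
  refine ⟨fun h => ?_, fun h => ⟨fun h' => ?_, fun h' => ?_⟩, fun h => ?_⟩
  · linarith [O.low s hs h, hP.monotone (Nat.zero_le a)]
  · subst h; linarith [O.left a h']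
  · subst h; linarith [O.right a h' ha]
  · have : P a ≤ P (p' - 1) := hP.monotone (by omega)
    linarith [O.high s h hsn]

/-- At the two ends of the small circle no two of the points collide. -/
theorem pushed_ne {ε : ℝ} (hε : ε = r ∨ ε = -r) {a s : ℕ} (ha : a < p') (hs : p' ≤ s)
    (hsn : s < n) : P a ≠ P s + (P i - P m + ε) := by
  obtain ⟨h1, h2, h3⟩ := O.compare hP hε ha hs hsn
  have hr := O.r_pos
  rcases lt_trichotomy s m with h | h | h
  · exact (h1 h).ne'
  · rcases lt_trichotomy a i with h' | h' | h'
    · exact ((h2 h).1 h').ne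
    · subst h h'
      rcases hε with rfl | rfl <;> intro e <;> linarith
    · exact ((h2 h).2 h').ne'
  · exact (h3 h).ne

include hspan in
/-- The configuration at the two ends of the small circle. -/
def conf {ε : ℝ} (hε : ε = r ∨ ε = -r) : RealConf n where
  x s := if (s : ℕ) < p' then P s else P s + (P i - P m + ε)
  inj a b h := by
    simp only at h
    split_ifs at h with h1 h2 h2
    · exact Fin.ext (hP.injective h)
    · exact absurd h (O.pushed_ne hP hε h1 (not_lt.1 h2) b.2)
    · exact absurd h.symm (O.pushed_ne hP hε h2 (not_lt.1 h1) a.2)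
    · exact Fin.ext (hP.injective (add_right_cancel h))
  small a b := by
    have hr := O.r_pos
    have e1 : ε ≤ r := by rcases hε with rfl | rfl <;> linarith
    have e2 : -r ≤ ε := by rcases hε with rfl | rfl <;> linarith
    have hm := O.right_m
    have h3 := hspan a b a.2 b.2
    have h4 := hspan b a b.2 a.2
    rw [abs_lt]
    split_ifs with h1 h2 h2
    · constructor <;> linarith
    · have := O.box b a (not_lt.1 h2) b.2 h1
      constructor <;> linarith
    · have := O.box a b (not_lt.1 h1) a.2 h2
      constructor <;> linarith
    · constructor <;> linarith

/-- When the moving strand crosses the real axis next to the `i`-th point, the order of the points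
on the real axis is that of a placed configuration. -/
theorem bentOK_place {ε : ℝ} (hε : ε = r ∨ ε = -r) (k : ℕ) (hk : k ≤ m)
    (hk' : (ε = r ∧ k = i + 1) ∨ (ε = -r ∧ k = i)) :
    BentOK (O.conf hP hspan hε) (placedAt hP hspan m k hk O.hm) (bendLow p' m) := by
  have hpm := O.hpm
  have hi := O.hi
  have hr := O.r_pos
  refine BentOK.of_lt (bendLow_sub_le p' m) fun a b hab e => ?_
  have hab' : (a : ℕ) < b := hab
  have hlt : ∀ {u v : Fin n}, (place m k hk O.hm u : ℕ) < place m k hk O.hm v →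
      (placedAt hP hspan m k hk O.hm).x u < (placedAt hP hspan m k hk O.hm).x v := fun h => hP h
  have e' : (p' ≤ (a : ℕ) ∧ (a : ℕ) < m) ↔ (p' ≤ (b : ℕ) ∧ (b : ℕ) < m) := by
    unfold bendLow at e
    split_ifs at e with h1 h2 h2
    · exact iff_of_true h1 h2
    · norm_num at e
    · norm_num at e
    · exact iff_of_false h1 h2
  have hkb : k = i + 1 ∨ k = i := hk'.imp And.right And.right
  by_cases hb : (b : ℕ) < p'
  · left
    have ha : (a : ℕ) < p' := hab'.trans hb
    refine ⟨?_, hlt ?_⟩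
    · simp only [conf, if_pos ha, if_pos hb]; exact hP hab'
    · rw [place_val, place_val]; split_ifs <;> omega
  by_cases ha : (a : ℕ) < p'
  · have hbm : m ≤ (b : ℕ) := by omega
    obtain ⟨-, h2, h3⟩ := O.compare hP hε ha (not_lt.1 hb) b.2
    simp only [conf, if_pos ha, if_neg hb]
    rcases hbm.eq_or_lt with h | h
    · have h2 := h2 h.symm
      rcases lt_trichotomy (a : ℕ) i with h' | h' | h'
      · left
        refine ⟨h2.1 h', hlt ?_⟩
        rw [place_val, place_val]; split_ifs <;> omega
      · rcases hk' with ⟨rfl, hk1⟩ | ⟨rfl, hk1⟩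
        · left
          refine ⟨?_, hlt ?_⟩
          · rw [← h, h']; linarith
          · rw [place_val, place_val]; split_ifs <;> omega
        · right
          refine ⟨?_, hlt ?_⟩
          · rw [← h, h']; linarith
          · rw [place_val, place_val]; split_ifs <;> omega
      · right
        refine ⟨h2.2 h', hlt ?_⟩
        rw [place_val, place_val]; split_ifs <;> omega
    · left
      refine ⟨h3 h, hlt ?_⟩
      rw [place_val, place_val]; split_ifs <;> omega
  · left
    refine ⟨?_, hlt ?_⟩
    · simp only [conf, if_neg ha, if_neg hb]
      linarith [hP hab']
    · rw [place_val, place_val]; split_ifs <;> omega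

/-- Between the two crossings of the real axis next to the `i`-th point, only the order of the
strands `i` and `m` changes. -/
theorem bentOK_circle :
    BentOK (O.conf hP hspan (Or.inl rfl)) (O.conf hP hspan (Or.inr rfl)) (bendOne (n := n) m) := by
  have hpm := O.hpm
  have hi := O.hi
  refine BentOK.of_lt (bendOne_sub_le m) fun a b hab e => ?_
  have hab' : (a : ℕ) < b := hab
  have e' : (a : ℕ) = m ↔ (b : ℕ) = m := by
    unfold bendOne at e
    split_ifs at e with h1 h2 h2
    · exact iff_of_true h1 h2
    · norm_num at e
    · norm_num at e
    · exact iff_of_false h1 h2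
  by_cases hb : (b : ℕ) < p'
  · have ha : (a : ℕ) < p' := hab'.trans hb
    left
    simp only [conf, if_pos ha, if_pos hb]
    exact ⟨hP hab', hP hab'⟩
  by_cases ha : (a : ℕ) < p'
  · obtain ⟨h1, -, h3⟩ := O.compare hP (Or.inl rfl) ha (not_lt.1 hb) b.2
    obtain ⟨h1', -, h3'⟩ := O.compare hP (Or.inr rfl) ha (not_lt.1 hb) b.2
    simp only [conf, if_pos ha, if_neg hb]
    rcases lt_trichotomy (b : ℕ) m with h | h | h
    · exact Or.inr ⟨h1 h, h1' h⟩
    · omega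
    · exact Or.inl ⟨h3 h, h3' h⟩
  · left
    simp only [conf, if_neg ha, if_neg hb]
    have := hP hab'
    constructor <;> linarith

include hspan in
/-- A pushed configuration is visible from a stack in which the strands are arranged suitably. -/
theorem pushed_mem (S : Stack n) {ζ : ℂ}
    (hS : ∀ a b, S.h a < S.h b → (pushed P p' ζ a).im ≤ (pushed P p' ζ b).im)
    (hne : ζ.im = 0 → ∀ a s, a < p' → p' ≤ s → s < n → P a ≠ P s + ζ.re)
    (hre : P i - P m - r ≤ ζ.re) (hre' : ζ.re ≤ 0) (him : |ζ.im| < 1 / 2) :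
    (fun s : Fin n => pushed P p' ζ s) ∈ heightSet S.h := by
  have key : ∀ a b : Fin n, (a : ℕ) < p' → ¬(b : ℕ) < p' → pushed P p' ζ a ≠ pushed P p' ζ b := by
    intro a b ha hb h
    simp only [pushed, if_pos ha, if_neg hb] at h
    have h1 := congrArg Complex.re h
    have h2 := congrArg Complex.im h
    simp at h1 h2
    exact hne h2.symm a b ha (not_lt.1 hb) b.2 h1
  refine ⟨hS, fun a b hab => ?_, fun a b => ⟨?_, ?_⟩⟩
  · by_cases ha : (a : ℕ) < p' <;> by_cases hb : (b : ℕ) < p'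
    · simp only [pushed, if_pos ha, if_pos hb]
      exact fun h => hab (Fin.ext (hP.injective (by exact_mod_cast h)))
    · exact key a b ha hb
    · exact (key b a hb ha).symm
    · simp only [pushed, if_neg ha, if_neg hb]
      intro h
      exact hab (Fin.ext (hP.injective (by exact_mod_cast add_right_cancel h)))
  · have h3 := hspan a b a.2 b.2
    have h4 := hspan b a b.2 a.2
    rw [abs_lt]
    simp only [pushed]
    split_ifs with h1 h2 h2 <;> simp
    · constructor <;> linarith
    · have := O.box b a (not_lt.1 h2) b.2 h1
      constructor <;> linarith
    · have := O.box a b (not_lt.1 h1) a.2 h2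
      constructor <;> linarith
    · constructor <;> linarith
  · simp only [pushed]
    split_ifs <;> simp <;> first | exact him | (simpa using him)

end PushOK

theorem halfTurn_add (u v b : ℂ) (t : I) : halfTurn (u + b) (v + b) t = halfTurn u v t + b := by
  change (u + b + (v + b)) / 2 + Complex.exp (Real.pi * (t : ℝ) * Complex.I) * ((u + b - (v + b)) / 2)
    = (u + v) / 2 + Complex.exp (Real.pi * (t : ℝ) * Complex.I) * ((u - v) / 2) + b
  ring

theorem halfTurn_im_eq_zero {u v : ℝ} (huv : u ≠ v) {t : I} (h : (halfTurn u v t).im = 0) :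
    t = 0 ∨ t = 1 := by
  rw [halfTurn_im] at h
  by_contra hc
  push Not at hc
  have := sin_pi_pos hc.1 hc.2
  rcases mul_eq_zero.1 h with h | h
  · exact this.ne' h
  · exact huv (by linarith)

theorem abs_halfTurn_im_lt {u v : ℝ} (h : |u - v| < 1) (t : I) : |(halfTurn u v t).im| < 1 / 2 := by
  rw [halfTurn_im, abs_mul, abs_of_nonneg (sin_pi_nonneg t), abs_div]
  have := Real.sin_le_one (Real.pi * t)
  have h0 := sin_pi_nonneg t
  have : |(2 : ℝ)| = 2 := by norm_num
  rw [this]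
  nlinarith [abs_nonneg (u - v)]

end StrandLoops

/-! ### A lasso as a word in half twists -/

section StrandLoops

variable {ω₁ ω₂ : ℂ} {n : ℕ}

theorem stackLow_pushed {p' m : ℕ} {P : ℕ → ℝ} {ζ : ℂ} (h : ζ.im ≤ 0) (a b : Fin n)
    (hab : (stackLow n p' m).h a < (stackLow n p' m).h b) :
    (pushed P p' ζ a).im ≤ (pushed P p' ζ b).im := by
  rw [stackLow_lt] at hab
  have := a.2; have := b.2
  unfold rankLow at hab
  unfold pushed
  split_ifs <;> simp <;> first | (exact h) | (exfalso; split_ifs at hab <;> omega)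

theorem stackOver_pushed {p' m : ℕ} (hpm : p' ≤ m) {P : ℕ → ℝ} {ζ : ℂ} (h : 0 ≤ ζ.im) (a b : Fin n)
    (hab : (stackOver n p' m).h a < (stackOver n p' m).h b) :
    (pushed P p' ζ a).im ≤ (pushed P p' ζ b).im := by
  rw [stackOver_lt] at hab
  have := a.2; have := b.2
  unfold rankOver at hab
  unfold pushed
  split_ifs <;> simp <;> first | (exact h) | (exfalso; split_ifs at hab <;> omega)

/-- Pushing the strands `p', …, n - 1` along a lasso, so that the strand `m` runs around the
strand `i`, is the braid in which the strand `m` alone moves. -/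
theorem pushed_lasso_eq_word (hω : 0 < (ω₂ / ω₁).im) {P : ℕ → ℝ} (hP : StrictMono P)
    (hspan : ∀ i j, i < n → j < n → P i - P j < 1)
    (hgap : ∀ k, k + 1 < n → P (k + 1) - P k < 1 / 2) {i p' m : ℕ} {r : ℝ}
    (O : PushOK n P i p' m r)
    {c : OrdConf n (Curve ω₁ ω₂)} (hc : ∀ a : Fin n, c.1 a = chart ω₁ ω₂ (P a))
    {τ : Twists c} (hτ : ∀ k hk t (a : Fin n), (τ k hk t).1 a = chart ω₁ ω₂ (twistLift P k t a))
    (b : ℝ) (γ : Path c c) (hγ : ∀ t (a : Fin n), (γ t).1 a =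
      chart ω₁ ω₂ (pushed P p' (lasso b (((P i - P m : ℝ) : ℂ) + b) r t - b) a)) :
    pureToFull c (cls γ) =
      conjBy (pureWord τ.gen i p') ((List.range (m - p')).map fun k => τ.gen (p' + k)).prod := by
  rw [word_eq hω hP hspan hgap hc hτ O.hi O.hpm O.hm]
  have hr := O.r_pos
  have hm := O.right_m
  set d : ℝ := P i - P m with hd
  have hr' := O.r_lt
  have hdr : -1 < d := by linarith [hspan m i O.hm (O.lt_mi.trans O.hm)]
  let U : Set ℂ := {z | Function.Injective fun s : Fin n => chart ω₁ ω₂ (pushed P p' (z - b) s)}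
  let G : U → UnordConf n (Curve ω₁ ω₂) := fun z => toUnord n _ (confOf ω₁ ω₂ _ z.2)
  have hG : Continuous G := by
    refine (toUnord n _).continuous.comp (Continuous.subtype_mk (continuous_pi fun a => ?_) _)
    refine continuous_chart.comp ?_
    simp only [pushed]
    split_ifs <;> fun_prop
  have hU : ∀ {z : ℂ} (S : Stack n), (fun s : Fin n => pushed P p' (z - b) s) ∈ heightSet S.h →
      z ∈ U := fun S h => injective_chart_comp hω h.2.1 h.2.2
  -- the three parts of the lasso, relative to its base point
  have eHT : ∀ (u v u' v' : ℂ) (t : I), u = u' + b → v = v' + b →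
      halfTurn u v t - b = halfTurn u' v' t := by
    rintro u v u' v' t rfl rfl
    rw [halfTurn_add, add_sub_cancel_right]
  have eH : ∀ t, halfTurn ((d : ℂ) + b + r) b t - b =
      halfTurn ((d + r : ℝ) : ℂ) ((0 : ℝ) : ℂ) t :=
    fun t => eHT _ _ _ _ t (by push_cast; ring) (by simp)
  have e1 : ∀ t, halfTurn ((d : ℂ) + b + r) ((d : ℂ) + b - r) t - b =
      halfTurn ((d + r : ℝ) : ℂ) ((d - r : ℝ) : ℂ) t :=
    fun t => eHT _ _ _ _ t (by push_cast; ring) (by push_cast; ring)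
  have e2 : ∀ t, halfTurn ((d : ℂ) + b - r) ((d : ℂ) + b + r) t - b =
      halfTurn ((d - r : ℝ) : ℂ) ((d + r : ℝ) : ℂ) t :=
    fun t => eHT _ _ _ _ t (by push_cast; ring) (by push_cast; ring)
  have ne_base : ∀ a s, a < p' → p' ≤ s → s < n → P a ≠ P s + 0 := by
    intro a s ha hs _
    rw [add_zero]
    exact (hP (ha.trans_le hs)).ne
  have memH : ∀ t, (fun s : Fin n => pushed P p' (halfTurn ((d : ℂ) + b + r) b t - b) s) ∈
      heightSet (stackLow n p' m).h := by
    intro t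
    rw [eH]
    have hre := halfTurn_re_mem (u := d + r) (v := 0) (by linarith) t
    refine O.pushed_mem hP hspan _ (stackLow_pushed ?_) ?_ (by linarith) hre.2
      (abs_halfTurn_im_lt (by rw [abs_lt]; constructor <;> linarith) t)
    · rw [halfTurn_im]
      exact mul_nonpos_of_nonneg_of_nonpos (sin_pi_nonneg t) (by linarith)
    · intro h
      rcases halfTurn_im_eq_zero (by linarith) h with rfl | rfl
      · exact fun a s h1 h2 h3 => by simpa using O.pushed_ne hP (Or.inl rfl) h1 h2 h3
      · simpa using ne_base
  have mem1 : ∀ t, (fun s : Fin n => pushed P p'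
      (halfTurn ((d : ℂ) + b + r) ((d : ℂ) + b - r) t - b) s) ∈ heightSet (stackOver n p' m).h := by
    intro t
    rw [e1]
    have hre := halfTurn_re_mem' (u := d + r) (v := d - r) (by linarith) t
    refine O.pushed_mem hP hspan _ (stackOver_pushed O.hpm ?_) ?_ hre.1 (by linarith)
      (abs_halfTurn_im_lt (by rw [abs_lt]; constructor <;> linarith) t)
    · rw [halfTurn_im]
      exact mul_nonneg (sin_pi_nonneg t) (by linarith)
    · intro h
      rcases halfTurn_im_eq_zero (by linarith) h with rfl | rfl
      · exact fun a s h1 h2 h3 => by simpa using O.pushed_ne hP (Or.inl rfl) h1 h2 h3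
      · exact fun a s h1 h2 h3 => by
          simpa [hd, sub_eq_add_neg] using O.pushed_ne hP (Or.inr rfl) h1 h2 h3
  have mem2 : ∀ t, (fun s : Fin n => pushed P p'
      (halfTurn ((d : ℂ) + b - r) ((d : ℂ) + b + r) t - b) s) ∈ heightSet (stackLow n p' m).h := by
    intro t
    rw [e2]
    have hre := halfTurn_re_mem (u := d - r) (v := d + r) (by linarith) t
    refine O.pushed_mem hP hspan _ (stackLow_pushed ?_) ?_ hre.1 (by linarith)
      (abs_halfTurn_im_lt (by rw [abs_lt]; constructor <;> linarith) t)
    · rw [halfTurn_im]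
      exact mul_nonpos_of_nonneg_of_nonpos (sin_pi_nonneg t) (by linarith)
    · intro h
      rcases halfTurn_im_eq_zero (by linarith) h with rfl | rfl
      · exact fun a s h1 h2 h3 => by
          simpa [hd, sub_eq_add_neg] using O.pushed_ne hP (Or.inr rfl) h1 h2 h3
      · exact fun a s h1 h2 h3 => by simpa using O.pushed_ne hP (Or.inl rfl) h1 h2 h3
  let M := O.conf hP hspan (Or.inl rfl)
  let M' := O.conf hP hspan (Or.inr rfl)
  have ptsM : (fun s : Fin n => pushed P p' ((d : ℂ) + b + r - b) s) = M.pts := by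
    funext s
    simp only [pushed, RealConf.pts, M, PushOK.conf]
    split_ifs
    · rfl
    · rw [hd]; push_cast; ring
  have ptsM' : (fun s : Fin n => pushed P p' ((d : ℂ) + b - r - b) s) = M'.pts := by
    funext s
    simp only [pushed, RealConf.pts, M', PushOK.conf]
    split_ifs
    · rfl
    · rw [hd]; push_cast; ring
  have ptsC : (fun s : Fin n => pushed P p' ((b : ℂ) - b) s) =
      (placedAt hP hspan m m le_rfl O.hm).pts := by
    funext s
    have : place m m le_rfl O.hm s = s := Fin.ext (by rw [place_val]; split_ifs <;> omega)
    simp only [pushed, RealConf.pts, placed, sub_self, add_zero, ite_self, this]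
  obtain ⟨f, c₁, c₂, hf, hc₁, hc₂, hγ'⟩ := exists_lasso_split (a := toUnord n _ c)
    (e := toUnord n _ (M.conf hω)) (e' := toUnord n _ (M'.conf hω)) hG (U := U) (G := G)
    (b := b) (w := (d : ℂ) + b) (r := r)
    (fun t => hU _ (memH t)) (fun t => hU _ (mem1 t)) (fun t => hU _ (mem2 t))
    (fun h => congrArg (toUnord n _) (Subtype.ext (funext fun a =>
      congrArg (chart ω₁ ω₂) (congrFun ptsM a))))
    (fun h => congrArg (toUnord n _) (Subtype.ext (funext fun a =>
      congrArg (chart ω₁ ω₂) (congrFun ptsM' a))))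
    (γ.map (toUnord n _).continuous)
    (fun t h => congrArg (toUnord n _) (Subtype.ext (funext fun a => hγ t a)))
  change (Path.Homotopic.Quotient.mk (γ.map (toUnord n _).continuous) : Arc _ _) = _
  have hcont : ∀ u v : ℂ, Continuous fun t : I => (fun s : Fin n =>
      pushed P p' (halfTurn u v t - b) s) := by
    intro u v
    refine continuous_pi fun s => ?_
    simp only [pushed]
    split_ifs
    · fun_prop
    · exact continuous_const.add ((halfTurn u v).continuous.sub continuous_const)
  have E0 : (.mk f : Arc _ _) = ((stackLow n p' m).look hω M rfl).symm.trans
      ((stackLow n p' m).look hω (placedAt hP hspan m m le_rfl O.hm)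
        (toUnord_placed hω hP hspan _ hc)) := by
    refine ((stackLow n p' m).patchU hω).arc_eq f _ (hcont _ _) memH hf ?_ ?_ _ _ _ _
    · simp only [Path.source]; exact ptsM
    · simp only [Path.target]; exact ptsC
  have E1 : (.mk c₁ : Arc _ _) = ((stackOver n p' m).look hω M rfl).symm.trans
      ((stackOver n p' m).look hω M' rfl) := by
    refine ((stackOver n p' m).patchU hω).arc_eq c₁ _ (hcont _ _) mem1 hc₁ ?_ ?_ _ _ _ _
    · simp only [Path.source]; exact ptsM
    · simp only [Path.target]; exact ptsM'
  have E2 : (.mk c₂ : Arc _ _) = ((stackLow n p' m).look hω M' rfl).symm.trans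
      ((stackLow n p' m).look hω M rfl) := by
    refine ((stackLow n p' m).patchU hω).arc_eq c₂ _ (hcont _ _) mem2 hc₂ ?_ ?_ _ _ _ _
    · simp only [Path.source]; exact ptsM'
    · simp only [Path.target]; exact ptsM
  -- on the upper half of the small circle only the strand `m` needs to move
  have hcirc := mk_bentPath hω (O.bentOK_circle hP hspan) (stackOver n p' m) (stackOver n p' m)
    (bendOne_mono_over O.hpm) (bendOne_mono_over O.hpm) rfl rfl
  rw [mk_bentPath hω (O.bentOK_circle hP hspan) (stackHigh n p' m) (stackOver n p' m)
    (bendOne_mono_high O.hpm) (bendOne_mono_over O.hpm) rfl rfl] at hcirc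
  have hv := (stackLow n p' m).via_congr hω
    (O.bentOK_place hP hspan (Or.inl rfl) (i + 1) O.lt_mi (Or.inl ⟨rfl, rfl⟩)) (stackHigh n p' m)
    bendLow_mono_low bendLow_mono_high
  have hv' := (stackLow n p' m).via_congr hω
    (O.bentOK_place hP hspan (Or.inr rfl) i O.lt_mi.le (Or.inr ⟨rfl, rfl⟩)) (stackHigh n p' m)
    bendLow_mono_low bendLow_mono_high
  rw [hγ', E0, E1, ← hcirc, E2, ← hv, ← hv']
  simp only [Stack.via]
  simp
  rfl

end StrandLoops

/-! ### The positions of the standard arrangement -/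

section Positions

variable {p q : ℕ}

/-- The mesh of the standard arrangement as a real number. -/
def meshR (p q : ℕ) : ℝ := 1 / ((p + 1) * (q + 2))

/-- The positions of the standard arrangement as real numbers. -/
def posR (p q k : ℕ) : ℝ :=
  if k < p then ((k : ℝ) + 1) * meshR p q
  else ((p : ℝ) + 1) * ((k : ℝ) - p + 1) * meshR p q

theorem mesh_eq : mesh p q = (meshR p q : ℂ) := by
  simp [mesh, meshR]

theorem pos_eq (k : ℕ) : pos p q k = (posR p q k : ℂ) := by
  unfold pos posR
  split_ifs <;> simp [mesh_eq]

theorem meshR_pos : 0 < meshR p q := by unfold meshR; positivity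

theorem meshR_mul : ((p : ℝ) + 1) * meshR p q = 1 / (q + 2) := by
  unfold meshR; field_simp

theorem posR_of_lt {k : ℕ} (hk : k < p) : posR p q k = (k + 1) * meshR p q := if_pos hk

theorem posR_add (j : ℕ) : posR p q (p + j) = (j + 1) * (1 / (q + 2)) := by
  rw [posR, if_neg (by omega), ← meshR_mul (p := p)]
  push_cast
  ring

/-- Neighbouring points have at least the distance of one mesh. -/
theorem posR_succ (k : ℕ) : posR p q k + meshR p q ≤ posR p q (k + 1) := by
  have h0 := meshR_pos (p := p) (q := q)
  rcases lt_or_ge k p with h | h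
  · rcases (Nat.succ_le_of_lt h).lt_or_eq with h1 | h1
    · rw [posR_of_lt h, posR_of_lt h1]
      push_cast
      linarith
    · have h1 : k + 1 = p := h1
      have e := posR_add (p := p) (q := q) 0
      rw [← meshR_mul (p := p)] at e
      rw [Nat.add_zero] at e
      have hk : (k : ℝ) + 1 = p := by exact_mod_cast h1
      rw [posR_of_lt h, h1, e, hk]
      push_cast
      linarith
  · obtain ⟨j, rfl⟩ := Nat.exists_eq_add_of_le h
    rw [add_assoc, posR_add, posR_add, ← meshR_mul (p := p)]
    push_cast
    have : 0 ≤ (p : ℝ) * meshR p q := by positivity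
    linarith

theorem posR_strictMono : StrictMono (posR p q) :=
  strictMono_nat_of_lt_succ fun k => by
    linarith [posR_succ (p := p) (q := q) k, meshR_pos (p := p) (q := q)]

theorem posR_add_mesh_le {i j : ℕ} (h : i < j) : posR p q i + meshR p q ≤ posR p q j :=
  (posR_succ i).trans (posR_strictMono.monotone h)

theorem posR_gap (k : ℕ) : posR p q (k + 1) - posR p q k ≤ 1 / (q + 2) := by
  have h0 := meshR_pos (p := p) (q := q)
  have h1 : meshR p q ≤ 1 / (q + 2) := by
    rw [← meshR_mul (p := p)]
    have : 0 ≤ (p : ℝ) * meshR p q := by positivity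
    linarith
  rcases lt_or_ge k p with h | h
  · rcases (Nat.succ_le_of_lt h).lt_or_eq with h1 | h1
    · rw [posR_of_lt h, posR_of_lt h1]
      push_cast
      linarith
    · have h1 : k + 1 = p := h1
      have e := posR_add (p := p) (q := q) 0
      rw [← meshR_mul (p := p)] at e
      rw [Nat.add_zero] at e
      have hk : (k : ℝ) + 1 = p := by exact_mod_cast h1
      rw [posR_of_lt h, h1, e, hk]
      push_cast
      linarith
  · obtain ⟨j, rfl⟩ := Nat.exists_eq_add_of_le h
    rw [add_assoc, posR_add, posR_add]
    push_cast
    linarith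

theorem meshR_le_posR (k : ℕ) : meshR p q ≤ posR p q k := by
  have h0 := meshR_pos (p := p) (q := q)
  refine le_trans ?_ (posR_strictMono.monotone (Nat.zero_le k))
  rcases Nat.eq_zero_or_pos p with h | h
  · have e := posR_add (p := p) (q := q) 0
    rw [← meshR_mul (p := p)] at e
    subst h
    rw [show (0 : ℕ) = 0 + 0 from rfl, e]
    simp
  · rw [posR_of_lt h]; simp

theorem posR_pos (k : ℕ) : 0 < posR p q k := meshR_pos.trans_le (meshR_le_posR k)

theorem posR_lt_one {k : ℕ} (hk : k ≤ p + q) : posR p q k < 1 := by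
  refine (posR_strictMono.monotone hk).trans_lt ?_
  rw [posR_add]
  field_simp
  linarith

theorem posR_span {n : ℕ} (hn : n ≤ p + q + 1) (i j : ℕ) (hi : i < n) (_ : j < n) :
    posR p q i - posR p q j < 1 := by
  linarith [posR_pos (p := p) (q := q) j, posR_lt_one (p := p) (q := q) (k := i) (by omega)]

theorem posR_gap_lt (hq : 1 ≤ q) (k : ℕ) : posR p q (k + 1) - posR p q k < 1 / 2 := by
  refine (posR_gap k).trans_lt ?_
  have : (1 : ℝ) ≤ q := by exact_mod_cast hq
  exact one_div_lt_one_div_of_lt (by norm_num) (by linarith)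

theorem meshR_lt_half (hq : 1 ≤ q) : meshR p q < 1 / 2 := by
  have := posR_succ (p := p) (q := q) 0
  have := posR_gap_lt (p := p) hq 0
  linarith

/-- The `y`-translates can be pushed over the `x`-points. -/
theorem pushOK_base (hq : 1 ≤ q) (i : Fin p) (j : Fin q) :
    PushOK (p + q) (posR p q) i p (p + j) (meshR p q / 2) := by
  have h0 := meshR_pos (p := p) (q := q)
  have h1 := meshR_lt_half (p := p) hq
  have e := meshR_mul (p := p) (q := q)
  have hi := i.2
  have hp : posR p q (p - 1) = p * meshR p q := by
    rw [posR_of_lt (by omega), Nat.cast_sub (by omega)]; simp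
  have hi' : posR p q i ≤ p * meshR p q := hp ▸ posR_strictMono.monotone (by omega)
  have step : ∀ s t : ℕ, p ≤ s → s < t → posR p q s + (p + 1) * meshR p q ≤ posR p q t := by
    intro s t hs hst
    refine le_trans ?_ (posR_strictMono.monotone (Nat.succ_le_of_lt hst))
    obtain ⟨k, rfl⟩ := Nat.exists_eq_add_of_le hs
    rw [Nat.succ_eq_add_one, add_assoc, posR_add, posR_add, e]
    push_cast
    linarith
  have hm1 := meshR_le_posR (p := p) (q := q)
  refine ⟨hi, by omega, by omega, by positivity, by linarith, fun a h => ?_, fun a h _ => ?_, ?_,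
    fun b hb hbm => ?_, fun s hs _ => ?_, fun s a hs _ ha => ?_⟩
  · linarith [posR_add_mesh_le (p := p) (q := q) h]
  · linarith [posR_add_mesh_le (p := p) (q := q) h]
  · linarith [posR_add_mesh_le (p := p) (q := q) (show (i : ℕ) < p + j by omega)]
  · linarith [step b _ hb hbm, hm1 0]
  · linarith [step _ s (by omega) hs, hm1 i]
  · have := posR_add_mesh_le (p := p) (q := q) (ha.trans_le hs)
    have := posR_lt_one (p := p) (q := q) (k := p + j) (by omega)
    linarith [hm1 i]

/-- The last point can be pushed over all the others. -/
theorem pushOK_fibre (hq : 1 ≤ q) (k : Fin (p + q)) :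
    PushOK (p + q + 1) (posR p q) k (p + q) (p + q) (meshR p q / 2) := by
  have h0 := meshR_pos (p := p) (q := q)
  have h1 := meshR_lt_half (p := p) hq
  have hm1 := meshR_le_posR (p := p) (q := q)
  refine ⟨k.2, le_rfl, by omega, by positivity, by linarith, fun a h => ?_, fun a h _ => ?_, ?_,
    fun b hb hbm => ?_, fun s hs _ => ?_, fun s a hs hs' ha => ?_⟩
  · linarith [posR_add_mesh_le (p := p) (q := q) h]
  · linarith [posR_add_mesh_le (p := p) (q := q) h]
  · linarith [posR_add_mesh_le (p := p) (q := q) k.2]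
  · omega
  · omega
  · obtain rfl : s = p + q := by omega
    have := posR_lt_one (p := p) (q := q) (k := a) (by omega)
    linarith [hm1 k]

end Positions

/-! ### Braids of the standard arrangement -/

section StandardBraids

variable {p q : ℕ} {ω₁ ω₂ : ℂ} {M : Marking p q (Curve ω₁ ω₂)}

theorem stdTwist_eq (k : ℕ) (s : I) (m : ℕ) :
    stdTwist ω₁ ω₂ p q k s m = chart ω₁ ω₂ (twistLift (posR p q) k s m) := by
  have h : ∀ u v u' v' : ℂ, u = u' → v = v' → halfTurn u v s = halfTurn u' v' s := by
    rintro u v _ _ rfl rfl; rfl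
  unfold stdTwist twistLift
  split_ifs
  · rw [h _ _ _ _ (pos_eq k) (pos_eq (k + 1))]
  · rw [h _ _ _ _ (pos_eq (k + 1)) (pos_eq k)]
  · rw [pos_eq]

theorem lasso_congr {b w r b' w' r' : ℂ} (hb : b = b') (hw : w = w') (hr : r = r') (t : I) :
    lasso b w r t = lasso b' w' r' t := by
  subst hb hw hr; rfl

namespace Arrangement

variable {E : Type*} [AddCommGroup E] [TopologicalSpace E] [IsTopologicalAddGroup E]

theorem phi_castAdd (A : Arrangement p q E) (y : A.Base) (i : Fin p) :
    (A.phi y).1 (Fin.castAdd q i) = A.x i :=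
  Fin.append_left A.x (fun j => y.1 - A.y j) i

theorem phi_natAdd (A : Arrangement p q E) (y : A.Base) (j : Fin q) :
    (A.phi y).1 (Fin.natAdd p j) = y.1 - A.y j :=
  Fin.append_right A.x (fun j => y.1 - A.y j) j

theorem iota_castSucc (A : Arrangement p q E) (x : A.Fibre) (k : Fin (p + q)) :
    (A.iota x).1 k.castSucc = (A.phi A.basePt).1 k :=
  Fin.snoc_castSucc (α := fun _ => E) x.1 (A.phi A.basePt).1 k

theorem iota_last (A : Arrangement p q E) (x : A.Fibre) :
    (A.iota x).1 (Fin.last (p + q)) = x.1 :=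
  Fin.snoc_last (α := fun _ => E) x.1 (A.phi A.basePt).1

end Arrangement

namespace IsStandard

variable (hM : IsStandard ω₁ ω₂ M)
include hM

theorem phi_basePt (a : Fin (p + q)) : (M.phi M.basePt).1 a = chart ω₁ ω₂ (posR p q a) := by
  refine Fin.addCases (fun i => ?_) (fun j => ?_) a
  · rw [M.phi_castAdd, hM.x, pos_eq]; rfl
  · rw [M.phi_natAdd, hM.y, pos_eq]
    change M.y₀ - _ = _
    rw [hM.y₀]
    simp

theorem iota_fibrePt (a : Fin (p + q + 1)) :
    (M.iota M.fibrePt).1 a = chart ω₁ ω₂ (posR p q a) := by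
  refine Fin.lastCases ?_ (fun k => ?_) a
  · rw [M.iota_last]
    change M.x₀ = _
    rw [hM.x₀, pos_eq]; rfl
  · rw [M.iota_castSucc, hM.phi_basePt]; rfl

/-- The local braids of the standard arrangement: when the base point runs around `x_i + y_j`, the
points `y - y_1, …, y - y_q` move in parallel, and the `j`-th of them runs around `x_i`. -/
theorem phiStar_d (hω : 0 < (ω₂ / ω₁).im) (hq : 1 ≤ q) (i : Fin p) (j : Fin q) :
    pureToFull (M.phi M.basePt) (M.phiStar (M.d i j)) =
      conjBy (pureWord M.b i p) ((List.range (j : ℕ)).map fun k => M.b (p + k)).prod := by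
  have := pushed_lasso_eq_word hω posR_strictMono (posR_span (by omega))
    (fun k _ => posR_gap_lt hq k) (pushOK_base hq i j) hM.phi_basePt
    (fun k hk t a => (hM.twist k hk t a).trans (stdTwist_eq k t a)) 0
    ((M.delta i j).map M.phi.continuous) ?_
  · rw [add_tsub_cancel_left] at this
    exact this
  · intro t a
    refine Fin.addCases (fun i' => ?_) (fun j' => ?_) a
    · change (M.phi _).1 _ = _
      rw [M.phi_castAdd, hM.x, pos_eq, pushed, if_pos (by simp)]; rfl
    · change (M.phi _).1 _ = _
      rw [M.phi_natAdd, hM.y, hM.delta, pos_eq, pushed, if_neg (by simp), sub_neg_eq_add,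
        ← chart_add]
      congr 1
      rw [lasso_congr (b' := (0 : ℝ)) (w' := (posR p q i - posR p q (p + j) : ℝ) + (0 : ℝ))
        (r' := (meshR p q / 2 : ℝ)) (by simp) (by simp [pos_eq]) (by simp [mesh_eq])]
      simp [add_comm, pos_eq]

/-- The generators of the group of the fibre of the standard arrangement: the last point runs around
the `k`-th one. -/
theorem iotaStar_gA (hω : 0 < (ω₂ / ω₁).im) (hq : 1 ≤ q) (k : Fin (p + q)) :
    pureToFull (M.iota M.fibrePt) (M.iotaStar (M.gA k)) = pureWord M.bSucc k (p + q) := by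
  have := pushed_lasso_eq_word hω posR_strictMono (posR_span le_rfl)
    (fun k _ => posR_gap_lt hq k) (pushOK_fibre hq k) hM.iota_fibrePt
    (fun k hk t a => (hM.twistSucc k hk t a).trans (stdTwist_eq k t a)) (posR p q (p + q))
    ((M.a k).map M.iota.continuous) ?_
  · simp only [tsub_self, List.range_zero, List.map_nil, List.prod_nil, conjBy, inv_one, one_mul,
      mul_one] at this
    exact this
  · intro t a
    refine Fin.lastCases ?_ (fun a => ?_) a
    · change (M.iota _).1 _ = _
      rw [M.iota_last, hM.a, pushed, if_neg (by simp)]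
      congr 1
      rw [lasso_congr (b' := (posR p q (p + q) : ℝ))
        (w' := (posR p q k - posR p q (p + q) : ℝ) + (posR p q (p + q) : ℝ))
        (r' := (meshR p q / 2 : ℝ)) (by simp [pos_eq]) (by simp [pos_eq]) (by simp [mesh_eq])]
      simp
    · change (M.iota _).1 _ = _
      rw [M.iota_castSucc, hM.phi_basePt, pushed, if_pos (by simp)]; rfl

end IsStandard

end StandardBraids

/-! ### The relation in the group of a punctured torus -/

section Punctured

/-- A map to `X` from the complement in the curve of points of the real axis that are contained in
the interval `(b - 1, b)`, one fundamental interval of the horizontal circle. -/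
structure Punctured (ω₁ ω₂ : ℂ) (X : Type*) [TopologicalSpace X] where
  b : ℝ
  W : Set ℝ
  lt_of_mem : ∀ w ∈ W, b - 1 < w ∧ w < b
  G : {x : Curve ω₁ ω₂ // ∀ w ∈ W, x ≠ chart ω₁ ω₂ (w : ℝ)} → X
  cont : Continuous G

namespace Punctured

variable {ω₁ ω₂ : ℂ} {X : Type*} [TopologicalSpace X] (T : Punctured ω₁ ω₂ X)

/-- The point `z` of the plane does not lie over a puncture. -/
def Good (z : ℂ) : Prop := ∀ w ∈ T.W, chart ω₁ ω₂ z ≠ chart ω₁ ω₂ (w : ℝ)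

/-- The image of a point of the plane. -/
def pt {z : ℂ} (hz : T.Good z) : X := T.G ⟨chart ω₁ ω₂ z, hz⟩

theorem pt_eq {z z' : ℂ} (h : chart ω₁ ω₂ z = chart ω₁ ω₂ z') (hz : T.Good z) (hz' : T.Good z') :
    T.pt hz = T.pt hz' := by
  unfold pt; congr 2

theorem Good.congr {z z' : ℂ} (h : chart ω₁ ω₂ z = chart ω₁ ω₂ z') (hz : T.Good z) : T.Good z' :=
  fun w hw => h ▸ hz w hw

variable (hω : 0 < (ω₂ / ω₁).im)
include hω

theorem good_of_lt {z : ℂ} (c : ℤ) (h1 : (c : ℝ) / 2 < z.im) (h2 : z.im < (c + 1) / 2) :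
    T.Good z := by
  intro w _ h
  obtain ⟨k, l, hk, -⟩ := rows_of_chart_eq hω h
  simp at hk
  have h3 : (c : ℝ) < k := by linarith
  have h4 : (k : ℝ) < c + 1 := by linarith
  have h3 : c < k := by exact_mod_cast h3
  have h4 : k < c + 1 := by exact_mod_cast h4
  omega

theorem good_real {v : ℝ} (h1 : T.b - 1 ≤ v) (h2 : v ≤ T.b) (h : v ∉ T.W) : T.Good v := by
  intro w hw e
  have := T.lt_of_mem w hw
  have := eq_of_chart_eq hω e (by simp) (by
    simp only [Complex.ofReal_re]; rw [abs_lt]; constructor <;> linarith)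
  exact h (by rwa [Complex.ofReal_injective this])

/-- A horizontal strip between two neighbouring rows of punctures. -/
def strip (c : ℤ) : StarPatch ℂ X where
  S := {z | ((c : ℝ) / 2 ≤ z.im ∧ z.im ≤ (c + 1) / 2) ∧ T.Good z}
  Z := ((c / 2 + 1 / 4 : ℝ) : ℂ) * Complex.I
  mem := by
    have him : ((((c / 2 + 1 / 4 : ℝ) : ℂ) * Complex.I)).im = c / 2 + 1 / 4 := by
      rw [Complex.im_ofReal_mul]; simp
    refine ⟨by rw [him]; constructor <;> linarith, T.good_of_lt hω c ?_ ?_⟩ <;> rw [him] <;> linarith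
  star := by
    intro z hz s t hs ht hst
    have him : (s • (((c / 2 + 1 / 4 : ℝ) : ℂ) * Complex.I) + t • z).im =
        s * (c / 2 + 1 / 4) + t * z.im := by
      rw [Complex.add_im, Complex.smul_im, Complex.smul_im, Complex.im_ofReal_mul]; simp
    rcases hs.eq_or_lt with rfl | hs
    · obtain rfl : t = 1 := by linarith
      simpa using hz
    · obtain ⟨⟨h1, h2⟩, -⟩ := hz
      have e1 : (c : ℝ) / 2 < s * (c / 2 + 1 / 4) + t * z.im := by
        have : (c : ℝ) / 2 = s * (c / 2) + t * (c / 2) := by rw [← add_mul, hst, one_mul]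
        nlinarith
      have e2 : s * (c / 2 + 1 / 4) + t * z.im < ((c : ℝ) + 1) / 2 := by
        have : ((c : ℝ) + 1) / 2 = s * ((c + 1) / 2) + t * ((c + 1) / 2) := by
          rw [← add_mul, hst, one_mul]
        nlinarith
      exact ⟨by rw [him]; exact ⟨e1.le, e2.le⟩,
        T.good_of_lt hω c (by rw [him]; exact e1) (by rw [him]; exact e2)⟩
  F z := T.pt z.2.2
  cont := T.cont.comp (Continuous.subtype_mk (by fun_prop) _)

/-- Paths in a strip are determined up to homotopy by their ends. -/
theorem arc_strip (c : ℤ) {a a' : X} (γ : Path a a') (g : I → ℂ) (hg : Continuous g)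
    (hS : ∀ t, g t ∈ (T.strip hω c).S) (hγ : ∀ t, γ t = (T.strip hω c).F ⟨g t, hS t⟩) {z w : ℂ}
    (hz : g 0 = z) (hw : g 1 = w) (hzS : z ∈ (T.strip hω c).S) (hwS : w ∈ (T.strip hω c).S)
    (ha : (T.strip hω c).F ⟨z, hzS⟩ = a) (ha' : (T.strip hω c).F ⟨w, hwS⟩ = a') :
    (.mk γ : Arc a a') =
      ((T.strip hω c).ray hzS ha).symm.trans ((T.strip hω c).ray hwS ha') :=
  (T.strip hω c).arc_eq γ g hg hS hγ hz hw hzS hwS ha ha'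

theorem low_mem {v : ℝ} (hv : T.Good v) : (v : ℂ) ∈ (T.strip hω (-1)).S :=
  ⟨by constructor <;> norm_num, hv⟩

theorem up_mem {v : ℝ} (hv : T.Good v) : (v : ℂ) ∈ (T.strip hω 0).S :=
  ⟨by simp, hv⟩

/-- The path from the centre of the lower strip to a point of the real axis. -/
def low {v : ℝ} (hv : T.Good v) : Arc (T.strip hω (-1)).o (T.pt hv) :=
  (T.strip hω (-1)).ray (T.low_mem hω hv) rfl

/-- The path from the centre of the upper strip to a point of the real axis. -/
def up {v : ℝ} (hv : T.Good v) : Arc (T.strip hω 0).o (T.pt hv) :=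
  (T.strip hω 0).ray (T.up_mem hω hv) rfl

/-- The path from the centre of the lower strip to that of the upper one through a point of the
real axis. -/
def cross {v : ℝ} (hv : T.Good v) : Arc (T.strip hω (-1)).o (T.strip hω 0).o :=
  (T.low hω hv).trans (T.up hω hv).symm

/-- The path from `u` to `v` below the real axis. -/
def below {u v : ℝ} (hu : T.Good u) (hv : T.Good v) : Arc (T.pt hu) (T.pt hv) :=
  (T.low hω hu).symm.trans (T.low hω hv)

/-- The path from `u` to `v` above the real axis. -/
def above {u v : ℝ} (hu : T.Good u) (hv : T.Good v) : Arc (T.pt hu) (T.pt hv) :=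
  (T.up hω hu).symm.trans (T.up hω hv)

theorem below_eq {u v : ℝ} (hu : T.Good u) (hv : T.Good v) (γ : Path (T.pt hu) (T.pt hv))
    (g : I → ℂ) (hg : Continuous g) (h0 : g 0 = u) (h1 : g 1 = v) (hG : ∀ t, T.Good (g t))
    (him : ∀ t, -1 / 2 ≤ (g t).im ∧ (g t).im ≤ 0) (hγ : ∀ t, γ t = T.pt (hG t)) :
    (.mk γ : Arc _ _) = T.below hω hu hv :=
  T.arc_strip hω (-1) γ g hg (fun t => ⟨by simpa [neg_div] using him t, hG t⟩) hγ h0 h1 _ _ _ _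

theorem above_eq {u v : ℝ} (hu : T.Good u) (hv : T.Good v) (γ : Path (T.pt hu) (T.pt hv))
    (g : I → ℂ) (hg : Continuous g) (h0 : g 0 = u) (h1 : g 1 = v) (hG : ∀ t, T.Good (g t))
    (him : ∀ t, 0 ≤ (g t).im ∧ (g t).im ≤ 1 / 2) (hγ : ∀ t, γ t = T.pt (hG t)) :
    (.mk γ : Arc _ _) = T.above hω hu hv :=
  T.arc_strip hω 0 γ g hg (fun t => ⟨by simpa using him t, hG t⟩) hγ h0 h1 _ _ _ _

/-- On a segment without punctures it does not matter where one crosses the real axis. -/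
theorem below_eq_above {u v : ℝ} (huv : u ≤ v) (h : ∀ x ∈ Set.Icc u v, T.Good (x : ℝ)) :
    T.below hω (h u ⟨le_rfl, huv⟩) (h v ⟨huv, le_rfl⟩) =
      T.above hω (h u ⟨le_rfl, huv⟩) (h v ⟨huv, le_rfl⟩) := by
  have hx : ∀ t : I, (1 - (t : ℝ)) * u + t * v ∈ Set.Icc u v := fun t => by
    have := t.2.1; have := t.2.2
    constructor <;> nlinarith
  let γ : Path (T.pt (h u ⟨le_rfl, huv⟩)) (T.pt (h v ⟨huv, le_rfl⟩)) :=
    { toFun t := T.pt (h _ (hx t))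
      continuous_toFun := T.cont.comp (Continuous.subtype_mk (by fun_prop) _)
      source' := T.pt_eq (by simp) _ _
      target' := T.pt_eq (by simp) _ _ }
  rw [← T.below_eq hω _ _ γ (fun t => ((1 - (t : ℝ)) * u + t * v : ℝ)) (by fun_prop) (by simp)
      (by simp) (fun t => h _ (hx t)) (fun t => by constructor <;> norm_num) (fun t => rfl),
    ← T.above_eq hω _ _ γ (fun t => ((1 - (t : ℝ)) * u + t * v : ℝ)) (by fun_prop) (by simp)
      (by simp) (fun t => h _ (hx t)) (fun t => by simp) (fun t => rfl)]

theorem cross_congr {u v : ℝ} (huv : u ≤ v) (h : ∀ x ∈ Set.Icc u v, T.Good (x : ℝ)) :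
    T.cross hω (h u ⟨le_rfl, huv⟩) = T.cross hω (h v ⟨huv, le_rfl⟩) := by
  have := T.below_eq_above hω huv h
  unfold below above at this
  unfold cross
  apply Arc.trans_left_cancel (T.low hω (h u ⟨le_rfl, huv⟩)).symm
  have e := congrArg (fun k => Path.Homotopic.Quotient.trans k (T.up hω (h v ⟨huv, le_rfl⟩)).symm) this
  simp only [Path.Homotopic.Quotient.trans_assoc] at e
  simpa using e.symm

/-- A half turn of diameter less than one stays off the punctures if its ends do: in between it
does not meet the rows of the lattice. -/
theorem halfTurn_good {x y : ℝ} (hx : T.Good x) (hy : T.Good y) (hxy : |x - y| < 1) (t : I) :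
    T.Good (halfTurn x y t) := by
  have hi := abs_halfTurn_im_lt hxy t
  rw [abs_lt] at hi
  rcases eq_or_ne x y with rfl | hne
  · have : halfTurn (x : ℂ) x t = x := by
      apply Complex.ext
      · rw [halfTurn_re, Complex.ofReal_re]; ring
      · rw [halfTurn_im, Complex.ofReal_im]; simp
    rwa [this]
  by_cases hz : (halfTurn x y t).im = 0
  · rcases halfTurn_im_eq_zero hne hz with rfl | rfl
    · simpa using hx
    · simpa using hy
  · rcases lt_or_gt_of_ne hz with hz | hz
    · exact T.good_of_lt hω (-1) (by push_cast; linarith) (by push_cast; linarith)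
    · exact T.good_of_lt hω 0 (by push_cast; linarith) (by push_cast; linarith)

/-- A lasso around `w` crosses the real axis upwards to the right of `w` and downwards to the left
of `w`. -/
theorem lasso_eq {u w r v : ℝ} (hr : 0 < r) (h1 : T.b - 1 ≤ u) (h2 : u ≤ w - r) (h3 : w + r ≤ v)
    (h4 : v ≤ T.b) (h5 : w + r < T.b)
    (h : ∀ x, u ≤ x → x ≤ v → x ≠ w → x ∉ T.W) (hu : T.Good u) (hv : T.Good v)
    (hb : T.Good T.b) (γ : Path (T.pt hb) (T.pt hb))
    (hγ : ∀ t (h : T.Good (lasso T.b w r t)), γ t = T.pt h) :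
    (.mk γ : Arc _ _) = (T.low hω hb).symm.trans ((T.cross hω hv).trans
      ((T.cross hω hu).symm.trans (T.low hω hb))) := by
  have good : ∀ x : ℝ, u ≤ x → x ≤ v → x ≠ w → T.Good x := fun x a b c =>
    T.good_real hω (by linarith) (by linarith) (h x a b c)
  have hp : T.Good ((w + r : ℝ) : ℂ) := good _ (by linarith) (by linarith) (by linarith)
  have hm : T.Good ((w - r : ℝ) : ℂ) := good _ (by linarith) (by linarith) (by linarith)
  have key : ∀ x y : ℝ, T.Good x → T.Good y → |x - y| < 1 → ∀ t : I, T.Good (halfTurn x y t) ∧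
      (x ≤ y → -1 / 2 ≤ (halfTurn x y t).im ∧ (halfTurn x y t).im ≤ 0) ∧
      (y ≤ x → 0 ≤ (halfTurn x y t).im ∧ (halfTurn x y t).im ≤ 1 / 2) := by
    intro x y hx hy hxy t
    have hi := abs_halfTurn_im_lt hxy t
    rw [abs_lt] at hi
    have hs := sin_pi_nonneg t
    have hle : x ≤ y → (halfTurn x y t).im ≤ 0 := fun h => by
      rw [halfTurn_im]
      exact mul_nonpos_of_nonneg_of_nonpos hs (by linarith)
    have hge : y ≤ x → 0 ≤ (halfTurn x y t).im := fun h => by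
      rw [halfTurn_im]
      exact mul_nonneg hs (by linarith)
    exact ⟨T.halfTurn_good hω hx hy hxy t, fun h => ⟨by linarith, hle h⟩,
      fun h => ⟨hge h, by linarith⟩⟩
  have cast : ∀ {x y x' y' : ℂ} (t : I), x = x' → y = y' → halfTurn x y t = halfTurn x' y' t := by
    rintro x y _ _ t rfl rfl; rfl
  have kH := key _ _ hp hb (by rw [abs_lt]; constructor <;> linarith)
  have k1 := key _ _ hp hm (by rw [abs_lt]; constructor <;> linarith)
  have k2 := key _ _ hm hp (by rw [abs_lt]; constructor <;> linarith)
  have cH : ∀ t, halfTurn ((w : ℂ) + r) T.b t = halfTurn ((w + r : ℝ) : ℂ) T.b t := fun t =>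
    cast t (by simp) rfl
  have c1 : ∀ t, halfTurn ((w : ℂ) + r) (w - r) t = halfTurn ((w + r : ℝ) : ℂ) ((w - r : ℝ) : ℂ) t :=
    fun t => cast t (by simp) (by simp)
  have c2 : ∀ t, halfTurn ((w : ℂ) - r) (w + r) t = halfTurn ((w - r : ℝ) : ℂ) ((w + r : ℝ) : ℂ) t :=
    fun t => cast t (by simp) (by simp)
  obtain ⟨f, d₁, d₂, hf, hd₁, hd₂, hγ'⟩ := exists_lasso_split (U := {z | T.Good z})
    (G := fun z => T.pt z.2) (T.cont.comp (Continuous.subtype_mk (by fun_prop) _))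
    (b := T.b) (w := w) (r := r) (e := T.pt hp) (e' := T.pt hm)
    (fun t => by rw [cH]; exact (kH t).1) (fun t => by rw [c1]; exact (k1 t).1)
    (fun t => by rw [c2]; exact (k2 t).1)
    (fun h => T.pt_eq (by simp) _ _) (fun h => T.pt_eq (by simp) _ _) γ hγ
  rw [hγ', T.below_eq hω hp hb f (fun t => halfTurn ((w + r : ℝ) : ℂ) T.b t)
      (halfTurn _ _).continuous (by simp) (by simp) (fun t => (kH t).1)
      (fun t => (kH t).2.1 h5.le) (fun t => (hf t).trans (T.pt_eq (congrArg _ (cH _)) _ _)),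
    T.above_eq hω hp hm d₁ (fun t => halfTurn ((w + r : ℝ) : ℂ) ((w - r : ℝ) : ℂ) t)
      (halfTurn _ _).continuous (by simp) (by simp) (fun t => (k1 t).1)
      (fun t => (k1 t).2.2 (by linarith)) (fun t => (hd₁ t).trans (T.pt_eq (congrArg _ (c1 _)) _ _)),
    T.below_eq hω hm hp d₂ (fun t => halfTurn ((w - r : ℝ) : ℂ) ((w + r : ℝ) : ℂ) t)
      (halfTurn _ _).continuous (by simp) (by simp) (fun t => (k2 t).1)
      (fun t => (k2 t).2.1 (by linarith)) (fun t => (hd₂ t).trans (T.pt_eq (congrArg _ (c2 _)) _ _)),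
    ← T.cross_congr hω h3 (fun x hx => good x (by linarith [hx.1]) hx.2 (by linarith [hx.1])),
    T.cross_congr hω h2 (fun x hx => good x hx.1 (by linarith [hx.2]) (by linarith [hx.2]))]
  simp [below, above, cross]

end Punctured

end Punctured

/-! ### Telescoping the lassos of a punctured torus -/

section Punctured

/-- A telescoping product of loops; the last factor is run through first. -/
theorem prod_ofFn_telescope {X : Type*} [TopologicalSpace X] {x y : X} {n : ℕ}
    (g : Fin n → FundamentalGroup X x) (A : ℕ → Arc x y)
    (h : ∀ k : Fin n, g k = ((A (k + 1)).trans (A k).symm : Arc x x)) :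
    (List.ofFn g).prod = ((A n).trans (A 0).symm : Arc x x) := by
  induction n generalizing A with
  | zero => simp; rfl
  | succ n ih =>
    rw [List.ofFn_succ, List.prod_cons, ih (fun k => g k.succ) (fun k => A (k + 1))
      (fun k => by simpa using h k.succ), h 0, FundamentalGroup.mul_def]
    simp

namespace Punctured

variable {ω₁ ω₂ : ℂ} {X : Type*} [TopologicalSpace X] (T : Punctured ω₁ ω₂ X)
variable (hω : 0 < (ω₂ / ω₁).im)

theorem good_sub_one (hω : 0 < (ω₂ / ω₁).im) {b : ℝ} (hb : T.Good b) : T.Good ((b - 1 : ℝ) : ℂ) :=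
  hb.congr T (chart_eq_of_rows hω 0 1 (by simp) (by simp))

include hω

/-- The product of the lassos around consecutive punctures telescopes to two crossings of the real
axis: to the left of the first and to the right of the last puncture. -/
theorem prod_lasso {N : ℕ} {r : ℝ} (hr : 0 < r) (w : Fin N → ℝ) (u : ℕ → ℝ)
    (hu : ∀ k, T.Good (u k)) (h1 : ∀ k : Fin N, T.b - 1 ≤ u k ∧ u k ≤ w k - r ∧
      w k + r ≤ u (k + 1) ∧ u (k + 1) ≤ T.b ∧ w k + r < T.b)
    (h : ∀ (k : Fin N) x, u k ≤ x → x ≤ u (k + 1) → x ≠ w k → x ∉ T.W) (hb : T.Good T.b)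
    (γ : Fin N → Path (T.pt hb) (T.pt hb))
    (hγ : ∀ k t (h : T.Good (lasso T.b (w k) r t)), γ k t = T.pt h) :
    (List.ofFn fun k => cls (γ k)).prod = ((T.low hω hb).symm.trans ((T.cross hω (hu N)).trans
      ((T.cross hω (hu 0)).symm.trans (T.low hω hb))) : Arc _ _) := by
  rw [prod_ofFn_telescope _ (fun k => (T.low hω hb).symm.trans (T.cross hω (hu k)))]
  · simp
  · intro k
    obtain ⟨a, b, c, d, e⟩ := h1 k
    rw [cls_eq, T.lasso_eq hω hr a b c d e (h k) (hu k) (hu (k + 1)) hb (γ k) (hγ k)]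
    simp

/-- The commutator of the two straight loops crosses the real axis at the base point and, in the
other direction, at its translate. -/
theorem comm_eq (hb : T.Good T.b) (γ δ : Path (T.pt hb) (T.pt hb))
    (hγ : ∀ t h, γ t = T.pt (z := T.b + (t : ℝ) * ((1 - Complex.I) / 2)) h)
    (hδ : ∀ t h, δ t = T.pt (z := T.b + (t : ℝ) * ((1 + Complex.I) / 2)) h) :
    comm (cls γ) (cls δ) = ((T.low hω hb).symm.trans
      ((T.cross hω (T.good_sub_one hω hb)).trans
      ((T.cross hω hb).symm.trans (T.low hω hb))) : Arc _ _) := by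
  have hb' := T.good_sub_one hω hb
  -- all straight segments in question, and their ends
  have chartA : ∀ t : I, chart ω₁ ω₂ ((T.b - 1 : ℝ) + (t : ℝ) * ((1 - Complex.I) / 2)) =
      chart ω₁ ω₂ (T.b + (t : ℝ) * ((1 - Complex.I) / 2)) := fun t =>
    chart_eq_of_rows hω 0 (-1) (by simp) (by simp)
  have chartA' : ∀ t : I, chart ω₁ ω₂ ((T.b - 1 / 2 : ℝ) + Complex.I / 2 +
      (t : ℝ) * ((1 - Complex.I) / 2)) = chart ω₁ ω₂ (T.b + (t : ℝ) * ((1 - Complex.I) / 2)) :=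
    fun t => chart_eq_of_rows hω 1 (-1) (by simp) (by simp; ring)
  have chartB : ∀ t : I, chart ω₁ ω₂ ((T.b - 1 / 2 : ℝ) - Complex.I / 2 +
      (t : ℝ) * ((1 + Complex.I) / 2)) = chart ω₁ ω₂ (T.b + (t : ℝ) * ((1 + Complex.I) / 2)) :=
    fun t => chart_eq_of_rows hω (-1) 0 (by simp; ring) (by simp; ring)
  have chartB' : ∀ t : I, chart ω₁ ω₂ ((T.b - 1 : ℝ) + (t : ℝ) * ((1 + Complex.I) / 2)) =
      chart ω₁ ω₂ (T.b + (t : ℝ) * ((1 + Complex.I) / 2)) := fun t =>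
    chart_eq_of_rows hω 0 (-1) (by simp) (by simp)
  have goodA : ∀ t : I, T.Good (T.b + (t : ℝ) * ((1 - Complex.I) / 2)) := by
    intro t
    by_cases h0 : t = 0
    · subst h0; simpa using hb
    by_cases h1 : t = 1
    · subst h1
      exact hb.congr T (chart_eq_of_rows hω 1 (-1) (by simp; norm_num) (by simp; ring))
    obtain ⟨h0, h1⟩ := I_pos_of_ne h0 h1
    exact T.good_of_lt hω (-1) (by simp; linarith) (by simp; linarith)
  have goodB : ∀ t : I, T.Good (T.b + (t : ℝ) * ((1 + Complex.I) / 2)) := by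
    intro t
    by_cases h0 : t = 0
    · subst h0; simpa using hb
    by_cases h1 : t = 1
    · subst h1
      exact hb.congr T (chart_eq_of_rows hω (-1) 0 (by simp; ring) (by simp; ring))
    obtain ⟨h0, h1⟩ := I_pos_of_ne h0 h1
    have him : (T.b + (t : ℝ) * ((1 + Complex.I) / 2) : ℂ).im = t / 2 := by
      simp [div_eq_mul_inv]
    exact T.good_of_lt hω 0 (by rw [him]; push_cast; linarith) (by rw [him]; push_cast; linarith)
  have t0 : ∀ t : I, 0 ≤ (t : ℝ) := fun t => t.2.1
  have t1 : ∀ t : I, (t : ℝ) ≤ 1 := fun t => t.2.2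
  have zm_eq : chart ω₁ ω₂ T.b = chart ω₁ ω₂ ((T.b - 1 / 2 : ℝ) - Complex.I / 2) :=
    chart_eq_of_rows hω 1 0 (by simp) (by simp)
  have zp_eq : chart ω₁ ω₂ T.b = chart ω₁ ω₂ ((T.b - 1 / 2 : ℝ) + Complex.I / 2) :=
    chart_eq_of_rows hω (-1) 1 (by simp; ring) (by simp; ring)
  have zm : ((T.b - 1 / 2 : ℝ) - Complex.I / 2 : ℂ) ∈ (T.strip hω (-1)).S :=
    ⟨by simp; norm_num, hb.congr T zm_eq⟩
  have zp : ((T.b - 1 / 2 : ℝ) + Complex.I / 2 : ℂ) ∈ (T.strip hω 0).S :=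
    ⟨by simp, hb.congr T zp_eq⟩
  have lowb := T.low_mem hω hb
  have lowb' := T.low_mem hω hb'
  have upb := T.up_mem hω hb
  have upb' := T.up_mem hω hb'
  have bb : T.pt hb' = T.pt hb :=
    T.pt_eq (chart_eq_of_rows hω 0 (-1) (by simp) (by simp)) _ _
  -- each of the two loops lies in both strips, up to a translation by a lattice vector
  have eA := T.arc_strip hω (-1) γ (fun t => (T.b - 1 : ℝ) + (t : ℝ) * ((1 - Complex.I) / 2))
    (by fun_prop) (fun t => ⟨by simp; constructor <;> linarith [t0 t, t1 t],
      (goodA t).congr T (chartA t).symm⟩) (fun t => (hγ t (goodA t)).trans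
      (T.pt_eq (chartA t).symm _ _)) (by simp) (by push_cast; simp; ring) lowb' zm bb
      (T.pt_eq zm_eq.symm _ _)
  have eA' := T.arc_strip hω 0 γ (fun t => (T.b - 1 / 2 : ℝ) + Complex.I / 2 +
      (t : ℝ) * ((1 - Complex.I) / 2))
    (by fun_prop) (fun t => ⟨by simp; constructor <;> linarith [t0 t, t1 t],
      (goodA t).congr T (chartA' t).symm⟩) (fun t => (hγ t (goodA t)).trans
      (T.pt_eq (chartA' t).symm _ _)) (by simp) (by push_cast; simp; ring) zp upb
      (T.pt_eq zp_eq.symm _ _) rfl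
  have eB := T.arc_strip hω (-1) δ (fun t => (T.b - 1 / 2 : ℝ) - Complex.I / 2 +
      (t : ℝ) * ((1 + Complex.I) / 2))
    (by fun_prop) (fun t => ⟨by simp; constructor <;> linarith [t0 t, t1 t],
      (goodB t).congr T (chartB t).symm⟩) (fun t => (hδ t (goodB t)).trans
      (T.pt_eq (chartB t).symm _ _)) (by simp) (by push_cast; simp; ring) zm lowb
      (T.pt_eq zm_eq.symm _ _) rfl
  have eB' := T.arc_strip hω 0 δ (fun t => (T.b - 1 : ℝ) + (t : ℝ) * ((1 + Complex.I) / 2))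
    (by fun_prop) (fun t => ⟨by simp; constructor <;> linarith [t0 t, t1 t],
      (goodB t).congr T (chartB' t).symm⟩) (fun t => (hδ t (goodB t)).trans
      (T.pt_eq (chartB' t).symm _ _)) (by simp) (by push_cast; simp; ring) upb' zp bb
      (T.pt_eq zp_eq.symm _ _)
  have e1 : (Path.Homotopic.Quotient.mk δ).symm.trans (Path.Homotopic.Quotient.mk γ).symm =
      ((T.strip hω (-1)).ray lowb rfl).symm.trans ((T.strip hω (-1)).ray lowb' bb) := by
    rw [eA, eB]; simp; rfl
  have e2 : (Path.Homotopic.Quotient.mk δ).trans (Path.Homotopic.Quotient.mk γ) =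
      ((T.strip hω 0).ray upb' bb).symm.trans ((T.strip hω 0).ray upb rfl) := by
    rw [eA', eB']; simp; rfl
  have e3 : ∀ (a : X) (ha : T.pt hb' = a), T.cross hω hb' =
      ((T.strip hω (-1)).ray lowb' ha).trans ((T.strip hω 0).ray upb' ha).symm := by
    rintro a rfl; rfl
  have e4 : comm (cls γ) (cls δ) = (((Path.Homotopic.Quotient.mk δ).symm.trans
      (Path.Homotopic.Quotient.mk γ).symm).trans ((Path.Homotopic.Quotient.mk δ).trans
      (Path.Homotopic.Quotient.mk γ)) : Arc _ _) := by
    simp only [Path.Homotopic.Quotient.trans_assoc]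
    rfl
  rw [e4, e1, e2, e3 _ bb]
  have assoc : ∀ {o o' a : X} (L L' : Arc o a) (U U' : Arc o' a),
      (L.symm.trans L').trans (U'.symm.trans U) =
        L.symm.trans ((L'.trans U'.symm).trans ((L.trans U.symm).symm.trans L)) := by
    intros; simp
  exact assoc _ _ _ _

/-- The relation between the lassos and the straight loops. -/
theorem mul_comm_eq_one {u v : ℝ} (hu : T.Good u) (hv : T.Good v) (hb : T.Good T.b)
    (h1 : T.b - 1 ≤ u) (h2 : ∀ x, T.b - 1 ≤ x → x ≤ u → x ∉ T.W) (h3 : v ≤ T.b)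
    (h4 : ∀ x, v ≤ x → x ≤ T.b → x ∉ T.W) (hub : u ≤ T.b) (hvb : T.b - 1 ≤ v)
    (γ δ : Path (T.pt hb) (T.pt hb)) (g : FundamentalGroup X (T.pt hb))
    (hg : g = ((T.low hω hb).symm.trans ((T.cross hω hv).trans
      ((T.cross hω hu).symm.trans (T.low hω hb))) : Arc _ _))
    (hγ : ∀ t h, γ t = T.pt (z := T.b + (t : ℝ) * ((1 - Complex.I) / 2)) h)
    (hδ : ∀ t h, δ t = T.pt (z := T.b + (t : ℝ) * ((1 + Complex.I) / 2)) h) :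
    g * comm (cls γ) (cls δ) = 1 := by
  rw [hg, T.comm_eq hω hb γ δ hγ hδ,
    T.cross_congr hω h3 (fun x hx => T.good_real hω (hvb.trans hx.1) hx.2 (h4 x hx.1 hx.2)),
    ← T.cross_congr hω h1 (fun x hx => T.good_real hω hx.1 (hx.2.trans hub) (h2 x hx.1 hx.2)),
    FundamentalGroup.mul_def]
  simp
  rfl

end Punctured

end Punctured

section StandardRelations

variable {p q : ℕ} {ω₁ ω₂ : ℂ} {M : Marking p q (Curve ω₁ ω₂)}

namespace IsStandard

variable (hM : IsStandard ω₁ ω₂ M)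
include hM

/-- The fibre of the standard arrangement. -/
def fibre : Punctured ω₁ ω₂ M.Fibre where
  b := posR p q (p + q)
  W := {w | ∃ k < p + q, w = posR p q k}
  lt_of_mem := by
    rintro w ⟨k, hk, rfl⟩
    have := posR_pos (p := p) (q := q) k
    have := posR_lt_one (p := p) (q := q) (k := p + q) le_rfl
    exact ⟨by linarith, posR_strictMono hk⟩
  G x := ⟨x.1, fun i => by
      rw [hM.x, pos_eq]
      exact x.2 _ ⟨i, by omega, rfl⟩, fun j => by
      rw [hM.y₀, hM.y, pos_eq, zero_sub, neg_neg]
      exact x.2 _ ⟨p + j, by omega, rfl⟩⟩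
  cont := by fun_prop

theorem good_fibre (hω : 0 < (ω₂ / ω₁).im) : hM.fibre.Good hM.fibre.b :=
  hM.fibre.good_real hω (by linarith) le_rfl fun h => (hM.fibre.lt_of_mem _ h).2.false

theorem pt_fibre (hω : 0 < (ω₂ / ω₁).im) : hM.fibre.pt (hM.good_fibre hω) = M.fibrePt := by
  refine Subtype.ext ?_
  change _ = M.x₀
  rw [hM.x₀, pos_eq]
  rfl

/-- The relation in the group of the fibre of the standard arrangement. -/
theorem prod_gA (hω : 0 < (ω₂ / ω₁).im) (hq : 1 ≤ q) :
    (List.ofFn M.gA).prod * comm M.gAlpha M.gBeta = 1 := by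
  have h0 := meshR_pos (p := p) (q := q)
  have h1 := meshR_lt_half (p := p) hq
  set T := hM.fibre with hT
  have hbT : T.b = posR p q (p + q) := rfl
  have hb := hM.good_fibre hω
  have hb1 := posR_lt_one (p := p) (q := q) (k := p + q) le_rfl
  let u : ℕ → ℝ := fun k => posR p q (min k (p + q)) - meshR p q / 2
  have hm : ∀ k, T.b - 1 ≤ u k ∧ u k ≤ T.b := fun k => by
    have := meshR_le_posR (p := p) (q := q) (min k (p + q))
    have := posR_strictMono.monotone (a := min k (p + q)) (b := p + q) (by omega) (f := posR p q)
    constructor <;> simp only [u, hbT] <;> linarith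
  -- the punctures on either side
  have side : ∀ k x, x ∈ T.W → (x < posR p q k → x + meshR p q ≤ posR p q k) ∧
      (posR p q k < x → posR p q k + meshR p q ≤ x) := by
    rintro k x ⟨l, hl, rfl⟩
    exact ⟨fun h => posR_add_mesh_le (posR_strictMono.lt_iff_lt.1 h),
      fun h => posR_add_mesh_le (posR_strictMono.lt_iff_lt.1 h)⟩
  have hu : ∀ k, T.Good (u k) := fun k => T.good_real hω (hm k).1 (hm k).2 fun h => by
    have := side (min k (p + q)) _ h
    have := this.1 (by simp only [u]; linarith)
    simp only [u] at this
    linarith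
  have ha := hM.pt_fibre hω
  have huk : ∀ k : Fin (p + q), u k = posR p q k - meshR p q / 2 ∧
      u (k + 1) = posR p q (k + 1) - meshR p q / 2 := fun k => by
    simp only [u]
    rw [min_eq_left (by omega), min_eq_left (by omega)]
    exact ⟨rfl, rfl⟩
  have key : ∀ (a : M.Fibre) (ha : T.pt hb = a) (γ : Fin (p + q) → Path a a) (δ ε : Path a a),
      (∀ k t, (γ k t).1 = chart ω₁ ω₂ (lasso T.b (posR p q k) (meshR p q / 2 : ℝ) t)) →
      (∀ t, (δ t).1 = chart ω₁ ω₂ (T.b + (t : ℝ) * ((1 - Complex.I) / 2))) →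
      (∀ t, (ε t).1 = chart ω₁ ω₂ (T.b + (t : ℝ) * ((1 + Complex.I) / 2))) →
      (List.ofFn fun k => cls (γ k)).prod * comm (cls δ) (cls ε) = 1 := by
    rintro a rfl γ δ ε hγ hδ hε
    refine T.mul_comm_eq_one hω (hu 0) (hu (p + q)) hb (hm 0).1 ?_ (hm _).2 ?_ (hm 0).2 (hm _).1
      δ ε _ (T.prod_lasso hω (r := meshR p q / 2) (by linarith)
        (fun k => posR p q k) u hu ?_ ?_ hb γ ?_) ?_ ?_
    · intro x _ hx hxW
      simp only [u, Nat.zero_min] at hx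
      obtain ⟨l, hl, rfl⟩ := hxW
      have := posR_strictMono.monotone (Nat.zero_le l) (f := posR p q)
      linarith
    · intro x hx hxb hxW
      simp only [u, min_self] at hx
      have := (side (p + q) x hxW).1 (T.lt_of_mem x hxW).2
      linarith
    · intro k
      have := posR_succ (p := p) (q := q) k
      have := posR_add_mesh_le (p := p) (q := q) k.2
      obtain ⟨e1, e2⟩ := huk k
      refine ⟨(hm k).1, by rw [e1], by rw [e2]; linarith, (hm _).2, by rw [hbT]; linarith⟩
    · intro k x h1 h2 hx hxW
      obtain ⟨e1, e2⟩ := huk k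
      rw [e1] at h1
      rw [e2] at h2
      rcases lt_or_gt_of_ne hx with h | h
      · linarith [(side k x hxW).1 h]
      · obtain ⟨l, hl, rfl⟩ := hxW
        have := posR_strictMono.monotone (Nat.succ_le_of_lt (posR_strictMono.lt_iff_lt.1 h))
          (f := posR p q)
        simp only [Nat.succ_eq_add_one] at this
        linarith
    · exact fun k t h => Subtype.ext (hγ k t)
    · exact fun t h => Subtype.ext (hδ t)
    · exact fun t h => Subtype.ext (hε t)
  refine key _ ha M.a M.alpha M.beta (fun k t => ?_) (fun t => ?_) (fun t => ?_)
  · rw [hM.a]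
    congr 1
    exact lasso_congr (pos_eq _) (pos_eq _) (by simp [mesh_eq]) t
  · rw [hM.alpha, proj_mul_period_one, hM.x₀, pos_eq, ← chart_add, hbT]
  · rw [hM.beta, proj_mul_period_two, hM.x₀, pos_eq, ← chart_add, hbT]

end IsStandard

end StandardRelations

/-! ### The relation in the base of the standard arrangement -/

section StandardRelations

variable {p q : ℕ} {ω₁ ω₂ : ℂ} {M : Marking p q (Curve ω₁ ω₂)}

theorem posR_eq_mul_of_lt (i : Fin p) : posR p q i = ((i : ℕ) + 1 : ℝ) * meshR p q :=
  posR_of_lt i.2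

theorem posR_add_eq_mul (j : ℕ) : posR p q (p + j) = ((p : ℝ) + 1) * (j + 1) * meshR p q := by
  rw [posR_add, ← meshR_mul (p := p)]; ring

namespace IsStandard

variable (hM : IsStandard ω₁ ω₂ M)
include hM

/-- The base of the standard arrangement. -/
def base : Punctured ω₁ ω₂ M.Base where
  b := 0
  W := {w | ∃ (i : Fin p) (j : Fin q), w = posR p q i - posR p q (p + j)}
  lt_of_mem := by
    rintro w ⟨i, j, rfl⟩
    have := posR_pos (p := p) (q := q) i
    have := posR_lt_one (p := p) (q := q) (k := p + j) (by omega)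
    have := posR_strictMono (p := p) (q := q) (show (i : ℕ) < p + j by omega)
    constructor <;> linarith
  G x := ⟨x.1, fun i j => by
      rw [hM.x, hM.y, pos_eq, pos_eq, ← sub_eq_add_neg, ← chart_sub, ← Complex.ofReal_sub]
      exact x.2 _ ⟨i, j, rfl⟩⟩
  cont := by fun_prop

theorem good_base (hω : 0 < (ω₂ / ω₁).im) : hM.base.Good hM.base.b :=
  hM.base.good_real hω (by linarith) le_rfl fun h => (hM.base.lt_of_mem _ h).2.false

theorem pt_base (hω : 0 < (ω₂ / ω₁).im) : hM.base.pt (hM.good_base hω) = M.basePt := by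
  refine Subtype.ext ?_
  change chart ω₁ ω₂ ((0 : ℝ) : ℂ) = M.y₀
  rw [hM.y₀, Complex.ofReal_zero, chart_zero]

/-- Measured in meshes, the punctures of the base are integers that are not divisible by
`p + 1`. -/
theorem mem_base_W {x : ℝ} (hx : x ∈ hM.base.W) :
    ∃ z : ℤ, x = z * meshR p q ∧ ¬ ((p : ℤ) + 1 ∣ z) ∧ -((p : ℤ) + 1) * q < z := by
  obtain ⟨i, j, rfl⟩ := hx
  refine ⟨(i : ℤ) + 1 - (p + 1) * (j + 1), ?_, ?_, ?_⟩
  · rw [posR_eq_mul_of_lt, posR_add_eq_mul]; push_cast; ring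
  · intro h
    have h' : (p : ℤ) + 1 ∣ (i : ℤ) + 1 := by
      have := dvd_add h (dvd_mul_right ((p : ℤ) + 1) ((j : ℤ) + 1))
      simpa using this
    have := Int.le_of_dvd (by positivity) h'
    have := i.2
    omega
  · have : (j : ℤ) + 1 ≤ q := by have := j.2; omega
    have : ((p : ℤ) + 1) * (j + 1) ≤ (p + 1) * q := by gcongr
    linarith [show (0 : ℤ) ≤ i by positivity]

theorem not_mem_base_W (m : ℤ) {x : ℝ}
    (h1 : (m * (p + 1) - 1 / 2) * meshR p q ≤ x) (h2 : x ≤ (m * (p + 1) + 1 / 2) * meshR p q) :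
    x ∉ hM.base.W := by
  intro hx
  have h0 := meshR_pos (p := p) (q := q)
  obtain ⟨z, rfl, hz, -⟩ := hM.mem_base_W hx
  have h1 := le_of_mul_le_mul_right h1 h0
  have h2 := le_of_mul_le_mul_right h2 h0
  have h3 : m * ((p : ℤ) + 1) - 1 < z := by
    have : (m * ((p : ℝ) + 1) - 1) < z := by linarith
    exact_mod_cast this
  have h4 : z < m * ((p : ℤ) + 1) + 1 := by
    have : z < (m * ((p : ℝ) + 1) + 1) := by linarith
    exact_mod_cast this
  exact hz ⟨m, by linarith⟩

/-- The relation in the group of the base of the standard arrangement. The punctures `x_i + y_j`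
occur from left to right in the order of the product: `j` decreases, and `i` increases for each `j`.
-/
theorem prod_d (hω : 0 < (ω₂ / ω₁).im) (hq : 1 ≤ q) :
    (List.ofFn fun j : Fin q => (List.ofFn fun i : Fin p => M.d i j.rev).prod).prod *
      comm M.gAlphaHat M.gBetaHat = 1 := by
  have h0 := meshR_pos (p := p) (q := q)
  have h1 := meshR_lt_half (p := p) hq
  set T := hM.base with hT
  have hbT : T.b = 0 := rfl
  have hb := hM.good_base hω
  have hN : ((p : ℝ) + 1) * q * meshR p q < 1 := by
    have := posR_lt_one (p := p) (q := q) (k := p + (q - 1)) (by omega)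
    rwa [posR_add_eq_mul, Nat.cast_sub hq, Nat.cast_one, sub_add_cancel] at this
  -- separators between the groups of punctures, and within one group
  let v : ℕ → ℝ := fun k => (-((q - k : ℕ) : ℤ) * (p + 1) : ℝ) * meshR p q
  let u : Fin q → ℕ → ℝ := fun k i =>
    (-((q - k : ℕ) : ℤ) * (p + 1) + (min i p : ℕ) + 1 / 2 : ℝ) * meshR p q
  have hqk' : ∀ k : Fin q, (1 : ℝ) ≤ ((q - k : ℕ) : ℝ) := fun k => by
    have := k.2
    exact_mod_cast (show 1 ≤ q - k by omega)
  have hv : ∀ k, T.b - 1 ≤ v k ∧ v k ≤ T.b := by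
    intro k
    rw [hbT]
    have e1 : ((q - k : ℕ) : ℝ) * ((p + 1) * meshR p q) ≤ q * ((p + 1) * meshR p q) := by
      gcongr; exact Nat.sub_le _ _
    have e2 : 0 ≤ ((q - k : ℕ) : ℝ) * ((p + 1) * meshR p q) := by positivity
    simp only [v, Int.cast_natCast]
    constructor <;> linarith
  have hu : ∀ k i, T.b - 1 ≤ u k i ∧ u k i ≤ T.b := by
    intro k i
    rw [hbT]
    have e1 : ((q - k : ℕ) : ℝ) * ((p + 1) * meshR p q) ≤ q * ((p + 1) * meshR p q) := by
      gcongr; exact Nat.sub_le _ _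
    have e2 : 1 * ((p + 1) * meshR p q) ≤ ((q - k : ℕ) : ℝ) * ((p + 1) * meshR p q) := by
      gcongr; exact hqk' k
    have e3 : ((min i p : ℕ) : ℝ) * meshR p q ≤ p * meshR p q := by gcongr; exact min_le_right _ _
    have e4 : 0 ≤ ((min i p : ℕ) : ℝ) * meshR p q := by positivity
    simp only [u, Int.cast_natCast]
    constructor <;> linarith
  have gv : ∀ k, T.Good (v k) := fun k => T.good_real hω (hv k).1 (hv k).2
    (hM.not_mem_base_W (-((q - k : ℕ) : ℤ)) (by simp only [v]; push_cast; linarith)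
      (by simp only [v]; push_cast; linarith))
  -- the separators within a group are half-integers
  have half : ∀ (n : ℤ) (x : ℝ), x = (n + 1 / 2) * meshR p q → x ∉ T.W := by
    rintro n x rfl hx
    obtain ⟨z, hz, -⟩ := hM.mem_base_W hx
    have hz := mul_right_cancel₀ h0.ne' hz
    have h3 : n < z := by
      have : (n : ℝ) < z := by linarith
      exact_mod_cast this
    have h4 : z < n + 1 := by
      have : (z : ℝ) < n + 1 := by linarith
      exact_mod_cast this
    omega
  have gu : ∀ k i, T.Good (u k i) := fun k i => T.good_real hω (hu k i).1 (hu k i).2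
    (half (-((q - k : ℕ) : ℤ) * (p + 1) + (min i p : ℕ)) _ (by simp only [u]; push_cast; rfl))
  have c0 : ∀ k : Fin q, T.cross hω (gu k 0) = T.cross hω (gv k) := fun k => by
    have hle : v k ≤ u k 0 := by simp only [u, v, Nat.zero_min, Nat.cast_zero]; linarith
    have hgood : ∀ x ∈ Set.Icc (v k) (u k 0), T.Good (x : ℝ) := fun x hx => by
      refine T.good_real hω ((hv k).1.trans hx.1) (hx.2.trans (hu k 0).2)
        (hM.not_mem_base_W (-((q - k : ℕ) : ℤ)) ?_ ?_)
      · have := hx.1; simp only [v] at this; push_cast at this ⊢; linarith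
      · have := hx.2
        simp only [u, Nat.zero_min, Nat.cast_zero] at this; push_cast at this ⊢; linarith
    exact (T.cross_congr hω hle hgood).symm
  have hsucc : ∀ k : Fin q, ((q - (k + 1) : ℕ) : ℝ) = ((q - k : ℕ) : ℝ) - 1 := fun k => by
    have := k.2
    rw [show q - (k : ℕ) = q - (k + 1) + 1 by omega]
    push_cast; ring
  have c1 : ∀ k : Fin q, T.cross hω (gu k p) = T.cross hω (gv (k + 1)) := fun k => by
    have hle : u k p ≤ v (k + 1) := by
      simp only [u, v, min_self, Int.cast_natCast, hsucc]; linarith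
    have hgood : ∀ x ∈ Set.Icc (u k p) (v (k + 1)), T.Good (x : ℝ) := fun x hx => by
      refine T.good_real hω ((hu k p).1.trans hx.1) (hx.2.trans (hv _).2)
        (hM.not_mem_base_W (-((q - (k + 1) : ℕ) : ℤ)) ?_ ?_)
      · have := hx.1
        simp only [u, min_self] at this; push_cast [hsucc] at this ⊢; linarith
      · have := hx.2; simp only [v] at this; push_cast [hsucc] at this ⊢; linarith
    exact T.cross_congr hω hle hgood
  have hw : ∀ (k : Fin q) (i : Fin p), posR p q i - posR p q (p + (k.rev : ℕ)) =
      (-((q - k : ℕ) : ℤ) * (p + 1) + i + 1 : ℝ) * meshR p q := by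
    intro k i
    have : (((k.rev : Fin q) : ℕ) : ℝ) + 1 = ((q - k : ℕ) : ℝ) := by
      have := k.2
      have e : ((k.rev : Fin q) : ℕ) + 1 = q - k := by rw [Fin.val_rev]; omega
      exact_mod_cast e
    rw [posR_eq_mul_of_lt, posR_add_eq_mul, this]
    push_cast; ring
  have hui : ∀ (k : Fin q) (i : Fin p),
      u k i = (-((q - k : ℕ) : ℤ) * (p + 1) + i + 1 / 2 : ℝ) * meshR p q ∧
      u k (i + 1) = (-((q - k : ℕ) : ℤ) * (p + 1) + i + 1 + 1 / 2 : ℝ) * meshR p q := by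
    intro k i
    simp only [u]
    rw [min_eq_left (by omega), min_eq_left (by omega)]
    push_cast
    exact ⟨rfl, by ring⟩
  have key : ∀ (a : M.Base) (ha : T.pt hb = a) (γ : Fin p → Fin q → Path a a) (δ ε : Path a a),
      (∀ i j t, (γ i j t).1 = chart ω₁ ω₂ (lasso T.b ((posR p q i - posR p q (p + j) : ℝ) : ℂ)
        (meshR p q / 2 : ℝ) t)) →
      (∀ t, (δ t).1 = chart ω₁ ω₂ (T.b + (t : ℝ) * ((1 - Complex.I) / 2))) →
      (∀ t, (ε t).1 = chart ω₁ ω₂ (T.b + (t : ℝ) * ((1 + Complex.I) / 2))) →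
      (List.ofFn fun j : Fin q => (List.ofFn fun i : Fin p => cls (γ i j.rev)).prod).prod *
        comm (cls δ) (cls ε) = 1 := by
    rintro a rfl γ δ ε hγ hδ hε
    have inner : ∀ k : Fin q, (List.ofFn fun i : Fin p => cls (γ i k.rev)).prod =
        (((T.low hω hb).symm.trans (T.cross hω (gv (k + 1)))).trans
          ((T.low hω hb).symm.trans (T.cross hω (gv k))).symm : Arc _ _) := by
      intro k
      rw [T.prod_lasso hω (r := meshR p q / 2) (by linarith)
        (fun i : Fin p => posR p q i - posR p q (p + (k.rev : ℕ))) (u k) (gu k) ?_ ?_ hb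
        (fun i => γ i k.rev) (fun i t h => Subtype.ext (hγ i _ t)), c0, c1]
      · simp
      · intro i
        obtain ⟨e1, e2⟩ := hui k i
        have := (hu k (i + 1)).2
        rw [e2, hbT] at this
        refine ⟨(hu k i).1, ?_, ?_, (hu k _).2, ?_⟩
        · rw [hw, e1]; linarith
        · rw [hw, e2]; linarith
        · rw [hw, hbT]
          have hp := i.2
          have e3 : ((i : ℕ) : ℝ) + 1 ≤ p := by exact_mod_cast hp
          have e4 : 1 * (p + 1) ≤ ((q - k : ℕ) : ℝ) * ((p : ℝ) + 1) := by gcongr; exact hqk' k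
          have e5 : (-((q - k : ℕ) : ℤ) * (p + 1) + i + 1 : ℝ) ≤ -1 := by push_cast; linarith
          have e6 : (-((q - k : ℕ) : ℤ) * (p + 1) + i + 1 : ℝ) * meshR p q ≤ -1 * meshR p q := by
            gcongr
          linarith
      · intro i x h3 h4 hx hxW
        obtain ⟨e1, e2⟩ := hui k i
        rw [e1] at h3
        rw [e2] at h4
        rw [hw] at hx
        obtain ⟨z, rfl, -⟩ := hM.mem_base_W hxW
        have h3 := le_of_mul_le_mul_right h3 h0
        have h4 := le_of_mul_le_mul_right h4 h0
        apply hx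
        congr 1
        have h5 : -((q - k : ℕ) : ℤ) * ((p : ℤ) + 1) + i < z := by
          have : (-((q - k : ℕ) : ℤ) * (p + 1) + i : ℝ) < z := by linarith
          exact_mod_cast this
        have h6 : z < -((q - k : ℕ) : ℤ) * ((p : ℤ) + 1) + i + 1 + 1 := by
          have : (z : ℝ) < (-((q - k : ℕ) : ℤ) * (p + 1) + i + 1 + 1 : ℝ) := by linarith
          exact_mod_cast this
        have h7 : z = -((q - k : ℕ) : ℤ) * ((p : ℤ) + 1) + i + 1 := by linarith
        rw [h7]; push_cast; ring
    refine T.mul_comm_eq_one hω (gv 0) (gv q) hb (hv 0).1 ?_ (hv _).2 ?_ (hv 0).2 (hv _).1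
      δ ε _ ((prod_ofFn_telescope _ (fun k => (T.low hω hb).symm.trans (T.cross hω (gv k)))
        inner).trans (by simp)) ?_ ?_
    · intro x _ hx hxW
      simp only [v, tsub_zero] at hx
      obtain ⟨z, rfl, -, hz⟩ := hM.mem_base_W hxW
      have := le_of_mul_le_mul_right hx h0
      have : z ≤ -(q : ℤ) * ((p : ℤ) + 1) := by exact_mod_cast this
      linarith
    · intro x hx hxb
      refine hM.not_mem_base_W 0 ?_ ?_
      · simp [v] at hx
        push_cast; linarith
      · rw [hbT] at hxb; push_cast; linarith
    · exact fun t h => Subtype.ext (hδ t)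
    · exact fun t h => Subtype.ext (hε t)
  refine key _ (hM.pt_base hω) M.delta M.alphaHat M.betaHat (fun i j t => ?_) (fun t => ?_)
    (fun t => ?_)
  · rw [hM.delta]
    congr 1
    exact lasso_congr (by simp [hbT]) (by simp [pos_eq]) (by simp [mesh_eq]) t
  · rw [hM.alphaHat, proj_mul_period_one, hM.y₀, zero_add, hbT]; simp
  · rw [hM.betaHat, proj_mul_period_two, hM.y₀, zero_add, hbT]; simp

end IsStandard

end StandardRelations

/-! ### Motions along a period -/

section Torus

variable {p q : ℕ} {ω₁ ω₂ : ℂ}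

/-- The periods in the plane: `(1 - i) / 2` for `c = -1`, and `(1 + i) / 2` for `c = 0`. -/
def period (c : ℤ) : ℂ := (1 + (2 * c + 1 : ℝ) * Complex.I) / 2

theorem period_re (c : ℤ) : (period c).re = 1 / 2 := by simp [period]

theorem period_im (c : ℤ) : (period c).im = (2 * c + 1) / 2 := by
  simp [period]

/-- A linear function that is integral on the lattice is constant in the direction of each
period. -/
theorem exists_int_of_chart_eq (hω : 0 < (ω₂ / ω₁).im) {c : ℤ} (hc : c = 0 ∨ c = -1) {z : ℂ}
    {w t : ℝ} (h : chart ω₁ ω₂ z = chart ω₁ ω₂ (w + t * period c)) :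
    ∃ m : ℤ, z.re - (2 * c + 1) * z.im - w = m := by
  obtain ⟨k, l, h1, h2⟩ := rows_of_chart_eq hω h
  simp only [Complex.add_im, Complex.ofReal_im, Complex.im_ofReal_mul, period_im, zero_add] at h1
  simp only [Complex.add_re, Complex.ofReal_re, Complex.re_ofReal_mul, period_re] at h2
  rcases hc with rfl | rfl
  · refine ⟨l, ?_⟩
    push_cast at *; linarith
  · refine ⟨l + k, ?_⟩
    push_cast at *; linarith

theorem false_of_int {x : ℝ} (h : ∃ m : ℤ, x = m) (h0 : 0 < x) (h1 : x < 1) : False := by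
  obtain ⟨m, rfl⟩ := h
  have h0 : 0 < m := by exact_mod_cast h0
  have h1 : m < 1 := by exact_mod_cast h1
  omega

theorem false_of_int' {x : ℝ} (h : ∃ m : ℤ, x = m) (h0 : -1 < x) (h1 : x < 0) : False := by
  obtain ⟨m, rfl⟩ := h
  exact false_of_int (x := m + 1) ⟨m + 1, by push_cast; ring⟩ (by linarith) (by linarith)

variable (p q ω₁ ω₂) in
/-- The pairs of a time `t` and a point `z` such that `z` does not collide with the points `x_i` and
the points `y_0 - y_j`, where the latter are translated by `t` times a period. -/
def moveSet (c : ℤ) : Set (I × ℂ) :=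
  {x | (∀ i < p, chart ω₁ ω₂ x.2 ≠ chart ω₁ ω₂ (posR p q i)) ∧
    ∀ j < q, chart ω₁ ω₂ x.2 ≠
      chart ω₁ ω₂ ((posR p q (p + j) : ℂ) + ((x.1 : ℝ) : ℂ) * period c)}

/-- While the second group of points moves along a period, it does not meet the first group: the
linear function of `exists_int_of_chart_eq` separates them. -/
theorem chart_pos_ne_moved (hω : 0 < (ω₂ / ω₁).im) {c : ℤ} (hc : c = 0 ∨ c = -1) (t : ℝ) {i j : ℕ}
    (hi : i < p) (hj : j < q) : chart ω₁ ω₂ (posR p q i) ≠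
      chart ω₁ ω₂ ((posR p q (p + j) : ℂ) + (t : ℂ) * period c) := by
  intro h
  have := posR_pos (p := p) (q := q) i
  have := posR_lt_one (p := p) (q := q) (k := p + j) (by omega)
  have := posR_strictMono (p := p) (q := q) (show i < p + j by omega)
  have h := exists_int_of_chart_eq hω hc h
  simp only [Complex.ofReal_re, Complex.ofReal_im, mul_zero, sub_zero] at h
  exact false_of_int' h (by linarith) (by linarith)

theorem chart_posR_injective (hω : 0 < (ω₂ / ω₁).im) {i j : ℕ} (hi : i ≤ p + q) (hj : j ≤ p + q)
    (h : chart ω₁ ω₂ (posR p q i) = chart ω₁ ω₂ (posR p q j)) : i = j := by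
  have := eq_of_chart_eq hω h (by simp) (by
    simp only [Complex.ofReal_re]
    rw [abs_lt]
    have := posR_pos (p := p) (q := q) i
    have := posR_pos (p := p) (q := q) j
    have := posR_lt_one hi
    have := posR_lt_one hj
    constructor <;> linarith)
  exact posR_strictMono.injective (Complex.ofReal_injective this)

/-- The configuration of the points `x_i`, the translated points `y_0 - y_j`, and one more
point. -/
def moveConf (hω : 0 < (ω₂ / ω₁).im) {c : ℤ} (hc : c = 0 ∨ c = -1) (x : moveSet p q ω₁ ω₂ c) :
    OrdConf (p + q + 1) (Curve ω₁ ω₂) :=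
  ⟨Fin.snoc (α := fun _ => Curve ω₁ ω₂) (Fin.append (fun i : Fin p => chart ω₁ ω₂ (posR p q i))
    fun j : Fin q => chart ω₁ ω₂ ((posR p q (p + j) : ℂ) + ((x.1.1 : ℝ) : ℂ) * period c))
    (chart ω₁ ω₂ x.1.2), by
    rw [Fin.snoc_injective_iff, Fin.append_injective_iff]
    refine ⟨⟨fun i i' h => Fin.ext (chart_posR_injective (by omega) (by omega) (by omega) h),
      fun j j' h => ?_, fun i j => chart_pos_ne_moved hω hc _ i.2 j.2⟩, ?_⟩
    · simp only [chart_add] at h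
      have := chart_posR_injective hω (by omega) (by omega) (add_right_cancel h)
      exact Fin.ext (by omega)
    · rintro ⟨a, ha⟩
      revert ha
      refine Fin.addCases (fun i => ?_) (fun j => ?_) a
      · rw [Fin.append_left]; exact fun h => x.2.1 i i.2 h.symm
      · rw [Fin.append_right]; exact fun h => x.2.2 j j.2 h.symm⟩

theorem moveConf_castSucc_castAdd (hω : 0 < (ω₂ / ω₁).im) {c : ℤ} (hc : c = 0 ∨ c = -1)
    (x : moveSet p q ω₁ ω₂ c) (i : Fin p) :
    (moveConf hω hc x).1 (Fin.castAdd q i).castSucc = chart ω₁ ω₂ (posR p q i) := by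
  simp [moveConf]

theorem moveConf_castSucc_natAdd (hω : 0 < (ω₂ / ω₁).im) {c : ℤ} (hc : c = 0 ∨ c = -1)
    (x : moveSet p q ω₁ ω₂ c) (j : Fin q) :
    (moveConf hω hc x).1 (Fin.natAdd p j).castSucc =
      chart ω₁ ω₂ ((posR p q (p + j) : ℂ) + ((x.1.1 : ℝ) : ℂ) * period c) :=
  (Fin.snoc_castSucc (α := fun _ => Curve ω₁ ω₂) _ _ _).trans (Fin.append_right _ _ j)

theorem moveConf_last (hω : 0 < (ω₂ / ω₁).im) {c : ℤ} (hc : c = 0 ∨ c = -1)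
    (x : moveSet p q ω₁ ω₂ c) :
    (moveConf hω hc x).1 (Fin.last (p + q)) = chart ω₁ ω₂ x.1.2 := by
  simp [moveConf]

theorem continuous_moveConf (hω : 0 < (ω₂ / ω₁).im) {c : ℤ} (hc : c = 0 ∨ c = -1) :
    Continuous (moveConf (p := p) (q := q) hω hc) := by
  refine Continuous.subtype_mk (continuous_pi fun a => ?_) _
  refine Fin.lastCases ?_ (fun a => ?_) a
  · simp only [Fin.snoc_last]; fun_prop
  · simp only [Fin.snoc_castSucc]
    refine Fin.addCases (fun i => ?_) (fun j => ?_) a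
    · simp only [Fin.append_left]; fun_prop
    · simp only [Fin.append_right]; fun_prop

theorem chart_period (hω : 0 < (ω₂ / ω₁).im) {c : ℤ} (hc : c = 0 ∨ c = -1) :
    chart ω₁ ω₂ (period c) = 0 := by
  rw [chart_eq_zero_iff hω]
  rcases hc with rfl | rfl
  · exact ⟨0, 1, by rw [period_re, period_im]; norm_num, by rw [period_re, period_im]; norm_num⟩
  · exact ⟨1, 0, by rw [period_re, period_im]; norm_num, by rw [period_re, period_im]; norm_num⟩

theorem chart_add_mul_period (hω : 0 < (ω₂ / ω₁).im) {c : ℤ} (hc : c = 0 ∨ c = -1) {t : I}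
    (ht : t = 0 ∨ t = 1) (z : ℂ) :
    chart ω₁ ω₂ (z + ((t : ℝ) : ℂ) * period c) = chart ω₁ ω₂ z := by
  rcases ht with rfl | rfl
  · simp
  · rw [Set.Icc.coe_one, Complex.ofReal_one, one_mul, chart_add, chart_period hω hc, add_zero]

namespace Punctured

variable {X : Type*} [TopologicalSpace X] (T : Punctured ω₁ ω₂ X) (hω : 0 < (ω₂ / ω₁).im)
  {c : ℤ}

theorem real_mem_strip (hc : c = 0 ∨ c = -1) {v : ℝ} (hv : T.Good v) :
    (v : ℂ) ∈ (T.strip hω c).S := by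
  rcases hc with rfl | rfl
  · exact T.up_mem hω hv
  · exact T.low_mem hω hv

/-- The path from `u` to `v` on one side of the real axis. -/
def side (hc : c = 0 ∨ c = -1) {u v : ℝ} (hu : T.Good u) (hv : T.Good v) :
    Arc (T.pt hu) (T.pt hv) :=
  ((T.strip hω c).ray (T.real_mem_strip hω hc hu) rfl).symm.trans
    ((T.strip hω c).ray (T.real_mem_strip hω hc hv) rfl)

/-- A flat arc from `u` to `v`. -/
def bulge (c : ℤ) (ε u v : ℝ) (s : I) : ℂ :=
  ((u + s * (v - u) : ℝ) : ℂ) + (((2 * c + 1) * ε * (s * (1 - s)) : ℝ) : ℂ) * Complex.I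

theorem bulge_re (c : ℤ) (ε u v : ℝ) (s : I) : (bulge c ε u v s).re = u + s * (v - u) := by
  simp [bulge]

theorem bulge_im (c : ℤ) (ε u v : ℝ) (s : I) :
    (bulge c ε u v s).im = (2 * c + 1) * ε * (s * (1 - s)) := by
  rw [bulge, Complex.add_im, Complex.ofReal_im, Complex.im_ofReal_mul]
  simp

@[simp] theorem bulge_zero (c : ℤ) (ε u v : ℝ) : bulge c ε u v 0 = u := by simp [bulge]

@[simp] theorem bulge_one (c : ℤ) (ε u v : ℝ) : bulge c ε u v 1 = v := by simp [bulge]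

theorem continuous_bulge (c : ℤ) (ε u v : ℝ) : Continuous (bulge c ε u v) := by
  unfold bulge; fun_prop

theorem I_mul_le (s : I) : 0 ≤ (s : ℝ) * (1 - s) ∧ (s : ℝ) * (1 - s) ≤ 1 / 4 :=
  ⟨mul_nonneg s.2.1 (by linarith [s.2.2]), by nlinarith [sq_nonneg ((s : ℝ) - 1 / 2)]⟩

/-- A bulge stays within one strip between the rows of the lattice. -/
theorem bulge_good (hω : 0 < (ω₂ / ω₁).im) (hc : c = 0 ∨ c = -1) {ε u v : ℝ} (hε : 0 < ε)
    (hε' : ε ≤ 1) (hu : T.Good u) (hv : T.Good v) (s : I) : T.Good (bulge c ε u v s) := by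
  by_cases h0 : s = 0
  · subst h0; simpa using hu
  by_cases h1 : s = 1
  · subst h1; simpa using hv
  obtain ⟨h0, h1⟩ := I_pos_of_ne h0 h1
  have h2 : 0 < ε * ((s : ℝ) * (1 - s)) := mul_pos hε (mul_pos h0 (by linarith))
  have h3 : ε * ((s : ℝ) * (1 - s)) ≤ 1 * (1 / 4) :=
    mul_le_mul hε' (I_mul_le s).2 (I_mul_le s).1 (by norm_num)
  refine T.good_of_lt hω c ?_ ?_ <;> rw [bulge_im] <;> rcases hc with rfl | rfl <;> push_cast <;>
    linarith

/-- The flat arc as a path. -/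
def bulgePath (hc : c = 0 ∨ c = -1) {ε u v : ℝ} (hε : 0 < ε)
    (hε' : ε ≤ 1) (hu : T.Good u) (hv : T.Good v) : Path (T.pt hu) (T.pt hv) where
  toFun s := T.pt (T.bulge_good hω hc hε hε' hu hv s)
  continuous_toFun := T.cont.comp (Continuous.subtype_mk
    (continuous_chart.comp (continuous_bulge c ε u v)) _)
  source' := T.pt_eq (by simp) _ _
  target' := T.pt_eq (by simp) _ _

theorem mk_bulgePath (hc : c = 0 ∨ c = -1) {ε u v : ℝ} (hε : 0 < ε)
    (hε' : ε ≤ 1) (hu : T.Good u) (hv : T.Good v) :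
    (.mk (T.bulgePath hω hc hε hε' hu hv) : Arc _ _) = T.side hω hc hu hv := by
  refine T.arc_strip hω c _ (bulge c ε u v) (continuous_bulge c ε u v)
    (fun s => ⟨?_, T.bulge_good hω hc hε hε' hu hv s⟩)
    (fun s => rfl) (by simp) (by simp) _ _ _ _
  have h2 : 0 ≤ ε * ((s : ℝ) * (1 - s)) := mul_nonneg hε.le (I_mul_le s).1
  have h3 : ε * ((s : ℝ) * (1 - s)) ≤ 1 * (1 / 4) :=
    mul_le_mul hε' (I_mul_le s).2 (I_mul_le s).1 (by norm_num)
  rw [bulge_im]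
  rcases hc with rfl | rfl <;> push_cast <;> constructor <;> linarith

theorem slope_good (hω : 0 < (ω₂ / ω₁).im) (hc : c = 0 ∨ c = -1) {u v : ℝ} (hu : T.Good u)
    (hv : T.Good v) (s : I) :
    T.Good (((u + s * (v - u) : ℝ) : ℂ) + ((s : ℝ) : ℂ) * period c) := by
  by_cases h0 : s = 0
  · subst h0; simpa using hu
  by_cases h1 : s = 1
  · subst h1
    exact hv.congr T ((chart_add_mul_period hω hc (Or.inr rfl) _).trans (by simp)).symm
  obtain ⟨h0, h1⟩ := I_pos_of_ne h0 h1
  refine T.good_of_lt hω c ?_ ?_ <;>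
    rw [Complex.add_im, Complex.ofReal_im, Complex.im_ofReal_mul, period_im] <;>
    rcases hc with rfl | rfl <;> push_cast <;> linarith

/-- The straight path from `u` to the translate of `v` by a period. -/
def slopePath (hc : c = 0 ∨ c = -1) {u v : ℝ} (hu : T.Good u) (hv : T.Good v) :
    Path (T.pt hu) (T.pt hv) where
  toFun s := T.pt (T.slope_good hω hc hu hv s)
  continuous_toFun := T.cont.comp (Continuous.subtype_mk (by fun_prop) _)
  source' := T.pt_eq (by simp) _ _
  target' := T.pt_eq ((chart_add_mul_period hω hc (Or.inr rfl) _).trans (by simp)) _ _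

/-- A change of the target of a straight path can be performed on the far side. -/
theorem slopePath_trans (hc : c = 0 ∨ c = -1) (hc' : -1 - c = 0 ∨ -1 - c = -1) {u v w : ℝ}
    (hu : T.Good u) (hv : T.Good v) (hw : T.Good w) :
    (Path.Homotopic.Quotient.mk (T.slopePath hω hc hu hv)).trans (T.side hω hc' hv hw) =
      .mk (T.slopePath hω hc hu hw) := by
  have hbd : ∀ s : I, (c : ℝ) / 2 ≤ (s : ℝ) * ((2 * c + 1) / 2) ∧
      (s : ℝ) * ((2 * c + 1) / 2) ≤ (c + 1) / 2 := fun s => by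
    have := s.2.1; have := s.2.2
    rcases hc with rfl | rfl <;> push_cast <;> constructor <;> linarith
  have mem : ∀ {v : ℝ}, T.Good v → ((v : ℂ) + period c) ∈ (T.strip hω c).S := fun {v} hv => by
    refine ⟨?_, hv.congr T ?_⟩
    · have := hbd 1
      rw [Complex.add_im, Complex.ofReal_im, period_im]
      simpa using this
    · rw [chart_add, chart_period hω hc, add_zero]
  have ends : ∀ {v : ℝ} (hv : T.Good v), (T.strip hω c).F ⟨_, mem hv⟩ = T.pt hv := fun hv =>
    T.pt_eq (by rw [chart_add, chart_period hω hc, add_zero]) _ _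
  have slope : ∀ {u v : ℝ} (hu : T.Good u) (hv : T.Good v), (.mk (T.slopePath hω hc hu hv) :
      Arc _ _) = ((T.strip hω c).ray (T.real_mem_strip hω hc hu) rfl).symm.trans
        ((T.strip hω c).ray (mem hv) (ends hv)) := by
    intro u v hu hv
    refine T.arc_strip hω c _ (fun s => ((u + s * (v - u) : ℝ) : ℂ) + ((s : ℝ) : ℂ) * period c)
      (by fun_prop) (fun s => ⟨?_, T.slope_good hω hc hu hv s⟩) (fun s => rfl) (by simp) (by simp)
      _ _ _ _
    rw [Complex.add_im, Complex.ofReal_im, Complex.im_ofReal_mul, period_im, zero_add]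
    exact hbd s
  have far : T.side hω hc' hv hw = ((T.strip hω c).ray (mem hv) (ends hv)).symm.trans
        ((T.strip hω c).ray (mem hw) (ends hw)) := by
    rw [← T.mk_bulgePath hω hc' one_pos le_rfl hv hw]
    refine T.arc_strip hω c _ (fun s => bulge (-1 - c) 1 v w s + period c)
      ((continuous_bulge _ _ _ _).add continuous_const)
      (fun s => ⟨?_, (T.bulge_good hω hc' one_pos le_rfl hv hw s).congr T
        (by rw [chart_add, chart_period hω hc, add_zero])⟩)
      (fun s => T.pt_eq (by rw [chart_add, chart_period hω hc, add_zero]) _ _) (by simp) (by simp)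
      _ _ _ _
    have := I_mul_le s
    rw [Complex.add_im, bulge_im, period_im]
    rcases hc with rfl | rfl <;> push_cast <;> constructor <;> linarith
  have cancel : ∀ {o a b d : X} (A : Arc o a) (B : Arc o b) (C : Arc o d),
      (A.symm.trans B).trans (B.symm.trans C) = A.symm.trans C := by
    intros; simp
  rw [slope hu hv, slope hu hw, far]
  exact cancel _ _ _

end Punctured

end Torus

/-! ### Squares of commuting motions -/

section Torus

variable {p q : ℕ} {ω₁ ω₂ : ℂ} {M : Marking p q (Curve ω₁ ω₂)} {c : ℤ}

/-- A point on the real axis that is not a puncture may be moved along the period, at any speed,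
during the motion of the second group of points. -/
theorem mem_moveSet_line (hM : IsStandard ω₁ ω₂ M) (hω : 0 < (ω₂ / ω₁).im) (hc : c = 0 ∨ c = -1)
    {u : ℝ} (hu : hM.fibre.Good u) (t : I) (r : ℝ) :
    (t, (u : ℂ) + (r : ℂ) * period c) ∈ moveSet p q ω₁ ω₂ c := by
  have key : ∀ k < p + q, ∀ r' : ℝ, chart ω₁ ω₂ ((u : ℂ) + (r : ℂ) * period c) ≠
      chart ω₁ ω₂ ((posR p q k : ℂ) + (r' : ℂ) * period c) := by
    intro k hk r' h
    have h : chart ω₁ ω₂ (u : ℂ) = chart ω₁ ω₂ ((posR p q k : ℂ) + ((r' - r : ℝ) : ℂ) * period c) := by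
      rw [← sub_eq_zero, ← chart_sub] at h ⊢
      rw [← h]; congr 1; push_cast; ring
    obtain ⟨m, hm⟩ := exists_int_of_chart_eq hω hc h
    refine hu _ ⟨k, hk, rfl⟩ (chart_eq_of_rows hω 0 m (by simp) ?_)
    simpa using hm
  exact ⟨fun i hi => by simpa using key i (by omega) 0, fun j hj => key _ (by omega) _⟩

theorem moveConf_eq_iota (hM : IsStandard ω₁ ω₂ M) (hω : 0 < (ω₂ / ω₁).im)
    (hc : c = 0 ∨ c = -1) {t : I} (ht : t = 0 ∨ t = 1) {z z' : ℂ}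
    (h : (t, z) ∈ moveSet p q ω₁ ω₂ c) (hz : hM.fibre.Good z')
    (he : chart ω₁ ω₂ z = chart ω₁ ω₂ z') :
    moveConf hω hc ⟨(t, z), h⟩ = M.iota (hM.fibre.pt hz) := by
  refine Subtype.ext (funext fun a => ?_)
  refine Fin.lastCases ?_ (fun a => ?_) a
  · rw [moveConf_last, M.iota_last]; exact he
  · refine Fin.addCases (fun i => ?_) (fun j => ?_) a
    · rw [moveConf_castSucc_castAdd, M.iota_castSucc, hM.phi_basePt]; rfl
    · rw [moveConf_castSucc_natAdd, M.iota_castSucc, hM.phi_basePt,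
        chart_add_mul_period hω hc ht]; rfl

/-- A motion of the last point along `f`, while the points `y_0 - y_j` run along a period. -/
def track (hM : IsStandard ω₁ ω₂ M) (hω : 0 < (ω₂ / ω₁).im) (hc : c = 0 ∨ c = -1) (f : I → ℂ)
    (hf : Continuous f) (hV : ∀ t, (t, f t) ∈ moveSet p q ω₁ ω₂ c) {z w : ℂ}
    (hz : hM.fibre.Good z) (hw : hM.fibre.Good w) (h0 : chart ω₁ ω₂ (f 0) = chart ω₁ ω₂ z)
    (h1 : chart ω₁ ω₂ (f 1) = chart ω₁ ω₂ w) :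
    Path (M.iota (hM.fibre.pt hz)) (M.iota (hM.fibre.pt hw)) where
  toFun t := moveConf hω hc ⟨(t, f t), hV t⟩
  continuous_toFun := (continuous_moveConf hω hc).comp
    (Continuous.subtype_mk (continuous_id.prodMk hf) _)
  source' := moveConf_eq_iota hM hω hc (Or.inl rfl) _ _ h0
  target' := moveConf_eq_iota hM hω hc (Or.inr rfl) _ _ h1

/-- A family of motions of the last point, carried along while the points `y_0 - y_j` run along a
period. -/
theorem move_square (hM : IsStandard ω₁ ω₂ M) (hω : 0 < (ω₂ / ω₁).im) (hc : c = 0 ∨ c = -1)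
    (z : I × I → ℂ) (hz : Continuous z) (hV : ∀ s t, (t, z (s, t)) ∈ moveSet p q ω₁ ω₂ c)
    {a a' : M.Fibre} (B B' : Path a a')
    (hB : ∀ s, ∃ h, B s = hM.fibre.pt (z := z (s, 0)) h)
    (hB' : ∀ s, ∃ h, B' s = hM.fibre.pt (z := z (s, 1)) h)
    (l : Path (M.iota a) (M.iota a)) (r : Path (M.iota a') (M.iota a'))
    (hl : ∀ t, l t = moveConf hω hc ⟨(t, z (0, t)), hV 0 t⟩)
    (hr : ∀ t, r t = moveConf hω hc ⟨(t, z (1, t)), hV 1 t⟩) :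
    ((Path.Homotopic.Quotient.mk B).map M.iota).trans (.mk r) =
      (Path.Homotopic.Quotient.mk l).trans ((Path.Homotopic.Quotient.mk B').map M.iota) := by
  refine square (fun x : I × I => moveConf hω hc ⟨(x.2, z x), hV x.1 x.2⟩)
    ((continuous_moveConf hω hc).comp (Continuous.subtype_mk (continuous_snd.prodMk hz) _))
    (bottom := B.map M.iota.continuous) (right := r) (left := l)
    (top := B'.map M.iota.continuous) ?_ hr hl ?_
  · intro s
    obtain ⟨h, e⟩ := hB s
    exact (congrArg M.iota e).trans (moveConf_eq_iota hM hω hc (Or.inl rfl) _ h rfl).symm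
  · intro s
    obtain ⟨h, e⟩ := hB' s
    exact (congrArg M.iota e).trans (moveConf_eq_iota hM hω hc (Or.inr rfl) _ h rfl).symm

variable (hM : IsStandard ω₁ ω₂ M) (hω : 0 < (ω₂ / ω₁).im) (hc : c = 0 ∨ c = -1)

/-- The loop in which the points `y_0 - y_j` run along a period and the last point rests. -/
def hold {u : ℝ} (hu : hM.fibre.Good u) :
    Path (M.iota (hM.fibre.pt hu)) (M.iota (hM.fibre.pt hu)) :=
  track hM hω hc (fun _ => u) continuous_const
    (fun t => by simpa using mem_moveSet_line hM hω hc hu t 0) hu hu rfl rfl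

/-- The loop in which the points `y_0 - y_j` and the last point run along a period. -/
def diag {u : ℝ} (hu : hM.fibre.Good u) :
    Path (M.iota (hM.fibre.pt hu)) (M.iota (hM.fibre.pt hu)) :=
  track hM hω hc (fun t => (u : ℂ) + ((t : ℝ) : ℂ) * period c) (by fun_prop)
    (fun t => mem_moveSet_line hM hω hc hu t t) hu hu
    (chart_add_mul_period hω hc (Or.inl rfl) _) (chart_add_mul_period hω hc (Or.inr rfl) _)

theorem moveConf_congr {t : I} {z z' : ℂ} (h : (t, z) ∈ moveSet p q ω₁ ω₂ c)
    (h' : (t, z') ∈ moveSet p q ω₁ ω₂ c) (e : chart ω₁ ω₂ z = chart ω₁ ω₂ z') :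
    moveConf hω hc ⟨(t, z), h⟩ = moveConf hω hc ⟨(t, z'), h'⟩ := by
  refine Subtype.ext (funext fun a => ?_)
  refine Fin.lastCases ?_ (fun a => ?_) a
  · rw [moveConf_last, moveConf_last]; exact e
  · refine Fin.addCases (fun i => ?_) (fun j => ?_) a
    · rw [moveConf_castSucc_castAdd, moveConf_castSucc_castAdd]
    · rw [moveConf_castSucc_natAdd, moveConf_castSucc_natAdd]

/-- The loop of the last point along the period in question commutes with the motion. -/
theorem slope_trans_hold {u : ℝ} (hu : hM.fibre.Good u) :
    ((Path.Homotopic.Quotient.mk (hM.fibre.slopePath hω hc hu hu)).map M.iota).trans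
      (.mk (hold hM hω hc hu)) = (Path.Homotopic.Quotient.mk (hold hM hω hc hu)).trans
      ((Path.Homotopic.Quotient.mk (hM.fibre.slopePath hω hc hu hu)).map M.iota) := by
  have e : ∀ s : I, ((u + s * (u - u) : ℝ) : ℂ) = u := fun s => by simp
  refine move_square hM hω hc (fun x => (u : ℂ) + ((x.1 : ℝ) : ℂ) * period c) (by fun_prop)
    (fun s t => mem_moveSet_line hM hω hc hu t s) _ _ (fun s => ?_) (fun s => ?_) _ _
    (fun t => moveConf_congr hω hc _ _ (by simp))
    (fun t => moveConf_congr hω hc _ _ (chart_add_mul_period hω hc (Or.inr rfl) _).symm)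
  · exact ⟨by simpa using hM.fibre.slope_good hω hc hu hu s, hM.fibre.pt_eq (by rw [e]) _ _⟩
  · exact ⟨by simpa using hM.fibre.slope_good hω hc hu hu s, hM.fibre.pt_eq (by rw [e]) _ _⟩

theorem mk_diag {u : ℝ} (hu : hM.fibre.Good u) :
    (Path.Homotopic.Quotient.mk (diag hM hω hc hu) : Arc _ _) =
      (Path.Homotopic.Quotient.mk (hold hM hω hc hu)).trans
      ((Path.Homotopic.Quotient.mk (hM.fibre.slopePath hω hc hu hu)).map M.iota) := by
  have e : ∀ s : I, ((u + s * (u - u) : ℝ) : ℂ) = u := fun s => by simp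
  have := move_square hM hω hc
    (fun x => (u : ℂ) + (((x.2 : ℝ) * (1 - (x.1 : ℝ)) : ℝ) : ℂ) * period c) (by fun_prop)
    (fun s t => mem_moveSet_line hM hω hc hu t _) (Path.refl _)
    (hM.fibre.slopePath hω hc hu hu).symm (fun s => ⟨by simpa using hu, hM.fibre.pt_eq (by simp) _ _⟩)
    (fun s => ⟨?_, ?_⟩) (diag hM hω hc hu) (hold hM hω hc hu)
    (fun t => moveConf_congr hω hc _ _ (by simp)) (fun t => moveConf_congr hω hc _ _ (by simp))
  · apply Arc.trans_left_cancel (Path.Homotopic.Quotient.mk (diag hM hω hc hu)).symm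
    rw [Path.Homotopic.Quotient.mk_refl, Path.Homotopic.Quotient.mk_symm, Arc.map_symm] at this
    have h2 : (Path.Homotopic.Quotient.refl (hM.fibre.pt hu)).map M.iota =
      Path.Homotopic.Quotient.refl (M.iota (hM.fibre.pt hu)) := rfl
    rw [h2, Path.Homotopic.Quotient.refl_trans] at this
    rw [this]
    simp
  · simpa [unitInterval.coe_symm_eq] using hM.fibre.slope_good hω hc hu hu (σ s)
  · exact hM.fibre.pt_eq (by simp) _ _

/-- If the last point passes over the places `y_0 - y_j`, then the motion turns one side into the
other one. -/
theorem side_trans_hold (hc' : -1 - c = 0 ∨ -1 - c = -1) {u v : ℝ} (hu : hM.fibre.Good u)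
    (hv : hM.fibre.Good v) (hX : ∀ i < p, ∀ s : I, 0 < u + s * (v - u) - posR p q i ∧
      u + s * (v - u) - posR p q i < 1) :
    ((hM.fibre.side hω hc' hu hv).map M.iota).trans (.mk (hold hM hω hc hv)) =
      (Path.Homotopic.Quotient.mk (hold hM hω hc hu)).trans
      ((hM.fibre.side hω hc hu hv).map M.iota) := by
  rw [← hM.fibre.mk_bulgePath hω hc one_pos le_rfl, ← hM.fibre.mk_bulgePath hω hc' one_pos le_rfl]
  refine move_square hM hω hc (fun x => Punctured.bulge (-1 - c) (1 - 2 * (x.2 : ℝ)) u v x.1)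
    (by unfold Punctured.bulge; fun_prop) (fun s t => ?_) _ _ (fun s => ?_) (fun s => ?_) _ _
    (fun t => moveConf_congr hω hc _ _ (by simp)) (fun t => moveConf_congr hω hc _ _ (by simp))
  · have hs := Punctured.I_mul_le s
    have ht0 := t.2.1
    have ht1 := t.2.2
    refine ⟨fun i hi h => ?_, fun j hj h => ?_⟩
    · have := hX i hi s
      have e := congrArg Complex.re (eq_of_chart_eq hω h ?_ ?_)
      · rw [Punctured.bulge_re, Complex.ofReal_re] at e
        linarith
      · rw [Punctured.bulge_im, Complex.ofReal_im, sub_zero, abs_lt]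
        rcases hc with rfl | rfl <;> push_cast <;> constructor <;> nlinarith
      · rw [Punctured.bulge_re, Complex.ofReal_re, abs_lt]
        constructor <;> linarith
    · by_cases hs' : s = 0 ∨ s = 1
      · rcases hs' with rfl | rfl
        · exact (mem_moveSet_line hM hω hc hu t 0).2 j hj (by simpa using h)
        · exact (mem_moveSet_line hM hω hc hv t 0).2 j hj (by simpa using h)
      push Not at hs'
      obtain ⟨h0, h1⟩ := I_pos_of_ne hs'.1 hs'.2
      have h2 : 0 < (s : ℝ) * (1 - s) := mul_pos h0 (by linarith)
      obtain ⟨k, l, hk, -⟩ := rows_of_chart_eq hω h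
      simp only [Complex.add_im, Complex.ofReal_im, Complex.im_ofReal_mul, period_im, zero_add,
        Punctured.bulge_im] at hk
      rcases hc with rfl | rfl <;> push_cast at hk
      · exact false_of_int (x := -k) ⟨-k, by simp⟩ (by nlinarith) (by nlinarith)
      · exact false_of_int (x := k) ⟨k, rfl⟩ (by nlinarith) (by nlinarith)
  · refine ⟨by simpa using hM.fibre.bulge_good hω hc' one_pos le_rfl hu hv s, ?_⟩
    exact hM.fibre.pt_eq (by simp) _ _
  · have e : Punctured.bulge c 1 u v s = Punctured.bulge (-1 - c) (1 - 2 * ((1 : I) : ℝ)) u v s := by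
      unfold Punctured.bulge; congr 3; push_cast; ring
    exact ⟨e ▸ hM.fibre.bulge_good hω hc one_pos le_rfl hu hv s, hM.fibre.pt_eq (by rw [e]) _ _⟩

/-- The last point may move along the other period if it keeps off the moving points. -/
theorem slope_trans_hold' (hc' : -1 - c = 0 ∨ -1 - c = -1) {u v : ℝ} (hu : hM.fibre.Good u)
    (hv : hM.fibre.Good v) (hX : ∀ i < p, ∀ s : I, 0 < u + s * (v - u) - posR p q i ∧
      u + s * (v - u) - posR p q i < 1)
    (hY : ∀ j < q, ∀ s : I, 0 < u + s * (1 + v - u) - posR p q (p + j) ∧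
      u + s * (1 + v - u) - posR p q (p + j) < 1) :
    ((Path.Homotopic.Quotient.mk (hM.fibre.slopePath hω hc' hu hv)).map M.iota).trans
      (.mk (hold hM hω hc hv)) = (Path.Homotopic.Quotient.mk (hold hM hω hc hu)).trans
      ((Path.Homotopic.Quotient.mk (hM.fibre.slopePath hω hc' hu hv)).map M.iota) := by
  refine move_square hM hω hc (fun x => ((u + x.1 * (v - u) : ℝ) : ℂ) +
      ((x.1 : ℝ) : ℂ) * period (-1 - c)) (by fun_prop) (fun s t => ⟨fun i hi h => ?_,
      fun j hj h => ?_⟩) _ _ (fun s => ⟨hM.fibre.slope_good hω hc' hu hv s, rfl⟩)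
    (fun s => ⟨hM.fibre.slope_good hω hc' hu hv s, rfl⟩) _ _
    (fun t => moveConf_congr hω hc _ _ (by simp))
    (fun t => moveConf_congr hω hc _ _
      ((chart_add_mul_period hω hc' (Or.inr rfl) _).trans (by simp)).symm)
  · have h : chart ω₁ ω₂ ((u + s * (v - u) : ℝ) : ℂ) = chart ω₁ ω₂ ((posR p q i : ℝ) +
        ((-s : ℝ) : ℂ) * period (-1 - c)) := by
      rw [← sub_eq_zero, ← chart_sub] at h ⊢
      rw [← h]; congr 1; push_cast; ring
    have := exists_int_of_chart_eq hω hc' h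
    simp only [Complex.ofReal_re, Complex.ofReal_im, mul_zero, sub_zero] at this
    exact false_of_int this (hX i hi s).1 (hX i hi s).2
  · have := exists_int_of_chart_eq hω hc h
    simp only [Complex.add_re, Complex.ofReal_re, Complex.re_ofReal_mul, Complex.add_im,
      Complex.ofReal_im, Complex.im_ofReal_mul, period_re, period_im, zero_add] at this
    have h3 := hY j hj s
    refine false_of_int this ?_ ?_ <;> rcases hc with rfl | rfl <;> push_cast <;> linarith

/-- A flat motion of the last point away from the points `y_0 - y_j` commutes with their motion. -/
theorem side_commute_hold {c' : ℤ} (hc' : c' = 0 ∨ c' = -1) {ε u v : ℝ} (hε : 0 < ε) (hε' : ε ≤ 1)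
    (hu : hM.fibre.Good u) (hv : hM.fibre.Good v)
    (hY : ∀ j < q, ∀ s : I, -1 + ε / 2 ≤ u + s * (v - u) - posR p q (p + j) ∧
      u + s * (v - u) - posR p q (p + j) ≤ -(ε / 2)) :
    ((hM.fibre.side hω hc' hu hv).map M.iota).trans (.mk (hold hM hω hc hv)) =
      (Path.Homotopic.Quotient.mk (hold hM hω hc hu)).trans
      ((hM.fibre.side hω hc' hu hv).map M.iota) := by
  rw [← hM.fibre.mk_bulgePath hω hc' hε hε']
  have hg := hM.fibre.bulge_good hω hc' hε hε' hu hv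
  refine move_square hM hω hc (fun x => Punctured.bulge c' ε u v x.1)
    ((Punctured.continuous_bulge c' ε u v).comp continuous_fst)
    (fun s t => ⟨fun i hi => hg s _ ⟨i, by omega, rfl⟩, fun j hj h => ?_⟩) _ _
    (fun s => ⟨hg s, rfl⟩) (fun s => ⟨hg s, rfl⟩) _ _
    (fun t => moveConf_congr hω hc _ _ (by simp)) (fun t => moveConf_congr hω hc _ _ (by simp))
  have := exists_int_of_chart_eq hω hc h
  rw [Punctured.bulge_re, Punctured.bulge_im] at this
  obtain ⟨h1, h2⟩ := hY j hj s
  have hs := Punctured.I_mul_le s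
  have h3 : 0 ≤ ε * ((s : ℝ) * (1 - s)) := mul_nonneg hε.le hs.1
  have h4 : ε * ((s : ℝ) * (1 - s)) ≤ ε * (1 / 4) := mul_le_mul_of_nonneg_left hs.2 hε.le
  refine false_of_int' this ?_ ?_ <;> rcases hc with rfl | rfl <;> rcases hc' with rfl | rfl <;>
    push_cast <;> linarith

/-- A flat motion of the last point away from the points `x_i` commutes with the translation of all
other points. -/
theorem side_commute_diag {c' : ℤ} (hc' : c' = 0 ∨ c' = -1) {ε u v : ℝ} (hε : 0 < ε) (hε' : ε ≤ 1)
    (hu : hM.fibre.Good u) (hv : hM.fibre.Good v)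
    (hX : ∀ i < p, ∀ s : I, ε / 2 ≤ u + s * (v - u) - posR p q i ∧
      u + s * (v - u) - posR p q i ≤ 1 - ε / 2) :
    ((hM.fibre.side hω hc' hu hv).map M.iota).trans (.mk (diag hM hω hc hv)) =
      (Path.Homotopic.Quotient.mk (diag hM hω hc hu)).trans
      ((hM.fibre.side hω hc' hu hv).map M.iota) := by
  rw [← hM.fibre.mk_bulgePath hω hc' hε hε']
  have hg := hM.fibre.bulge_good hω hc' hε hε' hu hv
  refine move_square hM hω hc (fun x => Punctured.bulge c' ε u v x.1 + ((x.2 : ℝ) : ℂ) * period c)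
    (((Punctured.continuous_bulge c' ε u v).comp continuous_fst).add (by fun_prop))
    (fun s t => ⟨fun i hi h => ?_, fun j hj h => ?_⟩) _ _
    (fun s => ⟨(hg s).congr _ (chart_add_mul_period hω hc (Or.inl rfl) _).symm,
      hM.fibre.pt_eq (chart_add_mul_period hω hc (Or.inl rfl) _).symm _ _⟩)
    (fun s => ⟨(hg s).congr _ (chart_add_mul_period hω hc (Or.inr rfl) _).symm,
      hM.fibre.pt_eq (chart_add_mul_period hω hc (Or.inr rfl) _).symm _ _⟩) _ _
    (fun t => moveConf_congr hω hc _ _ (by simp)) (fun t => moveConf_congr hω hc _ _ (by simp))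
  · have h : chart ω₁ ω₂ (Punctured.bulge c' ε u v s) = chart ω₁ ω₂ ((posR p q i : ℝ) +
        ((-t : ℝ) : ℂ) * period c) := by
      rw [← sub_eq_zero, ← chart_sub] at h ⊢
      rw [← h]; congr 1; push_cast; ring
    have := exists_int_of_chart_eq hω hc h
    rw [Punctured.bulge_re, Punctured.bulge_im] at this
    obtain ⟨h1, h2⟩ := hX i hi s
    have hs := Punctured.I_mul_le s
    have h3 : 0 ≤ ε * ((s : ℝ) * (1 - s)) := mul_nonneg hε.le hs.1
    have h4 : ε * ((s : ℝ) * (1 - s)) ≤ ε * (1 / 4) := mul_le_mul_of_nonneg_left hs.2 hε.le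
    refine false_of_int this ?_ ?_ <;> rcases hc with rfl | rfl <;> rcases hc' with rfl | rfl <;>
      push_cast <;> linarith
  · rw [chart_add, chart_add] at h
    exact hg s _ ⟨p + j, by omega, rfl⟩ (add_right_cancel h)

end Torus

/-! ### Loops that commute with the motion of the second group of points -/

section Torus

variable {p q : ℕ} {ω₁ ω₂ : ℂ} {M : Marking p q (Curve ω₁ ω₂)} {c : ℤ}

namespace Punctured

variable {X : Type*} [TopologicalSpace X] (T : Punctured ω₁ ω₂ X) (hω : 0 < (ω₂ / ω₁).im)

/-- Running back along both periods amounts to moving below the punctures by one full turn of the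
horizontal circle. -/
theorem slopePath_symm_trans_symm {b : ℝ} (hb : T.Good b) (hb' : T.Good ((b - 1 : ℝ) : ℂ))
    (bb : T.pt hb' = T.pt hb) :
    (Path.Homotopic.Quotient.mk (T.slopePath hω (c := 0) (Or.inl rfl) hb hb)).symm.trans
      (Path.Homotopic.Quotient.mk (T.slopePath hω (c := -1) (Or.inr rfl) hb hb)).symm =
      (T.low hω hb).symm.trans ((T.strip hω (-1)).ray (T.low_mem hω hb') bb) := by
  have p0 := chart_period hω (ω₁ := ω₁) (ω₂ := ω₂) (c := 0) (Or.inl rfl)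
  have e0 : ∀ t : I, chart ω₁ ω₂ ((b : ℂ) - period 0 + ((t : ℝ) : ℂ) * period 0) =
      chart ω₁ ω₂ (((b + t * (b - b) : ℝ) : ℂ) + ((t : ℝ) : ℂ) * period 0) := fun t => by
    rw [chart_add, chart_sub, p0, sub_zero, ← chart_add]; simp
  have e1 : ∀ t : I, chart ω₁ ω₂ (((b - 1 : ℝ) : ℂ) + ((t : ℝ) : ℂ) * period (-1)) =
      chart ω₁ ω₂ (((b + t * (b - b) : ℝ) : ℂ) + ((t : ℝ) : ℂ) * period (-1)) := fun t => by
    rw [chart_add, chart_add, chart_eq_of_rows hω 0 (-1) (z := ((b - 1 : ℝ) : ℂ)) (w := b)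
      (by simp) (by simp)]
    simp
  have ez : chart ω₁ ω₂ ((b : ℂ) - period 0) = chart ω₁ ω₂ b := by
    rw [chart_sub, p0, sub_zero]
  have hz : ((b : ℂ) - period 0) ∈ (T.strip hω (-1)).S := by
    refine ⟨?_, hb.congr T ez.symm⟩
    rw [Complex.sub_im, Complex.ofReal_im, period_im]
    norm_num
  have zz : ((b - 1 : ℝ) : ℂ) + period (-1) = (b : ℂ) - period 0 := by
    apply Complex.ext <;> simp only [Complex.add_re, Complex.add_im, Complex.sub_re, Complex.sub_im,
      Complex.ofReal_re, Complex.ofReal_im, period_re, period_im] <;> push_cast <;> ring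
  have b0 : ∀ t : I, ((-1 : ℤ) : ℝ) / 2 ≤ ((b : ℂ) - period 0 + ((t : ℝ) : ℂ) * period 0).im ∧
      ((b : ℂ) - period 0 + ((t : ℝ) : ℂ) * period 0).im ≤ (((-1 : ℤ) : ℝ) + 1) / 2 := fun t => by
    rw [Complex.add_im, Complex.sub_im, Complex.ofReal_im, Complex.im_ofReal_mul, period_im]
    have := t.2.1; have := t.2.2
    push_cast
    constructor <;> linarith
  have b1 : ∀ t : I, ((-1 : ℤ) : ℝ) / 2 ≤ (((b - 1 : ℝ) : ℂ) + ((t : ℝ) : ℂ) * period (-1)).im ∧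
      (((b - 1 : ℝ) : ℂ) + ((t : ℝ) : ℂ) * period (-1)).im ≤ (((-1 : ℤ) : ℝ) + 1) / 2 := fun t => by
    rw [Complex.add_im, Complex.ofReal_im, Complex.im_ofReal_mul, period_im]
    have := t.2.1; have := t.2.2
    push_cast
    constructor <;> linarith
  have hA := T.arc_strip hω (-1) (T.slopePath hω (c := 0) (Or.inl rfl) hb hb)
    (fun t => (b : ℂ) - period 0 + ((t : ℝ) : ℂ) * period 0) (by fun_prop)
    (fun t => ⟨b0 t, (T.slope_good hω (Or.inl rfl) hb hb t).congr T (e0 t).symm⟩)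
    (fun t => T.pt_eq (e0 t).symm _ _) (by simp) (by simp) hz (T.low_mem hω hb)
    (T.pt_eq ez _ _) rfl
  have hB := T.arc_strip hω (-1) (T.slopePath hω (c := -1) (Or.inr rfl) hb hb)
    (fun t => ((b - 1 : ℝ) : ℂ) + ((t : ℝ) : ℂ) * period (-1)) (by fun_prop)
    (fun t => ⟨b1 t, (T.slope_good hω (Or.inr rfl) hb hb t).congr T (e1 t).symm⟩)
    (fun t => T.pt_eq (e1 t).symm _ _) (by simp) (by simpa using zz) (T.low_mem hω hb') hz
    bb (T.pt_eq ez _ _)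
  have cancel : ∀ {o a : X} (A B C : Arc o a),
      (A.symm.trans B).symm.trans (C.symm.trans A).symm = B.symm.trans C := by
    intros; simp
  exact (congrArg₂ (fun f g => Path.Homotopic.Quotient.trans f.symm g.symm) hA hB).trans
    (cancel _ _ _)

end Punctured

theorem seg_mem_Icc {A B u v : ℝ} (hu : u ∈ Set.Icc A B) (hv : v ∈ Set.Icc A B) (s : I) :
    u + s * (v - u) ∈ Set.Icc A B := by
  have := s.2.1; have := s.2.2
  obtain ⟨h1, h2⟩ := hu
  obtain ⟨h3, h4⟩ := hv
  constructor <;> nlinarith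

/-- A point between the `x_i` and the `y_0 - y_j`. -/
def gapPt (p q : ℕ) : ℝ := posR p q p - meshR p q / 2

/-- A loop composed of three arcs commutes with `H` if each arc carries the motion at its source to
the motion at its target. -/
theorem Arc.trans_comm_of_three {X : Type*} [TopologicalSpace X] {x y z : X} {H : Arc x x}
    {h₁ : Arc y y} {h₂ : Arc z z} {s₁ : Arc x y} {s₂ : Arc y z} {s₃ : Arc z x}
    (e₁ : s₁.trans h₁ = H.trans s₁) (e₂ : s₂.trans h₂ = h₁.trans s₂)
    (e₃ : s₃.trans H = h₂.trans s₃) :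
    (s₁.trans (s₂.trans s₃)).trans H = H.trans (s₁.trans (s₂.trans s₃)) := by
  rw [Path.Homotopic.Quotient.trans_assoc, Path.Homotopic.Quotient.trans_assoc, e₃,
    ← Path.Homotopic.Quotient.trans_assoc s₂, e₂, Path.Homotopic.Quotient.trans_assoc,
    ← Path.Homotopic.Quotient.trans_assoc s₁, e₁, Path.Homotopic.Quotient.trans_assoc]

variable (hM : IsStandard ω₁ ω₂ M) (hω : 0 < (ω₂ / ω₁).im) (hc : c = 0 ∨ c = -1)

include hM hω

/-- The point between the two groups of points is not a puncture. -/
theorem gapPt_good : hM.fibre.Good (gapPt p q) := by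
  have h0 := meshR_pos (p := p) (q := q)
  have h1 := posR_lt_one (p := p) (q := q) (k := p + q) le_rfl
  have h2 : posR p q p ≤ posR p q (p + q) := posR_strictMono.monotone (by omega)
  have h3 := meshR_le_posR (p := p) (q := q) p
  refine hM.fibre.good_real hω ?_ ?_ ?_
  · change posR p q (p + q) - 1 ≤ _
    unfold gapPt; linarith
  · change _ ≤ posR p q (p + q)
    unfold gapPt; linarith
  · rintro ⟨k, -, hk⟩
    unfold gapPt at hk
    rcases lt_or_ge k p with h | h
    · linarith [posR_add_mesh_le (p := p) (q := q) h]
    · linarith [posR_strictMono.monotone h (f := posR p q)]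

/-- Points near a puncture are no punctures. -/
theorem good_near (k : ℕ) (hk : k < p + q) {e : ℝ}
    (he : e = meshR p q / 2 ∨ e = -(meshR p q / 2)) : hM.fibre.Good ((posR p q k + e : ℝ) : ℂ) := by
  have h0 := meshR_pos (p := p) (q := q)
  have h1 := posR_lt_one (p := p) (q := q) (k := p + q) le_rfl
  have h2 := posR_add_mesh_le (p := p) (q := q) hk
  have h3 := meshR_le_posR (p := p) (q := q) k
  refine hM.fibre.good_real hω ?_ ?_ ?_
  · change posR p q (p + q) - 1 ≤ _
    rcases he with rfl | rfl <;> linarith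
  · change _ ≤ posR p q (p + q)
    rcases he with rfl | rfl <;> linarith
  · rintro ⟨l, -, hl⟩
    rcases lt_trichotomy l k with h | rfl | h
    · have := posR_add_mesh_le (p := p) (q := q) h
      rcases he with rfl | rfl <;> linarith
    · rcases he with rfl | rfl <;> linarith
    · have := posR_add_mesh_le (p := p) (q := q) h
      rcases he with rfl | rfl <;> linarith

/-- The decomposition of the loop around one puncture. -/
theorem lasso_fibre (hq : 1 ≤ q) (hb : hM.fibre.Good hM.fibre.b) (k : ℕ) (hk : k < p + q)
    (hp : hM.fibre.Good ((posR p q k + meshR p q / 2 : ℝ) : ℂ))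
    (hm : hM.fibre.Good ((posR p q k + -(meshR p q / 2) : ℝ) : ℂ))
    (γ : Path (hM.fibre.pt hb) (hM.fibre.pt hb))
    (hγ : ∀ t, (γ t).1 = chart ω₁ ω₂ (lasso hM.fibre.b (posR p q k) (meshR p q / 2 : ℝ) t)) :
    (.mk γ : Arc _ _) = (hM.fibre.low hω hb).symm.trans ((hM.fibre.cross hω hp).trans
      ((hM.fibre.cross hω hm).symm.trans (hM.fibre.low hω hb))) := by
  have h0 := meshR_pos (p := p) (q := q)
  have h1 := meshR_lt_half (p := p) hq
  have h2 := posR_add_mesh_le (p := p) (q := q) hk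
  have h3 := meshR_le_posR (p := p) (q := q) k
  have h4 := posR_lt_one (p := p) (q := q) (k := p + q) le_rfl
  have hbT : hM.fibre.b = posR p q (p + q) := rfl
  refine hM.fibre.lasso_eq hω (r := meshR p q / 2) (by linarith) ?_ (by linarith) le_rfl ?_ ?_
    ?_ hm hp hb γ (fun t h => Subtype.ext (hγ t))
  · rw [hbT]; linarith
  · rw [hbT]; linarith
  · rw [hbT]; linarith
  · rintro x hx1 hx2 hx ⟨l, -, rfl⟩
    rcases lt_trichotomy l k with h | rfl | h
    · linarith [posR_add_mesh_le (p := p) (q := q) h]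
    · exact hx rfl
    · linarith [posR_add_mesh_le (p := p) (q := q) h]

/-- The loop around `x_i`, taken from the other side, commutes with the motion of the
`y_0 - y_j`. -/
theorem exists_left_conj (hq : 1 ≤ q) (hb : hM.fibre.Good hM.fibre.b) (i : ℕ) (hi : i < p)
    (γ : Path (hM.fibre.pt hb) (hM.fibre.pt hb))
    (hγ : ∀ t, (γ t).1 = chart ω₁ ω₂ (lasso hM.fibre.b (posR p q i) (meshR p q / 2 : ℝ) t)) :
    ∃ B : FundamentalGroup M.Fibre (hM.fibre.pt hb),
      cls γ = cls (hM.fibre.slopePath hω (c := 0) (Or.inl rfl) hb hb) *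
        cls (hM.fibre.slopePath hω (c := -1) (Or.inr rfl) hb hb) * B *
        (cls (hM.fibre.slopePath hω (c := -1) (Or.inr rfl) hb hb))⁻¹ *
        (cls (hM.fibre.slopePath hω (c := 0) (Or.inl rfl) hb hb))⁻¹ ∧
      ∀ {c : ℤ} (hc : c = 0 ∨ c = -1), Commute (FundamentalGroup.map M.iota _ B)
        (cls (hold hM hω hc hb)) := by
  have h0 := meshR_pos (p := p) (q := q)
  have hb' := hM.fibre.good_sub_one hω hb
  have bb : hM.fibre.pt hb' = hM.fibre.pt hb :=
    hM.fibre.pt_eq (chart_eq_of_rows hω 0 (-1) (by simp) (by simp)) _ _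
  have hp := good_near hM hω i (by omega) (Or.inl rfl)
  have hm := good_near hM hω i (by omega) (Or.inr rfl)
  set L' := (hM.fibre.strip hω (-1)).ray (hM.fibre.low_mem hω hb') bb with hL'
  have hR := hM.fibre.slopePath_symm_trans_symm hω hb hb' bb
  refine ⟨((L'.symm.trans (hM.fibre.low hω hp)).trans (((hM.fibre.up hω hp).symm.trans
    (hM.fibre.up hω hm)).trans ((hM.fibre.low hω hm).symm.trans L')) : Arc _ _), ?_, ?_⟩
  · have e := lasso_fibre hM hω hq hb i (by omega) hp hm γ hγ
    have alg : ∀ {o o' x y z : M.Fibre} (A B : Arc x x) (Lo Lo' : Arc o x) (Lp : Arc o y)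
        (Up : Arc o' y) (Um : Arc o' z) (Lm : Arc o z),
        A.symm.trans B.symm = Lo.symm.trans Lo' →
        Lo.symm.trans ((Lp.trans Up.symm).trans ((Lm.trans Um.symm).symm.trans Lo)) =
        A.symm.trans (B.symm.trans (((Lo'.symm.trans Lp).trans ((Up.symm.trans Um).trans
          (Lm.symm.trans Lo'))).trans (B.trans A))) := by
      intro o o' x y z A B Lo Lo' Lp Up Um Lm h
      have h' : B.trans A = Lo'.symm.trans Lo := by
        have := congrArg Path.Homotopic.Quotient.symm h
        simpa using this
      rw [h', ← Path.Homotopic.Quotient.trans_assoc A.symm, h]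
      simp
    exact e.trans (alg _ _ _ _ _ _ _ _ hR)
  · intro c hc
    -- the whole loop stays to the left of the gap
    have hY : ∀ {u v : ℝ}, u ∈ Set.Icc (posR p q (p + q) - 1) (gapPt p q) →
        v ∈ Set.Icc (posR p q (p + q) - 1) (gapPt p q) → ∀ j < q, ∀ s : I,
        -1 + meshR p q / 2 ≤ u + s * (v - u) - posR p q (p + j) ∧
        u + s * (v - u) - posR p q (p + j) ≤ -(meshR p q / 2) := by
      intro u v hu hv j hj s
      obtain ⟨h1, h2⟩ := seg_mem_Icc hu hv s
      have h3 := posR_add_mesh_le (p := p) (q := q) (show p + j < p + q by omega)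
      have h4 : posR p q p ≤ posR p q (p + j) := posR_strictMono.monotone (by omega)
      unfold gapPt at h2
      constructor <;> linarith
    have h1 := posR_lt_one (p := p) (q := q) (k := p + q) le_rfl
    have h2 := meshR_le_posR (p := p) (q := q) i
    have h3 := posR_add_mesh_le (p := p) (q := q) hi
    have m0 : hM.fibre.b - 1 ∈ Set.Icc (posR p q (p + q) - 1) (gapPt p q) := by
      change posR p q (p + q) - 1 ∈ _
      unfold gapPt; constructor <;> linarith
    have m1 : posR p q i + meshR p q / 2 ∈ Set.Icc (posR p q (p + q) - 1) (gapPt p q) := by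
      unfold gapPt; constructor <;> linarith
    have m2 : posR p q i + -(meshR p q / 2) ∈ Set.Icc (posR p q (p + q) - 1) (gapPt p q) := by
      unfold gapPt; constructor <;> linarith
    have hmesh : meshR p q ≤ 1 := by linarith [meshR_lt_half (p := p) hq]
    have f1 : ∀ (a : M.Fibre) (ha : hM.fibre.pt hb' = a) (l : Path (M.iota a) (M.iota a)),
        (∀ t, l t = hold hM hω hc hb' t) →
        ((((hM.fibre.strip hω (-1)).ray (hM.fibre.low_mem hω hb') ha).symm.trans
          (hM.fibre.low hω hp)).map M.iota).trans (.mk (hold hM hω hc hp)) =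
        (Path.Homotopic.Quotient.mk l).trans
        ((((hM.fibre.strip hω (-1)).ray (hM.fibre.low_mem hω hb') ha).symm.trans
          (hM.fibre.low hω hp)).map M.iota) := by
      rintro a rfl l hl
      obtain rfl : l = hold hM hω hc hb' := Path.ext (funext hl)
      exact side_commute_hold hM hω hc (Or.inr rfl) h0 hmesh hb' hp (hY m0 m1)
    have f3 : ∀ (a : M.Fibre) (ha : hM.fibre.pt hb' = a) (l : Path (M.iota a) (M.iota a)),
        (∀ t, l t = hold hM hω hc hb' t) →
        (((hM.fibre.low hω hm).symm.trans
          ((hM.fibre.strip hω (-1)).ray (hM.fibre.low_mem hω hb') ha)).map M.iota).trans (.mk l) =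
        (Path.Homotopic.Quotient.mk (hold hM hω hc hm)).trans
        (((hM.fibre.low hω hm).symm.trans
          ((hM.fibre.strip hω (-1)).ray (hM.fibre.low_mem hω hb') ha)).map M.iota) := by
      rintro a rfl l hl
      obtain rfl : l = hold hM hω hc hb' := Path.ext (funext hl)
      exact side_commute_hold hM hω hc (Or.inr rfl) h0 hmesh hm hb' (hY m2 m0)
    have f2 := side_commute_hold hM hω hc (Or.inl rfl) h0 hmesh hp hm (hY m1 m2)
    have hl : ∀ t, hold hM hω hc hb t = hold hM hω hc hb' t := fun t =>
      moveConf_congr hω hc _ _ (chart_eq_of_rows hω 0 1 (by simp) (by simp))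
    have := Arc.trans_comm_of_three (f1 _ bb _ hl) f2 (f3 _ bb _ hl)
    rw [← Arc.map_trans, ← Arc.map_trans] at this
    exact this.symm

/-- The loop around `y_0 - y_j` commutes with the translation of all points but the `x_i`. -/
theorem commute_diag (hq : 1 ≤ q) (hb : hM.fibre.Good hM.fibre.b) (j : ℕ) (hj : j < q)
    (γ : Path (hM.fibre.pt hb) (hM.fibre.pt hb))
    (hγ : ∀ t, (γ t).1 = chart ω₁ ω₂ (lasso hM.fibre.b (posR p q (p + j)) (meshR p q / 2 : ℝ) t)) :
    Commute (FundamentalGroup.map M.iota _ (cls γ)) (cls (diag hM hω hc hb)) := by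
  have h0 := meshR_pos (p := p) (q := q)
  have hp := good_near hM hω (p + j) (by omega) (Or.inl rfl)
  have hm := good_near hM hω (p + j) (by omega) (Or.inr rfl)
  have hX : ∀ {u v : ℝ}, u ∈ Set.Icc (gapPt p q) (posR p q (p + q)) →
      v ∈ Set.Icc (gapPt p q) (posR p q (p + q)) → ∀ i < p, ∀ s : I,
      meshR p q / 2 ≤ u + s * (v - u) - posR p q i ∧
      u + s * (v - u) - posR p q i ≤ 1 - meshR p q / 2 := by
    intro u v hu hv i hi s
    obtain ⟨h1, h2⟩ := seg_mem_Icc hu hv s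
    have h3 := posR_add_mesh_le (p := p) (q := q) hi
    have h4 := meshR_le_posR (p := p) (q := q) i
    have h5 := posR_lt_one (p := p) (q := q) (k := p + q) le_rfl
    unfold gapPt at h1
    constructor <;> linarith
  have h1 : posR p q p ≤ posR p q (p + j) := posR_strictMono.monotone (by omega)
  have h3 := posR_add_mesh_le (p := p) (q := q) (show p + j < p + q by omega)
  have m0 : hM.fibre.b ∈ Set.Icc (gapPt p q) (posR p q (p + q)) := by
    change posR p q (p + q) ∈ _
    unfold gapPt; constructor <;> linarith
  have m1 : posR p q (p + j) + meshR p q / 2 ∈ Set.Icc (gapPt p q) (posR p q (p + q)) := by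
    unfold gapPt; constructor <;> linarith
  have m2 : posR p q (p + j) + -(meshR p q / 2) ∈ Set.Icc (gapPt p q) (posR p q (p + q)) := by
    unfold gapPt; constructor <;> linarith
  have hmesh : meshR p q ≤ 1 := by linarith [meshR_lt_half (p := p) hq]
  -- the three parts of the lasso; during the motion they keep their place relative to the second
  -- group, and the first group stays outside
  have f1 := side_commute_diag hM hω hc (c' := -1) (Or.inr rfl) h0 hmesh hb hp (hX m0 m1)
  have f2 := side_commute_diag hM hω hc (c' := 0) (Or.inl rfl) h0 hmesh hp hm (hX m1 m2)
  have f3 := side_commute_diag hM hω hc (c' := -1) (Or.inr rfl) h0 hmesh hm hb (hX m2 m0)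
  have := Arc.trans_comm_of_three f1 f2 f3
  rw [← Arc.map_trans, ← Arc.map_trans] at this
  have e := lasso_fibre hM hω hq hb (p + j) (by omega) hp hm γ hγ
  have alg : ∀ {o o' x y z : M.Fibre} (Lo : Arc o x) (Lp : Arc o y)
      (Up : Arc o' y) (Um : Arc o' z) (Lm : Arc o z),
      Lo.symm.trans ((Lp.trans Up.symm).trans ((Lm.trans Um.symm).symm.trans Lo)) =
      (Lo.symm.trans Lp).trans ((Up.symm.trans Um).trans (Lm.symm.trans Lo)) := by
    intros; simp
  have e' := e.trans (alg _ _ _ _ _)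
  rw [cls_eq, e']
  exact this.symm

end Torus

/-! ### The action of a global braid on the loops along the periods -/

/-- If `g` commutes with `l h`, then conjugation of `g` by `h` can be traded for conjugation by `l`.
-/
theorem conj_eq_of_commute {G : Type*} [Group G] {g l h : G} (h1 : Commute g (l * h))
    (h2 : Commute l h) : h⁻¹ * g * h = l * g * l⁻¹ := by
  have e : h * l * g = g * (h * l) := by rw [← h2.eq]; exact h1.symm.eq
  calc h⁻¹ * g * h = h⁻¹ * (g * (h * l)) * l⁻¹ := by group
    _ = l * g * l⁻¹ := by rw [← e]; group

section Torus

variable {p q : ℕ} {ω₁ ω₂ : ℂ} {M : Marking p q (Curve ω₁ ω₂)} {c c' : ℤ}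

theorem Arc.trans_conj_of_comm {X : Type*} [TopologicalSpace X] {x y : X} {H : Arc x x}
    {K : Arc y y} {D S S' : Arc x y} (e : D.trans K = H.trans D) (e' : S'.trans K = H.trans S) :
    H.trans ((D.trans S.symm).trans H.symm) = D.trans S'.symm := by
  have h1 : H.trans D = D.trans K := e.symm
  have h2 : S.symm.trans H.symm = K.symm.trans S'.symm := by
    have := congrArg Path.Homotopic.Quotient.symm e'
    simpa using this.symm
  rw [Path.Homotopic.Quotient.trans_assoc, h2, ← Path.Homotopic.Quotient.trans_assoc, h1]
  simp

variable (hM : IsStandard ω₁ ω₂ M) (hω : 0 < (ω₂ / ω₁).im)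
  (hc : c = 0 ∨ c = -1) (hc' : c' = 0 ∨ c' = -1)

include hM hω

/-- The effect of the motion along one period on the loop along the other one. -/
theorem conjBy_slope_other (h : c + c' = -1) (hb : hM.fibre.Good hM.fibre.b)
    (hg : hM.fibre.Good (gapPt p q)) :
    conjBy (FundamentalGroup.map M.iota _ (cls (hM.fibre.slopePath hω hc' hb hb)))
        (cls (hold hM hω hc hb)) =
      FundamentalGroup.map M.iota _ (FundamentalGroup.fromPath ((hM.fibre.side hω hc hb hg).trans
        (hM.fibre.side hω hc' hb hg).symm) * cls (hM.fibre.slopePath hω hc' hb hb)) := by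
  obtain rfl : c' = -1 - c := by omega
  have h0 := meshR_pos (p := p) (q := q)
  have hbT : hM.fibre.b = posR p q (p + q) := rfl
  have hb1 := posR_lt_one (p := p) (q := q) (k := p + q) le_rfl
  have hpb : posR p q p ≤ posR p q (p + q) := posR_strictMono.monotone (by omega)
  have hX : ∀ i < p, ∀ s : I, 0 < hM.fibre.b + s * (gapPt p q - hM.fibre.b) - posR p q i ∧
      hM.fibre.b + s * (gapPt p q - hM.fibre.b) - posR p q i < 1 := by
    intro i hi s
    obtain ⟨h1, h2⟩ := seg_mem_Icc (A := gapPt p q) (B := posR p q (p + q)) (u := hM.fibre.b)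
      (v := gapPt p q) ⟨by rw [hbT]; unfold gapPt; linarith, le_rfl⟩
      ⟨le_rfl, by unfold gapPt; linarith⟩ s
    have h3 := posR_add_mesh_le (p := p) (q := q) hi
    have h4 := posR_pos (p := p) (q := q) i
    constructor
    · unfold gapPt at *; linarith
    · linarith
  have hY : ∀ j < q, ∀ s : I,
      0 < hM.fibre.b + s * (1 + gapPt p q - hM.fibre.b) - posR p q (p + j) ∧
      hM.fibre.b + s * (1 + gapPt p q - hM.fibre.b) - posR p q (p + j) < 1 := by
    intro j hj s
    have h3 := posR_add_mesh_le (p := p) (q := q) (show p + j < p + q by omega)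
    have h4 : posR p q p ≤ posR p q (p + j) := posR_strictMono.monotone (by omega)
    have h5 := meshR_le_posR (p := p) (q := q) p
    obtain ⟨h1, h2⟩ := seg_mem_Icc (A := posR p q (p + q)) (B := 1 + gapPt p q) (u := hM.fibre.b)
      (v := 1 + gapPt p q) ⟨le_rfl, by rw [hbT]; unfold gapPt; linarith⟩
      ⟨by unfold gapPt; linarith, le_rfl⟩ s
    constructor
    · linarith
    · unfold gapPt at *; linarith
  have e1 := hM.fibre.slopePath_trans hω hc' (by rcases hc with rfl | rfl <;> simp) hb hb hg
  have hcc : -1 - (-1 - c) = c := by ring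
  have e1 : (Path.Homotopic.Quotient.mk (hM.fibre.slopePath hω hc' hb hb)).trans
      (hM.fibre.side hω hc hb hg) = .mk (hM.fibre.slopePath hω hc' hb hg) := by
    have key : ∀ (d : ℤ) (hd : d = 0 ∨ d = -1), d = c →
        (Path.Homotopic.Quotient.mk (hM.fibre.slopePath hω hc' hb hb)).trans
        (hM.fibre.side hω hd hb hg) = .mk (hM.fibre.slopePath hω hc' hb hg) →
        (Path.Homotopic.Quotient.mk (hM.fibre.slopePath hω hc' hb hb)).trans
        (hM.fibre.side hω hc hb hg) = .mk (hM.fibre.slopePath hω hc' hb hg) := by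
      rintro d hd rfl h; exact h
    exact key _ _ hcc e1
  -- the straight path to the gap between the two groups, before and during the motion
  have e2 := slope_trans_hold' hM hω hc hc' hb hg hX hY
  have e3 := side_trans_hold hM hω hc hc' hb hg hX
  have e := Arc.trans_conj_of_comm e2 e3
  rw [← e1, Arc.map_trans] at e
  have lhs : ∀ {x y : OrdConf (p + q + 1) (Curve ω₁ ω₂)} (H l : Arc x x) (S S' : Arc x y),
      H.trans (((l.trans S).trans S.symm).trans H.symm) = (l.trans S).trans S'.symm →
      H.trans (l.trans H.symm) = l.trans (S.trans S'.symm) := by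
    intro x y H l S S' h; simpa using h
  have e4 := lhs _ _ _ _ e
  rw [← Arc.map_symm, ← Arc.map_trans, ← Arc.map_trans] at e4
  exact e4

/-- The loop of the last point along a period commutes with the motion of the second group of points
along the same period: both can be run at independent speeds. -/
theorem slope_commute_hold (hb : hM.fibre.Good hM.fibre.b) :
    Commute (FundamentalGroup.map M.iota _ (cls (hM.fibre.slopePath hω hc hb hb)))
        (cls (hold hM hω hc hb)) :=
  (slope_trans_hold hM hω hc hb).symm

/-- The effect of the motion on the loops around the `y_0 - y_j`. -/
theorem conjBy_right (hq : 1 ≤ q) (hb : hM.fibre.Good hM.fibre.b) (j : ℕ) (hj : j < q)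
    (γ : Path (hM.fibre.pt hb) (hM.fibre.pt hb))
    (hγ : ∀ t, (γ t).1 = chart ω₁ ω₂ (lasso hM.fibre.b (posR p q (p + j)) (meshR p q / 2 : ℝ) t)) :
    conjBy (FundamentalGroup.map M.iota _ (cls γ)) (cls (hold hM hω hc hb)) =
      FundamentalGroup.map M.iota _
        (conjBy (cls γ) (cls (hM.fibre.slopePath hω hc hb hb))⁻¹) := by
  have h1 := commute_diag hM hω hc hq hb j hj γ hγ
  have h2 := slope_commute_hold hM hω hc hb
  have h3 : cls (diag hM hω hc hb) = FundamentalGroup.map M.iota _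
      (cls (hM.fibre.slopePath hω hc hb hb)) * cls (hold hM hω hc hb) := mk_diag hM hω hc hb
  rw [h3] at h1
  simp only [conjBy, map_mul, map_inv, inv_inv]
  exact conj_eq_of_commute h1 h2

end Torus

/-! ### The action of a global braid on the group of the fibre -/

section Torus

variable {p q : ℕ} {ω₁ ω₂ : ℂ} {M : Marking p q (Curve ω₁ ω₂)} {c : ℤ}

theorem conjBy_mul {G : Type*} [Group G] (g h k : G) :
    conjBy (g * h) k = conjBy g k * conjBy h k := by
  simp only [conjBy]; group

theorem conjBy_inv {G : Type*} [Group G] (g k : G) : conjBy g⁻¹ k = (conjBy g k)⁻¹ := by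
  simp only [conjBy]; group

theorem conjBy_of_commute {G : Type*} [Group G] {g k : G} (h : Commute g k) : conjBy g k = g := by
  rw [conjBy, mul_assoc, h.eq, inv_mul_cancel_left]

theorem map_conjBy {G H : Type*} [Group G] [Group H] (f : G →* H) (g k : G) :
    f (conjBy g k) = conjBy (f g) (f k) := by
  simp [conjBy]

variable (hM : IsStandard ω₁ ω₂ M) (hω : 0 < (ω₂ / ω₁).im)

include hM hω

/-- The product of the loops around the `y_0 - y_j` runs above these points to the gap and back
below them. -/
theorem prod_right (hq : 1 ≤ q) (hb : hM.fibre.Good hM.fibre.b) (hg : hM.fibre.Good (gapPt p q))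
    (γ : Fin q → Path (hM.fibre.pt hb) (hM.fibre.pt hb))
    (hγ : ∀ j t, (γ j t).1 =
      chart ω₁ ω₂ (lasso hM.fibre.b (posR p q (p + j)) (meshR p q / 2 : ℝ) t)) :
    (List.ofFn fun j => cls (γ j)).prod = FundamentalGroup.fromPath
      ((hM.fibre.side hω (c := 0) (Or.inl rfl) hb hg).trans
        (hM.fibre.side hω (c := -1) (Or.inr rfl) hb hg).symm) := by
  have h0 := meshR_pos (p := p) (q := q)
  have h1 := meshR_lt_half (p := p) hq
  have hb1 := posR_lt_one (p := p) (q := q) (k := p + q) le_rfl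
  have hbT : hM.fibre.b = posR p q (p + q) := rfl
  let u : ℕ → ℝ := fun k => posR p q (p + min k q) - meshR p q / 2
  have hm : ∀ k, hM.fibre.b - 1 ≤ u k ∧ u k ≤ hM.fibre.b := fun k => by
    have := meshR_le_posR (p := p) (q := q) (p + min k q)
    have := posR_strictMono.monotone (a := p + min k q) (b := p + q) (by omega) (f := posR p q)
    constructor <;> simp only [u, hbT] <;> linarith
  have off : ∀ k (e : ℝ), 0 < e → e ≤ meshR p q / 2 → posR p q k - e ∉ hM.fibre.W := by
    rintro k e he he' ⟨l, hl, h⟩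
    rcases lt_or_ge l k with h' | h'
    · linarith [posR_add_mesh_le (p := p) (q := q) h']
    · linarith [posR_strictMono.monotone h' (f := posR p q)]
  have hu : ∀ k, hM.fibre.Good (u k) := fun k =>
    hM.fibre.good_real hω (hm k).1 (hm k).2 (off _ _ (by linarith) le_rfl)
  have e := hM.fibre.prod_lasso hω (r := meshR p q / 2) (by linarith)
    (fun j : Fin q => posR p q (p + j)) u hu (fun k => ?_) (fun k x hx1 hx2 hx hxW => ?_) hb γ
    (fun j t h => Subtype.ext (hγ j t))
  · have ec : ∀ (v w : ℝ) (hv : hM.fibre.Good v) (hw : hM.fibre.Good w), v = w →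
        hM.fibre.cross hω hv = hM.fibre.cross hω hw := by
      rintro v _ hv hw rfl; rfl
    have e0 := ec _ _ (hu 0) hg (by simp [u, gapPt])
    have eq : hM.fibre.cross hω (hu q) = hM.fibre.cross hω hb := by
      refine hM.fibre.cross_congr hω (hm q).2 fun x hx =>
        hM.fibre.good_real hω ((hm q).1.trans hx.1) hx.2 fun hxW => ?_
      have hx1 := hx.1
      simp only [u, min_self] at hx1
      have hlt := (hM.fibre.lt_of_mem x hxW).2
      rw [hbT] at hlt
      refine off (p + q) (posR p q (p + q) - x) (by linarith) (by linarith) ?_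
      simpa using hxW
    rw [e, e0, eq]
    have alg : ∀ {o o' x y : M.Fibre} (L : Arc o x) (U : Arc o' x) (L' : Arc o y) (U' : Arc o' y),
        L.symm.trans ((L.trans U.symm).trans ((L'.trans U'.symm).symm.trans L)) =
        (U.symm.trans U').trans (L.symm.trans L').symm := by
      intros; simp
    exact alg _ _ _ _
  · have e1 : u k = posR p q (p + k) - meshR p q / 2 := by
      simp only [u]; rw [min_eq_left (by omega)]
    have e2 : u (k + 1) = posR p q (p + k + 1) - meshR p q / 2 := by
      simp only [u]; rw [min_eq_left (by omega), add_assoc]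
    have h4 := posR_add_mesh_le (p := p) (q := q) (show p + k.1 < p + k.1 + 1 by omega)
    have h5 := posR_add_mesh_le (p := p) (q := q) (show p + k.1 < p + q by omega)
    refine ⟨(hm k).1, by rw [e1], by rw [e2]; linarith, (hm _).2, by rw [hbT]; linarith⟩
  · obtain ⟨l, hl, rfl⟩ := hxW
    simp only [u] at hx1 hx2
    rw [min_eq_left (by omega)] at hx1 hx2
    rcases lt_trichotomy l (p + k.1) with h | h | h
    · linarith [posR_add_mesh_le (p := p) (q := q) h]
    · exact hx (by rw [h])
    · have := posR_strictMono.monotone (show p + (k.1 + 1) ≤ l by omega) (f := posR p q)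
      linarith

/-- The action of the two motions on the loops in the fibre. -/
theorem conjBy_hold (hq : 1 ≤ q) (hb : hM.fibre.Good hM.fibre.b)
    (γ : Fin (p + q) → Path (hM.fibre.pt hb) (hM.fibre.pt hb))
    (hγ : ∀ k t, (γ k t).1 =
      chart ω₁ ω₂ (lasso hM.fibre.b (posR p q k) (meshR p q / 2 : ℝ) t))
    {a b : FundamentalGroup M.Fibre (hM.fibre.pt hb)}
    {g : Fin (p + q) → FundamentalGroup M.Fibre (hM.fibre.pt hb)}
    {Y : FundamentalGroup M.Fibre (hM.fibre.pt hb)}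
    (ha : a = cls (hM.fibre.slopePath hω (c := -1) (Or.inr rfl) hb hb))
    (hb' : b = cls (hM.fibre.slopePath hω (c := 0) (Or.inl rfl) hb hb))
    (hg : ∀ k, g k = cls (γ k)) (hY : Y = (List.ofFn fun j : Fin q => g (Fin.natAdd p j)).prod)
    {f : FundamentalGroup M.Fibre (hM.fibre.pt hb) →*
      FundamentalGroup (OrdConf (p + q + 1) (Curve ω₁ ω₂)) (M.iota (hM.fibre.pt hb))}
    (hf : f = FundamentalGroup.map M.iota _)
    {H H' : FundamentalGroup (OrdConf (p + q + 1) (Curve ω₁ ω₂)) (M.iota (hM.fibre.pt hb))}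
    (hH : H = cls (hold hM hω (c := -1) (Or.inr rfl) hb))
    (hH' : H' = cls (hold hM hω (c := 0) (Or.inl rfl) hb)) :
    ((∀ i : Fin p, conjBy (f (g (Fin.castAdd q i))) H = f (conjBy (g (Fin.castAdd q i)) Y)) ∧
      (∀ j : Fin q, conjBy (f (g (Fin.natAdd p j))) H = f (conjBy (g (Fin.natAdd p j)) a⁻¹)) ∧
      conjBy (f a) H = f a ∧ conjBy (f b) H = f (Y⁻¹ * b)) ∧
    ((∀ i : Fin p, conjBy (f (g (Fin.castAdd q i))) H' =
        f (conjBy (g (Fin.castAdd q i)) (b * Y⁻¹ * b⁻¹))) ∧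
      (∀ j : Fin q, conjBy (f (g (Fin.natAdd p j))) H' = f (conjBy (g (Fin.natAdd p j)) b⁻¹)) ∧
      conjBy (f a) H' = f (Y * a) ∧ conjBy (f b) H' = f b) := by
  have hgap := gapPt_good hM hω
  have hY' : Y = FundamentalGroup.fromPath ((hM.fibre.side hω (c := 0) (Or.inl rfl) hb hgap).trans
      (hM.fibre.side hω (c := -1) (Or.inr rfl) hb hgap).symm) := by
    rw [hY, ← prod_right hM hω hq hb hgap (fun j => γ (Fin.natAdd p j))
      (fun j t => by simpa using hγ (Fin.natAdd p j) t)]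
    simp only [hg]
  have hYi : Y⁻¹ = FundamentalGroup.fromPath
      ((hM.fibre.side hω (c := -1) (Or.inr rfl) hb hgap).trans
      (hM.fibre.side hω (c := 0) (Or.inl rfl) hb hgap).symm) := by
    have alg : ∀ {x y : M.Fibre} (A B : Arc x y), (A.trans B.symm).symm = B.trans A.symm := by
      intros; simp
    rw [hY']
    exact alg (hM.fibre.side hω (c := 0) (Or.inl rfl) hb hgap)
      (hM.fibre.side hω (c := -1) (Or.inr rfl) hb hgap)
  have aH : conjBy (f a) H = f a := by
    rw [hf, ha, hH]; exact conjBy_of_commute (slope_commute_hold hM hω _ hb)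
  have bH' : conjBy (f b) H' = f b := by
    rw [hf, hb', hH']; exact conjBy_of_commute (slope_commute_hold hM hω _ hb)
  have bH : conjBy (f b) H = f (Y⁻¹ * b) := by
    rw [hf, hb', hH, hYi]
    exact conjBy_slope_other hM hω (Or.inr rfl) (Or.inl rfl) (by norm_num) hb hgap
  have aH' : conjBy (f a) H' = f (Y * a) := by
    rw [hf, ha, hH', hY']
    exact conjBy_slope_other hM hω (Or.inl rfl) (Or.inr rfl) (by norm_num) hb hgap
  have left : ∀ i : Fin p, ∃ B, g (Fin.castAdd q i) = b * a * B * a⁻¹ * b⁻¹ ∧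
      conjBy (f B) H = f B ∧ conjBy (f B) H' = f B := fun i => by
    obtain ⟨B, h1, h2⟩ := exists_left_conj hM hω hq hb i i.2 (γ (Fin.castAdd q i))
      (fun t => by simpa using hγ (Fin.castAdd q i) t)
    refine ⟨B, by rw [hg, h1, ha, hb'], ?_, ?_⟩
    · rw [hf, hH]; exact conjBy_of_commute (h2 _)
    · rw [hf, hH']; exact conjBy_of_commute (h2 _)
  have right : ∀ j : Fin q, ∀ {c : ℤ} (hc : c = 0 ∨ c = -1),
      conjBy (f (g (Fin.natAdd p j))) (cls (hold hM hω hc hb)) =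
        f (conjBy (g (Fin.natAdd p j)) (cls (hM.fibre.slopePath hω hc hb hb))⁻¹) := by
    intro j c hc
    rw [hf, hg]
    exact conjBy_right hM hω hc hq hb j j.2 _ (fun t => by simpa using hγ (Fin.natAdd p j) t)
  refine ⟨⟨fun i => ?_, fun j => ?_, aH, bH⟩, fun i => ?_, fun j => ?_, aH', bH'⟩
  · obtain ⟨B, h1, h2, -⟩ := left i
    rw [h1]
    simp only [map_mul, map_inv, conjBy_mul, conjBy_inv, aH, bH, h2, map_conjBy]
    simp only [conjBy]; group
  · rw [hH, right, ha]
  · obtain ⟨B, h1, -, h2⟩ := left i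
    rw [h1]
    simp only [map_mul, map_inv, conjBy_mul, conjBy_inv, aH', bH', h2, map_conjBy]
    simp only [conjBy]; group
  · rw [hH', right, hb']

end Torus

/-! ### A section, and the splitting it induces -/

section Section

variable {ω₁ ω₂ : ℂ} {n : ℕ}

/-- A small positive distance: a point displaced by it in the real direction stays off all other
points of the configuration. -/
def sectionGap (κ : ℝ) (i : Fin n) (c : OrdConf n (Curve ω₁ ω₂)) : ℝ :=
  κ * ∏ a : Fin n, if a = i then 1 else min 1 (‖c.1 i - c.1 a‖ / (‖ω₁ + ω₂‖ + 1))

theorem continuous_sectionGap (κ : ℝ) (i : Fin n) :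
    Continuous (sectionGap (ω₁ := ω₁) (ω₂ := ω₂) κ i) := by
  refine continuous_const.mul (continuous_finsetProd _ fun a _ => ?_)
  split_ifs
  · exact continuous_const
  · exact continuous_const.min ((continuous_norm.comp
      (((continuous_apply i).comp continuous_subtype_val).sub
        ((continuous_apply a).comp continuous_subtype_val))).div_const _)

/-- The displacement by `sectionGap` is short enough to avoid all other points. -/
theorem sectionGap_spec (hω : 0 < (ω₂ / ω₁).im) {κ : ℝ} (hκ : 0 < κ) (hκ' : κ < 1) (i : Fin n)
    (c : OrdConf n (Curve ω₁ ω₂)) : 0 < sectionGap κ i c ∧ sectionGap κ i c ≤ κ ∧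
      ∀ a, a ≠ i → sectionGap κ i c * ‖ω₁ + ω₂‖ < ‖c.1 i - c.1 a‖ := by
  have hw : 0 ≤ ‖ω₁ + ω₂‖ := norm_nonneg _
  have hn : ∀ a, a ≠ i → 0 < ‖c.1 i - c.1 a‖ := fun a ha =>
    lt_of_le_of_ne (norm_nonneg _) fun h =>
      ha (c.2 (sub_eq_zero.1 (norm_curve_eq_zero hω h.symm))).symm
  have h0 : ∀ a, 0 < if a = i then 1 else min 1 (‖c.1 i - c.1 a‖ / (‖ω₁ + ω₂‖ + 1)) := fun a => by
    split_ifs with h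
    · exact one_pos
    · exact lt_min one_pos (div_pos (hn a h) (by positivity))
  have h1 : ∀ a, (if a = i then 1 else min 1 (‖c.1 i - c.1 a‖ / (‖ω₁ + ω₂‖ + 1))) ≤ 1 :=
    fun a => by
    split_ifs
    · exact le_rfl
    · exact min_le_left _ _
  have hle : sectionGap κ i c ≤ κ :=
    mul_le_of_le_one_right hκ.le (Finset.prod_le_one (fun a _ => (h0 a).le) fun a _ => h1 a)
  refine ⟨mul_pos hκ (Finset.prod_pos fun a _ => h0 a), hle, fun a ha => ?_⟩
  have h2 : sectionGap κ i c ≤ ‖c.1 i - c.1 a‖ / (‖ω₁ + ω₂‖ + 1) := by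
    have e := Finset.mul_prod_erase Finset.univ
      (fun a => if a = i then 1 else min 1 (‖c.1 i - c.1 a‖ / (‖ω₁ + ω₂‖ + 1))) (Finset.mem_univ a)
    have h3 : ∏ a ∈ Finset.univ.erase a,
        (if a = i then 1 else min 1 (‖c.1 i - c.1 a‖ / (‖ω₁ + ω₂‖ + 1))) ≤ 1 :=
      Finset.prod_le_one (fun a _ => (h0 a).le) fun a _ => h1 a
    have h4 := h0 a
    have h5 : ∏ a, (if a = i then 1 else min 1 (‖c.1 i - c.1 a‖ / (‖ω₁ + ω₂‖ + 1))) ≤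
        ‖c.1 i - c.1 a‖ / (‖ω₁ + ω₂‖ + 1) := by
      rw [← e]
      refine (mul_le_of_le_one_right h4.le h3).trans ?_
      rw [if_neg ha]
      exact min_le_right _ _
    refine (mul_le_of_le_one_left (Finset.prod_nonneg fun a _ => (h0 a).le) hκ'.le).trans h5
  rw [le_div_iff₀ (by positivity)] at h2
  nlinarith [mul_pos hκ (Finset.prod_pos fun a (_ : a ∈ Finset.univ) => h0 a),
    show 0 < sectionGap κ i c from mul_pos hκ (Finset.prod_pos fun a _ => h0 a)]

/-- A section of the forgetful map: the new point lies slightly to the left of the point number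
`i`. -/
def sectionMap (hω : 0 < (ω₂ / ω₁).im) {κ : ℝ} (hκ : 0 < κ) (hκ' : κ < 1) (i : Fin n) :
    C(OrdConf n (Curve ω₁ ω₂), OrdConf (n + 1) (Curve ω₁ ω₂)) where
  toFun c := ⟨Fin.snoc (α := fun _ => Curve ω₁ ω₂) c.1
    (c.1 i - chart ω₁ ω₂ (sectionGap κ i c)), by
    obtain ⟨h1, h2, h3⟩ := sectionGap_spec hω hκ hκ' i c
    rw [Fin.snoc_injective_iff]
    refine ⟨c.2, ?_⟩
    rintro ⟨a, ha⟩
    have e : chart ω₁ ω₂ (sectionGap κ i c) = c.1 i - c.1 a := by rw [ha]; abel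
    by_cases hai : a = i
    · rw [hai, sub_self, ← chart_zero] at e
      have := eq_of_chart_eq hω e (by simp) (by simpa [abs_of_pos h1] using h2.trans_lt hκ')
      exact h1.ne' (by simpa using this)
    · have := h3 a hai
      rw [← e] at this
      have h4 := norm_chart_real_le (ω₁ := ω₁) (ω₂ := ω₂) (sectionGap κ i c)
      rw [abs_of_pos h1] at h4
      linarith⟩
  continuous_toFun := by
    have := continuous_sectionGap (ω₁ := ω₁) (ω₂ := ω₂) κ i
    refine Continuous.subtype_mk (continuous_pi fun k => ?_) _
    refine Fin.lastCases ?_ (fun k => ?_) k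
    · simp only [Fin.snoc_last]
      exact ((continuous_apply i).comp continuous_subtype_val).sub
        (Complex.continuous_ofReal.comp this).chart
    · simp only [Fin.snoc_castSucc]
      exact (continuous_apply k).comp continuous_subtype_val

theorem sectionMap_last (hω : 0 < (ω₂ / ω₁).im) {κ : ℝ} (hκ : 0 < κ) (hκ' : κ < 1) (i : Fin n)
    (c : OrdConf n (Curve ω₁ ω₂)) : (sectionMap hω hκ hκ' i c).1 (Fin.last n) =
      c.1 i - chart ω₁ ω₂ (sectionGap κ i c) :=
  Fin.snoc_last (α := fun _ => Curve ω₁ ω₂) _ _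

theorem sectionMap_castSucc (hω : 0 < (ω₂ / ω₁).im) {κ : ℝ} (hκ : 0 < κ) (hκ' : κ < 1) (i : Fin n)
    (c : OrdConf n (Curve ω₁ ω₂)) (k : Fin n) :
    (sectionMap hω hκ hκ' i c).1 k.castSucc = c.1 k :=
  Fin.snoc_castSucc (α := fun _ => Curve ω₁ ω₂) _ _ _

end Section

section Splitting

theorem map_baseChange {X Y : Type*} [TopologicalSpace X] [TopologicalSpace Y] (F : C(Y, X))
    {a b : Y} (δ : Path a b) (g : FundamentalGroup Y a) :
    FundamentalGroup.map F b (FundamentalGroup.fundamentalGroupMulEquivOfPath δ g) =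
      FundamentalGroup.fundamentalGroupMulEquivOfPath (δ.map F.continuous)
        (FundamentalGroup.map F a g) := by
  rw [baseChange_apply, baseChange_apply]
  change Path.Homotopic.Quotient.map (Path.Homotopic.Quotient.trans _ _) F = _
  rw [Arc.map_trans, Arc.map_trans, Arc.map_symm]
  rfl

/-- A map that contracts the path of base points and carries the loop `γ'` to `γ` does so for
classes. -/
theorem mapOfEq_baseChange_cls {X Y : Type*} [TopologicalSpace X] [TopologicalSpace Y] (F : C(Y, X))
    {a b : Y} {x : X} (hb : F b = x) (δ : Path a b) (hδ : ∀ t, F (δ t) = x) (γ' : Path a a)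
    (γ : Path x x) (hγ : ∀ t, F (γ' t) = γ t) :
    FundamentalGroup.mapOfEq F hb (FundamentalGroup.fundamentalGroupMulEquivOfPath δ (cls γ')) =
      cls γ := by
  subst hb
  rw [FundamentalGroup.mapOfEq_apply]
  have h := map_baseChange F δ (cls γ')
  rw [map_cls, baseChange_cls (fun x => γ x.2) (by fun_prop) (c := δ.map F.continuous)
    (fun t => by simp [hδ]) (fun t => by simp [hδ]) (δ := γ) (fun s => by simp [hγ])
    (fun s => rfl)] at h
  exact h

/-- A section of the forgetful map, together with a path in a fibre that joins the base points,
splits the forgetful homomorphism. -/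
theorem Arrangement.exists_splitting {E : Type*} [AddCommGroup E] [TopologicalSpace E]
    [IsTopologicalAddGroup E] {p q : ℕ} (A : Arrangement p q E)
    (S : C(OrdConf (p + q) E, OrdConf (p + q + 1) E)) (hS : ∀ c, forget (p + q) E (S c) = c)
    (δ : Path (S (A.phi A.basePt)) (A.iota A.fibrePt))
    (hδ : ∀ t, forget (p + q) E (δ t) = A.phi A.basePt) :
    ∃ s : A.PureGroup →* A.PureGroupSucc, A.thetaStar.comp s = MonoidHom.id _ ∧
      ∀ (γ : Path A.basePt A.basePt) (l : Path (A.iota A.fibrePt) (A.iota A.fibrePt))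
        (H : I × I → OrdConf (p + q + 1) E), Continuous H → (∀ t, H (t, 0) = δ t) →
        (∀ t, H (t, 1) = δ t) → (∀ t, H (0, t) = S (A.phi (γ t))) → (∀ t, H (1, t) = l t) →
        s (A.phiStar (cls γ)) = cls l := by
  refine ⟨(FundamentalGroup.fundamentalGroupMulEquivOfPath δ).toMonoidHom.comp
    (FundamentalGroup.map S (A.phi A.basePt)), ?_, ?_⟩
  · refine MonoidHom.ext fun g => ?_
    induction g using Path.Homotopic.Quotient.ind with
    | mk g =>
      exact mapOfEq_baseChange_cls _ A.forget_iota δ hδ (g.map S.continuous) g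
        (fun t => hS _)
  · intro γ l H hH h0 h1 hl hr
    exact baseChange_cls H hH h0 h1 (γ := (γ.map A.phi.continuous).map S.continuous)
      (fun t => (hl t).symm) (fun t => (hr t).symm)

variable {p q : ℕ} {ω₁ ω₂ : ℂ} {M : Marking p q (Curve ω₁ ω₂)}

/-- The action of the global braids, for the standard arrangement. -/
theorem IsStandard.exists_action (hM : IsStandard ω₁ ω₂ M) (hω : 0 < (ω₂ / ω₁).im) (hp : 1 ≤ p)
    (hq : 1 ≤ q) :
    ∃ s : M.PureGroup →* M.PureGroupSucc,
        M.thetaStar.comp s = MonoidHom.id _ ∧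
        ((∀ i : Fin p,
            conjBy (M.iotaStar (M.gA (Fin.castAdd q i))) (s (M.phiStar M.gAlphaHat)) =
              M.iotaStar (conjBy (M.gA (Fin.castAdd q i)) M.prodY)) ∧
          (∀ j : Fin q,
            conjBy (M.iotaStar (M.gA (Fin.natAdd p j))) (s (M.phiStar M.gAlphaHat)) =
              M.iotaStar (conjBy (M.gA (Fin.natAdd p j)) M.gAlpha⁻¹)) ∧
          conjBy (M.iotaStar M.gAlpha) (s (M.phiStar M.gAlphaHat)) = M.iotaStar M.gAlpha ∧
          conjBy (M.iotaStar M.gBeta) (s (M.phiStar M.gAlphaHat)) =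
            M.iotaStar (M.prodY⁻¹ * M.gBeta)) ∧
        ((∀ i : Fin p,
            conjBy (M.iotaStar (M.gA (Fin.castAdd q i))) (s (M.phiStar M.gBetaHat)) =
              M.iotaStar (conjBy (M.gA (Fin.castAdd q i))
                (M.gBeta * M.prodY⁻¹ * M.gBeta⁻¹))) ∧
          (∀ j : Fin q,
            conjBy (M.iotaStar (M.gA (Fin.natAdd p j))) (s (M.phiStar M.gBetaHat)) =
              M.iotaStar (conjBy (M.gA (Fin.natAdd p j)) M.gBeta⁻¹)) ∧
          conjBy (M.iotaStar M.gAlpha) (s (M.phiStar M.gBetaHat)) =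
            M.iotaStar (M.prodY * M.gAlpha) ∧
          conjBy (M.iotaStar M.gBeta) (s (M.phiStar M.gBetaHat)) = M.iotaStar M.gBeta) := by
  have hb := hM.good_fibre hω
  have hpt := hM.pt_fibre hω
  have hκ := meshR_pos (p := p) (q := q)
  have hκ' : meshR p q < 1 := by linarith [meshR_lt_half (p := p) hq]
  have hb1 := posR_lt_one (p := p) (q := q) (k := p + q) le_rfl
  have hbT : hM.fibre.b = posR p q (p + q) := rfl
  let i₀ : Fin (p + q) := ⟨0, by omega⟩
  let S := sectionMap (ω₁ := ω₁) (ω₂ := ω₂) hω hκ hκ' i₀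
  let ε : M.Base → ℝ := fun y => sectionGap (meshR p q) i₀ (M.phi y)
  have hεc : Continuous ε := (continuous_sectionGap _ _).comp M.phi.continuous
  have hε : ∀ y, 0 < ε y ∧ ε y ≤ meshR p q := fun y =>
    let h := sectionGap_spec hω hκ hκ' i₀ (M.phi y)
    ⟨h.1, h.2.1⟩
  have hP := meshR_le_posR (p := p) (q := q) 0
  -- the last point runs from the left neighbourhood of the first point to the left
  let f : M.Base → I → ℝ := fun y s => (posR p q 0 - ε y) + s * ((hM.fibre.b - 1) - (posR p q 0 - ε y))
  have hf : ∀ y s, hM.fibre.Good (f y s) := fun y s => by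
    obtain ⟨h1, h2⟩ := hε y
    obtain ⟨h3, h4⟩ := seg_mem_Icc (A := hM.fibre.b - 1) (B := posR p q 0 - ε y)
      (u := posR p q 0 - ε y) (v := hM.fibre.b - 1) ⟨by rw [hbT]; linarith, le_rfl⟩
      ⟨le_rfl, by rw [hbT]; linarith⟩ s
    refine hM.fibre.good_real hω h3 ?_ ?_
    · have := posR_strictMono.monotone (Nat.zero_le (p + q)) (f := posR p q)
      rw [hbT]; linarith
    · rintro ⟨k, -, hk⟩
      have := posR_strictMono.monotone (Nat.zero_le k) (f := posR p q)
      linarith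
  -- its end is the translate of `x_0` by `-1`, which is the same point of the curve
  have hend : M.iota (hM.fibre.pt (hf M.basePt 1)) = M.iota M.fibrePt := by
    rw [← hpt]
    refine congrArg _ (hM.fibre.pt_eq ?_ _ _)
    refine chart_eq_of_rows hω 0 (-1) ?_ ?_ <;> simp [f]
  have hS0 : ∀ {c : ℤ} (hc : c = 0 ∨ c = -1) (γ : Path M.basePt M.basePt),
      (∀ t, (γ t).1 = chart ω₁ ω₂ (((t : ℝ) : ℂ) * period c)) → ∀ t,
      moveConf hω hc ⟨(t, (f (γ t) 0 : ℝ)), by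
        simpa using mem_moveSet_line hM hω hc (hf (γ t) 0) t 0⟩ = S (M.phi (γ t)) := by
    intro c hc γ hγ t
    refine Subtype.ext (funext fun a => ?_)
    refine Fin.lastCases ?_ (fun a => ?_) a
    · rw [moveConf_last, sectionMap_last]
      have : (M.phi (γ t)).1 i₀ = chart ω₁ ω₂ (posR p q 0) := by
        have e : i₀ = Fin.castAdd q ⟨0, hp⟩ := rfl
        rw [e, M.phi_castAdd, hM.x, pos_eq]
      rw [this, ← chart_sub]
      simp [f, ε]
    · rw [sectionMap_castSucc]
      refine Fin.addCases (fun i => ?_) (fun j => ?_) a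
      · rw [moveConf_castSucc_castAdd, M.phi_castAdd, hM.x, pos_eq]
      · rw [moveConf_castSucc_natAdd, M.phi_natAdd, hM.y, pos_eq, hγ, chart_add]
        simp [add_comm]
  have hα : ∀ t, (M.alphaHat t).1 = chart ω₁ ω₂ (((t : ℝ) : ℂ) * period (-1)) := fun t => by
    rw [hM.alphaHat, hM.y₀, zero_add, proj_mul_period_one]
    congr 2; simp [period]; ring
  have hβ : ∀ t, (M.betaHat t).1 = chart ω₁ ω₂ (((t : ℝ) : ℂ) * period 0) := fun t => by
    rw [hM.betaHat, hM.y₀, zero_add, proj_mul_period_two]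
    congr 2; simp [period]
  have hstart : M.iota (hM.fibre.pt (hf M.basePt 0)) = S (M.phi M.basePt) := by
    have := hS0 (Or.inr rfl) M.alphaHat hα 0
    simp only [M.alphaHat.source] at this
    rw [← this]
    exact (moveConf_eq_iota hM hω _ (Or.inl rfl) _ (hf M.basePt 0) rfl).symm
  let δ : Path (S (M.phi M.basePt)) (M.iota M.fibrePt) :=
    { toFun := fun s => M.iota (hM.fibre.pt (hf M.basePt s))
      continuous_toFun := M.iota.continuous.comp (hM.fibre.cont.comp
        (Continuous.subtype_mk (by fun_prop) _))
      source' := hstart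
      target' := hend }
  obtain ⟨s, hs, hs'⟩ := M.toArrangement.exists_splitting S
    (fun c => Subtype.ext (funext fun k => sectionMap_castSucc hω hκ hκ' i₀ c k)) δ
    (fun t => Subtype.ext (funext fun k => M.iota_castSucc _ k))
  -- the square that deforms the image of `γ` under the section into the motion with `x_0` at rest
  have key : ∀ {c : ℤ} (hc : c = 0 ∨ c = -1) (γ : Path M.basePt M.basePt),
      (∀ t, (γ t).1 = chart ω₁ ω₂ (((t : ℝ) : ℂ) * period c)) →
      ∀ l : Path (M.iota M.fibrePt) (M.iota M.fibrePt), (∀ t, l t = hold hM hω hc hb t) →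
      s (M.phiStar (cls γ)) = cls l := by
    intro c hc γ hγ l hl
    refine hs' γ l (fun x => moveConf hω hc ⟨(x.2, (f (γ x.2) x.1 : ℝ)), by
        simpa using mem_moveSet_line hM hω hc (hf (γ x.2) x.1) x.2 0⟩) ?_ ?_ ?_ ?_ ?_
    · exact (continuous_moveConf hω hc).comp (Continuous.subtype_mk (by fun_prop) _)
    · intro t
      refine moveConf_eq_iota hM hω hc (Or.inl rfl) _ (hf M.basePt t) ?_
      simp
    · intro t
      refine moveConf_eq_iota hM hω hc (Or.inr rfl) _ (hf M.basePt t) ?_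
      simp
    · exact hS0 hc γ hγ
    · intro t
      rw [hl]
      exact moveConf_congr hω hc _ _ (chart_eq_of_rows hω 0 (-1) (by simp [f]) (by simp [f]))
  refine ⟨s, hs, ?_⟩
  -- replacing the end `pt hb` of the computation by the equal point `x_0`, for all loops at once
  have hmain : ∀ (x : M.Fibre) (hx : hM.fibre.pt hb = x) (γ : Fin (p + q) → Path x x)
      (α β : Path x x) (l l' : Path (M.iota x) (M.iota x)),
      (∀ k t, (γ k t).1 =
        chart ω₁ ω₂ (lasso hM.fibre.b (posR p q k) (meshR p q / 2 : ℝ) t)) →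
      (∀ t, α t = hM.fibre.slopePath hω (c := -1) (Or.inr rfl) hb hb t) →
      (∀ t, β t = hM.fibre.slopePath hω (c := 0) (Or.inl rfl) hb hb t) →
      (∀ t, l t = hold hM hω (c := -1) (Or.inr rfl) hb t) →
      (∀ t, l' t = hold hM hω (c := 0) (Or.inl rfl) hb t) → ∀ g Y a b f H H',
      g = (fun k => cls (γ k)) → Y = (List.ofFn fun j : Fin q => g (Fin.natAdd p j)).prod →
      a = cls α → b = cls β → f = FundamentalGroup.map M.iota x → H = cls l → H' = cls l' →
      ((∀ i : Fin p, conjBy (f (g (Fin.castAdd q i))) H = f (conjBy (g (Fin.castAdd q i)) Y)) ∧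
        (∀ j : Fin q, conjBy (f (g (Fin.natAdd p j))) H = f (conjBy (g (Fin.natAdd p j)) a⁻¹)) ∧
        conjBy (f a) H = f a ∧ conjBy (f b) H = f (Y⁻¹ * b)) ∧
      ((∀ i : Fin p, conjBy (f (g (Fin.castAdd q i))) H' =
          f (conjBy (g (Fin.castAdd q i)) (b * Y⁻¹ * b⁻¹))) ∧
        (∀ j : Fin q, conjBy (f (g (Fin.natAdd p j))) H' = f (conjBy (g (Fin.natAdd p j)) b⁻¹)) ∧
        conjBy (f a) H' = f (Y * a) ∧ conjBy (f b) H' = f b) := by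
    rintro x rfl γ α β l l' hγ hα hβ hl hl' g Y a b f H H' rfl rfl rfl rfl rfl rfl rfl
    obtain rfl := Path.ext (funext hα)
    obtain rfl := Path.ext (funext hβ)
    obtain rfl := Path.ext (funext hl)
    obtain rfl := Path.ext (funext hl')
    exact conjBy_hold hM hω hq hb γ hγ rfl rfl (fun _ => rfl) rfl rfl rfl rfl
  have hio : ∀ {x : M.Fibre}, hM.fibre.pt hb = x → M.iota x = M.iota (hM.fibre.pt hb) := by
    rintro x rfl; rfl
  refine hmain M.fibrePt hpt M.a M.alpha M.beta
    ((hold hM hω (c := -1) (Or.inr rfl) hb).cast (hio hpt) (hio hpt))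
    ((hold hM hω (c := 0) (Or.inl rfl) hb).cast (hio hpt) (hio hpt))
    (fun k t => ?_) (fun t => ?_) (fun t => ?_) (fun t => rfl) (fun t => rfl) _ _ _ _ _ _ _
    rfl rfl rfl rfl rfl (key (Or.inr rfl) _ hα _ (fun t => rfl)) (key (Or.inl rfl) _ hβ _ (fun t => rfl))
  · rw [hM.a]
    congr 1
    exact lasso_congr (pos_eq _) (pos_eq _) (by simp [mesh_eq]) t
  · refine Subtype.ext ?_
    rw [hM.alpha, proj_mul_period_one, hM.x₀, pos_eq, ← chart_add]
    have e1 : period (-1) = (1 - Complex.I) / 2 := by simp [period]; ring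
    exact congrArg _ (by rw [hbT, e1]; simp)
  · refine Subtype.ext ?_
    rw [hM.beta, proj_mul_period_two, hM.x₀, pos_eq, ← chart_add]
    have e0 : period 0 = (1 + Complex.I) / 2 := by simp [period]
    exact congrArg _ (by rw [hbT, e0]; simp)

end Splitting

/-! ### Pushing points of the curve -/

section PointPush

variable {ω₁ ω₂ : ℂ} {ι : Type*} [Fintype ι]

/-- Displacement of the points of the curve: a point `z` at distance less than `ε` of `d k` is moved
along with `d k` by a fraction of the vector `v k`. -/
def pointPush (ε : ℝ) (d : ι → Curve ω₁ ω₂) (v : ι → ℂ) (z : Curve ω₁ ω₂) : Curve ω₁ ω₂ :=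
  z + proj ω₁ ω₂ (∑ k, ((max 0 (1 - ‖z - d k‖ / ε) : ℝ) : ℂ) * v k)

theorem pointPush_apply {ε : ℝ} (hε : 0 < ε) {d : ι → Curve ω₁ ω₂}
    (v : ι → ℂ) (h : ∀ k l, k ≠ l → ε ≤ ‖d k - d l‖) (k : ι) :
    pointPush ε d v (d k) = d k + proj ω₁ ω₂ (v k) := by
  classical
  rw [pointPush, Finset.sum_eq_single k]
  · simp
  · intro l _ hl
    have : 1 ≤ ‖d k - d l‖ / ε := (one_le_div hε).2 (h k l hl.symm)
    rw [max_eq_left (by linarith)]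
    simp
  · simp

/-- The displacement varies by less than the distance of two points, since its Lipschitz constant is
`(∑ ‖v k‖) / ε < 1`. -/
theorem pointPush_injective {ε : ℝ} (hω : 0 < (ω₂ / ω₁).im) (hε : 0 < ε) (d : ι → Curve ω₁ ω₂)
    (v : ι → ℂ) (hv : ∑ k, ‖v k‖ < ε) : Function.Injective (pointPush ε d v) := by
  intro z z' h
  by_contra hne
  have hpos : 0 < ‖z - z'‖ := lt_of_le_of_ne (norm_nonneg _) fun h0 =>
    hne (sub_eq_zero.1 (norm_curve_eq_zero hω h0.symm))
  have e : z - z' = proj ω₁ ω₂ (∑ k, ((max 0 (1 - ‖z' - d k‖ / ε) -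
      max 0 (1 - ‖z - d k‖ / ε) : ℝ) : ℂ) * v k) := by
    have e0 : (∑ k, ((max 0 (1 - ‖z' - d k‖ / ε) - max 0 (1 - ‖z - d k‖ / ε) : ℝ) : ℂ) * v k) =
        (∑ k, ((max 0 (1 - ‖z' - d k‖ / ε) : ℝ) : ℂ) * v k) -
        ∑ k, ((max 0 (1 - ‖z - d k‖ / ε) : ℝ) : ℂ) * v k := by
      rw [← Finset.sum_sub_distrib]
      exact Finset.sum_congr rfl fun k _ => by push_cast; ring
    rw [e0, proj_sub]
    simp only [pointPush] at h
    rw [sub_eq_sub_iff_add_eq_add, h, add_comm]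
  have hk : ∀ k, ‖((max 0 (1 - ‖z' - d k‖ / ε) - max 0 (1 - ‖z - d k‖ / ε) : ℝ) : ℂ) * v k‖ ≤
      ‖z - z'‖ / ε * ‖v k‖ := fun k => by
    rw [norm_mul, Complex.norm_real, Real.norm_eq_abs]
    refine mul_le_mul_of_nonneg_right ?_ (norm_nonneg _)
    have h1 := abs_max_sub_max_le_max 0 (1 - ‖z' - d k‖ / ε) 0 (1 - ‖z - d k‖ / ε)
    have h2 : |(1 - ‖z' - d k‖ / ε) - (1 - ‖z - d k‖ / ε)| ≤ ‖z - z'‖ / ε := by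
      have e : (1 - ‖z' - d k‖ / ε) - (1 - ‖z - d k‖ / ε) = (‖z - d k‖ - ‖z' - d k‖) / ε := by ring
      rw [e, abs_div, abs_of_pos hε]
      refine div_le_div_of_nonneg_right ?_ hε.le
      simpa using abs_norm_sub_norm_le (z - d k) (z' - d k)
    refine h1.trans (max_le ?_ h2)
    simp only [sub_self, abs_zero]
    positivity
  have h1 : ‖z - z'‖ ≤ ‖z - z'‖ / ε * ∑ k, ‖v k‖ := by
    conv_lhs => rw [e]
    refine (norm_proj_le _).trans ((norm_sum_le _ _).trans ?_)
    rw [Finset.mul_sum]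
    exact Finset.sum_le_sum fun k _ => hk k
  have h2 : ‖z - z'‖ / ε * ∑ k, ‖v k‖ < ‖z - z'‖ / ε * ε :=
    mul_lt_mul_of_pos_left hv (div_pos hpos hε)
  rw [div_mul_cancel₀ _ hε.ne'] at h2
  linarith

/-- A motion of finitely many points extends, for short intervals of time, to injective motions of
the curve. -/
theorem exists_pointPush (hω : 0 < (ω₂ / ω₁).im) (d : ι → I → Curve ω₁ ω₂)
    (hd : ∀ k, Continuous (d k)) (hinj : ∀ t k l, k ≠ l → d k t ≠ d l t) :
    ∃ δ > 0, ∃ Ψ : I → I → Curve ω₁ ω₂ → Curve ω₁ ω₂,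
      (Continuous fun x : I × I × Curve ω₁ ω₂ => Ψ x.1 x.2.1 x.2.2) ∧
      (∀ u t, dist u t < δ → Function.Injective (Ψ u t)) ∧
      (∀ u t k, Ψ u t (d k u) = d k t) ∧ ∀ u z, Ψ u u z = z := by
  choose D hD hD' using fun k => exists_lift_path hω (hd k)
  -- a common lower bound `ε` for the distances of any two of the moving points
  have sep : ∀ k l, k ≠ l → ∀ᶠ ε in 𝓝[>] (0 : ℝ), ∀ t, ε ≤ ‖d k t - d l t‖ := by
    intro k l hkl
    obtain ⟨t₀, -, ht₀⟩ := isCompact_univ.exists_isMinOn (Set.univ_nonempty (α := I))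
      (continuous_norm.comp ((hd k).sub (hd l))).continuousOn
    have hpos : 0 < ‖d k t₀ - d l t₀‖ := lt_of_le_of_ne (norm_nonneg _) fun h0 =>
      hinj t₀ k l hkl (sub_eq_zero.1 (norm_curve_eq_zero hω h0.symm))
    filter_upwards [nhdsWithin_le_nhds (Iio_mem_nhds hpos)] with ε hε t
    exact (le_of_lt hε).trans (ht₀ (Set.mem_univ t))
  have sep' : ∀ᶠ ε in 𝓝[>] (0 : ℝ), ∀ k l, k ≠ l → ∀ t, ε ≤ ‖d k t - d l t‖ :=
    Filter.eventually_all.2 fun k => Filter.eventually_all.2 fun l => by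
      by_cases h : k = l
      · exact Filter.Eventually.of_forall fun _ h' => absurd h h'
      · exact (sep k l h).mono fun _ h' _ => h'
  obtain ⟨ε, hε, hε0⟩ := (sep'.and self_mem_nhdsWithin).exists
  have hε0 : 0 < ε := hε0
  have hDc : UniformContinuous fun t : I => fun k => D k t :=
    CompactSpace.uniformContinuous_of_continuous (continuous_pi hD)
  -- the displacements sum up to less than `ε`, as `pointPush_injective` requires
  obtain ⟨δ, hδ, hδ'⟩ := Metric.uniformContinuous_iff.1 hDc (ε / (Fintype.card ι + 1))
    (by positivity)
  refine ⟨δ, hδ, fun u t => pointPush ε (fun k => d k u) (fun k => D k t - D k u), ?_,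
    fun u t hut => ?_, fun u t k => ?_, fun u z => ?_⟩
  · have hn : Continuous fun x : Curve ω₁ ω₂ => ‖x‖ := continuous_norm
    have hp := continuous_proj (ω₁ := ω₁) (ω₂ := ω₂)
    unfold pointPush
    refine (continuous_snd.comp continuous_snd).add (hp.comp (continuous_finsetSum _ fun k _ => ?_))
    refine (Complex.continuous_ofReal.comp (continuous_const.max (continuous_const.sub
      ((hn.comp ((continuous_snd.comp continuous_snd).sub ((hd k).comp continuous_fst))).div_const
        _)))).mul ?_
    exact ((hD k).comp (continuous_fst.comp continuous_snd)).sub ((hD k).comp continuous_fst)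
  · refine pointPush_injective hω hε0 _ _ ?_
    have h1 := hδ' hut
    have h2 : ∀ k, ‖D k t - D k u‖ ≤ ε / (Fintype.card ι + 1) := fun k => by
      rw [← dist_eq_norm, dist_comm]
      exact (dist_le_pi_dist (fun k => D k u) (fun k => D k t) k).trans h1.le
    refine (Finset.sum_le_sum fun k _ => h2 k).trans_lt ?_
    rw [Finset.sum_const, Finset.card_univ, nsmul_eq_mul, mul_div_assoc', div_lt_iff₀ (by positivity)]
    nlinarith
  · refine (pointPush_apply hε0 _ (fun k l h => hε k l h u) k).trans ?_
    rw [proj_sub, hD', hD']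
    abel
  · simp [pointPush, proj_zero]

end PointPush

section LoopTransport

/-- If the spaces `{z // Q t z}` are complements of moving points, then loops that move along with
the base point correspond under a homomorphism of the fundamental groups. -/
theorem exists_transport {ω₁ ω₂ : ℂ} (hω : 0 < (ω₂ / ω₁).im) {ι : Type*} [Fintype ι]
    (d : ι → I → Curve ω₁ ω₂) (hd : ∀ k, Continuous (d k))
    (hinj : ∀ t k l, k ≠ l → d k t ≠ d l t) (Q : I → Curve ω₁ ω₂ → Prop)
    (k₀ : ι) (hQ : ∀ t z, Q t z ↔ ∀ k, k ≠ k₀ → z ≠ d k t)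
    (b : ∀ t, {z // Q t z}) (hb : ∀ t, (b t).1 = d k₀ t) {κ : Type*}
    (γ : κ → ∀ t, Path (b t) (b t))
    (hγ : ∀ j, Continuous fun x : I × I => (γ j x.1 x.2).1) (t₁ t₂ : I) :
    ∃ Φ : FundamentalGroup {z // Q t₁ z} (b t₁) →* FundamentalGroup {z // Q t₂ z} (b t₂),
      ∀ j, Φ (cls (γ j t₁)) = cls (γ j t₂) := by
  obtain ⟨δ, hδ, Ψ, hc, hi, hp, hid⟩ := exists_pointPush hω d hd hinj
  have step : ∀ t t' : I, dist t t' < δ →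
      ∃ Φ : FundamentalGroup {z // Q t z} (b t) →* FundamentalGroup {z // Q t' z} (b t'),
      ∀ j, Φ (cls (γ j t)) = cls (γ j t') := by
    intro t t' htt
    -- the times between `t` and `t'`
    let u : I → I := fun r => ⟨t + r * (t' - t), seg_mem_Icc t.2 t'.2 r⟩
    have hu : Continuous u := Continuous.subtype_mk (by fun_prop) _
    have hu0 : u 0 = t := Subtype.ext (by simp [u])
    have hu1 : u 1 = t' := Subtype.ext (by simp [u])
    have hd' : ∀ r, dist (u r) t' < δ := fun r => by
      refine lt_of_le_of_lt ?_ htt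
      rw [Subtype.dist_eq, Subtype.dist_eq, Real.dist_eq, Real.dist_eq]
      have e : ((u r : I) : ℝ) - t' = (1 - r) * (t - t') := by simp only [u]; ring
      rw [e, abs_mul, abs_of_nonneg (by linarith [r.2.2])]
      exact mul_le_of_le_one_left (abs_nonneg _) (by linarith [r.2.1])
    have hmaps : ∀ w, dist w t' < δ → ∀ z, Q w z → Q t' (Ψ w t' z) := by
      intro w hw z hz
      rw [hQ] at hz ⊢
      intro k hk h
      rw [← hp w t' k] at h
      exact hz k hk (hi w t' hw h)
    let f : C({z // Q t z}, {z // Q t' z}) :=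
      ⟨fun z => ⟨Ψ t t' z.1, hmaps t htt z.1 z.2⟩, Continuous.subtype_mk
        (hc.comp (continuous_const.prodMk (continuous_const.prodMk continuous_subtype_val))) _⟩
    have hf : f (b t) = b t' := Subtype.ext (by
      change Ψ t t' (b t).1 = (b t').1
      rw [hb, hb, hp])
    refine ⟨FundamentalGroup.mapOfEq f hf, fun j => ?_⟩
    rw [FundamentalGroup.mapOfEq_apply]
    change (Path.Homotopic.Quotient.mk
      (((γ j t).map f.continuous).cast hf.symm hf.symm) : Arc _ _) = .mk (γ j t')
    have hend : ∀ r s, s = 0 ∨ s = 1 → Ψ (u r) t' (γ j (u r) s).1 = (b t').1 := by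
      intro r s hs
      have : γ j (u r) s = b (u r) := by
        rcases hs with rfl | rfl
        · exact (γ j (u r)).source
        · exact (γ j (u r)).target
      rw [this, hb, hb, hp]
    refine mk_eq_of_family (fun x : I × I => (⟨Ψ (u x.2) t' (γ j (u x.2) x.1).1,
      hmaps _ (hd' x.2) _ (γ j (u x.2) x.1).2⟩ : {z // Q t' z})) ?_ ?_ ?_ ?_ ?_
    · refine Continuous.subtype_mk (hc.comp ((hu.comp continuous_snd).prodMk
        (continuous_const.prodMk ?_))) _
      exact (hγ j).comp ((hu.comp continuous_snd).prodMk continuous_fst)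
    · exact fun r => Subtype.ext (hend r 0 (Or.inl rfl))
    · exact fun r => Subtype.ext (hend r 1 (Or.inr rfl))
    · intro s
      refine Subtype.ext ?_
      change Ψ t t' (γ j t s).1 = Ψ (u 0) t' (γ j (u 0) s).1
      rw [hu0]
    · intro s
      refine Subtype.ext ?_
      change _ = Ψ (u 1) t' (γ j (u 1) s).1
      rw [hu1, hid]
  refine PreconnectedSpace.induction₂' (fun t t' => ∃ Φ : FundamentalGroup {z // Q t z} (b t) →*
    FundamentalGroup {z // Q t' z} (b t'), ∀ j, Φ (cls (γ j t)) = cls (γ j t')) ?_ ⟨?_⟩ t₁ t₂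
  · intro t
    filter_upwards [Metric.ball_mem_nhds t hδ] with t' ht'
    exact ⟨step t t' (by rwa [dist_comm]), step t' t ht'⟩
  · rintro t t' t'' ⟨Φ, hΦ⟩ ⟨Φ', hΦ'⟩
    exact ⟨Φ'.comp Φ, fun j => by rw [MonoidHom.comp_apply, hΦ, hΦ']⟩

end LoopTransport

/-! ### Properties of braids under deformation -/

section Deformation

theorem map_pureWord {G H : Type*} [Group G] [Group H] (f : G →* H) (b : ℕ → G) (i j : ℕ) :
    f (pureWord b i j) = pureWord (fun k => f (b k)) i j := by
  simp [pureWord, map_list_prod, List.map_map, Function.comp_def]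

theorem mapOfEq_baseChange {X Y : Type*} [TopologicalSpace X] [TopologicalSpace Y] (F : C(Y, X))
    {a b : Y} {x y : X} (ha : F a = x) (hb : F b = y) (δ' : Path a b) (δ : Path x y)
    (h : ∀ t, F (δ' t) = δ t) (g : FundamentalGroup Y a) :
    FundamentalGroup.mapOfEq F hb (FundamentalGroup.fundamentalGroupMulEquivOfPath δ' g) =
      FundamentalGroup.fundamentalGroupMulEquivOfPath δ (FundamentalGroup.mapOfEq F ha g) := by
  subst ha hb
  obtain rfl : δ'.map F.continuous = δ := Path.ext (funext h)
  have e : ∀ {c : Y} (g : FundamentalGroup Y c), FundamentalGroup.mapOfEq F (rfl : F c = F c) g =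
      FundamentalGroup.map F c g := fun g => by
    rw [FundamentalGroup.mapOfEq_apply]
    induction g using Path.Homotopic.Quotient.ind with
    | mk g => rfl
  rw [e, e]
  exact map_baseChange F δ' g

/-- The half twists of a moving configuration correspond to each other under transport along the
path of the configuration. -/
theorem baseChange_gen {X : Type*} [TopologicalSpace X] {n : ℕ} {c : I → OrdConf n X}
    (τ : ∀ t, Twists (c t))
    (hτ : ∀ k hk, Continuous fun x : I × I => (τ x.1 k hk x.2).1)
    (δ : Path (toUnord n X (c 0)) (toUnord n X (c 1))) (hδ : ∀ t, δ t = toUnord n X (c t)) (k : ℕ) :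
    FundamentalGroup.fundamentalGroupMulEquivOfPath δ ((τ 0).gen k) = (τ 1).gen k := by
  unfold Twists.gen
  split_ifs with hk
  · refine baseChange_cls (fun x => toUnord n X (τ x.1 k hk x.2)) ?_ ?_ ?_ (fun _ => rfl)
      (fun _ => rfl)
    · exact (toUnord n X).continuous.comp (continuous_induced_rng.2 (hτ k hk))
    · intro t
      change toUnord n X (τ t k hk 0) = _
      rw [Path.source, hδ]
    · intro t
      change toUnord n X (τ t k hk 1) = _
      rw [Path.target, hδ, ← toUnord_swapLabels]
  · exact map_one _

theorem baseChange_pureToFull {X : Type*} [TopologicalSpace X] {n : ℕ} {c : I → OrdConf n X}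
    (γ : ∀ t, Path (c t) (c t)) (hγ : Continuous fun x : I × I => γ x.1 x.2)
    (δ : Path (toUnord n X (c 0)) (toUnord n X (c 1))) (hδ : ∀ t, δ t = toUnord n X (c t)) :
    FundamentalGroup.fundamentalGroupMulEquivOfPath δ (pureToFull (c 0) (cls (γ 0))) =
      pureToFull (c 1) (cls (γ 1)) := by
  refine baseChange_cls (fun x => toUnord n X (γ x.1 x.2)) ((toUnord n X).continuous.comp hγ) ?_ ?_
    (fun _ => rfl) (fun _ => rfl)
  · intro t
    rw [Path.source, hδ]
  · intro t
    rw [Path.target, hδ]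

variable {E : Type*} [AddCommGroup E] [TopologicalSpace E] [IsTopologicalAddGroup E] {p q : ℕ}

/-- The formulas for the action of the global braids, for elements `A k`, `a`, `b` of a group that
are conjugated by `H` and `H'`. -/
def ActionFormulas {G : Type*} [Group G] (A : Fin (p + q) → G) (a b H H' : G) : Prop :=
  ((∀ i : Fin p, conjBy (A (Fin.castAdd q i)) H =
      conjBy (A (Fin.castAdd q i)) (List.ofFn fun j : Fin q => A (Fin.natAdd p j)).prod) ∧
    (∀ j : Fin q, conjBy (A (Fin.natAdd p j)) H = conjBy (A (Fin.natAdd p j)) a⁻¹) ∧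
    conjBy a H = a ∧
    conjBy b H = (List.ofFn fun j : Fin q => A (Fin.natAdd p j)).prod⁻¹ * b) ∧
  ((∀ i : Fin p, conjBy (A (Fin.castAdd q i)) H' = conjBy (A (Fin.castAdd q i))
      (b * (List.ofFn fun j : Fin q => A (Fin.natAdd p j)).prod⁻¹ * b⁻¹)) ∧
    (∀ j : Fin q, conjBy (A (Fin.natAdd p j)) H' = conjBy (A (Fin.natAdd p j)) b⁻¹) ∧
    conjBy a H' = (List.ofFn fun j : Fin q => A (Fin.natAdd p j)).prod * a ∧
    conjBy b H' = b)

theorem ActionFormulas.map {G G' : Type*} [Group G] [Group G'] {A : Fin (p + q) → G}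
    {a b H H' : G} (h : ActionFormulas A a b H H') (f : G →* G') :
    ActionFormulas (fun k => f (A k)) (f a) (f b) (f H) (f H') := by
  have e : (List.ofFn fun j : Fin q => f (A (Fin.natAdd p j))).prod =
      f (List.ofFn fun j : Fin q => A (Fin.natAdd p j)).prod := by
    rw [map_list_prod, List.map_ofFn]; rfl
  obtain ⟨⟨h1, h2, h3, h4⟩, h5, h6, h7, h8⟩ := h
  refine ⟨⟨fun i => ?_, fun j => ?_, ?_, ?_⟩, fun i => ?_, fun j => ?_, ?_, ?_⟩ <;>
    simp only [e, ← map_inv, ← map_mul, ← map_conjBy, h1, h2, h3, h4, h5, h6, h7, h8]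

/-- A splitting under which the global braids act by the given formulas. -/
def HasAction (M : Marking p q E) : Prop :=
  ∃ s : M.PureGroup →* M.PureGroupSucc, M.thetaStar.comp s = MonoidHom.id _ ∧
    ActionFormulas (fun k => M.iotaStar (M.gA k)) (M.iotaStar M.gAlpha) (M.iotaStar M.gBeta)
      (s (M.phiStar M.gAlphaHat)) (s (M.phiStar M.gBetaHat))

theorem hasAction_iff (M : Marking p q E) : HasAction M ↔
    ∃ s : M.PureGroup →* M.PureGroupSucc,
        M.thetaStar.comp s = MonoidHom.id _ ∧
        ((∀ i : Fin p,
            conjBy (M.iotaStar (M.gA (Fin.castAdd q i))) (s (M.phiStar M.gAlphaHat)) =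
              M.iotaStar (conjBy (M.gA (Fin.castAdd q i)) M.prodY)) ∧
          (∀ j : Fin q,
            conjBy (M.iotaStar (M.gA (Fin.natAdd p j))) (s (M.phiStar M.gAlphaHat)) =
              M.iotaStar (conjBy (M.gA (Fin.natAdd p j)) M.gAlpha⁻¹)) ∧
          conjBy (M.iotaStar M.gAlpha) (s (M.phiStar M.gAlphaHat)) = M.iotaStar M.gAlpha ∧
          conjBy (M.iotaStar M.gBeta) (s (M.phiStar M.gAlphaHat)) =
            M.iotaStar (M.prodY⁻¹ * M.gBeta)) ∧
        ((∀ i : Fin p,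
            conjBy (M.iotaStar (M.gA (Fin.castAdd q i))) (s (M.phiStar M.gBetaHat)) =
              M.iotaStar (conjBy (M.gA (Fin.castAdd q i))
                (M.gBeta * M.prodY⁻¹ * M.gBeta⁻¹))) ∧
          (∀ j : Fin q,
            conjBy (M.iotaStar (M.gA (Fin.natAdd p j))) (s (M.phiStar M.gBetaHat)) =
              M.iotaStar (conjBy (M.gA (Fin.natAdd p j)) M.gBeta⁻¹)) ∧
          conjBy (M.iotaStar M.gAlpha) (s (M.phiStar M.gBetaHat)) =
            M.iotaStar (M.prodY * M.gAlpha) ∧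
          conjBy (M.iotaStar M.gBeta) (s (M.phiStar M.gBetaHat)) = M.iotaStar M.gBeta) := by
  have e : M.iotaStar M.prodY =
      (List.ofFn fun j : Fin q => M.iotaStar (M.gA (Fin.natAdd p j))).prod := by
    rw [Marking.prodY, map_list_prod, List.map_ofFn]; rfl
  simp only [HasAction, ActionFormulas, map_conjBy, map_mul, map_inv, e]

namespace IsDeformation

variable {F : I → Marking p q E} (hF : IsDeformation F)
include hF

theorem continuous_phi {Z : Type*} [TopologicalSpace Z] {t : Z → I} (ht : Continuous t)
    {y : ∀ z, (F (t z)).Base} (hy : Continuous fun z => (y z).1) :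
    Continuous fun z => (F (t z)).phi (y z) := by
  refine Continuous.subtype_mk (continuous_pi fun k => ?_) _
  refine Fin.addCases (fun i => ?_) (fun j => ?_) k
  · simp only [Fin.append_left]
    exact (hF.x i).comp ht
  · simp only [Fin.append_right]
    exact hy.sub ((hF.y j).comp ht)

theorem continuous_iota {Z : Type*} [TopologicalSpace Z] {t : Z → I} (ht : Continuous t)
    {x : ∀ z, (F (t z)).Fibre} (hx : Continuous fun z => (x z).1) :
    Continuous fun z => (F (t z)).iota (x z) := by
  have h := hF.continuous_phi ht (y := fun z => (F (t z)).basePt) (hF.y₀.comp ht)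
  refine Continuous.subtype_mk (continuous_pi fun k => ?_) _
  refine Fin.lastCases ?_ (fun i => ?_) k
  · simp only [Fin.snoc_last]
    exact hx
  · simp only [Fin.snoc_castSucc]
    exact (continuous_apply i).comp (continuous_subtype_val.comp h)

/-- The motion of the configuration of `p + q` points. -/
def phiPath : Path ((F 0).phi (F 0).basePt) ((F 1).phi (F 1).basePt) where
  toFun t := (F t).phi (F t).basePt
  continuous_toFun := hF.continuous_phi continuous_id hF.y₀
  source' := rfl
  target' := rfl

/-- The motion of the configuration of `p + q + 1` points. -/
def iotaPath : Path ((F 0).iota (F 0).fibrePt) ((F 1).iota (F 1).fibrePt) where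
  toFun t := (F t).iota (F t).fibrePt
  continuous_toFun := hF.continuous_iota continuous_id hF.x₀
  source' := rfl
  target' := rfl

/-- Both sides are transported along the path of the configurations `φ(y_0)`. -/
theorem local_braid {i : Fin p} {j : Fin q}
    (h : pureToFull ((F 0).phi (F 0).basePt) ((F 0).phiStar ((F 0).d i j)) =
      conjBy (pureWord (F 0).b i p) ((List.range (j : ℕ)).map fun k => (F 0).b (p + k)).prod) :
    pureToFull ((F 1).phi (F 1).basePt) ((F 1).phiStar ((F 1).d i j)) =
      conjBy (pureWord (F 1).b i p) ((List.range (j : ℕ)).map fun k => (F 1).b (p + k)).prod := by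
  let δ := hF.phiPath.map (toUnord (p + q) E).continuous
  have hb : ∀ k, FundamentalGroup.fundamentalGroupMulEquivOfPath δ ((F 0).b k) = (F 1).b k :=
    baseChange_gen (c := fun t => (F t).phi (F t).basePt) (fun t => (F t).twist) hF.twist δ
      (fun _ => rfl)
  have hd : FundamentalGroup.fundamentalGroupMulEquivOfPath δ
      (pureToFull ((F 0).phi (F 0).basePt) ((F 0).phiStar ((F 0).d i j))) =
      pureToFull ((F 1).phi (F 1).basePt) ((F 1).phiStar ((F 1).d i j)) :=
    baseChange_pureToFull (c := fun t => (F t).phi (F t).basePt)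
      (fun t => ((F t).delta i j).map (F t).phi.continuous)
      (hF.continuous_phi continuous_fst (hF.delta i j)) δ (fun _ => rfl)
  rw [← hd, h, ← MulEquiv.coe_toMonoidHom, map_conjBy, map_pureWord, map_list_prod, List.map_map]
  simp only [MulEquiv.coe_toMonoidHom, hb, Function.comp_def]

/-- Both sides are transported along the path of the configurations `(φ(y_0), x_0)`. -/
theorem fibre_braid {k : Fin (p + q)}
    (h : pureToFull ((F 0).iota (F 0).fibrePt) ((F 0).iotaStar ((F 0).gA k)) =
      pureWord (F 0).bSucc k (p + q)) :
    pureToFull ((F 1).iota (F 1).fibrePt) ((F 1).iotaStar ((F 1).gA k)) =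
      pureWord (F 1).bSucc k (p + q) := by
  let δ := hF.iotaPath.map (toUnord (p + q + 1) E).continuous
  have hb : ∀ k, FundamentalGroup.fundamentalGroupMulEquivOfPath δ ((F 0).bSucc k) =
      (F 1).bSucc k :=
    baseChange_gen (c := fun t => (F t).iota (F t).fibrePt) (fun t => (F t).twistSucc)
      hF.twistSucc δ (fun _ => rfl)
  have hd : FundamentalGroup.fundamentalGroupMulEquivOfPath δ
      (pureToFull ((F 0).iota (F 0).fibrePt) ((F 0).iotaStar ((F 0).gA k))) =
      pureToFull ((F 1).iota (F 1).fibrePt) ((F 1).iotaStar ((F 1).gA k)) :=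
    baseChange_pureToFull (c := fun t => (F t).iota (F t).fibrePt)
      (fun t => ((F t).a k).map (F t).iota.continuous)
      (hF.continuous_iota continuous_fst (hF.a k)) δ (fun _ => rfl)
  rw [← hd, h, ← MulEquiv.coe_toMonoidHom, map_pureWord]
  simp only [MulEquiv.coe_toMonoidHom, hb]

/-- The splitting is conjugated by the transports along the paths of the configurations `φ(y_0)` and
`(φ(y_0), x_0)`. -/
theorem hasAction (h : HasAction (F 0)) : HasAction (F 1) := by
  obtain ⟨s, hs, hs'⟩ := h
  let e := FundamentalGroup.fundamentalGroupMulEquivOfPath hF.phiPath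
  let e' := FundamentalGroup.fundamentalGroupMulEquivOfPath hF.iotaPath
  have hi : ∀ γ : ∀ t, Path (F t).fibrePt (F t).fibrePt,
      (Continuous fun x : I × I => (γ x.1 x.2).1) →
      e' ((F 0).iotaStar (cls (γ 0))) = (F 1).iotaStar (cls (γ 1)) := fun γ hγ =>
    baseChange_cls (fun x : I × I => (F x.1).iota (γ x.1 x.2))
      (hF.continuous_iota continuous_fst hγ)
      (fun t => by simp only [Path.source]; rfl) (fun t => by simp only [Path.target]; rfl)
      (fun _ => rfl) (fun _ => rfl)
  have hp : ∀ γ : ∀ t, Path (F t).basePt (F t).basePt,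
      (Continuous fun x : I × I => (γ x.1 x.2).1) →
      e.symm ((F 1).phiStar (cls (γ 1))) = (F 0).phiStar (cls (γ 0)) := fun γ hγ => by
    rw [MulEquiv.symm_apply_eq]
    exact (baseChange_cls (fun x : I × I => (F x.1).phi (γ x.1 x.2))
      (hF.continuous_phi continuous_fst hγ)
      (fun t => by simp only [Path.source]; rfl) (fun t => by simp only [Path.target]; rfl)
      (fun _ => rfl) (fun _ => rfl)).symm
  have hθ : ∀ g, (F 1).thetaStar (e' g) = e ((F 0).thetaStar g) := fun g => by
    exact mapOfEq_baseChange (forget (p + q) E) (F 0).forget_iota (F 1).forget_iota hF.iotaPath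
      hF.phiPath (fun t => (F t).forget_iota) g
  refine ⟨e'.toMonoidHom.comp (s.comp e.symm.toMonoidHom), ?_, ?_⟩
  · refine MonoidHom.ext fun g => ?_
    have := DFunLike.congr_fun hs (e.symm g)
    simp only [MonoidHom.comp_apply, MonoidHom.id_apply] at this
    change (F 1).thetaStar (e' (s (e.symm g))) = g
    rw [hθ, this]
    exact e.apply_symm_apply g
  · have := hs'.map e'.toMonoidHom
    have hA : ∀ k, e' ((F 0).iotaStar ((F 0).gA k)) = (F 1).iotaStar ((F 1).gA k) :=
      fun k => hi (fun t => (F t).a k) (hF.a k)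
    have ha : e' ((F 0).iotaStar (F 0).gAlpha) = (F 1).iotaStar (F 1).gAlpha :=
      hi (fun t => (F t).alpha) hF.alpha
    have hb : e' ((F 0).iotaStar (F 0).gBeta) = (F 1).iotaStar (F 1).gBeta :=
      hi (fun t => (F t).beta) hF.beta
    have hH : e.symm ((F 1).phiStar (F 1).gAlphaHat) = (F 0).phiStar (F 0).gAlphaHat :=
      hp (fun t => (F t).alphaHat) hF.alphaHat
    have hH' : e.symm ((F 1).phiStar (F 1).gBetaHat) = (F 0).phiStar (F 0).gBetaHat :=
      hp (fun t => (F t).betaHat) hF.betaHat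
    rw [← hH, ← hH'] at this
    simp only [MulEquiv.coe_toMonoidHom, hA, ha, hb] at this
    exact this

end IsDeformation

end Deformation

/-! ### Relations under deformation -/

section Relations

variable {E : Type*} [AddCommGroup E] {p q : ℕ}

theorem Arrangement.sum_injective (A : Arrangement p q E) :
    Function.Injective fun ij : Fin p × Fin q => A.x ij.1 + A.y ij.2 := by
  classical
  have h := A.generic
  rw [← Set.image_univ, ← Finset.coe_univ, ← Finset.coe_image, Set.ncard_coe_finset] at h
  have := Finset.card_image_iff.1 (h.trans (by simp) :
    (Finset.univ.image fun ij : Fin p × Fin q => A.x ij.1 + A.y ij.2).card = Finset.univ.card)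
  simpa [Set.injOn_univ] using this

/-- The points of the curve that are relevant for the base: the punctures `x_i + y_j` and the base
point. -/
def Arrangement.basePts (A : Arrangement p q E) :
    Option (Fin p × Fin q) → E
  | none => A.y₀
  | some ij => A.x ij.1 + A.y ij.2

/-- The points of the curve that are relevant for the fibre: the punctures and the base point. -/
def Arrangement.fibrePts (A : Arrangement p q E) :
    Option (Fin p ⊕ Fin q) → E
  | none => A.x₀
  | some (Sum.inl i) => A.x i
  | some (Sum.inr j) => A.y₀ - A.y j

theorem Arrangement.basePts_injective (A : Arrangement p q E) :
    Function.Injective A.basePts := by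
  rintro (_ | ij) (_ | kl) h
  · rfl
  · exact absurd h (A.y₀_ne _ _)
  · exact absurd h.symm (A.y₀_ne _ _)
  · exact congrArg some (A.sum_injective h)

theorem Arrangement.fibrePts_injective (A : Arrangement p q E) :
    Function.Injective A.fibrePts := by
  rintro (_ | i | j) (_ | k | l) h
  · rfl
  · exact absurd h (A.x₀_ne_x _)
  · exact absurd h (A.x₀_ne_y _)
  · exact absurd h.symm (A.x₀_ne_x _)
  · exact congrArg (some ∘ Sum.inl) (A.x_injective h)
  · exact absurd (show A.y₀ = A.x i + A.y l by
      rw [show A.x i = A.y₀ - A.y l from h]; abel) (A.y₀_ne _ _)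
  · exact absurd h.symm (A.x₀_ne_y _)
  · exact absurd (show A.y₀ = A.x k + A.y j by
      rw [show A.x k = A.y₀ - A.y j from h.symm]; abel) (A.y₀_ne _ _)
  · exact congrArg (some ∘ Sum.inr) (A.y_injective (sub_right_injective h))

variable {ω₁ ω₂ : ℂ} {F : I → Marking p q (Curve ω₁ ω₂)}

namespace IsDeformation

variable (hF : IsDeformation F) (hω : 0 < (ω₂ / ω₁).im)
include hF

theorem continuous_basePts (k : Option (Fin p × Fin q)) :
    Continuous fun t => (F t).basePts k := by
  rcases k with _ | ij
  · exact hF.y₀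
  · exact (hF.x _).add (hF.y _)

theorem continuous_fibrePts (k : Option (Fin p ⊕ Fin q)) :
    Continuous fun t => (F t).fibrePts k := by
  rcases k with _ | i | j
  · exact hF.x₀
  · exact hF.x _
  · exact hF.y₀.sub (hF.y _)

include hω

/-- The complement of the punctures moves along with the arrangement, so that the relation is
carried over by the homomorphism of `exists_transport`. -/
theorem base_relation
    (h : (List.ofFn fun j : Fin q => (List.ofFn fun i : Fin p => (F 0).d i j.rev).prod).prod *
        comm (F 0).gAlphaHat (F 0).gBetaHat = 1) :
    (List.ofFn fun j : Fin q => (List.ofFn fun i : Fin p => (F 1).d i j.rev).prod).prod *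
        comm (F 1).gAlphaHat (F 1).gBetaHat = 1 := by
  obtain ⟨Φ, hΦ⟩ := exists_transport hω (fun k t => (F t).basePts k) hF.continuous_basePts
    (fun t k l hkl h => hkl ((F t).basePts_injective h))
    (fun t z => ∀ i j, z ≠ (F t).x i + (F t).y j) none
    (fun t z => ⟨fun hz k hk => by
      rcases k with _ | ij
      · exact absurd rfl hk
      · exact hz _ _, fun hz i j => hz (some (i, j)) (by simp)⟩)
    (fun t => (F t).basePt) (fun t => rfl)
    (κ := Fin p × Fin q ⊕ Bool)
    (fun k t => match k with
      | Sum.inl ij => (F t).delta ij.1 ij.2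
      | Sum.inr true => (F t).alphaHat
      | Sum.inr false => (F t).betaHat)
    (by
      rintro (ij | _ | _)
      · exact hF.delta _ _
      · exact hF.betaHat
      · exact hF.alphaHat) 0 1
  have hd : ∀ i j, Φ ((F 0).d i j) = (F 1).d i j := fun i j => hΦ (Sum.inl (i, j))
  have ha : Φ (F 0).gAlphaHat = (F 1).gAlphaHat := hΦ (Sum.inr true)
  have hb : Φ (F 0).gBetaHat = (F 1).gBetaHat := hΦ (Sum.inr false)
  have := congrArg Φ h
  simpa only [map_mul, map_list_prod, List.map_ofFn, Function.comp_def, comm, map_inv, hd, ha, hb,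
    map_one] using this

/-- As for `base_relation`, in the complement of the points of `φ(y_0)`. -/
theorem fibre_relation (h : (List.ofFn (F 0).gA).prod * comm (F 0).gAlpha (F 0).gBeta = 1) :
    (List.ofFn (F 1).gA).prod * comm (F 1).gAlpha (F 1).gBeta = 1 := by
  obtain ⟨Φ, hΦ⟩ := exists_transport hω (fun k t => (F t).fibrePts k) hF.continuous_fibrePts
    (fun t k l hkl h => hkl ((F t).fibrePts_injective h))
    (fun t z => (∀ i, z ≠ (F t).x i) ∧ ∀ j, z ≠ (F t).y₀ - (F t).y j) none
    (fun t z => ⟨fun hz k hk => by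
      rcases k with _ | i | j
      · exact absurd rfl hk
      · exact hz.1 _
      · exact hz.2 _, fun hz => ⟨fun i => hz (some (Sum.inl i)) (by simp),
        fun j => hz (some (Sum.inr j)) (by simp)⟩⟩)
    (fun t => (F t).fibrePt) (fun t => rfl)
    (κ := Fin (p + q) ⊕ Bool)
    (fun k t => match k with
      | Sum.inl k => (F t).a k
      | Sum.inr true => (F t).alpha
      | Sum.inr false => (F t).beta)
    (by
      rintro (k | _ | _)
      · exact hF.a _
      · exact hF.beta
      · exact hF.alpha) 0 1
  have hd : ∀ k, Φ ((F 0).gA k) = (F 1).gA k := fun k => hΦ (Sum.inl k)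
  have ha : Φ (F 0).gAlpha = (F 1).gAlpha := hΦ (Sum.inr true)
  have hb : Φ (F 0).gBeta = (F 1).gBeta := hΦ (Sum.inr false)
  have := congrArg Φ h
  have e : (List.ofFn (F 0).gA).map Φ = List.ofFn (F 1).gA := by
    rw [List.map_ofFn]; exact congrArg List.ofFn (funext hd)
  simpa only [map_mul, map_list_prod, e, comm, map_inv, ha, hb, map_one] using this

end IsDeformation

end Relations

section Existence

variable {E : Type*} [AddCommGroup E] [TopologicalSpace E] [IsTopologicalAddGroup E] {p q : ℕ}

/-- One family after the other. -/
def concatFamily {T : Type*} (F G : I → T) (t : I) : T :=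
  if (t : ℝ) ≤ 1 / 2 then F (Set.projIcc 0 1 zero_le_one (2 * (t : ℝ)))
  else G (Set.projIcc 0 1 zero_le_one (2 * (t : ℝ) - 1))

theorem concatFamily_zero {T : Type*} (F G : I → T) : concatFamily F G 0 = F 0 := by
  simp [concatFamily]

theorem concatFamily_one {T : Type*} (F G : I → T) : concatFamily F G 1 = G 1 := by
  have : ¬ ((1 : I) : ℝ) ≤ 1 / 2 := by norm_num
  rw [concatFamily, if_neg this]
  congr 1
  norm_num

theorem continuous_concatFamily {T Z W : Type*} [TopologicalSpace Z] [TopologicalSpace W]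
    {F G : I → T} (h : F 1 = G 0) (φ : T → Z → W)
    (hF : Continuous fun x : I × Z => φ (F x.1) x.2) (hG : Continuous fun x : I × Z => φ (G x.1) x.2) :
    Continuous fun x : I × Z => φ (concatFamily F G x.1) x.2 := by
  have e : (fun x : I × Z => φ (concatFamily F G x.1) x.2) = fun x : I × Z =>
      if (x.1 : ℝ) ≤ 1 / 2 then φ (F (Set.projIcc 0 1 zero_le_one (2 * (x.1 : ℝ)))) x.2
      else φ (G (Set.projIcc 0 1 zero_le_one (2 * (x.1 : ℝ) - 1))) x.2 := by
    funext x
    unfold concatFamily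
    split_ifs <;> rfl
  rw [e]
  refine Continuous.if_le ?_ ?_ (by fun_prop) continuous_const ?_
  · exact hF.comp (((continuous_projIcc (h := zero_le_one)).comp (by fun_prop)).prodMk continuous_snd)
  · exact hG.comp (((continuous_projIcc (h := zero_le_one)).comp (by fun_prop)).prodMk continuous_snd)
  · intro x hx
    rw [hx]
    norm_num
    rw [← h]

theorem IsDeformation.concat {F G : I → Marking p q E} (hF : IsDeformation F)
    (hG : IsDeformation G) (h : F 1 = G 0) : IsDeformation (concatFamily F G) := by
  have key : ∀ (φ : Marking p q E → E), Continuous (fun t => φ (F t)) →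
      Continuous (fun t => φ (G t)) → Continuous fun t => φ (concatFamily F G t) := by
    intro φ h1 h2
    exact (continuous_concatFamily h (fun M (_ : Unit) => φ M) (h1.comp continuous_fst)
      (h2.comp continuous_fst)).comp (continuous_id.prodMk (continuous_const (y := ())))
  exact
    { x := fun i => key (fun M => M.x i) (hF.x i) (hG.x i)
      y := fun j => key (fun M => M.y j) (hF.y j) (hG.y j)
      y₀ := key (fun M => M.y₀) hF.y₀ hG.y₀
      x₀ := key (fun M => M.x₀) hF.x₀ hG.x₀
      delta := fun i j => continuous_concatFamily h (fun M s => (M.delta i j s).1) (hF.delta i j)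
        (hG.delta i j)
      alphaHat := continuous_concatFamily h (fun M s => (M.alphaHat s).1) hF.alphaHat hG.alphaHat
      betaHat := continuous_concatFamily h (fun M s => (M.betaHat s).1) hF.betaHat hG.betaHat
      a := fun k => continuous_concatFamily h (fun M s => (M.a k s).1) (hF.a k) (hG.a k)
      alpha := continuous_concatFamily h (fun M s => (M.alpha s).1) hF.alpha hG.alpha
      beta := continuous_concatFamily h (fun M s => (M.beta s).1) hF.beta hG.beta
      twist := fun k hk => continuous_concatFamily h (fun M s => (M.twist k hk s).1)
        (hF.twist k hk) (hG.twist k hk)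
      twistSucc := fun k hk => continuous_concatFamily h (fun M s => (M.twistSucc k hk s).1)
        (hF.twistSucc k hk) (hG.twistSucc k hk) }

end Existence

/-! ### Existence of geometric systems of generators -/

section Push

variable {E : Type*} [AddCommGroup E] [TopologicalSpace E] [IsTopologicalAddGroup E] {p q n : ℕ}

/-- The image of a configuration under an injective map. -/
def OrdConf.push {X : Type*} (f : X → X) (hf : Function.Injective f) (c : OrdConf n X) :
    OrdConf n X := ⟨f ∘ c.1, hf.comp c.2⟩

/-- The marking obtained by applying injective maps to all loops in the fibre, respectively in the
base, and to all half twists. -/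
def Marking.push (M : Marking p q E) (A : Arrangement p q E) (f g : E → E) (hf : Continuous f)
    (hg : Continuous g) (hf' : Function.Injective f) (hg' : Function.Injective g)
    (h1 : ∀ k, f (M.fibrePts k) = A.fibrePts k) (h2 : ∀ k, g (M.basePts k) = A.basePts k) :
    Marking p q E :=
  have hphi : ∀ a, f ((M.phi M.basePt).1 a) = (A.phi A.basePt).1 a := fun a => by
    refine Fin.addCases (fun i => ?_) (fun j => ?_) a
    · rw [M.phi_castAdd, A.phi_castAdd]; exact h1 (some (Sum.inl i))
    · rw [M.phi_natAdd, A.phi_natAdd]; exact h1 (some (Sum.inr j))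
  have hiota : ∀ a, f ((M.iota M.fibrePt).1 a) = (A.iota A.fibrePt).1 a := fun a => by
    refine Fin.lastCases ?_ (fun a => ?_) a
    · rw [M.iota_last, A.iota_last]; exact h1 none
    · rw [M.iota_castSucc, A.iota_castSucc]; exact hphi a
  have hB : ∀ z, (∀ i j, z ≠ M.x i + M.y j) → ∀ i j, g z ≠ A.x i + A.y j := fun z hz i j h =>
    hz i j (hg' (h.trans (h2 (some (i, j))).symm))
  have hF : ∀ z, ((∀ i, z ≠ M.x i) ∧ ∀ j, z ≠ M.y₀ - M.y j) →
      (∀ i, f z ≠ A.x i) ∧ ∀ j, f z ≠ A.y₀ - A.y j := fun z hz =>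
    ⟨fun i h => hz.1 i (hf' (h.trans (h1 (some (Sum.inl i))).symm)),
      fun j h => hz.2 j (hf' (h.trans (h1 (some (Sum.inr j))).symm))⟩
  let base : Path M.basePt M.basePt → Path A.basePt A.basePt := fun γ =>
    { toFun := fun s => ⟨g (γ s).1, hB _ (γ s).2⟩
      continuous_toFun := Continuous.subtype_mk
        (hg.comp (continuous_subtype_val.comp γ.continuous)) _
      source' := Subtype.ext (by rw [γ.source]; exact h2 none)
      target' := Subtype.ext (by rw [γ.target]; exact h2 none) }
  let fibre : Path M.fibrePt M.fibrePt → Path A.fibrePt A.fibrePt := fun γ =>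
    { toFun := fun s => ⟨f (γ s).1, hF _ (γ s).2⟩
      continuous_toFun := Continuous.subtype_mk
        (hf.comp (continuous_subtype_val.comp γ.continuous)) _
      source' := Subtype.ext (by rw [γ.source]; exact h1 none)
      target' := Subtype.ext (by rw [γ.target]; exact h1 none) }
  let twist : ∀ {n : ℕ} {c c' : OrdConf n E}, (∀ a, f (c.1 a) = c'.1 a) → Twists c → Twists c' :=
    fun {n c c'} h τ k hk =>
    { toFun := fun s => (τ k hk s).push f hf'
      continuous_toFun := Continuous.subtype_mk (continuous_pi fun a => hf.comp
        ((continuous_apply a).comp (continuous_subtype_val.comp (τ k hk).continuous))) _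
      source' := Subtype.ext (funext fun a => by
        rw [Path.source]; exact h a)
      target' := Subtype.ext (funext fun a => by
        rw [Path.target]; exact h _) }
  { A with
    delta := fun i j => base (M.delta i j)
    alphaHat := base M.alphaHat
    betaHat := base M.betaHat
    a := fun k => fibre (M.a k)
    alpha := fibre M.alpha
    beta := fibre M.beta
    twist := twist hphi M.twist
    twistSucc := twist hiota M.twistSucc }

theorem Marking.push_id (M : Marking p q E) {A : Arrangement p q E} {f g : E → E} (hf hg hf' hg' h1
    h2) (hA : M.toArrangement = A) (hf0 : f = id) (hg0 : g = id) :
    M.push A f g hf hg hf' hg' h1 h2 = M := by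
  subst hA hf0 hg0
  rfl

end Push

section Existence

variable {p q : ℕ} {ω₁ ω₂ : ℂ}

theorem IsStandard.isGeometric {M : Marking p q (Curve ω₁ ω₂)} (hM : IsStandard ω₁ ω₂ M) :
    IsGeometric ω₁ ω₂ M := by
  have key : ∀ {X : Type} [TopologicalSpace X] {P : X → Prop} {b b' : {z // P z}} (γ : Path b b'),
      Continuous fun ts : I × I => (γ ts.2).1 := fun γ =>
    continuous_subtype_val.comp (γ.continuous.comp continuous_snd)
  exact ⟨fun _ => M,
    { x := fun i => continuous_const
      y := fun j => continuous_const
      y₀ := continuous_const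
      x₀ := continuous_const
      delta := fun i j => key _
      alphaHat := key _
      betaHat := key _
      a := fun k => key _
      alpha := key _
      beta := key _
      twist := fun k hk => key (M.twist k hk)
      twistSucc := fun k hk => key (M.twistSucc k hk) }, hM, rfl⟩

/-- Geometric markings can be carried along a motion of the arrangement. -/
theorem exists_geometric_of_path (hω : 0 < (ω₂ / ω₁).im)
    (A : I → Arrangement p q (Curve ω₁ ω₂)) (hx : ∀ i, Continuous fun t => (A t).x i)
    (hy : ∀ j, Continuous fun t => (A t).y j) (hy₀ : Continuous fun t => (A t).y₀)
    (hx₀ : Continuous fun t => (A t).x₀)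
    (h : ∃ M : Marking p q (Curve ω₁ ω₂), M.toArrangement = A 0 ∧ IsGeometric ω₁ ω₂ M) :
    ∃ M : Marking p q (Curve ω₁ ω₂), M.toArrangement = A 1 ∧ IsGeometric ω₁ ω₂ M := by
  obtain ⟨δ, hδ, f, fc, fi, fp, fid⟩ := exists_pointPush hω (fun k t => (A t).fibrePts k)
    (by rintro (_ | i | j)
        · exact hx₀
        · exact hx _
        · exact hy₀.sub (hy _))
    (fun t k l hkl h => hkl ((A t).fibrePts_injective h))
  obtain ⟨δ', hδ', g, gc, gi, gp, gid⟩ := exists_pointPush hω (fun k t => (A t).basePts k)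
    (by rintro (_ | ij)
        · exact hy₀
        · exact (hx _).add (hy _))
    (fun t k l hkl h => hkl ((A t).basePts_injective h))
  have step : ∀ t t' : I, dist t t' < δ → dist t t' < δ' →
      (∃ M : Marking p q (Curve ω₁ ω₂), M.toArrangement = A t ∧ IsGeometric ω₁ ω₂ M) →
      ∃ M : Marking p q (Curve ω₁ ω₂), M.toArrangement = A t' ∧ IsGeometric ω₁ ω₂ M := by
    rintro t t' h1 h2 ⟨M, hM, F, hF, hF0, rfl⟩
    let u : I → I := fun r => ⟨t + r * (t' - t), seg_mem_Icc t.2 t'.2 r⟩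
    have hu : Continuous u := Continuous.subtype_mk (by fun_prop) _
    have hu0 : u 0 = t := Subtype.ext (by simp [u])
    have hu1 : u 1 = t' := Subtype.ext (by simp [u])
    have hd : ∀ r, dist t (u r) ≤ dist t t' := fun r => by
      rw [Subtype.dist_eq, Subtype.dist_eq, Real.dist_eq, Real.dist_eq]
      have e : (t : ℝ) - (u r : I) = r * (t - t') := by simp only [u]; ring
      rw [e, abs_mul, abs_of_nonneg r.2.1]
      exact mul_le_of_le_one_left (abs_nonneg _) r.2.2
    have fcont : ∀ w, Continuous (f t w) := fun w =>
      fc.comp (continuous_const.prodMk (continuous_const.prodMk continuous_id))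
    have gcont : ∀ w, Continuous (g t w) := fun w =>
      gc.comp (continuous_const.prodMk (continuous_const.prodMk continuous_id))
    let G : I → Marking p q (Curve ω₁ ω₂) := fun r => (F 1).push (A (u r)) (f t (u r)) (g t (u r))
      (fcont _) (gcont _) (fi _ _ ((hd r).trans_lt h1)) (gi _ _ ((hd r).trans_lt h2))
      (fun k => by rw [hM]; exact fp t (u r) k) (fun k => by rw [hM]; exact gp t (u r) k)
    have hG0 : F 1 = G 0 := by
      refine (Marking.push_id _ _ _ _ _ _ _ (by rw [hM, hu0]) ?_ ?_).symm
      · rw [hu0]; exact funext (fid t)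
      · rw [hu0]; exact funext (gid t)
    have fcu : Continuous fun x : I × Curve ω₁ ω₂ => f t (u x.1) x.2 :=
      fc.comp (continuous_const.prodMk ((hu.comp continuous_fst).prodMk continuous_snd))
    have gcu : Continuous fun x : I × Curve ω₁ ω₂ => g t (u x.1) x.2 :=
      gc.comp (continuous_const.prodMk ((hu.comp continuous_fst).prodMk continuous_snd))
    have fib : ∀ γ : Path (F 1).fibrePt (F 1).fibrePt,
        Continuous fun x : I × I => f t (u x.1) (γ x.2).1 := fun γ =>
      fcu.comp (continuous_fst.prodMk
        (continuous_subtype_val.comp (γ.continuous.comp continuous_snd)))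
    have bas : ∀ γ : Path (F 1).basePt (F 1).basePt,
        Continuous fun x : I × I => g t (u x.1) (γ x.2).1 := fun γ =>
      gcu.comp (continuous_fst.prodMk
        (continuous_subtype_val.comp (γ.continuous.comp continuous_snd)))
    have tw : ∀ {n : ℕ} {c c' : OrdConf n (Curve ω₁ ω₂)} (γ : Path c c'),
        Continuous fun x : I × I => f t (u x.1) ∘ (γ x.2).1 := fun γ =>
      continuous_pi fun a => fcu.comp (continuous_fst.prodMk
        ((continuous_apply a).comp (continuous_subtype_val.comp (γ.continuous.comp continuous_snd))))
    have hG : IsDeformation G :=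
      { x := fun i => (hx i).comp hu
        y := fun j => (hy j).comp hu
        y₀ := hy₀.comp hu
        x₀ := hx₀.comp hu
        delta := fun i j => bas _
        alphaHat := bas _
        betaHat := bas _
        a := fun k => fib _
        alpha := fib _
        beta := fib _
        twist := fun k hk => tw ((F 1).twist k hk)
        twistSucc := fun k hk => tw ((F 1).twistSucc k hk) }
    refine ⟨G 1, congrArg A hu1, concatFamily F G, hF.concat hG hG0, ?_, concatFamily_one F G⟩
    rw [concatFamily_zero]
    exact hF0
  refine PreconnectedSpace.induction₂' (fun t t' =>
      (∃ M : Marking p q (Curve ω₁ ω₂), M.toArrangement = A t ∧ IsGeometric ω₁ ω₂ M) →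
      ∃ M : Marking p q (Curve ω₁ ω₂), M.toArrangement = A t' ∧ IsGeometric ω₁ ω₂ M) ?_
    ⟨fun t t' t'' h1 h2 h => h2 (h1 h)⟩ (0 : I) 1 h
  intro t
  filter_upwards [Metric.ball_mem_nhds t hδ, Metric.ball_mem_nhds t hδ'] with t' h1 h2
  exact ⟨step t t' (by rwa [dist_comm]) (by rwa [dist_comm]), step t' t h1 h2⟩

/-- The parameters on a complex line for which two of the given points coincide in the curve. -/
theorem countable_collisions {ι : Type*} [Countable ι] (b₀ b₁ : ι → ℂ)
    (h : Function.Injective fun k => proj ω₁ ω₂ (b₀ k)) :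
    {z : ℂ | ¬ Function.Injective fun k => proj ω₁ ω₂ (b₀ k + z * (b₁ k - b₀ k))}.Countable := by
  have hL : ((AddSubgroup.closure ({ω₁, ω₂} : Set ℂ) : Set ℂ)).Countable := by
    refine (Set.countable_range fun x : ℤ × ℤ => x.1 • ω₁ + x.2 • ω₂).mono fun z hz => ?_
    obtain ⟨a, b, rfl⟩ := AddSubgroup.mem_closure_pair.1 hz
    exact ⟨(a, b), rfl⟩
  have hline : ∀ α β : ℂ, proj ω₁ ω₂ α ≠ 0 → {z : ℂ | proj ω₁ ω₂ (α + z * β) = 0}.Countable := by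
    intro α β hα
    by_cases hβ : β = 0
    · simp [hβ, hα]
    · have hinj : Function.Injective fun z : ℂ => α + z * β := fun z w h =>
        mul_right_cancel₀ hβ (add_left_cancel h)
      refine (hL.preimage hinj).mono fun z hz => ?_
      have : α + z * β ∈ AddSubgroup.closure ({ω₁, ω₂} : Set ℂ) := proj_eq_zero_iff.1 hz
      exact this
  refine (Set.countable_iUnion fun x : {x : ι × ι // x.1 ≠ x.2} =>
    hline (b₀ x.1.1 - b₀ x.1.2) ((b₁ x.1.1 - b₀ x.1.1) - (b₁ x.1.2 - b₀ x.1.2)) ?_).mono ?_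
  · rw [proj_sub, sub_ne_zero]
    exact fun e => x.2 (h e)
  · intro z hz
    simp only [Function.Injective, Set.mem_ofPred_eq, not_forall] at hz
    obtain ⟨k, l, e, hne⟩ := hz
    refine Set.mem_iUnion.2 ⟨⟨(k, l), hne⟩, ?_⟩
    rw [← sub_eq_zero, ← proj_sub] at e
    change proj ω₁ ω₂ _ = 0
    rw [← e]
    congr 1
    ring

theorem Arrangement.ext' {E : Type*} [AddCommGroup E] {A B : Arrangement p q E} (h1 : A.x = B.x)
    (h2 : A.y = B.y) (h3 : A.y₀ = B.y₀) (h4 : A.x₀ = B.x₀) : A = B := by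
  cases A; cases B
  subst h1 h2 h3 h4
  rfl

/-- Any two arrangements are joined by a motion. -/
theorem exists_path_arrangement (A₀ A₁ : Arrangement p q (Curve ω₁ ω₂)) :
    ∃ A : I → Arrangement p q (Curve ω₁ ω₂), (∀ i, Continuous fun t => (A t).x i) ∧
      (∀ j, Continuous fun t => (A t).y j) ∧ (Continuous fun t => (A t).y₀) ∧
      (Continuous fun t => (A t).x₀) ∧ A 0 = A₀ ∧ A 1 = A₁ := by
  have lift : ∀ A : Arrangement p q (Curve ω₁ ω₂), ∃ (X : Fin p → ℂ) (Y : Fin q → ℂ) (y x : ℂ),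
      (∀ i, proj ω₁ ω₂ (X i) = A.x i) ∧ (∀ j, proj ω₁ ω₂ (Y j) = A.y j) ∧
      proj ω₁ ω₂ y = A.y₀ ∧ proj ω₁ ω₂ x = A.x₀ := fun A => by
    choose X hX using fun i => proj_surjective (A.x i)
    choose Y hY using fun j => proj_surjective (A.y j)
    obtain ⟨y, hy⟩ := proj_surjective A.y₀
    obtain ⟨x, hx⟩ := proj_surjective A.x₀
    exact ⟨X, Y, y, x, hX, hY, hy, hx⟩
  -- lifts to the plane of all points that have to stay distinct: the index `none` is the base point
  let base : (Fin p → ℂ) → (Fin q → ℂ) → ℂ → Option (Fin p × Fin q) → ℂ := fun X Y y k =>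
    k.elim y fun ij => X ij.1 + Y ij.2
  let fib : (Fin p → ℂ) → (Fin q → ℂ) → ℂ → ℂ → Option (Fin p ⊕ Fin q) → ℂ := fun X Y y x k =>
    k.elim x fun k => k.elim X fun j => y - Y j
  have inj : ∀ (A : Arrangement p q (Curve ω₁ ω₂)) X Y y x, (∀ i, proj ω₁ ω₂ (X i) = A.x i) →
      (∀ j, proj ω₁ ω₂ (Y j) = A.y j) → proj ω₁ ω₂ y = A.y₀ → proj ω₁ ω₂ x = A.x₀ →
      (Function.Injective fun k => proj ω₁ ω₂ (base X Y y k)) ∧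
      Function.Injective fun k => proj ω₁ ω₂ (fib X Y y x k) := by
    intro A X Y y x hX hY hy hx
    have e1 : (fun k => proj ω₁ ω₂ (base X Y y k)) = A.basePts := by
      funext k
      rcases k with _ | ij
      · exact hy
      · exact (proj_add _ _).trans (congrArg₂ _ (hX _) (hY _))
    have e2 : (fun k => proj ω₁ ω₂ (fib X Y y x k)) = A.fibrePts := by
      funext k
      rcases k with _ | i | j
      · exact hx
      · exact hX _
      · exact (proj_sub _ _).trans (congrArg₂ _ hy (hY _))
    rw [e1, e2]
    exact ⟨A.basePts_injective, A.fibrePts_injective⟩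
  obtain ⟨X₀, Y₀, y₀, x₀, hX₀, hY₀, hy₀, hx₀⟩ := lift A₀
  obtain ⟨X₁, Y₁, y₁, x₁, hX₁, hY₁, hy₁, hx₁⟩ := lift A₁
  obtain ⟨ib₀, if₀⟩ := inj A₀ X₀ Y₀ y₀ x₀ hX₀ hY₀ hy₀ hx₀
  obtain ⟨ib₁, if₁⟩ := inj A₁ X₁ Y₁ y₁ x₁ hX₁ hY₁ hy₁ hx₁
  have hc := (countable_collisions _ (base X₁ Y₁ y₁) ib₀).union
    (countable_collisions _ (fib X₁ Y₁ y₁ x₁) if₀)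
  -- a complex parameter running from `0` to `1` avoids the countably many collisions
  obtain ⟨γ, hγ⟩ := (hc.isPathConnected_compl_of_one_lt_rank (by
    rw [Complex.rank_real_complex]; norm_num)).joinedIn 0 (by simpa using ⟨ib₀, if₀⟩) 1
    (by simpa using ⟨ib₁, if₁⟩)
  simp only [Set.mem_compl_iff, Set.mem_union, Set.mem_ofPred_eq, not_or, not_not] at hγ
  -- all points lie on the complex line through the two given positions
  let mix : ℂ → ℂ → I → ℂ := fun a b t => a + γ t * (b - a)
  have hmix : ∀ a b, Continuous fun t => proj ω₁ ω₂ (mix a b t) := fun a b =>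
    continuous_proj.comp (continuous_const.add (γ.continuous.mul continuous_const))
  have hb : ∀ t, Function.Injective fun k => proj ω₁ ω₂ (base (fun i => mix (X₀ i) (X₁ i) t)
      (fun j => mix (Y₀ j) (Y₁ j) t) (mix y₀ y₁ t) k) := fun t => by
    convert (hγ t).1 using 3 with k
    rcases k with _ | ij
    · rfl
    · simp only [base, mix, Option.elim]; ring
  have hf : ∀ t, Function.Injective fun k => proj ω₁ ω₂ (fib (fun i => mix (X₀ i) (X₁ i) t)
      (fun j => mix (Y₀ j) (Y₁ j) t) (mix y₀ y₁ t) (mix x₀ x₁ t) k) := fun t => by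
    convert (hγ t).2 using 3 with k
    rcases k with _ | i | j
    · rfl
    · rfl
    · simp only [fib, mix, Option.elim, Sum.elim_inr]; ring
  let A : I → Arrangement p q (Curve ω₁ ω₂) := fun t =>
    { x := fun i => proj ω₁ ω₂ (mix (X₀ i) (X₁ i) t)
      y := fun j => proj ω₁ ω₂ (mix (Y₀ j) (Y₁ j) t)
      y₀ := proj ω₁ ω₂ (mix y₀ y₁ t)
      x₀ := proj ω₁ ω₂ (mix x₀ x₁ t)
      x_injective := fun i i' h => by
        simpa using hf t (a₁ := some (Sum.inl i)) (a₂ := some (Sum.inl i')) h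
      y_injective := fun j j' h => by
        have := hf t (a₁ := some (Sum.inr j)) (a₂ := some (Sum.inr j'))
          ((proj_sub _ _).trans ((congrArg _ h).trans (proj_sub _ _).symm))
        simpa using this
      generic := by
        have : Function.Injective fun ij : Fin p × Fin q => proj ω₁ ω₂ (mix (X₀ ij.1) (X₁ ij.1) t) +
            proj ω₁ ω₂ (mix (Y₀ ij.2) (Y₁ ij.2) t) := fun ij kl h => by
          simpa using hb t (a₁ := some ij) (a₂ := some kl) h
        rw [← Set.image_univ, Set.ncard_image_of_injective _ this, Set.ncard_univ]
        simp
      y₀_ne := fun i j h => by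
        simpa using hb t (a₁ := none) (a₂ := some (i, j)) h
      x₀_ne_x := fun i h => by
        simpa using hf t (a₁ := none) (a₂ := some (Sum.inl i)) h
      x₀_ne_y := fun j h => by
        simpa using hf t (a₁ := none) (a₂ := some (Sum.inr j)) h }
  have h0 : ∀ a b, mix a b 0 = a := fun a b => by simp [mix]
  have h1 : ∀ a b, mix a b 1 = b := fun a b => by simp [mix]
  refine ⟨A, fun i => hmix _ _, fun j => hmix _ _, hmix _ _, hmix _ _, ?_, ?_⟩
  · refine Arrangement.ext' (funext fun i => ?_) (funext fun j => ?_) ?_ ?_ <;>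
      simp only [A, h0, hX₀, hY₀, hy₀, hx₀]
  · refine Arrangement.ext' (funext fun i => ?_) (funext fun j => ?_) ?_ ?_ <;>
      simp only [A, h1, hX₁, hY₁, hy₁, hx₁]

end Existence

/-! ### The standard marking -/

section StandardMarking

variable {p q : ℕ} {ω₁ ω₂ : ℂ}

namespace Punctured

/-- The complement itself. -/
def ofSet (ω₁ ω₂ : ℂ) (b : ℝ) (W : Set ℝ) (h : ∀ w ∈ W, b - 1 < w ∧ w < b) :
    Punctured ω₁ ω₂ {x : Curve ω₁ ω₂ // ∀ w ∈ W, x ≠ chart ω₁ ω₂ (w : ℝ)} where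
  b := b
  W := W
  lt_of_mem := h
  G := id
  cont := continuous_id

variable {X : Type*} [TopologicalSpace X] (T : Punctured ω₁ ω₂ X)

/-- A lasso stays off the punctures if it crosses the real axis away from them. -/
theorem lasso_good (hω : 0 < (ω₂ / ω₁).im) {w r : ℝ} (hr : 0 < r) (hr' : r < 1 / 2)
    (h1 : T.b - 1 < w + r) (h2 : w + r < T.b + 1) (hb : T.Good T.b)
    (hp : T.Good ((w + r : ℝ) : ℂ)) (hm : T.Good ((w - r : ℝ) : ℂ)) (t : I) :
    T.Good (lasso T.b w r t) := by
  have key : ∀ x y : ℝ, T.Good x → T.Good y → |x - y| < 1 → ∀ u v : ℂ, (x : ℂ) = u → (y : ℂ) = v →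
      ∀ t : I, T.Good (halfTurn u v t) := by
    rintro x y hx hy hxy _ _ rfl rfl t
    exact T.halfTurn_good hω hx hy hxy t
  have mem : lasso T.b w r t ∈ Set.range (lasso T.b w r) := ⟨t, rfl⟩
  simp only [lasso, Path.trans_range, Path.symm_range] at mem
  have eH := key _ _ hp hb (by rw [abs_lt]; constructor <;> linarith) _ _
    (Complex.ofReal_add w r) rfl
  have e1 := key _ _ hp hm (by rw [abs_lt]; constructor <;> linarith) _ _
    (Complex.ofReal_add w r) (Complex.ofReal_sub w r)
  have e2 := key _ _ hm hp (by rw [abs_lt]; constructor <;> linarith) _ _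
    (Complex.ofReal_sub w r) (Complex.ofReal_add w r)
  rcases mem with (⟨s, hs⟩ | ⟨s, hs⟩ | ⟨s, hs⟩) | ⟨s, hs⟩ <;> rw [lasso, ← hs]
  exacts [eH s, e1 s, e2 s, eH s]

end Punctured

/-- The positions are multiples of the mesh. -/
theorem exists_posR_eq (k : ℕ) : ∃ m : ℤ, posR p q k = m * meshR p q := by
  rcases lt_or_ge k p with h | h
  · exact ⟨k + 1, by rw [posR_of_lt h]; push_cast; ring⟩
  · obtain ⟨j, rfl⟩ := Nat.exists_eq_add_of_le h
    exact ⟨(p + 1) * (j + 1), by rw [posR_add_eq_mul]; push_cast; ring⟩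

theorem half_ne_mul_mesh (m n : ℤ) : (m + 1 / 2 : ℝ) * meshR p q ≠ n * meshR p q := by
  intro h
  have h0 := meshR_pos (p := p) (q := q)
  have h1 := mul_right_cancel₀ h0.ne' h
  have h2 : (2 * m + 1 : ℤ) = 2 * n := by
    have : (2 * m + 1 : ℝ) = 2 * n := by linarith
    exact_mod_cast this
  omega

/-- The differences of the two kinds of positions are distinct. -/
theorem posR_sub_injective (hω : 0 < (ω₂ / ω₁).im) :
    Function.Injective fun ij : Fin p × Fin q =>
      chart ω₁ ω₂ (posR p q ij.1 : ℝ) - chart ω₁ ω₂ (posR p q (p + ij.2) : ℝ) := by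
  rintro ⟨i, j⟩ ⟨k, l⟩ h
  simp only [← chart_sub, ← Complex.ofReal_sub] at h
  have bd : ∀ (i : Fin p) (j : Fin q), -1 < posR p q i - posR p q (p + j) ∧
      posR p q i - posR p q (p + j) < 0 := fun i j => by
    have := posR_pos (p := p) (q := q) i
    have := posR_lt_one (p := p) (q := q) (k := p + j) (by omega)
    have := posR_strictMono (p := p) (q := q) (show (i : ℕ) < p + j by omega)
    constructor <;> linarith
  have e := eq_of_chart_eq hω h (by simp) (by
    rw [Complex.ofReal_re, Complex.ofReal_re, abs_lt]
    constructor <;> linarith [(bd i j).1, (bd i j).2, (bd k l).1, (bd k l).2])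
  have e := Complex.ofReal_injective e
  rw [posR_eq_mul_of_lt, posR_eq_mul_of_lt, posR_add_eq_mul, posR_add_eq_mul, ← sub_mul,
    ← sub_mul] at e
  have e := mul_right_cancel₀ (meshR_pos (p := p) (q := q)).ne' e
  have e : ((i : ℤ) + 1) - (p + 1) * (j + 1) = (k + 1) - (p + 1) * (l + 1) := by exact_mod_cast e
  have hi := i.2
  have hk := k.2
  have d : (p : ℤ) + 1 ∣ (i : ℤ) - k := ⟨(j : ℤ) - l, by linarith⟩
  have ik : (i : ℤ) = k := by
    have := Int.eq_zero_of_abs_lt_dvd d (by rw [abs_lt]; constructor <;> omega)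
    omega
  have jl : (j : ℤ) = l := by
    rw [ik] at e
    have : ((p : ℤ) + 1) * ((j : ℤ) - l) = 0 := by linarith
    rcases mul_eq_zero.1 this with h | h <;> omega
  exact Prod.ext (Fin.ext (by exact_mod_cast ik)) (Fin.ext (by exact_mod_cast jl))

/-- The standard arrangement. -/
def stdArrangement (p q : ℕ) (hω : 0 < (ω₂ / ω₁).im) : Arrangement p q (Curve ω₁ ω₂) where
  x i := chart ω₁ ω₂ (posR p q i)
  y j := -chart ω₁ ω₂ (posR p q (p + j))
  y₀ := 0
  x₀ := chart ω₁ ω₂ (posR p q (p + q))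
  x_injective i j h := Fin.ext (chart_posR_injective hω (by omega) (by omega) h)
  y_injective i j h := by
    have := chart_posR_injective hω (by omega) (by omega) (neg_injective h)
    exact Fin.ext (by omega)
  generic := by
    have := posR_sub_injective (p := p) (q := q) hω
    simp only [sub_eq_add_neg] at this
    rw [← Set.image_univ, Set.ncard_image_of_injective _ this, Set.ncard_univ]
    simp
  y₀_ne i j h := by
    have := chart_posR_injective hω (p := p) (q := q) (i := i) (j := p + j) (by omega) (by omega)
      (sub_eq_zero.1 (by rw [h, sub_eq_add_neg]))
    omega
  x₀_ne_x i h := by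
    have := chart_posR_injective hω (by omega) (by omega) h
    omega
  x₀_ne_y j h := by
    have := chart_posR_injective hω (p := p) (q := q) (i := p + q) (j := p + j) (by omega)
      (by omega) (by rw [h]; simp)
    omega

theorem chart_twistLift_injective (hω : 0 < (ω₂ / ω₁).im) (hq : 1 ≤ q) {n : ℕ}
    (hn : n ≤ p + q + 1) {k : ℕ} (hk : k + 1 < n) (t : I) :
    Function.Injective fun a : Fin n => chart ω₁ ω₂ (twistLift (posR p q) k t a) := by
  have E : Exchange k (⟨k, by omega⟩ : Fin n) ⟨k + 1, hk⟩ id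
      (Equiv.swap ⟨k, by omega⟩ ⟨k + 1, hk⟩) :=
    { inj := Function.injective_id
      lo_eq := rfl
      up_eq := rfl
      lo_eq' := by rw [Equiv.swap_apply_left]
      up_eq' := by rw [Equiv.swap_apply_right]
      other := fun a h1 h2 => Equiv.swap_apply_of_ne_of_ne h1 h2 }
  have := twist_line_injective hω E posR_strictMono (posR_span hn) (posR_gap_lt hq k)
    (η := fun a => if a = ⟨k + 1, hk⟩ then 1 else 0)
    (fun a b => by split_ifs <;> norm_num) (by simp) t 0
  simpa using this

theorem twistLift_zero (P : ℕ → ℝ) (k m : ℕ) : twistLift P k 0 m = P m := by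
  unfold twistLift
  split_ifs with h1 h2
  · rw [Path.source, h1]
  · rw [Path.source, h2]
  · rfl

theorem twistLift_one (P : ℕ → ℝ) {n k : ℕ} (hk : k + 1 < n) (a : Fin n) :
    twistLift P k 1 a = P (Equiv.swap (⟨k, by omega⟩ : Fin n) ⟨k + 1, hk⟩ a) := by
  unfold twistLift
  split_ifs with h1 h2
  · rw [Path.target, show a = ⟨k, by omega⟩ from Fin.ext h1, Equiv.swap_apply_left]
  · rw [Path.target, show a = ⟨k + 1, hk⟩ from Fin.ext h2, Equiv.swap_apply_right]
  · rw [Equiv.swap_apply_of_ne_of_ne (fun h => h1 (congrArg Fin.val h))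
      (fun h => h2 (congrArg Fin.val h))]

/-- The half twists of the standard arrangement. -/
def stdTwists (hω : 0 < (ω₂ / ω₁).im) (hq : 1 ≤ q) {n : ℕ} (hn : n ≤ p + q + 1)
    (c : OrdConf n (Curve ω₁ ω₂)) (hc : ∀ a, c.1 a = chart ω₁ ω₂ (posR p q a)) : Twists c :=
  fun k hk =>
  { toFun := fun t => ⟨fun a => chart ω₁ ω₂ (twistLift (posR p q) k t a),
      chart_twistLift_injective hω hq hn hk t⟩
    continuous_toFun := Continuous.subtype_mk (continuous_pi fun _ =>
      continuous_chart.comp (continuous_twistLift _ _ _)) _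
    source' := Subtype.ext (funext fun a =>
      (congrArg _ (twistLift_zero _ _ _)).trans (hc a).symm)
    target' := Subtype.ext (funext fun _ =>
      (congrArg _ (twistLift_one _ hk _)).trans (hc _).symm) }

/-- The standard marking exists: none of the prescribed loops and twists runs into a collision. -/
theorem exists_isStandard (hω : 0 < (ω₂ / ω₁).im) (hq : 1 ≤ q) :
    ∃ M : Marking p q (Curve ω₁ ω₂), IsStandard ω₁ ω₂ M := by
  have h0 := meshR_pos (p := p) (q := q)
  have hh := meshR_lt_half (p := p) hq
  let A := stdArrangement (ω₁ := ω₁) (ω₂ := ω₂) p q hω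
  have hphi : ∀ a, (A.phi A.basePt).1 a = chart ω₁ ω₂ (posR p q a) := fun a => by
    refine Fin.addCases (fun i => ?_) (fun j => ?_) a
    · rw [A.phi_castAdd]; rfl
    · rw [A.phi_natAdd]
      change (0 : Curve ω₁ ω₂) - -_ = _
      rw [zero_sub, neg_neg]; rfl
  have hiota : ∀ a, (A.iota A.fibrePt).1 a = chart ω₁ ω₂ (posR p q a) := fun a => by
    refine Fin.lastCases ?_ (fun a => ?_) a
    · rw [A.iota_last]; rfl
    · rw [A.iota_castSucc, hphi]; rfl
  -- the base
  have bdB : ∀ (i : Fin p) (j : Fin q), (0 : ℝ) - 1 < posR p q i - posR p q (p + j) ∧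
      posR p q i - posR p q (p + j) < 0 := fun i j => by
    have := posR_pos (p := p) (q := q) i
    have := posR_lt_one (p := p) (q := q) (k := p + j) (by omega)
    have := posR_strictMono (p := p) (q := q) (show (i : ℕ) < p + j by omega)
    constructor <;> linarith
  let TB := Punctured.ofSet ω₁ ω₂ 0 {w | ∃ (i : Fin p) (j : Fin q),
    w = posR p q i - posR p q (p + j)} (by rintro w ⟨i, j, rfl⟩; exact bdB i j)
  have hTB : ∀ z, TB.Good z ↔ ∀ i j, chart ω₁ ω₂ z ≠ A.x i + A.y j := fun z => by
    have e : ∀ (i : Fin p) (j : Fin q), A.x i + A.y j =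
        chart ω₁ ω₂ ((posR p q i - posR p q (p + j) : ℝ) : ℂ) := fun i j => by
      rw [Complex.ofReal_sub, chart_sub, sub_eq_add_neg]; rfl
    constructor
    · intro h i j
      rw [e]
      exact h _ ⟨i, j, rfl⟩
    · rintro h w ⟨i, j, rfl⟩
      rw [← e]
      exact h i j
  have bB : TB.Good ((0 : ℝ) : ℂ) :=
    TB.good_real hω (by change (0 : ℝ) - 1 ≤ 0; norm_num) le_rfl fun h => (TB.lt_of_mem _ h).2.false
  have intB : ∀ w ∈ TB.W, ∃ m : ℤ, w = m * meshR p q := by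
    rintro w ⟨i, j, rfl⟩
    obtain ⟨m, hm⟩ := exists_posR_eq (p := p) (q := q) i
    obtain ⟨n, hn⟩ := exists_posR_eq (p := p) (q := q) (p + j)
    exact ⟨m - n, by rw [hm, hn]; push_cast; ring⟩
  -- the fibre
  let TF := Punctured.ofSet ω₁ ω₂ (posR p q (p + q)) {w | ∃ k < p + q, w = posR p q k} (by
    rintro w ⟨k, hk, rfl⟩
    have := posR_pos (p := p) (q := q) k
    have := posR_lt_one (p := p) (q := q) (k := p + q) le_rfl
    exact ⟨by linarith, posR_strictMono hk⟩)
  have hTF : ∀ z, TF.Good z ↔ (∀ i, chart ω₁ ω₂ z ≠ A.x i) ∧ ∀ j, chart ω₁ ω₂ z ≠ A.y₀ - A.y j :=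
    fun z => by
    have e : ∀ j : Fin q, A.y₀ - A.y j = chart ω₁ ω₂ (posR p q (p + j)) := fun j => by
      change (0 : Curve ω₁ ω₂) - -_ = _
      rw [zero_sub, neg_neg]
    constructor
    · intro h
      exact ⟨fun i => h _ ⟨i, by omega, rfl⟩, fun j => by rw [e]; exact h _ ⟨p + j, by omega, rfl⟩⟩
    · rintro ⟨h1, h2⟩ w ⟨k, hk, rfl⟩
      rcases lt_or_ge k p with h | h
      · exact h1 ⟨k, h⟩
      · obtain ⟨j, rfl⟩ := Nat.exists_eq_add_of_le h
        have := h2 ⟨j, by omega⟩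
        rwa [e] at this
  have bF : TF.Good ((posR p q (p + q) : ℝ) : ℂ) :=
    TF.good_real hω (by change posR p q (p + q) - 1 ≤ _; linarith) le_rfl
      fun h => (TF.lt_of_mem _ h).2.false
  have intF : ∀ w ∈ TF.W, ∃ m : ℤ, w = m * meshR p q := by
    rintro w ⟨k, -, rfl⟩
    exact exists_posR_eq k
  -- points next to a puncture
  have near : ∀ {X : Type} [TopologicalSpace X] (T : Punctured ω₁ ω₂ X),
      (∀ w ∈ T.W, ∃ m : ℤ, w = m * meshR p q) → ∀ m : ℤ,
      T.b - 1 ≤ (m + 1 / 2) * meshR p q → (m + 1 / 2) * meshR p q ≤ T.b →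
      T.Good (((m + 1 / 2) * meshR p q : ℝ) : ℂ) := fun T hT m h1 h2 =>
    T.good_real hω h1 h2 fun h => by
      obtain ⟨n, hn⟩ := hT _ h
      exact half_ne_mul_mesh m n hn
  have lassoG : ∀ {X : Type} [TopologicalSpace X] (T : Punctured ω₁ ω₂ X),
      (∀ w ∈ T.W, ∃ m : ℤ, w = m * meshR p q) → (∃ m : ℤ, T.b = m * meshR p q) → T.Good T.b →
      ∀ w ∈ T.W, T.b - 1 + meshR p q / 2 ≤ w →
      ∀ t, T.Good (lasso T.b w (meshR p q / 2 : ℝ) t) := by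
    intro X _ T hT hb hgood w hw hw1
    obtain ⟨m, rfl⟩ := hT w hw
    obtain ⟨n, hn⟩ := hb
    have h1 := T.lt_of_mem _ hw
    have h2 : (m + 1 : ℝ) * meshR p q ≤ T.b := by
      have h3 := h1.2
      rw [hn] at h3 ⊢
      have h4 := lt_of_mul_lt_mul_right h3 h0.le
      have h5 : m + 1 ≤ n := by exact_mod_cast h4
      exact mul_le_mul_of_nonneg_right (by exact_mod_cast h5) h0.le
    have e1 : (m : ℝ) * meshR p q + meshR p q / 2 = (m + 1 / 2) * meshR p q := by ring
    have e2 : (m : ℝ) * meshR p q - meshR p q / 2 = ((m - 1 : ℤ) + 1 / 2) * meshR p q := by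
      push_cast; ring
    refine T.lasso_good hω (by linarith) (by linarith) (by linarith) (by linarith) hgood ?_ ?_
    · rw [e1]
      exact near T hT m (by linarith) (by linarith)
    · rw [e2]
      exact near T hT (m - 1) (by rw [← e2]; linarith) (by rw [← e2]; linarith)
  -- the loops
  have loopB : ∀ f : I → ℂ, Continuous f → (∀ t, TB.Good (f t)) → chart ω₁ ω₂ (f 0) = 0 →
      chart ω₁ ω₂ (f 1) = 0 → ∃ γ : Path A.basePt A.basePt, ∀ t, (γ t).1 = chart ω₁ ω₂ (f t) :=
    fun f hf hT h0 h1 => ⟨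
      { toFun := fun t => ⟨chart ω₁ ω₂ (f t), (hTB _).1 (hT t)⟩
        continuous_toFun := Continuous.subtype_mk hf.chart _
        source' := Subtype.ext h0
        target' := Subtype.ext h1 }, fun t => rfl⟩
  have loopF : ∀ f : I → ℂ, Continuous f → (∀ t, TF.Good (f t)) →
      chart ω₁ ω₂ (f 0) = chart ω₁ ω₂ (posR p q (p + q)) →
      chart ω₁ ω₂ (f 1) = chart ω₁ ω₂ (posR p q (p + q)) →
      ∃ γ : Path A.fibrePt A.fibrePt, ∀ t, (γ t).1 = chart ω₁ ω₂ (f t) :=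
    fun f hf hT h0 h1 => ⟨
      { toFun := fun t => ⟨chart ω₁ ω₂ (f t), (hTF _).1 (hT t)⟩
        continuous_toFun := Continuous.subtype_mk hf.chart _
        source' := Subtype.ext h0
        target' := Subtype.ext h1 }, fun t => rfl⟩
  have slopeB : ∀ {c : ℤ}, c = 0 ∨ c = -1 → ∃ γ : Path A.basePt A.basePt,
      ∀ t, (γ t).1 = chart ω₁ ω₂ (((t : ℝ) : ℂ) * period c) := fun {c} hc =>
    loopB (fun t => ((t : ℝ) : ℂ) * period c) (by fun_prop)
      (fun t => by simpa using TB.slope_good hω hc bB bB t) (by simp [chart_zero])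
      (by simpa using chart_period hω hc)
  have slopeF : ∀ {c : ℤ}, c = 0 ∨ c = -1 → ∃ γ : Path A.fibrePt A.fibrePt,
      ∀ t, (γ t).1 = chart ω₁ ω₂ (posR p q (p + q) + ((t : ℝ) : ℂ) * period c) := fun {c} hc =>
    loopF (fun t => posR p q (p + q) + ((t : ℝ) : ℂ) * period c) (by fun_prop)
      (fun t => by simpa using TF.slope_good hω hc bF bF t)
      (chart_add_mul_period hω hc (Or.inl rfl) _) (chart_add_mul_period hω hc (Or.inr rfl) _)
  have hδ : ∀ (i : Fin p) (j : Fin q), ∃ γ : Path A.basePt A.basePt, ∀ s, (γ s).1 =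
      chart ω₁ ω₂ (lasso 0 (pos p q i - pos p q (p + j)) (mesh p q / 2) s) := by
    intro i j
    have h1 := posR_lt_one (p := p) (q := q) (k := p + j) (by omega)
    have h2 := meshR_le_posR (p := p) (q := q) i
    refine loopB _ (lasso _ _ _).continuous (fun t => ?_) (by simp [chart_zero])
      (by simp [chart_zero])
    have := lassoG TB intB ⟨0, by simp [TB, Punctured.ofSet]⟩ bB _ ⟨i, j, rfl⟩
      (by change (0 : ℝ) - 1 + _ ≤ _; linarith) t
    rw [lasso_congr (b' := ((0 : ℝ) : ℂ)) (w' := ((posR p q i - posR p q (p + j) : ℝ) : ℂ))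
      (r' := ((meshR p q / 2 : ℝ) : ℂ)) Complex.ofReal_zero.symm
      (by rw [pos_eq, pos_eq, Complex.ofReal_sub]) (by simp [mesh_eq])]
    exact this
  have ha : ∀ k : Fin (p + q), ∃ γ : Path A.fibrePt A.fibrePt, ∀ s, (γ s).1 =
      chart ω₁ ω₂ (lasso (pos p q (p + q)) (pos p q k) (mesh p q / 2) s) := by
    intro k
    have h1 := posR_lt_one (p := p) (q := q) (k := p + q) le_rfl
    have h2 := meshR_le_posR (p := p) (q := q) k
    refine loopF _ (lasso _ _ _).continuous (fun t => ?_) (by simp [pos_eq]) (by simp [pos_eq])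
    have := lassoG TF intF (exists_posR_eq _) bF _ ⟨k, k.2, rfl⟩
      (by change posR p q (p + q) - 1 + _ ≤ _; linarith) t
    rw [lasso_congr (r' := ((meshR p q / 2 : ℝ) : ℂ)) (pos_eq _) (pos_eq _) (by simp [mesh_eq])]
    exact this
  choose δ hδ using hδ
  choose a ha using ha
  obtain ⟨α', hα'⟩ := slopeB (c := -1) (Or.inr rfl)
  obtain ⟨β', hβ'⟩ := slopeB (c := 0) (Or.inl rfl)
  obtain ⟨α, hα⟩ := slopeF (c := -1) (Or.inr rfl)
  obtain ⟨β, hβ⟩ := slopeF (c := 0) (Or.inl rfl)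
  have e1 : period (-1) = (1 - Complex.I) / 2 := by simp [period]; ring
  have e0 : period 0 = (1 + Complex.I) / 2 := by simp [period]
  let M : Marking p q (Curve ω₁ ω₂) :=
    { A with
      delta := δ
      alphaHat := α'
      betaHat := β'
      a := a
      alpha := α
      beta := β
      twist := stdTwists hω hq (by omega) _ hphi
      twistSucc := stdTwists hω hq le_rfl _ hiota }
  exact ⟨M,
    { x := fun i => by rw [pos_eq]; rfl
      y := fun j => by rw [pos_eq]; rfl
      y₀ := rfl
      x₀ := by rw [pos_eq]; rfl
      delta := hδ
      alphaHat := fun s => by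
        rw [proj_mul_period_one]
        exact (hα' s).trans (by rw [e1]; exact (zero_add _).symm)
      betaHat := fun s => by
        rw [proj_mul_period_two]
        exact (hβ' s).trans (by rw [e0]; exact (zero_add _).symm)
      a := ha
      alpha := fun s => by
        rw [proj_mul_period_one]
        exact (hα s).trans (by rw [e1, chart_add]; rfl)
      beta := fun s => by
        rw [proj_mul_period_two]
        exact (hβ s).trans (by rw [e0, chart_add]; rfl)
      twist := fun k hk s m => (stdTwist_eq k s m).symm
      twistSucc := fun k hk s m => (stdTwist_eq k s m).symm }⟩

end StandardMarking

end EllipticBraid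

end

theorem mainTheorem5 (p q : ℕ) (hp : 1 ≤ p) (hq : 1 ≤ q) (ω₁ ω₂ : ℂ) (hω : 0 < (ω₂ / ω₁).im) :
    -- every generic arrangement carries a geometric marking
    (∀ A : EllipticBraid.Arrangement p q (EllipticBraid.Curve ω₁ ω₂),
      ∃ M : EllipticBraid.Marking p q (EllipticBraid.Curve ω₁ ω₂),
        M.toArrangement = A ∧ EllipticBraid.IsGeometric ω₁ ω₂ M) ∧
    ∀ M : EllipticBraid.Marking p q (EllipticBraid.Curve ω₁ ω₂),
      EllipticBraid.IsGeometric ω₁ ω₂ M →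
      -- the images of the local braids
      (∀ (i : Fin p) (j : Fin q),
        EllipticBraid.pureToFull (M.phi M.basePt) (M.phiStar (M.d i j)) =
          EllipticBraid.conjBy (EllipticBraid.pureWord M.b i p)
            ((List.range (j : ℕ)).map fun k => M.b (p + k)).prod) ∧
      -- the relation between the local and the global braids
      (List.ofFn fun j : Fin q => (List.ofFn fun i : Fin p => M.d i j.rev).prod).prod *
        EllipticBraid.comm M.gAlphaHat M.gBetaHat = 1 ∧
      -- the generators of the group of the fibre
      (∀ k : Fin (p + q),
        EllipticBraid.pureToFull (M.iota M.fibrePt) (M.iotaStar (M.gA k)) =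
          EllipticBraid.pureWord M.bSucc k (p + q)) ∧
      (List.ofFn M.gA).prod * EllipticBraid.comm M.gAlpha M.gBeta = 1 ∧
      -- the action of the global braids on the group of the fibre, through a splitting
      ∃ s : M.PureGroup →* M.PureGroupSucc,
        M.thetaStar.comp s = MonoidHom.id _ ∧
        ((∀ i : Fin p,
            EllipticBraid.conjBy (M.iotaStar (M.gA (Fin.castAdd q i)))
                (s (M.phiStar M.gAlphaHat)) =
              M.iotaStar (EllipticBraid.conjBy (M.gA (Fin.castAdd q i)) M.prodY)) ∧
          (∀ j : Fin q,
            EllipticBraid.conjBy (M.iotaStar (M.gA (Fin.natAdd p j)))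
                (s (M.phiStar M.gAlphaHat)) =
              M.iotaStar (EllipticBraid.conjBy (M.gA (Fin.natAdd p j)) M.gAlpha⁻¹)) ∧
          EllipticBraid.conjBy (M.iotaStar M.gAlpha) (s (M.phiStar M.gAlphaHat)) =
            M.iotaStar M.gAlpha ∧
          EllipticBraid.conjBy (M.iotaStar M.gBeta) (s (M.phiStar M.gAlphaHat)) =
            M.iotaStar (M.prodY⁻¹ * M.gBeta)) ∧
        ((∀ i : Fin p,
            EllipticBraid.conjBy (M.iotaStar (M.gA (Fin.castAdd q i)))
                (s (M.phiStar M.gBetaHat)) =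
              M.iotaStar (EllipticBraid.conjBy (M.gA (Fin.castAdd q i))
                (M.gBeta * M.prodY⁻¹ * M.gBeta⁻¹))) ∧
          (∀ j : Fin q,
            EllipticBraid.conjBy (M.iotaStar (M.gA (Fin.natAdd p j)))
                (s (M.phiStar M.gBetaHat)) =
              M.iotaStar (EllipticBraid.conjBy (M.gA (Fin.natAdd p j)) M.gBeta⁻¹)) ∧
          EllipticBraid.conjBy (M.iotaStar M.gAlpha) (s (M.phiStar M.gBetaHat)) =
            M.iotaStar (M.prodY * M.gAlpha) ∧
          EllipticBraid.conjBy (M.iotaStar M.gBeta) (s (M.phiStar M.gBetaHat)) =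
            M.iotaStar M.gBeta) := by
  refine ⟨fun A => ?_, ?_⟩
  · obtain ⟨M, hM⟩ := EllipticBraid.exists_isStandard (p := p) (q := q) hω hq
    obtain ⟨F, h1, h2, h3, h4, h5, h6⟩ :=
      EllipticBraid.exists_path_arrangement M.toArrangement A
    obtain ⟨M', hM', hg⟩ := EllipticBraid.exists_geometric_of_path hω F h1 h2 h3 h4
      ⟨M, h5.symm, hM.isGeometric⟩
    exact ⟨M', hM'.trans h6, hg⟩
  · rintro _ ⟨F, hF, hS, rfl⟩
    exact ⟨fun i j => hF.local_braid (hS.phiStar_d hω hq i j),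
      hF.base_relation hω (hS.prod_d hω hq),
      fun k => hF.fibre_braid (hS.iotaStar_gA hω hq k),
      hF.fibre_relation hω (hS.prod_gA hω hq),
      (EllipticBraid.hasAction_iff _).1
        (hF.hasAction ((EllipticBraid.hasAction_iff _).2 (hS.exists_action hω hp hq)))⟩
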